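/- **Setting.** Let $T^N=\{\zeta\in\mathbb{C}^N : |\zeta_i|=1\}$ act on $\mathbb{H}^N=\mathbb{C}^N\times\mathbb{C}^N$ by $(z,w)\zeta=(z\zeta,w\zeta^{-1})$, with the flat metric and $I_1$ = multiplication by $\sqrt{-1}$. Let $K\subset T^N$ be a connected subtorus with Lie algebra $k\subset t^N=\mathbb{R}^N$ (exponential map $\mathrm{Exp}(x)=(e^{2\pi\sqrt{-1}x_i})_i$), let $\dim K=N-n$, let $K_{\mathbb C}$ be its complexification, $\iota\colon k\to t^N$ the inclusion, $X_1,\dots,X_N$ the standard basis of $t^N$, $u_1,\dots,u_N$ the dual basis, and $k_{\mathbb Z}=k\cap\mathbb{Z}^N$. The hyperkähler moment map is $\mu=(\mu_1,\mu_{\mathbb C})\colon\mathbb{H}^N\to k^*\times k^*_{\mathbb C}$, $$\mu_1(z,w)=\pi\sum_i(|z_i|^2-|w_i|^2)\,\iota^*u_i,\qquad \mu_{\mathbb C}(z,w)=-2\pi\sqrt{-1}\sum_i z_iw_i\,\iota^*u_i ,$$ and $X(\alpha,\beta)=\mu^{-1}(\alpha,\beta)/K$, with the complex structure $I_1$ and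 the holomorphic symplectic form induced by $\sum_i dz_i\wedge dw_i$ where it is smooth. Suppose that $\mathbb{Z}^N=k_{\mathbb Z}+\sum_{i\notin J}\mathbb{Z}X_i$ for every $J\subset\{1,\dots,N\}$ such that $(\iota^*u_i)_{i\in J}$ is a basis of $k^*$. Let $H_1,\dots,H_l$ be the one-dimensional isotropy subgroups of $K$ acting on $\mathbb{H}^N$, and let $W_s\subset k^*$ be the annihilator of $\mathrm{Lie}\,H_s$ (a wall). Fix $\beta\in k^*_{\mathbb C}$ and put $S_\beta=\{s : \beta\in W_s\otimes\mathbb{C}\}$; the chambers are the connected components of $k^*\setminus\bigcup_{s\in S_\beta}W_s$. Let $s_0\in S_\beta$ and let $\mathcal C_+\neq\mathcal C_-$ be chambers adjacent across $W_{s_0}$ (that is, $\overline{\mathcal C_+}\cap\overline{\mathcal C_-}$ contains a non-empty relatively open subset of $W_{s_0}$). Let $0\ne Y\in\mathrm{Lie}\,H_{s_0}$ and $J_{s_0}=\{i : \langle u_i,Y\rangle\neq0\}$. Fix $\alpha_\pm\in\mathcal C_\pm$ and $\alpha\in\overline{\mathcal C_+}\cap W_{s_0}$ with $\alpha\notin W_s$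 for all $s\in S_\beta\setminus\{s_0\}$. Let $\pi_\pm\colon X(\alpha_\pm,\beta)\to X(\alpha,\beta)$ be the natural morphisms: $\pi_\pm([p])=[q]$ if and only if $q$ lies in the closure of the orbit $pK_{\mathbb C}$. Put $V_0=\{[z,w]\in X(\alpha,\beta) : (z,w)\zeta=(z,w)\text{ for all }\zeta\in H_{s_0}\}$ and $V_\pm=\pi_\pm^{-1}(V_0)$. **Proposition.** In this setting $X(\alpha_\pm,\beta)$ are complex manifolds of dimension $2n$, the maps $\pi_\pm$ are well defined, and the following hold. (1) If $\#J_{s_0}\ge3$, then $X(\alpha_-,\beta)$ is related to $X(\alpha_+,\beta)$ by a (fibrewise) Mukai flop along $V_+$ over $X(\alpha,\beta)$. That is, with $r=\#J_{s_0}-1$: the $X(\alpha_\pm,\beta)$ are complex symplectic manifolds; $V_\pm$ are closed complex submanifolds of codimension $r$; $V_0$ carries a structure of complex manifold of dimension $2n-2r$ for which $\pi_\pm\colon V_\pm\to V_0$ are mutually dual $\mathbb{C}P^r$-bundles (the fibre of $V_-$ over $b$ is the space of hyperplanes of the fibre of $V_+$ over $b$); and there is a complex manifold $Z$ with maps $p_\pm\colon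 Z\to X(\alpha_\pm,\beta)$ such that $p_\pm$ is the blow-up along $V_\pm$, $p_+^{-1}(V_+)=p_-^{-1}(V_-)$, the map $(p_+,p_-)$ identifies this exceptional divisor with the variety of pairs (point $v$, hyperplane $h$) in the same fibre with $v\in h$, the pull-backs to $Z$ of the two holomorphic symplectic forms agree, and $\pi_+\circ p_+=\pi_-\circ p_-$. The flop is the bimeromorphic map $p_-\circ p_+^{-1}\colon X(\alpha_+,\beta)\dashrightarrow X(\alpha_-,\beta)$. (2) If $\#J_{s_0}=2$, there is a biholomorphic map $\phi\colon X(\alpha_+,\beta)\to X(\alpha_-,\beta)$ with $\pi_+=\pi_-\circ\phi$. -/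

import Mathlib

open scoped Manifold ContDiff Topology

noncomputable section

/-! ## Complex symplectic manifolds, blow-ups and (fibrewise) Mukai flops

A complex manifold of dimension `d` is a space with `ChartedSpace (Fin d → ℂ)` and
`IsManifold 𝓘(ℂ, Fin d → ℂ) ω`; holomorphic maps are `ContMDiff … ω` over `ℂ`. -/

namespace ComplexGeometry

/-- The expression of a field `Ω` of alternating 2-forms on `X` in the preferred chart at `x₀`:
the pull-back of `Ω` under the inverse of that chart. -/
def formInChart {d : ℕ} {X : Type} [TopologicalSpace X] [ChartedSpace (Fin d → ℂ) X]
    (Ω : (x : X) → TangentSpace 𝓘(ℂ, Fin d → ℂ) x [⋀^Fin 2]→L[ℂ] ℂ) (x₀ : X) :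
    (Fin d → ℂ) → (Fin d → ℂ) [⋀^Fin 2]→L[ℂ] ℂ :=
  fun y => (Ω ((chartAt (Fin d → ℂ) x₀).symm y)).compContinuousLinearMap
    (mfderiv 𝓘(ℂ, Fin d → ℂ) 𝓘(ℂ, Fin d → ℂ) (chartAt (Fin d → ℂ) x₀).symm y)

/-- `Ω` is a holomorphic symplectic form: holomorphic, closed and non-degenerate. -/
structure IsHolomorphicSymplectic {d : ℕ} {X : Type} [TopologicalSpace X]
    [ChartedSpace (Fin d → ℂ) X]
    (Ω : (x : X) → TangentSpace 𝓘(ℂ, Fin d → ℂ) x [⋀^Fin 2]→L[ℂ] ℂ) : Prop where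
  holomorphic : ∀ x₀ : X, ContDiffOn ℂ ω (formInChart Ω x₀) (chartAt (Fin d → ℂ) x₀).target
  closed : ∀ x₀ : X, ∀ y ∈ (chartAt (Fin d → ℂ) x₀).target, extDeriv (formInChart Ω x₀) y = 0
  nondegenerate : ∀ (x : X) (u : TangentSpace 𝓘(ℂ, Fin d → ℂ) x), u ≠ 0 →
    ∃ v : TangentSpace 𝓘(ℂ, Fin d → ℂ) x, Ω x ![u, v] ≠ 0

/-- `p : Z → X` is the blow-up of the complex manifold `X` along the closed complex submanifold
`V` of codimension `c`.  Outside `V` the map `p` is biholomorphic.  Near a point of `V` there are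
holomorphic coordinates `ψ = (y, x)` on an open `U ⊆ X` with values in `ℂᵉ × ℂᶜ` such that
`V ∩ U = {x = 0}`, and over `U` the manifold `Z` is the standard blow-up
`{(y, x, [l]) | x ∈ ℂ l}`.  The latter is the quotient of
`{(y, l, t) | l ≠ 0, (y, t l) ∈ ψ(U)}` by the free action
`(y, l, t) ↦ (y, s l, s⁻¹ t)` of `ℂˣ`, with projection `(y, l, t) ↦ (y, t l)`; the map `S` below
is the quotient map (a holomorphic surjective submersion whose fibres are the orbits). -/
structure IsBlowUp {d : ℕ} {X Z : Type} [TopologicalSpace X] [ChartedSpace (Fin d → ℂ) X]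
    [TopologicalSpace Z] [ChartedSpace (Fin d → ℂ) Z] (p : Z → X) (V : Set X) (c : ℕ) :
    Prop where
  holomorphic : ContMDiff 𝓘(ℂ, Fin d → ℂ) 𝓘(ℂ, Fin d → ℂ) ω p
  isClosed : IsClosed V
  biholomorphic_off : ∃ g : X → Z,
    ContMDiffOn 𝓘(ℂ, Fin d → ℂ) 𝓘(ℂ, Fin d → ℂ) ω g Vᶜ ∧
    (∀ x ∉ V, p (g x) = x) ∧ ∀ z, p z ∉ V → g (p z) = z
  local_model : ∀ v ∈ V, ∃ e : ℕ, e + c = d ∧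
    ∃ ψ : OpenPartialHomeomorph X ((Fin e → ℂ) × (Fin c → ℂ)), v ∈ ψ.source ∧
      ContMDiffOn 𝓘(ℂ, Fin d → ℂ) 𝓘(ℂ, (Fin e → ℂ) × (Fin c → ℂ)) ω ψ ψ.source ∧
      ContMDiffOn 𝓘(ℂ, (Fin e → ℂ) × (Fin c → ℂ)) 𝓘(ℂ, Fin d → ℂ) ω ψ.symm ψ.target ∧
      (∀ x ∈ ψ.source, x ∈ V ↔ (ψ x).2 = 0) ∧
      ∃ (W : Set ((Fin e → ℂ) × (Fin c → ℂ) × ℂ)) (S : (Fin e → ℂ) × (Fin c → ℂ) × ℂ → Z),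
        W = {a | a.2.1 ≠ 0 ∧ (a.1, a.2.2 • a.2.1) ∈ ψ.target} ∧
        ContMDiffOn 𝓘(ℂ, (Fin e → ℂ) × (Fin c → ℂ) × ℂ) 𝓘(ℂ, Fin d → ℂ) ω S W ∧
        (∀ a ∈ W, Function.Surjective
          (mfderiv 𝓘(ℂ, (Fin e → ℂ) × (Fin c → ℂ) × ℂ) 𝓘(ℂ, Fin d → ℂ) S a)) ∧
        S '' W = p ⁻¹' ψ.source ∧
        (∀ a ∈ W, ψ (p (S a)) = (a.1, a.2.2 • a.2.1)) ∧
        ∀ a ∈ W, ∀ b ∈ W, S a = S b ↔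
          a.1 = b.1 ∧ ∃ s : ℂ, s ≠ 0 ∧ b.2.1 = s • a.2.1 ∧ a.2.2 = s * b.2.2

/-- `T` is a holomorphic trivialization over `O ⊆ B`, written in homogeneous coordinates, of the
`ℂPʳ`-bundle `ρ : V → B`, where `V ⊆ X`: the map
`(b, a) ↦ T (b, a)` (`b ∈ O`, `0 ≠ a ∈ ℂʳ⁺¹`) into `X` is holomorphic, takes the same value at
`(b, a)` and `(b, a')` exactly when `[a] = [a']`, is an immersion modulo scaling of `a`, and
maps onto `ρ⁻¹(O)` compatibly with the projections to `O`.  So it induces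
`O × ℂPʳ ≅ ρ⁻¹(O)`. -/
structure IsProjectiveTrivialization {d m : ℕ} {X B : Type} [TopologicalSpace X]
    [ChartedSpace (Fin d → ℂ) X] [TopologicalSpace B] [ChartedSpace (Fin m → ℂ) B]
    {V : Set X} (ρ : V → B) (r : ℕ) (O : Set B) (T : B × (Fin (r + 1) → ℂ) → X) : Prop where
  holomorphic : ContMDiffOn (𝓘(ℂ, Fin m → ℂ).prod 𝓘(ℂ, Fin (r + 1) → ℂ)) 𝓘(ℂ, Fin d → ℂ) ω T
    (O ×ˢ {a | a ≠ 0})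
  mem : ∀ b ∈ O, ∀ a, a ≠ 0 → ∃ h : T (b, a) ∈ V, ρ ⟨T (b, a), h⟩ = b
  surjective : ∀ v : V, ρ v ∈ O → ∃ a, a ≠ 0 ∧ T (ρ v, a) = v
  eq_iff : ∀ b ∈ O, ∀ a a', a ≠ 0 → a' ≠ 0 →
    (T (b, a) = T (b, a') ↔ ∃ s : ℂ, s ≠ 0 ∧ a' = s • a)
  immersive : ∀ b ∈ O, ∀ a, a ≠ 0 → ∀ (u : Fin m → ℂ) (u' : Fin (r + 1) → ℂ),
    mfderiv (𝓘(ℂ, Fin m → ℂ).prod 𝓘(ℂ, Fin (r + 1) → ℂ)) 𝓘(ℂ, Fin d → ℂ) T (b, a) (u, u') = 0 →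
      u = 0 ∧ ∃ s : ℂ, u' = s • a

/-- A (fibrewise) Mukai flop `X₊ ⇢ X₋` of complex symplectic manifolds `(X₊, Ω₊)`, `(X₋, Ω₋)`
along `V₊`.  Here `V₊ ⊆ X₊`, `V₋ ⊆ X₋` are closed complex submanifolds of codimension `r`,
`ρ₊ : V₊ → B` is a `ℂPʳ`-bundle over a complex manifold `B`, and `ρ₋ : V₋ → B` is the dual
projective bundle, whose fibre over `b` is the space of hyperplanes of `ρ₊⁻¹(b)`.
There is one complex manifold `Z` which is both the blow-up `p₊ : Z → X₊` along `V₊` and the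
blow-up `p₋ : Z → X₋` along `V₋`, with the same exceptional divisor `D`, and `(p₊, p₋)` identifies
`D` with the variety of pairs `(v, h)`, `v` a point and `h` a hyperplane of the same fibre, with
`v ∈ h` (the projectivized relative cotangent bundle of `V₊`).
The flop is the bimeromorphic map `p₋ ∘ p₊⁻¹`; it is biholomorphic from `X₊ \ V₊` to `X₋ \ V₋`
and it respects the symplectic forms.  For `B` a point this is the flop along `V₊ ≅ ℂPʳ`. -/
structure MukaiFlop {d m : ℕ} {Xp Xm B : Type}
    [TopologicalSpace Xp] [ChartedSpace (Fin d → ℂ) Xp]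
    [TopologicalSpace Xm] [ChartedSpace (Fin d → ℂ) Xm]
    [TopologicalSpace B] [ChartedSpace (Fin m → ℂ) B]
    (Ωp : (x : Xp) → TangentSpace 𝓘(ℂ, Fin d → ℂ) x [⋀^Fin 2]→L[ℂ] ℂ)
    (Ωm : (x : Xm) → TangentSpace 𝓘(ℂ, Fin d → ℂ) x [⋀^Fin 2]→L[ℂ] ℂ)
    {Vp : Set Xp} {Vm : Set Xm} (ρp : Vp → B) (ρm : Vm → B) (r : ℕ) where
  isManifold_plus : IsManifold 𝓘(ℂ, Fin d → ℂ) ω Xp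
  isManifold_minus : IsManifold 𝓘(ℂ, Fin d → ℂ) ω Xm
  isManifold_base : IsManifold 𝓘(ℂ, Fin m → ℂ) ω B
  symplectic_plus : IsHolomorphicSymplectic Ωp
  symplectic_minus : IsHolomorphicSymplectic Ωm
  continuous_plus : Continuous ρp
  continuous_minus : Continuous ρm
  /-- The common blow-up. -/
  Z : Type
  [topologicalSpace : TopologicalSpace Z]
  [t2Space : T2Space Z]
  [chartedSpace : ChartedSpace (Fin d → ℂ) Z]
  [isManifold : IsManifold 𝓘(ℂ, Fin d → ℂ) ω Z]
  /-- The blow-down to `X₊`. -/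
  pp : Z → Xp
  /-- The blow-down to `X₋`. -/
  pm : Z → Xm
  isBlowUp_plus : IsBlowUp (d := d) pp Vp r
  isBlowUp_minus : IsBlowUp (d := d) pm Vm r
  divisor_eq : pp ⁻¹' Vp = pm ⁻¹' Vm
  pullback_eq : ∀ (z : Z) (u v : TangentSpace 𝓘(ℂ, Fin d → ℂ) z),
    Ωp (pp z) ![mfderiv 𝓘(ℂ, Fin d → ℂ) 𝓘(ℂ, Fin d → ℂ) pp z u,
        mfderiv 𝓘(ℂ, Fin d → ℂ) 𝓘(ℂ, Fin d → ℂ) pp z v] =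
      Ωm (pm z) ![mfderiv 𝓘(ℂ, Fin d → ℂ) 𝓘(ℂ, Fin d → ℂ) pm z u,
        mfderiv 𝓘(ℂ, Fin d → ℂ) 𝓘(ℂ, Fin d → ℂ) pm z v]
  divisor_fibred : ∀ (z : Z) (hp : pp z ∈ Vp) (hm : pm z ∈ Vm), ρp ⟨pp z, hp⟩ = ρm ⟨pm z, hm⟩
  divisor_injective : ∀ z z' : Z, pp z ∈ Vp → pp z = pp z' → pm z = pm z' → z = z'
  dual_bundles : ∀ b : B, ∃ O : Set B, IsOpen O ∧ b ∈ O ∧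
    ∃ (Tp : B × (Fin (r + 1) → ℂ) → Xp) (Tm : B × (Fin (r + 1) → ℂ) → Xm),
      IsProjectiveTrivialization (d := d) (m := m) ρp r O Tp ∧
      IsProjectiveTrivialization (d := d) (m := m) ρm r O Tm ∧
      ∀ c ∈ O, ∀ a a', a ≠ 0 → a' ≠ 0 →
        ((∃ z : Z, pp z = Tp (c, a) ∧ pm z = Tm (c, a')) ↔ ∑ i, a i * a' i = 0)

end ComplexGeometry

/-! ## Toric hyperkähler varieties -/

namespace ToricHK

/-- The quaternionic vector space `ℍᴺ`, with `ξ = z + w I₂` written as `(z, w)`.  The complex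
structure `I₁` is multiplication by `√-1` on both factors. -/
abbrev HN (N : ℕ) : Type := (Fin N → ℂ) × (Fin N → ℂ)

/-- The standard Riemannian metric of `ℍᴺ`. -/
def metric {N : ℕ} (v v' : HN N) : ℝ :=
  ∑ i, ((starRingEnd ℂ (v.1 i) * v'.1 i).re + (starRingEnd ℂ (v.2 i) * v'.2 i).re)

/-- The standard holomorphic symplectic form `ω₂ + √-1 ω₃ = ∑ dzᵢ ∧ dwᵢ` of `(ℍᴺ, I₁)`. -/
def complexForm {N : ℕ} (v v' : HN N) : ℂ := ∑ i, (v.1 i * v'.2 i - v.2 i * v'.1 i)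

/-- The exponential map `x ↦ (exp (2π√-1 xᵢ))ᵢ` of the complex torus `(ℂˣ)ᴺ`. -/
def torusExp {N : ℕ} (x : Fin N → ℂ) : Fin N → ℂˣ :=
  fun i => Units.mk0 (Complex.exp (2 * Real.pi * Complex.I * x i)) (Complex.exp_ne_zero _)

theorem torusExp_zero {N : ℕ} : torusExp (0 : Fin N → ℂ) = 1 := by
  funext i; ext; simp [torusExp]

theorem torusExp_add {N : ℕ} (x y : Fin N → ℂ) :
    torusExp (x + y) = torusExp x * torusExp y := by
  funext i; ext; simp [torusExp, mul_add, Complex.exp_add]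

theorem torusExp_neg {N : ℕ} (x : Fin N → ℂ) : torusExp (-x) = (torusExp x)⁻¹ := by
  rw [eq_inv_iff_mul_eq_one, ← torusExp_add, neg_add_cancel, torusExp_zero]

/-- The inclusion `ℝᴺ ⊆ ℂᴺ`. -/
def toC {N : ℕ} (x : Fin N → ℝ) : Fin N → ℂ := fun i => (x i : ℂ)

theorem toC_zero {N : ℕ} : toC (0 : Fin N → ℝ) = 0 := by funext i; simp [toC]

theorem toC_add {N : ℕ} (x y : Fin N → ℝ) : toC (x + y) = toC x + toC y := by
  funext i; simp [toC]

theorem toC_neg {N : ℕ} (x : Fin N → ℝ) : toC (-x) = -toC x := by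
  funext i; simp [toC]

/-- The action `(z, w) ζ = (z ζ, w ζ⁻¹)` of the torus on `ℍᴺ`. -/
def act {N : ℕ} (ζ : Fin N → ℂˣ) (p : HN N) : HN N :=
  (fun i => p.1 i * (ζ i : ℂ), fun i => p.2 i * ((ζ i)⁻¹ : ℂˣ))

theorem act_one {N : ℕ} (p : HN N) : act 1 p = p := by
  ext i <;> simp [act]

theorem act_mul {N : ℕ} (ζ η : Fin N → ℂˣ) (p : HN N) : act (ζ * η) p = act ζ (act η p) := by
  ext i <;> simp [act] <;> ring

/-- The integral points `k_ℤ = k ∩ ℤᴺ`, as a subgroup of `ℤᴺ`. -/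
def latticePoints {N : ℕ} (k : Submodule ℝ (Fin N → ℝ)) : AddSubgroup (Fin N → ℤ) where
  carrier := {x | (fun i => (x i : ℝ)) ∈ k}
  zero_mem' := by
    have : (fun i => (((0 : Fin N → ℤ) i : ℤ) : ℝ)) = (0 : Fin N → ℝ) := by funext i; simp
    simpa only [Set.mem_ofPred_eq, this] using k.zero_mem
  add_mem' := by
    intro a b ha hb
    have : (fun i => (((a + b) i : ℤ) : ℝ)) = (fun i => (a i : ℝ)) + fun i => (b i : ℝ) := by
      funext i; simp
    simpa only [Set.mem_ofPred_eq, this] using k.add_mem ha hb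
  neg_mem' := by
    intro a ha
    have : (fun i => (((-a) i : ℤ) : ℝ)) = -(fun i => (a i : ℝ)) := by funext i; simp
    simpa only [Set.mem_ofPred_eq, this] using k.neg_mem ha

/-- `k ⊆ tᴺ = ℝᴺ` is the Lie algebra of a connected subtorus of `Tᴺ`: it is spanned by its
integral points. -/
def IsSubtorusLie {N : ℕ} (k : Submodule ℝ (Fin N → ℝ)) : Prop :=
  Submodule.span ℝ ((fun (x : Fin N → ℤ) (i : Fin N) => (x i : ℝ)) '' latticePoints k) = k

/-- The connected subtorus `K = Exp k` of `Tᴺ = {ζ | |ζᵢ| = 1} ⊆ (ℂˣ)ᴺ`. -/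
def subtorus {N : ℕ} (k : Submodule ℝ (Fin N → ℝ)) : Subgroup (Fin N → ℂˣ) where
  carrier := {ζ | ∃ x ∈ k, ζ = torusExp (toC x)}
  one_mem' := ⟨0, k.zero_mem, by rw [toC_zero, torusExp_zero]⟩
  mul_mem' := by
    rintro _ _ ⟨x, hx, rfl⟩ ⟨y, hy, rfl⟩
    exact ⟨x + y, k.add_mem hx hy, by rw [toC_add, torusExp_add]⟩
  inv_mem' := by
    rintro _ ⟨x, hx, rfl⟩
    exact ⟨-x, k.neg_mem hx, by rw [toC_neg, torusExp_neg]⟩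

/-- The complexification `K_ℂ = Exp (k + √-1 k)` of `K`. -/
def complexSubtorus {N : ℕ} (k : Submodule ℝ (Fin N → ℝ)) : Subgroup (Fin N → ℂˣ) where
  carrier := {ζ | ∃ x ∈ k, ∃ y ∈ k, ζ = torusExp (toC x + Complex.I • toC y)}
  one_mem' := ⟨0, k.zero_mem, 0, k.zero_mem, by rw [toC_zero, smul_zero, add_zero, torusExp_zero]⟩
  mul_mem' := by
    rintro _ _ ⟨x, hx, y, hy, rfl⟩ ⟨x', hx', y', hy', rfl⟩
    refine ⟨x + x', k.add_mem hx hx', y + y', k.add_mem hy hy', ?_⟩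
    rw [toC_add, toC_add, ← torusExp_add, smul_add]
    congr 1; abel
  inv_mem' := by
    rintro _ ⟨x, hx, y, hy, rfl⟩
    refine ⟨-x, k.neg_mem hx, -y, k.neg_mem hy, ?_⟩
    rw [toC_neg, toC_neg, ← torusExp_neg, smul_neg, neg_add]

/-- The restriction `ι* uᵢ ∈ k*` of the `i`-th coordinate function. -/
def iotaU {N : ℕ} (k : Submodule ℝ (Fin N → ℝ)) (i : Fin N) : StrongDual ℝ k :=
  (ContinuousLinearMap.proj (R := ℝ) (φ := fun _ : Fin N => ℝ) i).comp k.subtypeL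

/-- The smoothness condition on `K`: `ℤᴺ = k_ℤ + ∑_{i ∉ J} ℤ Xᵢ` whenever `(ι* uᵢ)_{i ∈ J}` is a
basis of `k*`. -/
def IsUnimodular {N : ℕ} (k : Submodule ℝ (Fin N → ℝ)) : Prop :=
  ∀ J : Finset (Fin N),
    LinearIndependent ℝ (fun i : J => iotaU k i) →
    Submodule.span ℝ (Set.range fun i : J => iotaU k i) = ⊤ →
    latticePoints k ⊔ AddSubgroup.closure {x | ∃ i, i ∉ J ∧ x = Pi.single i (1 : ℤ)} = ⊤

/-- The real moment map `μ₁ : ℍᴺ → k*`. -/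
def mu1 {N : ℕ} (k : Submodule ℝ (Fin N → ℝ)) (p : HN N) : StrongDual ℝ k :=
  Real.pi • ∑ i, (‖p.1 i‖ ^ 2 - ‖p.2 i‖ ^ 2) • iotaU k i

/-- The complex moment map `μ_ℂ : ℍᴺ → k*_ℂ`, where `k*_ℂ` is the space of real linear maps
`k → ℂ`. -/
def muC {N : ℕ} (k : Submodule ℝ (Fin N → ℝ)) (p : HN N) : k →L[ℝ] ℂ :=
  (-2 * Real.pi * Complex.I : ℂ) • ∑ i, (p.1 i * p.2 i) • Complex.ofRealCLM.comp (iotaU k i)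

/-- The level set `μ⁻¹(α, β)`. -/
def level {N : ℕ} (k : Submodule ℝ (Fin N → ℝ)) (α : StrongDual ℝ k) (β : k →L[ℝ] ℂ) :
    Set (HN N) :=
  {p | mu1 k p = α ∧ muC k p = β}

/-- Two points of `μ⁻¹(α, β)` are equivalent if they lie in the same `K`-orbit. -/
instance orbitSetoid {N : ℕ} (k : Submodule ℝ (Fin N → ℝ)) (α : StrongDual ℝ k)
    (β : k →L[ℝ] ℂ) : Setoid (level k α β) where
  r p q := ∃ ζ ∈ subtorus k, act ζ (p : HN N) = q
  iseqv :=
    { refl := fun p => ⟨1, (subtorus k).one_mem, act_one _⟩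
      symm := by
        rintro p q ⟨ζ, hζ, h⟩
        exact ⟨ζ⁻¹, (subtorus k).inv_mem hζ, by rw [← h, ← act_mul, inv_mul_cancel, act_one]⟩
      trans := by
        rintro p q s ⟨ζ, hζ, h⟩ ⟨η, hη, h'⟩
        exact ⟨η * ζ, (subtorus k).mul_mem hη hζ, by rw [act_mul, h, h']⟩ }

/-- The toric hyperkähler variety `X(α, β) = μ⁻¹(α, β) / K`, with the quotient topology. -/
def X {N : ℕ} (k : Submodule ℝ (Fin N → ℝ)) (α : StrongDual ℝ k) (β : k →L[ℝ] ℂ) : Type :=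
  Quotient (orbitSetoid k α β)

instance {N : ℕ} (k : Submodule ℝ (Fin N → ℝ)) (α : StrongDual ℝ k) (β : k →L[ℝ] ℂ) :
    TopologicalSpace (X k α β) :=
  inferInstanceAs (TopologicalSpace (Quotient (orbitSetoid k α β)))

/-- The class `[z, w] ∈ X(α, β)`. -/
def X.mk {N : ℕ} {k : Submodule ℝ (Fin N → ℝ)} {α : StrongDual ℝ k} {β : k →L[ℝ] ℂ}
    (p : level k α β) : X k α β :=
  Quotient.mk (orbitSetoid k α β) p

/-- The value at `p` of the vector field on `ℍᴺ` induced by `x ∈ k`. -/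
def infAct {N : ℕ} (x : Fin N → ℝ) (p : HN N) : HN N :=
  (fun i => 2 * Real.pi * Complex.I * x i * p.1 i, fun i => -(2 * Real.pi * Complex.I * x i * p.2 i))

/-- The horizontal space at `p`: the vectors tangent to the level set of `μ = (μ₁, μ_ℂ)` and
orthogonal to the `K`-orbit through `p`. -/
def horizontal {N : ℕ} (k : Submodule ℝ (Fin N → ℝ)) (p : HN N) : Set (HN N) :=
  {v | fderiv ℝ (mu1 k) p v = 0 ∧ fderiv ℝ (muC k) p v = 0 ∧
    ∀ x ∈ k, metric v (infAct x p) = 0}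

/-- The given complex manifold structure on `X(α, β)` is the complex structure `I₁` of the
hyperkähler quotient, and `Ω` is its holomorphic symplectic form `ω₂ + √-1 ω₃`.
That is: the quotient map `q : μ⁻¹(α, β) → X(α, β)` is smooth (in the chart at `q(p)` it extends
near `p` to a smooth map `F` on `ℍᴺ`), its differential maps the horizontal space at each `p`
isomorphically onto the tangent space at `q(p)`, this isomorphism commutes with `I₁`, and
it pulls `Ω` back to the restriction of `∑ dzᵢ ∧ dwᵢ`.  These conditions determine the complex
structure and `Ω`.  (Mathlib's tangent space at `q(p)` is the model space of the preferred chart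
at `q(p)`, so `fderiv ℝ F p v` is the image of `v` under the differential of `q`.) -/
structure IsHyperkahlerQuotient {N n : ℕ} (k : Submodule ℝ (Fin N → ℝ)) (α : StrongDual ℝ k)
    (β : k →L[ℝ] ℂ) [ChartedSpace (Fin (2 * n) → ℂ) (X k α β)]
    (Ω : (x : X k α β) → TangentSpace 𝓘(ℂ, Fin (2 * n) → ℂ) x [⋀^Fin 2]→L[ℂ] ℂ) : Prop where
  isManifold : IsManifold 𝓘(ℂ, Fin (2 * n) → ℂ) ω (X k α β)
  quotient : ∀ p : level k α β, ∃ F : HN N → (Fin (2 * n) → ℂ),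
    ContDiffAt ℝ ∞ F p ∧
    (∀ᶠ q : level k α β in 𝓝 p, F (q : HN N) = chartAt (Fin (2 * n) → ℂ) (X.mk p) (X.mk q)) ∧
    Set.BijOn (fderiv ℝ F p) (horizontal k p) Set.univ ∧
    (∀ v ∈ horizontal k (p : HN N),
      fderiv ℝ F p (Complex.I • v) = Complex.I • fderiv ℝ F p v) ∧
    ∀ v ∈ horizontal k (p : HN N), ∀ v' ∈ horizontal k (p : HN N),
      Ω (X.mk p) ![fderiv ℝ F p v, fderiv ℝ F p v'] = complexForm v v'

/-- `f : X(α', β) → X(α, β)` is the natural morphism: `f [p] = [q]` exactly when the (closed)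
`K_ℂ`-orbit of `q` lies in the closure of the `K_ℂ`-orbit of `p`.  This is the map of categorical
quotients induced by the inclusion of the `α'`-semistable into the `α`-semistable points of
`μ_ℂ⁻¹(β)`. -/
def IsNaturalMorphism {N : ℕ} {k : Submodule ℝ (Fin N → ℝ)} {α' α : StrongDual ℝ k}
    {β : k →L[ℝ] ℂ} (f : X k α' β → X k α β) : Prop :=
  ∀ (p : level k α' β) (q : level k α β),
    f (X.mk p) = X.mk q ↔
      (q : HN N) ∈ closure {p' : HN N | ∃ ζ ∈ complexSubtorus k, p' = act ζ p}

/-- The isotropy subgroup `K_{(z, w)}` of `K` at `p = (z, w)`. -/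
def isotropy {N : ℕ} (k : Submodule ℝ (Fin N → ℝ)) (p : HN N) : Subgroup (Fin N → ℂˣ) where
  carrier := {ζ | ζ ∈ subtorus k ∧ act ζ p = p}
  one_mem' := ⟨(subtorus k).one_mem, act_one p⟩
  mul_mem' := by
    rintro ζ η ⟨hζ, h⟩ ⟨hη, h'⟩
    exact ⟨(subtorus k).mul_mem hζ hη, by rw [act_mul, h', h]⟩
  inv_mem' := by
    rintro ζ ⟨hζ, h⟩
    refine ⟨(subtorus k).inv_mem hζ, ?_⟩
    conv_lhs => rw [← h]
    rw [← act_mul, inv_mul_cancel, act_one]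

/-- The Lie algebra `{x ∈ tᴺ | Exp (t x) ∈ H for all t}` of a subgroup `H` of `Tᴺ`. -/
def lieAlg {N : ℕ} (H : Subgroup (Fin N → ℂˣ)) : Submodule ℝ (Fin N → ℝ) where
  carrier := {x | ∀ t : ℝ, torusExp (toC (t • x)) ∈ H}
  zero_mem' := by intro t; rw [smul_zero, toC_zero, torusExp_zero]; exact H.one_mem
  add_mem' := by
    intro x y hx hy t
    rw [smul_add, toC_add, torusExp_add]
    exact H.mul_mem (hx t) (hy t)
  smul_mem' := by
    intro c x hx t
    rw [smul_smul]
    exact hx (t * c)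

/-- `Λ⁽¹⁾`, the set of one-dimensional isotropy subgroups. -/
def isotropyOne {N : ℕ} (k : Submodule ℝ (Fin N → ℝ)) : Set (Subgroup (Fin N → ℂˣ)) :=
  {H | (∃ p : HN N, H = isotropy k p) ∧ Module.finrank ℝ (lieAlg H) = 1}

/-- The wall `W_H ⊆ k*`, the annihilator of the Lie algebra of `H`. -/
def wall {N : ℕ} (k : Submodule ℝ (Fin N → ℝ)) (H : Subgroup (Fin N → ℂˣ)) :
    Set (StrongDual ℝ k) :=
  {v | ∀ x : k, (x : Fin N → ℝ) ∈ lieAlg H → v x = 0}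

/-- The index set `S_β` of the walls `W_H` with `β ∈ W_H ⊗ ℂ`. -/
def wallIndex {N : ℕ} (k : Submodule ℝ (Fin N → ℝ)) (β : k →L[ℝ] ℂ) :
    Set (Subgroup (Fin N → ℂˣ)) :=
  {H | H ∈ isotropyOne k ∧ ∀ x : k, (x : Fin N → ℝ) ∈ lieAlg H → β x = 0}

/-- The complement of the walls `W_H`, `H ∈ S_β`. -/
def wallComplement {N : ℕ} (k : Submodule ℝ (Fin N → ℝ)) (β : k →L[ℝ] ℂ) :
    Set (StrongDual ℝ k) :=
  {v | ∀ H ∈ wallIndex k β, v ∉ wall k H}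

/-- A chamber for `β`: a connected component of the complement of the walls. -/
def IsChamber {N : ℕ} (k : Submodule ℝ (Fin N → ℝ)) (β : k →L[ℝ] ℂ)
    (C : Set (StrongDual ℝ k)) : Prop :=
  ∃ v ∈ wallComplement k β, C = connectedComponentIn (wallComplement k β) v

/-- The chambers `Cp` and `Cm` are next to each other across the wall `W_H`: they are different and
their closures share a non-empty relatively open part of `W_H`. -/
structure AreAdjacent {N : ℕ} (k : Submodule ℝ (Fin N → ℝ)) (β : k →L[ℝ] ℂ)
    (H : Subgroup (Fin N → ℂˣ)) (Cp Cm : Set (StrongDual ℝ k)) : Prop where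
  chamber_plus : IsChamber k β Cp
  chamber_minus : IsChamber k β Cm
  mem : H ∈ wallIndex k β
  ne : Cp ≠ Cm
  facet : ∃ U : Set (StrongDual ℝ k), IsOpen U ∧ (U ∩ wall k H).Nonempty ∧
    U ∩ wall k H ⊆ closure Cp ∩ closure Cm

/-- `V₀ = {[z, w] ∈ X(α, β) | (z, w) ζ = (z, w) for all ζ ∈ H}`. -/
def fixedLocus {N : ℕ} (k : Submodule ℝ (Fin N → ℝ)) (α : StrongDual ℝ k) (β : k →L[ℝ] ℂ)
    (H : Subgroup (Fin N → ℂˣ)) : Set (X k α β) :=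
  {x | ∃ p : level k α β, x = X.mk p ∧ ∀ ζ ∈ H, act ζ (p : HN N) = p}

end ToricHK

end

noncomputable section

namespace ToricHK

/-! ## Frames of the lattice -/

/-! The level set is first replaced by a stability condition. Along an orbit of K_ℂ the moment map
μ₁ is the differential of a convex function, a sum of exponentials minus a linear form (Kempf–Ness).
So X(α, β) is the quotient by K_ℂ of `stab k α β`, the points of μ_ℂ⁻¹(β) whose K_ℂ-orbit meets the
level set. Membership of q is tested on the cone `InCone` of those y ∈ k whose real one-parameter
group keeps q bounded: α(y) has to be negative unless y fixes q (`mem_stab_of_inCone`,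
`of_mem_stab`). A level point in an orbit closure is unique modulo K
(`exists_mem_subtorus_of_mem_closure`); this makes the quotient map `Qm` well defined and identifies
the natural morphisms.

When q has no infinitesimal stabilizer, its cone is generated by rays cut out by coordinate
hyperplanes. On these β vanishes, so they span the lines Lie H_s with s ∈ S_β (`inCone_induction`,
`IsRay.exists_wallIndex`). On all rays except multiples of Y the parameters α₊, α and α₋ have the
same signs, while α₊ and α₋ have opposite signs on Y (`exists_wallCrossing`). Unimodularity makes
the entries of Y, suitably scaled, equal to 0 or ±1. Write xᵢ and yᵢ for the coordinates of weight
+1 and −1 at the indices i with Yᵢ ≠ 0. Then x ≠ 0 on the α₊-stable points, y ≠ 0 on the α₋-stable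
ones, and the two sets agree where both are non-zero. The locus V₊ is y = 0. Over a point c of V₀
its fibre is the projective space of the x, because the stabilizer of c in K_ℂ is exactly the group
ℂˣ generated by Y. Since β(Y) = 0, every point of the fibre of μ_ℂ satisfies ∑ Yᵢ xᵢ yᵢ = 0.

The common blow-up consists of triples (x, y, t), with weight-zero coordinates added and ∑ Yᵢ xᵢ yᵢ
= 0, modulo K_ℂ × ℂˣ. It maps to X(α₊, β) by (x, t y) and to X(α₋, β) by (t x, y) (`Zhat`, `blw`).
For t ≠ 0 these two points lie in one K_ℂ-orbit. For t = 0 they are a point [x] and a hyperplane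
[y], and the equation says that they are incident (`WallCrossing.exists_incidence_iff`). The
equation is homogeneous in y, so it can be solved before y is multiplied by t; this gives the local
model of a blow-up (`IsAdapted.blw_lft`, `WallCrossing.isBlowUp`). The other side is the same
statement for −Y. Up to sign, the two pull-backs of the symplectic forms differ by dt ∧ d(∑ Yᵢ xᵢ
yᵢ), which is zero (`complexForm_blw`).

The complex structures come from slices. Unimodularity supplies integral frames of k
(`exists_frame`), so dim k coordinates can be normalized to constants by a unique monomial element
of K_ℂ, and the equation μ_ℂ = β is then solved for their partners. The remaining coordinates are
Darboux coordinates, which settles holomorphy and closedness of the form. Non-degeneracy, and the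
comparison with the hyperkähler quotient, use the quaternionic structure J through Ω(v, Jv) = |v|².

If only two entries of Y are non-zero, V₊ and V₋ have codimension one. A blow-up along a
hypersurface is biholomorphic (`IsBlowUp.exists_diffeomorph`), so the common blow-up identifies the
two sides. -/

/-- `e` is a family of integral points of `k` indexed by `B ⊆ A` and dual to the coordinates in `B`;
these coordinates determine the coordinates in `A` of the elements of `k`. -/
structure Frame {N : ℕ} (k : Submodule ℝ (Fin N → ℝ)) (A : Set (Fin N)) (B : Finset (Fin N))
    (e : Fin N → Fin N → ℤ) : Prop where
  mem : ∀ i ∈ B, (fun l => (e i l : ℝ)) ∈ k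
  dual : ∀ i ∈ B, ∀ j ∈ B, e i j = if i = j then 1 else 0
  sub : ∀ i ∈ B, i ∈ A
  det : ∀ x ∈ k, (∀ i ∈ B, x i = 0) → ∀ l ∈ A, x l = 0

variable {N : ℕ} {k : Submodule ℝ (Fin N → ℝ)}

theorem Frame.expand {A : Set (Fin N)} {B : Finset (Fin N)} {e : Fin N → Fin N → ℤ}
    (hB : Frame k A B e) {x : Fin N → ℝ} (hx : x ∈ k) {l : Fin N} (hl : l ∈ A) :
    x l = ∑ i ∈ B, x i * e i l := by
  have h := hB.det (x - ∑ i ∈ B, x i • (fun l => (e i l : ℝ)))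
    (k.sub_mem hx (k.sum_mem fun i hi => k.smul_mem _ (hB.mem i hi))) ?_ l hl
  · simpa [sub_eq_zero] using h
  · intro j hj
    have : ∑ i ∈ B, x i * (e i j : ℝ) = x j := by
      rw [Finset.sum_eq_single j]
      · simp [hB.dual j hj j hj]
      · intro i hi hij; simp [hB.dual i hi j hj, hij]
      · intro h; exact absurd hj h
    simp [this]

theorem iotaU_apply (i : Fin N) (x : k) : iotaU k i x = (x : Fin N → ℝ) i := rfl

theorem span_range_iotaU : Submodule.span ℝ (Set.range (iotaU k)) = ⊤ := by
  rw [eq_top_iff]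
  intro f _
  obtain ⟨g, hg⟩ := LinearMap.exists_extend (p := k) (f : k →ₗ[ℝ] ℝ)
  have : f = ∑ i, g (Pi.single i 1) • iotaU k i := by
    ext x
    have h1 : f x = g (x : Fin N → ℝ) := by rw [← k.subtype_apply, ← LinearMap.comp_apply, hg]; rfl
    rw [h1]
    conv_lhs => rw [← Finset.univ_sum_single (x : Fin N → ℝ)]
    rw [map_sum]
    simp only [sum_apply, smul_apply, iotaU_apply, smul_eq_mul]
    refine Finset.sum_congr rfl fun i _ => ?_
    have : Pi.single i ((x : Fin N → ℝ) i) = (x : Fin N → ℝ) i • (Pi.single i (1 : ℝ) : Fin N → ℝ) := by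
      rw [← Pi.single_smul]; simp
    rw [this, map_smul, smul_eq_mul, mul_comm]
  rw [this]
  exact Submodule.sum_mem _ fun i _ => Submodule.smul_mem _ _ (Submodule.subset_span ⟨i, rfl⟩)

/-- Unimodularity enters here. A basis of k* is chosen among the ι*uᵢ, maximal first inside T and
then overall. Writing Xᵢ as a point of k_ℤ plus standard vectors outside the basis, the first
summand has coordinates δᵢⱼ on the basis. The coordinates in T are combinations of those chosen
inside T, so `hT` carries vanishing over to A. -/
theorem exists_frame (hK : IsUnimodular k) {A T B₀ : Set (Fin N)} (hTA : T ⊆ A)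
    (hT : ∀ x ∈ k, (∀ i ∈ T, x i = 0) → ∀ l ∈ A, x l = 0)
    (hB₀ : B₀ ⊆ T) (hli : LinearIndepOn ℝ (iotaU k) B₀) :
    ∃ B e, Frame k A B e ∧ B₀ ⊆ B ∧ (B : Set (Fin N)) ⊆ T := by
  classical
  obtain ⟨b, hbT, hb0, hbs, hbli⟩ := exists_linearIndepOn_extension (K := ℝ) (V := StrongDual ℝ k) (v := iotaU k)
    (s := B₀) (t := T) (by exact hli) hB₀
  obtain ⟨c, -, hbc, hcs, hcli⟩ := exists_linearIndepOn_extension (K := ℝ) (V := StrongDual ℝ k) (v := iotaU k)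
    (s := b) (t := Set.univ) (by exact hbli) (Set.subset_univ b)
  have hcJ : ((c.toFinset : Finset (Fin N)) : Set (Fin N)) = c := by simp
  have hsp : Submodule.span ℝ (iotaU k '' c) = ⊤ := by
    rw [eq_top_iff, ← span_range_iotaU, Submodule.span_le, ← Set.image_univ]
    exact hcs
  have hlat := hK c.toFinset ?_ ?_
  rotate_left
  · have : LinearIndepOn ℝ (iotaU k) ((c.toFinset : Finset (Fin N)) : Set (Fin N)) := by rwa [hcJ]
    exact this
  · rw [← hsp]; congr 1
    ext f; simp
  have hex : ∀ i : Fin N, ∃ e : Fin N → ℤ, (fun l => (e l : ℝ)) ∈ k ∧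
      ∀ j ∈ c, e j = if i = j then 1 else 0 := by
    intro i
    have hi : (Pi.single i 1 : Fin N → ℤ) ∈ latticePoints k ⊔
        AddSubgroup.closure {x | ∃ i, i ∉ c.toFinset ∧ x = Pi.single i (1 : ℤ)} := by
      rw [hlat]; trivial
    obtain ⟨y, hy, z, hz, hyz⟩ := AddSubgroup.mem_sup.1 hi
    refine ⟨y, hy, fun j hj => ?_⟩
    -- The second summand involves only standard vectors outside `c`, so on `c` the lattice point y
    -- has the coordinates of Xᵢ.
    have hzj : z j = 0 := by
      clear hyz
      induction hz using AddSubgroup.closure_induction with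
      | mem x hx =>
        obtain ⟨i', hi', rfl⟩ := hx
        have : j ≠ i' := by rintro rfl; exact hi' (by simpa using hj)
        simp [this]
      | zero => rfl
      | add x y _ _ hx hy => simp [hx, hy]
      | neg x _ hx => simp [hx]
    have := congrFun hyz j
    simp only [Pi.add_apply, hzj, add_zero] at this
    rw [this, Pi.single_apply]
    simp [eq_comm]
  choose e he hed using hex
  refine ⟨b.toFinset, e, ⟨fun i _ => he i, fun i _ j hj => hed i j (hbc (by simpa using hj)),
    fun i hi => hTA (hbT (by simpa using hi)), fun x hx hxb => hT x hx fun i hi => ?_⟩,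
    by simpa using hb0, by simpa using hbT⟩
  have h1 : iotaU k i ∈ Submodule.span ℝ (iotaU k '' b) := hbs ⟨i, hi, rfl⟩
  have h2 : Submodule.span ℝ (iotaU k '' b) ≤
      LinearMap.ker (ContinuousLinearMap.apply ℝ ℝ (⟨x, hx⟩ : k)).toLinearMap := by
    rw [Submodule.span_le]
    rintro _ ⟨j, hj, rfl⟩
    simpa [iotaU_apply] using hxb j (by simpa using hj)
  simpa [iotaU_apply] using h2 h1

/-- Rank–nullity for the restriction of coordinates to B: duality makes this map onto, and `det`
identifies its kernel with L. -/
theorem Frame.card_add {A : Set (Fin N)} {B : Finset (Fin N)} {e : Fin N → Fin N → ℤ}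
    (hB : Frame k A B e) {m : ℕ} (L : Submodule ℝ (Fin N → ℝ)) (hL : ∀ x, x ∈ L ↔ x ∈ k ∧ ∀ l ∈ A, x l = 0)
    (hm : Module.finrank ℝ L = m) : B.card + m = Module.finrank ℝ k := by
  let φ : k →ₗ[ℝ] (B → ℝ) := LinearMap.pi fun i => (LinearMap.proj (i : Fin N)).comp k.subtype
  have h1 := LinearMap.finrank_range_add_finrank_ker φ
  have hsurj : LinearMap.range φ = ⊤ := by
    rw [LinearMap.range_eq_top]
    intro y
    refine ⟨⟨∑ i : B, y i • (fun l => (e i l : ℝ)), k.sum_mem fun i _ => k.smul_mem _ (hB.mem i i.2)⟩, ?_⟩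
    funext j
    simp only [φ, LinearMap.pi_apply, LinearMap.comp_apply, Submodule.subtype_apply, LinearMap.proj_apply,
      Finset.sum_apply, Pi.smul_apply, smul_eq_mul]
    rw [Finset.sum_eq_single j]
    · simp [hB.dual j j.2 j j.2]
    · intro i _ hij
      have : (i : Fin N) ≠ j := fun h => hij (Subtype.ext h)
      simp [hB.dual i i.2 j j.2, this]
    · simp
  have hker : Module.finrank ℝ (LinearMap.ker φ) = m := by
    rw [← hm]
    have : (LinearMap.ker φ).map k.subtype = L := by
      ext x
      rw [hL]
      simp only [Submodule.mem_map, LinearMap.mem_ker, Submodule.subtype_apply]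
      constructor
      · rintro ⟨y, hy, rfl⟩
        exact ⟨y.2, hB.det y y.2 fun i hi => congrFun hy ⟨i, hi⟩⟩
      · rintro ⟨hx, hxA⟩
        exact ⟨⟨x, hx⟩, funext fun i => hxA i (hB.sub i i.2), rfl⟩
    rw [← this]
    exact (LinearEquiv.finrank_eq (Submodule.equivMapOfInjective _ k.subtype_injective _))
  rw [hsurj, hker, finrank_top] at h1
  simpa using h1

/-! ## Monomial one-parameter families in `K_ℂ` and compactness of `K` -/

theorem exists_exp_eq {c : ℂ} (hc : c ≠ 0) : ∃ a b : ℝ,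
    Complex.exp (2 * Real.pi * Complex.I * (a + Complex.I * b)) = c := by
  have h2 : (2 * Real.pi * Complex.I : ℂ) ≠ 0 := by simp [Real.pi_ne_zero]
  set l := Complex.log c / (2 * Real.pi * Complex.I) with hl
  refine ⟨l.re, l.im, ?_⟩
  have : ((l.re : ℂ) + Complex.I * l.im) = l := by rw [mul_comm]; exact Complex.re_add_im l
  rw [this, hl, mul_div_cancel₀ _ h2, Complex.exp_log hc]

/-- The logarithms of the cᵢ are arbitrary: integrality of the frame turns the exponential of their
combination into a monomial. -/
theorem Frame.exists_monomial {A : Set (Fin N)} {B : Finset (Fin N)} {e : Fin N → Fin N → ℤ}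
    (hB : Frame k A B e) (c : Fin N → ℂ) (hc : ∀ i ∈ B, c i ≠ 0) :
    ∃ ζ ∈ complexSubtorus k, ∀ l, (ζ l : ℂ) = ∏ i ∈ B, c i ^ e i l := by
  have hex : ∀ i, ∃ a b : ℝ, i ∈ B →
      Complex.exp (2 * Real.pi * Complex.I * (a + Complex.I * b)) = c i := by
    intro i
    by_cases hi : i ∈ B
    · obtain ⟨a, b, h⟩ := exists_exp_eq (hc i hi); exact ⟨a, b, fun _ => h⟩
    · exact ⟨0, 0, fun h => absurd h hi⟩
  choose a b hab using hex
  refine ⟨_, ⟨∑ i ∈ B, a i • (fun l => (e i l : ℝ)),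
    k.sum_mem fun i hi => k.smul_mem _ (hB.mem i hi), ∑ i ∈ B, b i • (fun l => (e i l : ℝ)),
    k.sum_mem fun i hi => k.smul_mem _ (hB.mem i hi), rfl⟩, fun l => ?_⟩
  simp only [torusExp, Units.val_mk0, toC, Pi.add_apply, Pi.smul_apply, Finset.sum_apply, smul_eq_mul]
  push_cast
  rw [Finset.mul_sum, ← Finset.sum_add_distrib, Finset.mul_sum, Complex.exp_sum]
  refine Finset.prod_congr rfl fun i hi => ?_
  rw [← hab i hi, ← Complex.exp_int_mul]
  congr 1; ring

/-- Exponential form of `Frame.expand`. On A an element of K_ℂ is determined by its coordinates in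
B, which is the uniqueness behind all slices. -/
theorem Frame.torus_expand {A : Set (Fin N)} {B : Finset (Fin N)} {e : Fin N → Fin N → ℤ}
    (hB : Frame k A B e) {ζ : Fin N → ℂˣ} (hζ : ζ ∈ complexSubtorus k) {l : Fin N} (hl : l ∈ A) :
    (ζ l : ℂ) = ∏ i ∈ B, (ζ i : ℂ) ^ e i l := by
  obtain ⟨x, hx, y, hy, rfl⟩ := hζ
  simp only [torusExp, Units.val_mk0, toC, Pi.add_apply, Pi.smul_apply, smul_eq_mul,
    ← Complex.exp_int_mul, ← Complex.exp_sum]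
  rw [hB.expand hx hl, hB.expand hy hl]
  congr 1
  push_cast
  rw [Finset.mul_sum, ← Finset.sum_add_distrib, Finset.mul_sum]
  refine Finset.sum_congr rfl fun i _ => by ring

theorem subtorus_le : subtorus k ≤ complexSubtorus k := by
  rintro _ ⟨x, hx, rfl⟩
  exact ⟨x, hx, 0, k.zero_mem, by rw [toC_zero, smul_zero, add_zero]⟩

theorem exists_univ_frame (hK : IsUnimodular k) : ∃ B e, Frame k Set.univ B e := by
  obtain ⟨B, e, h, -⟩ := exists_frame hK (A := Set.univ) (T := Set.univ) (B₀ := ∅) subset_rfl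
    (fun x _ h l _ => h l trivial) (Set.empty_subset _) (linearIndepOn_empty ℝ _)
  exact ⟨B, e, h⟩

theorem continuous_torusExp_coe : Continuous fun x : Fin N → ℝ => torusExp (toC x) := by
  refine continuous_pi fun i => Units.continuous_iff.2 ⟨?_, ?_⟩
  · simp only [Function.comp_def, torusExp, toC, Units.val_mk0]; fun_prop
  · simp only [torusExp, toC, Units.val_inv_eq_inv_val, Units.val_mk0, ← Complex.exp_neg]; fun_prop

theorem torusExp_intCast (m : Fin N → ℤ) : torusExp (toC fun i => (m i : ℝ)) = 1 := by
  funext i; ext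
  simp only [torusExp, toC, Units.val_mk0, Pi.one_apply, Units.val_one]
  rw [Complex.exp_eq_one_iff]
  exact ⟨m i, by push_cast; ring⟩

/-- With a frame for all coordinates, K is the image of a cube: rounding the coordinates in B to
integers changes x by an integral vector, on which the exponential is trivial. -/
theorem isCompact_subtorus (hK : IsUnimodular k) :
    IsCompact (subtorus k : Set (Fin N → ℂˣ)) := by
  obtain ⟨B, e, hB⟩ := exists_univ_frame hK
  let f : (Fin N → ℝ) → (Fin N → ℂˣ) := fun θ => torusExp (toC (∑ i ∈ B, θ i • fun l => (e i l : ℝ)))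
  have hf : Continuous f := continuous_torusExp_coe.comp (by fun_prop)
  have : (subtorus k : Set (Fin N → ℂˣ)) = f '' (Set.pi Set.univ fun _ => Set.Icc 0 1) := by
    ext ζ
    constructor
    · rintro ⟨x, hx, rfl⟩
      refine ⟨fun i => Int.fract (x i), fun i _ => ⟨Int.fract_nonneg _, (Int.fract_lt_one _).le⟩, ?_⟩
      have : x = (∑ i ∈ B, Int.fract (x i) • fun l => (e i l : ℝ)) +
          fun l => ((∑ i ∈ B, ⌊x i⌋ * e i l : ℤ) : ℝ) := by
        funext l
        rw [hB.expand hx (Set.mem_univ l)]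
        simp only [Pi.add_apply, Finset.sum_apply, Pi.smul_apply, smul_eq_mul]
        push_cast
        rw [← Finset.sum_add_distrib]
        refine Finset.sum_congr rfl fun i _ => ?_
        rw [← add_mul, Int.fract_add_floor]
      conv_rhs => rw [this, toC_add, torusExp_add, torusExp_intCast, mul_one]
    · rintro ⟨θ, -, rfl⟩
      exact ⟨_, k.sum_mem fun i hi => k.smul_mem _ (hB.mem i hi), rfl⟩
  rw [this]
  exact (isCompact_univ_pi fun _ => isCompact_Icc).image hf

/-! ## Non-emptiness of the level sets -/

/-- Surjectivity of the hyperkähler moment map of a single quaternionic coordinate. The two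
equations force |z|² + |w|² = √(a² + 4|b|²), which is `s`, and hence |z|² = (a + s)/2. -/
theorem exists_mul_eq_and_normSq_sub (a : ℝ) (b : ℂ) :
    ∃ z w : ℂ, z * w = b ∧ ‖z‖ ^ 2 - ‖w‖ ^ 2 = a := by
  set s := Real.sqrt (a ^ 2 + 4 * ‖b‖ ^ 2) with hs
  have hs2 : s ^ 2 = a ^ 2 + 4 * ‖b‖ ^ 2 := Real.sq_sqrt (by positivity)
  have hsa : |a| ≤ s := Real.abs_le_sqrt (by nlinarith [sq_nonneg ‖b‖])
  have h1 : 0 ≤ (a + s) / 2 := by linarith [neg_abs_le a]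
  set ρ := Real.sqrt ((a + s) / 2) with hρ
  have hρ2 : ρ ^ 2 = (a + s) / 2 := Real.sq_sqrt h1
  by_cases h0 : ρ = 0
  · have h2 : a + s = 0 := by rw [h0] at hρ2; linarith
    have hb : b = 0 := by
      have : ‖b‖ ^ 2 = 0 := by
        have : s = -a := by linarith
        rw [this] at hs2; linarith
      simpa using this
    refine ⟨0, (Real.sqrt (-a) : ℝ), by simp [hb], ?_⟩
    have ha : 0 ≤ -a := by linarith [neg_abs_le a, abs_nonneg a]
    rw [Complex.norm_real, Real.norm_eq_abs, sq_abs, Real.sq_sqrt ha]; simp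
  · have hc : (ρ : ℂ) ≠ 0 := by exact_mod_cast h0
    refine ⟨ρ, b / ρ, mul_div_cancel₀ _ hc, ?_⟩
    rw [norm_div, Complex.norm_real, Real.norm_eq_abs, div_pow, sq_abs]
    have : ρ ^ 2 ≠ 0 := pow_ne_zero 2 h0
    rw [sub_eq_iff_eq_add, ← sub_eq_iff_eq_add', eq_div_iff this, hρ2]
    nlinarith

theorem mu1_apply (p : HN N) (x : k) :
    mu1 k p x = Real.pi * ∑ i, (‖p.1 i‖ ^ 2 - ‖p.2 i‖ ^ 2) * (x : Fin N → ℝ) i := by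
  simp [mu1, iotaU_apply]

theorem muC_apply (p : HN N) (x : k) :
    muC k p x = (-2 * Real.pi * Complex.I : ℂ) * ∑ i, (p.1 i * p.2 i) * ((x : Fin N → ℝ) i : ℂ) := by
  simp [muC, iotaU_apply]

theorem two_pi_I_ne_zero : (-2 * Real.pi * Complex.I : ℂ) ≠ 0 := by simp [Real.pi_ne_zero]

theorem Frame.eq_expand {A : Set (Fin N)} {B : Finset (Fin N)} {e : Fin N → Fin N → ℤ}
    (hB : Frame k A B e) {V : Type*} [NormedAddCommGroup V] [NormedSpace ℝ V] (f : k →L[ℝ] V)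
    (hf : ∀ x : k, (∀ l ∈ A, (x : Fin N → ℝ) l = 0) → f x = 0) (x : k) :
    f x = ∑ i ∈ B.attach, (x : Fin N → ℝ) i • f ⟨_, hB.mem i i.2⟩ := by
  have h := hf (x - ∑ i ∈ B.attach, (x : Fin N → ℝ) i • ⟨_, hB.mem i i.2⟩) ?_
  · rw [map_sub, map_sum, sub_eq_zero] at h
    rw [h]
    exact Finset.sum_congr rfl fun i _ => map_smul f _ _
  · intro l hl
    rw [Submodule.coe_sub, Pi.sub_apply, hB.expand x.2 hl, Submodule.coe_sum, Finset.sum_apply]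
    simp only [Submodule.coe_smul, Pi.smul_apply, smul_eq_mul]
    rw [Finset.sum_attach B fun i => (x : Fin N → ℝ) i * (e i l : ℝ), sub_self]

/-- Every frame index carries its own one-coordinate problem and all other coordinates are zero;
expanding elements of k in the frame gives the equations on all of k. -/
theorem Frame.exists_level {A : Set (Fin N)} {B : Finset (Fin N)} {e : Fin N → Fin N → ℤ}
    (hB : Frame k A B e) (α : StrongDual ℝ k) (β : k →L[ℝ] ℂ)
    (hα : ∀ x : k, (∀ l ∈ A, (x : Fin N → ℝ) l = 0) → α x = 0)
    (hβ : ∀ x : k, (∀ l ∈ A, (x : Fin N → ℝ) l = 0) → β x = 0) :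
    ∃ p ∈ level k α β, ∀ i ∉ A, p.1 i = 0 ∧ p.2 i = 0 := by
  have hex : ∀ i, ∃ z w : ℂ, (∀ hi : i ∈ B, z * w = β ⟨_, hB.mem i hi⟩ / (-2 * Real.pi * Complex.I) ∧
      ‖z‖ ^ 2 - ‖w‖ ^ 2 = α ⟨_, hB.mem i hi⟩ / Real.pi) ∧ (i ∉ B → z = 0 ∧ w = 0) := by
    intro i
    by_cases hi : i ∈ B
    · obtain ⟨z, w, h⟩ := exists_mul_eq_and_normSq_sub (α ⟨_, hB.mem i hi⟩ / Real.pi)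
        (β ⟨_, hB.mem i hi⟩ / (-2 * Real.pi * Complex.I))
      exact ⟨z, w, fun _ => h, fun h' => absurd hi h'⟩
    · exact ⟨0, 0, fun h' => absurd h' hi, fun _ => ⟨rfl, rfl⟩⟩
  choose z w h1 h2 using hex
  refine ⟨(z, w), ⟨?_, ?_⟩, fun i hi => h2 i fun h => hi (hB.sub i h)⟩
  · ext x
    rw [mu1_apply, hB.eq_expand α hα x]
    rw [← Finset.sum_subset (Finset.subset_univ B), ← Finset.sum_attach, Finset.mul_sum]
    · refine Finset.sum_congr rfl fun i _ => ?_
      simp only [(h1 i i.2).2, smul_eq_mul]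
      field_simp [Real.pi_ne_zero]
    · intro i _ hi; simp [h2 i hi]
  · ext x
    rw [muC_apply, hB.eq_expand β hβ x]
    rw [← Finset.sum_subset (Finset.subset_univ B), ← Finset.sum_attach, Finset.mul_sum]
    · refine Finset.sum_congr rfl fun i _ => ?_
      simp only [(h1 i i.2).1, Complex.real_smul]
      field_simp [two_pi_I_ne_zero]
    · intro i _ hi; simp [h2 i hi]

end ToricHK

namespace ToricHK

/-! ## Critical points of sums of exponentials -/

section KempfNess

variable {V : Type*} [NormedAddCommGroup V] [NormedSpace ℝ V]
  {ι : Type*} [Fintype ι]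

/-- The function `∑ aᵢ exp ℓᵢ + ∑ bᵢ exp (-ℓᵢ) - α`. -/
def expSum (l : ι → V →L[ℝ] ℝ) (α : V →L[ℝ] ℝ) (a b : ι → ℝ) (y : V) : ℝ :=
  ∑ i, (a i * Real.exp (l i y) + b i * Real.exp (-l i y)) - α y

/-- `y` is a critical point of `expSum l α a b`. -/
def IsExpCritical (l : ι → V →L[ℝ] ℝ) (α : V →L[ℝ] ℝ) (a b : ι → ℝ) (y : V) : Prop :=
  ∀ x, ∑ i, (a i * Real.exp (l i y) - b i * Real.exp (-l i y)) * l i x = α x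

variable {l : ι → V →L[ℝ] ℝ} {α : V →L[ℝ] ℝ} {a b : ι → ℝ}

theorem isExpCritical_of_isLocalMin {y : V} (h : IsLocalMin (expSum l α a b) y) :
    IsExpCritical l α a b y := by
  intro x
  have hd : HasDerivAt (fun t : ℝ => expSum l α a b (y + t • x))
      (∑ i, (a i * Real.exp (l i y) - b i * Real.exp (-l i y)) * l i x - α x) 0 := by
    have hl : ∀ f : V →L[ℝ] ℝ, HasDerivAt (fun t : ℝ => f (y + t • x)) (f x) 0 := by
      intro f
      have : (fun t : ℝ => f (y + t • x)) = fun t => f y + t * f x := by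
        funext t; simp
      rw [this]
      simpa using ((hasDerivAt_id (0 : ℝ)).mul_const (f x)).const_add (f y)
    unfold expSum
    refine HasDerivAt.sub (HasDerivAt.fun_sum fun i _ => ?_) (hl α)
    have h1 := ((hl (l i)).exp.const_mul (a i)).fun_add ((hl (l i)).fun_neg.exp.const_mul (b i))
    simp only [zero_smul, add_zero] at h1
    convert h1 using 1
    ring
  have hmin : IsLocalMin (fun t : ℝ => expSum l α a b (y + t • x)) 0 := by
    have hc : Filter.Tendsto (fun t : ℝ => y + t • x) (𝓝 0) (𝓝 y) := by
      have : Continuous fun t : ℝ => y + t • x := by fun_prop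
      simpa using this.tendsto 0
    filter_upwards [hc.eventually h] with t ht
    simpa using ht
  have := hmin.hasDerivAt_eq_zero hd
  linarith

theorem continuous_expSum_uncurry :
    Continuous fun q : ((ι → ℝ) × (ι → ℝ)) × V => expSum l α q.1.1 q.1.2 q.2 := by
  unfold expSum; fun_prop

/-- The minimum over the closed ball cannot lie on the sphere, where the values exceed the value at
the centre. -/
theorem exists_isExpCritical_of_sphere [FiniteDimensional ℝ V] {ε : ℝ} (hε : 0 < ε)
    (h : ∀ y, ‖y‖ = ε → expSum l α a b 0 < expSum l α a b y) :
    ∃ y, ‖y‖ < ε ∧ IsExpCritical l α a b y := by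
  have hc : Continuous (expSum l α a b) :=
    continuous_expSum_uncurry.comp (by fun_prop : Continuous fun y : V => ((a, b), y))
  obtain ⟨y, hy, hmin⟩ := (isCompact_closedBall (0 : V) ε).exists_isMinOn
    ⟨0, by simp [hε.le]⟩ hc.continuousOn
  have hyε : ‖y‖ < ε := by
    rcases lt_or_eq_of_le (by simpa using hy : ‖y‖ ≤ ε) with h1 | h1
    · exact h1
    · exact absurd (hmin (by simp [hε.le] : (0 : V) ∈ Metric.closedBall 0 ε)) (not_le.2 (h y h1))
  refine ⟨y, hyε, isExpCritical_of_isLocalMin ?_⟩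
  exact hmin.isLocalMin (Metric.closedBall_mem_nhds_of_mem (by simpa using hyε))

/-- Criticality at 0 cancels the linear terms and leaves nonnegative multiples of eˢ − 1 − s, which
is positive for s ≠ 0. -/
theorem expSum_zero_lt (ha : ∀ i, 0 ≤ a i) (hb : ∀ i, 0 ≤ b i) (hcr : IsExpCritical l α a b 0) {y : V}
    (hy : ∃ i, (a i ≠ 0 ∨ b i ≠ 0) ∧ l i y ≠ 0) : expSum l α a b 0 < expSum l α a b y := by
  have h1 := hcr y
  simp only [map_zero, neg_zero, Real.exp_zero, mul_one] at h1
  unfold expSum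
  simp only [map_zero, neg_zero, Real.exp_zero, mul_one, sub_zero, ← h1]
  rw [← Finset.sum_sub_distrib]
  obtain ⟨i, hi, hli⟩ := hy
  have hexp : ∀ s : ℝ, s + 1 ≤ Real.exp s := Real.add_one_le_exp
  refine Finset.sum_lt_sum (fun j _ => ?_) ⟨i, Finset.mem_univ i, ?_⟩
  · nlinarith [mul_le_mul_of_nonneg_left (hexp (l j y)) (ha j),
      mul_le_mul_of_nonneg_left (hexp (-l j y)) (hb j)]
  · have e1 := Real.add_one_lt_exp hli
    have e2 := Real.add_one_lt_exp (neg_ne_zero.2 hli)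
    rcases hi with h | h
    · have := lt_of_le_of_ne (ha i) (Ne.symm h)
      nlinarith [mul_lt_mul_of_pos_left e1 this, mul_le_mul_of_nonneg_left (hexp (-l i y)) (hb i)]
    · have := lt_of_le_of_ne (hb i) (Ne.symm h)
      nlinarith [mul_lt_mul_of_pos_left e2 this, mul_le_mul_of_nonneg_left (hexp (l i y)) (ha i)]

/-- A strict minimum survives perturbation of the coefficients: by compactness the strict inequality
on a small sphere persists. The perturbed coefficients need not be nonnegative. -/
theorem eventually_exists_isExpCritical [FiniteDimensional ℝ V]
    (ha : ∀ i, 0 ≤ a i) (hb : ∀ i, 0 ≤ b i) (hcr : IsExpCritical l α a b 0)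
    (hnd : ∀ y, (∀ i, (a i ≠ 0 ∨ b i ≠ 0) → l i y = 0) → y = 0) {ε : ℝ} (hε : 0 < ε) :
    ∀ᶠ c in 𝓝 (a, b), ∃ y, ‖y‖ < ε ∧ IsExpCritical l α c.1 c.2 y := by
  have hs : ∀ᶠ c in 𝓝 (a, b), ∀ y ∈ Metric.sphere (0 : V) ε,
      expSum l α c.1 c.2 0 < expSum l α c.1 c.2 y := by
    refine (isCompact_sphere (0 : V) ε).eventually_forall_of_forall_eventually fun y hy => ?_
    have hy0 : y ≠ 0 := by rintro rfl; simp at hy; exact hε.ne hy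
    have hlt : expSum l α a b 0 < expSum l α a b y := by
      refine expSum_zero_lt ha hb hcr ?_
      by_contra! hcon
      exact hy0 (hnd y fun i hi => hcon i hi)
    have c1 : Continuous fun q : ((ι → ℝ) × (ι → ℝ)) × V => expSum l α q.1.1 q.1.2 0 :=
      continuous_expSum_uncurry.comp
        (by fun_prop : Continuous fun q : ((ι → ℝ) × (ι → ℝ)) × V => (q.1, (0 : V)))
    exact (c1.tendsto ((a, b), y)).eventually_lt
      (continuous_expSum_uncurry.tendsto ((a, b), y)) hlt
  filter_upwards [hs] with c hc
  exact exists_isExpCritical_of_sphere hε fun y hy => hc y (by simpa using hy)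

theorem expSum_smul_le (ha : ∀ i, 0 ≤ a i) (hb : ∀ i, 0 ≤ b i) {y : V} {s : ℝ} (h0 : 0 ≤ s)
    (h1 : s ≤ 1) (hy : expSum l α a b y ≤ expSum l α a b 0) :
    expSum l α a b (s • y) ≤ expSum l α a b 0 := by
  have hexp : ∀ u : ℝ, Real.exp (s * u) ≤ (1 - s) + s * Real.exp u := by
    intro u
    have := convexOn_exp.2 (Set.mem_univ 0) (Set.mem_univ u) (by linarith : 0 ≤ 1 - s) h0 (by ring)
    simpa using this
  have : expSum l α a b (s • y) ≤ (1 - s) * expSum l α a b 0 + s * expSum l α a b y := by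
    unfold expSum
    simp only [map_zero, neg_zero, Real.exp_zero, mul_one, sub_zero, map_smul, smul_eq_mul]
    rw [mul_sub, Finset.mul_sum, Finset.mul_sum, ← add_sub_assoc, ← Finset.sum_add_distrib]
    refine sub_le_sub_right (Finset.sum_le_sum fun i _ => ?_) _
    have e1 := mul_le_mul_of_nonneg_left (hexp (l i y)) (ha i)
    have e2 := mul_le_mul_of_nonneg_left (hexp (-l i y)) (hb i)
    rw [mul_neg] at e2
    nlinarith
  nlinarith

/-- Coercivity by contradiction. Failure on spheres of growing radius produces, in the limit, a ray
on which the function stays below its value at 0. No exponential can grow along it, so the stability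
hypothesis makes α negative on its direction; but then the term −α is unbounded above on the ray. -/
theorem exists_isExpCritical [FiniteDimensional ℝ V] (ha : ∀ i, 0 ≤ a i) (hb : ∀ i, 0 ≤ b i)
    (hst : ∀ y, y ≠ 0 → (∀ i, a i ≠ 0 → l i y ≤ 0) → (∀ i, b i ≠ 0 → 0 ≤ l i y) → α y < 0) :
    ∃ y, IsExpCritical l α a b y := by
  have hc : Continuous (expSum l α a b) :=
    continuous_expSum_uncurry.comp (by fun_prop : Continuous fun y : V => ((a, b), y))
  by_contra hno
  -- Without a critical point every sphere contains a point whose value is at most the one at 0;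
  -- convexity extends this to the segment from 0.
  have hbad : ∀ n : ℕ, ∃ u : V, ‖u‖ = 1 ∧
      ∀ s : ℝ, 0 ≤ s → s ≤ n + 1 → expSum l α a b (s • u) ≤ expSum l α a b 0 := by
    intro n
    have hn : (0 : ℝ) < n + 1 := by positivity
    by_contra hcon
    refine hno ?_
    suffices h : ∀ y, ‖y‖ = (n : ℝ) + 1 → expSum l α a b 0 < expSum l α a b y by
      obtain ⟨y, -, hy⟩ := exists_isExpCritical_of_sphere hn h
      exact ⟨y, hy⟩
    · intro y hy
      by_contra hle
      rw [not_lt] at hle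
      refine hcon ⟨((n : ℝ) + 1)⁻¹ • y, ?_, fun s hs hsn => ?_⟩
      · rw [norm_smul, hy, Real.norm_eq_abs, abs_of_pos (inv_pos.2 hn), inv_mul_cancel₀ hn.ne']
      · rw [smul_smul]
        refine expSum_smul_le ha hb (by positivity) ?_ hle
        rw [← div_eq_mul_inv, div_le_one hn]; exact hsn
  choose u hu hus using hbad
  obtain ⟨v, hv, φ, hφ, hlim⟩ := (isCompact_sphere (0 : V) 1).tendsto_subseq
    (x := u) (fun n => by simp [hu n])
  have hv1 : ‖v‖ = 1 := by simpa using hv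
  have hv0 : v ≠ 0 := by rintro rfl; simp at hv1
  -- For fixed s the bound holds for all late terms of the subsequence, hence for the limit
  -- direction v.
  have hray : ∀ s : ℝ, 0 ≤ s → expSum l α a b (s • v) ≤ expSum l α a b 0 := by
    intro s hs
    have ht : Filter.Tendsto (fun n => expSum l α a b (s • u (φ n))) Filter.atTop
        (𝓝 (expSum l α a b (s • v))) :=
      (hc.tendsto _).comp (hlim.const_smul s)
    refine le_of_tendsto ht ?_
    obtain ⟨n₀, hn₀⟩ := exists_nat_ge s
    filter_upwards [Filter.eventually_ge_atTop n₀] with n hn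
    refine hus (φ n) s hs ?_
    have : (n₀ : ℝ) ≤ φ n := by exact_mod_cast hn.trans (hφ.id_le n)
    linarith
  set M := expSum l α a b 0 with hM
  have hsum : ∀ s : ℝ, 0 ≤ s → ∀ i, a i * Real.exp (s * l i v) ≤ M + s * α v ∧
      b i * Real.exp (-(s * l i v)) ≤ M + s * α v := by
    intro s hs i
    have h1 := hray s hs
    unfold expSum at h1
    simp only [map_smul, smul_eq_mul] at h1
    have hnn : ∀ j, 0 ≤ a j * Real.exp (s * l j v) + b j * Real.exp (-(s * l j v)) := fun j =>
      add_nonneg (mul_nonneg (ha j) (Real.exp_pos _).le) (mul_nonneg (hb j) (Real.exp_pos _).le)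
    have h2 := Finset.single_le_sum (f := fun j => a j * Real.exp (s * l j v) +
      b j * Real.exp (-(s * l j v))) (fun j _ => hnn j) (Finset.mem_univ i)
    have h3 := mul_nonneg (ha i) (Real.exp_pos (s * l i v)).le
    have h4 := mul_nonneg (hb i) (Real.exp_pos (-(s * l i v))).le
    constructor <;> linarith
  have hgrow : ∀ c t : ℝ, 0 < c → 0 < t → ∃ s : ℝ, 0 ≤ s ∧ M + s * α v < c * Real.exp (s * t) := by
    intro c t hc ht
    have h1 : Filter.Tendsto (fun s : ℝ => Real.exp (s * t) / s ^ 1) Filter.atTop Filter.atTop := by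
      have := tendsto_exp_mul_div_rpow_atTop 1 t ht
      refine this.congr fun s => ?_
      rw [Real.rpow_one, pow_one, mul_comm]
    have h2 := h1.eventually_gt_atTop ((|M| + |α v|) / c)
    obtain ⟨s, hs, hs1⟩ := (h2.and (Filter.eventually_ge_atTop 1)).exists
    refine ⟨s, by linarith, ?_⟩
    have hs0 : 0 < s := by linarith
    rw [pow_one, div_lt_div_iff₀ hc hs0] at hs
    have e1 : s * α v ≤ s * |α v| := mul_le_mul_of_nonneg_left (le_abs_self _) hs0.le
    have e2 : M ≤ s * |M| := (le_abs_self M).trans (by nlinarith [abs_nonneg M])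
    nlinarith
  have hneg : α v < 0 := by
    refine hst v hv0 (fun i hi => ?_) (fun i hi => ?_)
    · by_contra hpos
      obtain ⟨s, hs, hlt⟩ := hgrow (a i) (l i v) (lt_of_le_of_ne (ha i) (Ne.symm hi)) (not_le.1 hpos)
      exact absurd (hsum s hs i).1 (not_le.2 hlt)
    · by_contra hpos
      obtain ⟨s, hs, hlt⟩ := hgrow (b i) (-l i v) (lt_of_le_of_ne (hb i) (Ne.symm hi))
        (by linarith [not_le.1 hpos])
      rw [mul_neg] at hlt
      exact absurd (hsum s hs i).2 (not_le.2 hlt)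
  have hMle : ∀ s : ℝ, 0 ≤ s → 0 ≤ M + s * α v := by
    intro s hs
    have h1 := hray s hs
    unfold expSum at h1
    simp only [map_smul, smul_eq_mul] at h1
    have : 0 ≤ ∑ j, (a j * Real.exp (s * l j v) + b j * Real.exp (-(s * l j v))) :=
      Finset.sum_nonneg fun j _ =>
        add_nonneg (mul_nonneg (ha j) (Real.exp_pos _).le) (mul_nonneg (hb j) (Real.exp_pos _).le)
    linarith
  have hM0 := hMle 0 le_rfl
  -- At this s the bound reads 0 ≤ −1.
  have := hMle ((M + 1) / (-α v)) (div_nonneg (by linarith) (by linarith))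
  have e : (M + 1) / (-α v) * α v = -(M + 1) := by field_simp [hneg.ne]
  linarith

end KempfNess

end ToricHK

namespace ToricHK

variable {N : ℕ} {k : Submodule ℝ (Fin N → ℝ)} {α : StrongDual ℝ k} {β : k →L[ℝ] ℂ}

/-! ## The torus action and the moment maps -/

/-- The indices `i` with `(zᵢ, wᵢ) ≠ 0`. -/
def coordSupp (q : HN N) : Set (Fin N) := {i | q.1 i ≠ 0 ∨ q.2 i ≠ 0}

theorem coordSupp_act (ζ : Fin N → ℂˣ) (q : HN N) : coordSupp (act ζ q) = coordSupp q := by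
  ext i; simp [coordSupp, act]

theorem act_inv_act (ζ : Fin N → ℂˣ) (q : HN N) : act ζ⁻¹ (act ζ q) = q := by
  rw [← act_mul, inv_mul_cancel, act_one]

theorem muC_act (ζ : Fin N → ℂˣ) (q : HN N) : muC k (act ζ q) = muC k q := by
  ext x
  rw [muC_apply, muC_apply]
  congr 1
  refine Finset.sum_congr rfl fun i _ => ?_
  simp only [act, Units.val_inv_eq_inv_val]
  field_simp [(ζ i).ne_zero]

theorem norm_of_mem_subtorus {ζ : Fin N → ℂˣ} (hζ : ζ ∈ subtorus k) (i : Fin N) :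
    ‖(ζ i : ℂ)‖ = 1 := by
  obtain ⟨x, -, rfl⟩ := hζ
  simp only [torusExp, Units.val_mk0, toC]
  rw [Complex.norm_exp]
  simp

theorem mu1_act_of_mem_subtorus {ζ : Fin N → ℂˣ} (hζ : ζ ∈ subtorus k) (q : HN N) :
    mu1 k (act ζ q) = mu1 k q := by
  ext x
  rw [mu1_apply, mu1_apply]
  simp [act, norm_of_mem_subtorus hζ]

theorem act_mem_level {ζ : Fin N → ℂˣ} (hζ : ζ ∈ subtorus k) {q : HN N} (hq : q ∈ level k α β) :
    act ζ q ∈ level k α β :=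
  ⟨(mu1_act_of_mem_subtorus hζ q).trans hq.1, (muC_act ζ q).trans hq.2⟩

/-- The element `(exp (yᵢ / 2))ᵢ` of the real part of the complex torus. -/
def rexp (y : Fin N → ℝ) : Fin N → ℂˣ :=
  fun i => Units.mk0 (Complex.exp ((y i / 2 : ℝ) : ℂ)) (Complex.exp_ne_zero _)

theorem rexp_eq (y : Fin N → ℝ) :
    rexp y = torusExp (toC 0 + Complex.I • toC ((-(4 * Real.pi)⁻¹) • y)) := by
  funext i; ext
  simp only [rexp, torusExp, toC, Units.val_mk0, Pi.add_apply, Pi.smul_apply, smul_eq_mul, Pi.zero_apply]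
  congr 1
  push_cast
  have : (Real.pi : ℂ) ≠ 0 := by exact_mod_cast Real.pi_ne_zero
  field_simp
  linear_combination (4 * (y i : ℂ)) * Complex.I_sq

theorem rexp_mem {y : Fin N → ℝ} (hy : y ∈ k) : rexp y ∈ complexSubtorus k :=
  ⟨0, k.zero_mem, _, k.smul_mem _ hy, rexp_eq y⟩

/-- Polar decomposition of K_ℂ; only the real factor changes μ₁. -/
theorem exists_polar {ζ : Fin N → ℂˣ} (hζ : ζ ∈ complexSubtorus k) :
    ∃ κ ∈ subtorus k, ∃ y ∈ k, ζ = κ * rexp y := by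
  obtain ⟨x, hx, y, hy, rfl⟩ := hζ
  refine ⟨_, ⟨x, hx, rfl⟩, (-(4 * Real.pi)) • y, k.smul_mem _ hy, ?_⟩
  rw [rexp_eq, torusExp_add, toC_zero, zero_add, smul_smul]
  have : (-(4 * Real.pi)⁻¹ * -(4 * Real.pi)) = 1 := by field_simp [Real.pi_ne_zero]
  rw [this, one_smul]

/-- The halving in `rexp` is made for this: squared norms are multiplied by exp(±yᵢ), so μ₁ along an
orbit becomes the derivative of an exponential sum. -/
theorem normSq_act_rexp (y : Fin N → ℝ) (q : HN N) (i : Fin N) :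
    ‖(act (rexp y) q).1 i‖ ^ 2 = ‖q.1 i‖ ^ 2 * Real.exp (y i) ∧
    ‖(act (rexp y) q).2 i‖ ^ 2 = ‖q.2 i‖ ^ 2 * Real.exp (-y i) := by
  constructor
  · simp only [act, rexp, Units.val_mk0, norm_mul, Complex.norm_exp_ofReal, mul_pow, ← Real.exp_nat_mul]
    congr 2; push_cast; ring
  · simp only [act, rexp, Units.val_mk0, Units.val_inv_eq_inv_val, norm_mul, norm_inv,
      Complex.norm_exp_ofReal, mul_pow, ← Real.exp_neg, ← Real.exp_nat_mul]
    congr 2; push_cast; ring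

theorem continuous_act : Continuous fun q : (Fin N → ℂˣ) × HN N => act q.1 q.2 := by
  unfold act
  have h1 : ∀ i, Continuous fun q : (Fin N → ℂˣ) × HN N => ((q.1 i : ℂˣ) : ℂ) := fun i =>
    Units.continuous_val.comp (by fun_prop)
  have h2 : ∀ i, Continuous fun q : (Fin N → ℂˣ) × HN N => (((q.1 i)⁻¹ : ℂˣ) : ℂ) := fun i =>
    Units.continuous_val.comp (by fun_prop)
  fun_prop

theorem continuous_act_right (ζ : Fin N → ℂˣ) : Continuous (act ζ : HN N → HN N) :=
  continuous_act.comp (by fun_prop : Continuous fun q : HN N => (ζ, q))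

theorem continuous_act_rexp : Continuous fun q : (Fin N → ℝ) × HN N => act (rexp q.1) q.2 := by
  simp only [act, rexp, Units.val_mk0, Units.val_inv_eq_inv_val, ← Complex.exp_neg]
  fun_prop

theorem rexp_zero : rexp (0 : Fin N → ℝ) = 1 := by funext i; ext; simp [rexp]

/-! ## Existence of points of the level set in `K_ℂ`-orbits -/

/-- The Kempf–Ness principle. The subspace W allows directions that fix q to be left out, along
which no strict minimum can exist. -/
theorem isExpCritical_iff_mu1 {W : Submodule ℝ k} {q : HN N} {y : W} :
    IsExpCritical (fun i => (iotaU k i).comp W.subtypeL) ((Real.pi⁻¹ • α).comp W.subtypeL)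
      (fun i => ‖q.1 i‖ ^ 2) (fun i => ‖q.2 i‖ ^ 2) y ↔
    ∀ x : W, mu1 k (act (rexp (y : Fin N → ℝ)) q) x = α x := by
  unfold IsExpCritical
  refine forall_congr' fun x => ?_
  rw [mu1_apply]
  have : ∀ i, (‖(act (rexp ((y : k) : Fin N → ℝ)) q).1 i‖ ^ 2 -
      ‖(act (rexp ((y : k) : Fin N → ℝ)) q).2 i‖ ^ 2) * ((x : k) : Fin N → ℝ) i =
      (‖q.1 i‖ ^ 2 * Real.exp (((y : k) : Fin N → ℝ) i) -
        ‖q.2 i‖ ^ 2 * Real.exp (-((y : k) : Fin N → ℝ) i)) * ((x : k) : Fin N → ℝ) i := by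
    intro i; rw [(normSq_act_rexp _ q i).1, (normSq_act_rexp _ q i).2]
  simp only [this, ContinuousLinearMap.comp_apply, Submodule.subtypeL_apply, iotaU_apply,
    smul_apply, smul_eq_mul]
  rw [eq_inv_mul_iff_mul_eq₀ Real.pi_ne_zero]

/-- On L both sides vanish: α by hypothesis, and μ₁ because its terms only see the support of q. -/
theorem mu1_eq_of_isCompl {L W : Submodule ℝ k} (hLW : IsCompl L W) {q : HN N}
    (hL : ∀ x : k, x ∈ L → ∀ i ∈ coordSupp q, (x : Fin N → ℝ) i = 0)
    (hα : ∀ x : k, x ∈ L → α x = 0) (h : ∀ x : W, mu1 k q x = α x) : mu1 k q = α := by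
  ext x
  obtain ⟨u, v, hu, hv, rfl⟩ := Submodule.codisjoint_iff_exists_add_eq.1 hLW.codisjoint x
  rw [map_add, map_add, hα u hu, h ⟨v, hv⟩]
  congr 1
  rw [mu1_apply, Finset.sum_eq_zero, mul_zero]
  intro i _
  by_cases hi : i ∈ coordSupp q
  · rw [hL u hu i hi, mul_zero]
  · simp only [coordSupp, Set.mem_ofPred_eq, not_or, not_not] at hi
    simp [hi.1, hi.2]

/-- The elements of `k` whose coordinates in `T` vanish. -/
def vanishing (k : Submodule ℝ (Fin N → ℝ)) (T : Set (Fin N)) : Submodule ℝ k where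
  carrier := {x | ∀ i ∈ T, (x : Fin N → ℝ) i = 0}
  zero_mem' := fun i _ => rfl
  add_mem' := fun {x y} hx hy i hi => by
    rw [Submodule.coe_add, Pi.add_apply, hx i hi, hy i hi, add_zero]
  smul_mem' := fun c x hx i hi => by
    rw [Submodule.coe_smul, Pi.smul_apply, hx i hi, smul_zero]

/-- `y` lies in the cone of the directions along which `q` stays bounded. -/
def InCone (q : HN N) (y : Fin N → ℝ) : Prop :=
  (∀ i, q.1 i ≠ 0 → y i ≤ 0) ∧ ∀ i, q.2 i ≠ 0 → 0 ≤ y i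

/-- The points whose `K_ℂ`-orbit meets the level set. -/
def stab (k : Submodule ℝ (Fin N → ℝ)) (α : StrongDual ℝ k) (β : k →L[ℝ] ℂ) : Set (HN N) :=
  {q | ∃ ζ ∈ complexSubtorus k, act ζ q ∈ level k α β}

theorem level_subset_stab : level k α β ⊆ stab k α β := fun q hq =>
  ⟨1, one_mem _, by rwa [act_one]⟩

theorem muC_of_mem_stab {q : HN N} (hq : q ∈ stab k α β) : muC k q = β := by
  obtain ⟨ζ, -, h⟩ := hq
  rw [← muC_act ζ q]; exact h.2

theorem act_mem_stab {ζ : Fin N → ℂˣ} (hζ : ζ ∈ complexSubtorus k) {q : HN N}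
    (hq : q ∈ stab k α β) : act ζ q ∈ stab k α β := by
  obtain ⟨η, hη, h⟩ := hq
  exact ⟨η * ζ⁻¹, mul_mem hη (inv_mem hζ), by rwa [act_mul, act_inv_act]⟩

/-- Existence half of the stability criterion. The minimization takes place on a complement of the
infinitesimal stabilizer; there a direction of the cone that fixes q is zero, so α is negative on
every non-zero direction that has to be tested. -/
theorem mem_stab_of_inCone {q : HN N} (hβ : muC k q = β)
    (h0 : ∀ y : k, (∀ i ∈ coordSupp q, (y : Fin N → ℝ) i = 0) → α y = 0)
    (hst : ∀ y : k, InCone q y → (∀ i ∈ coordSupp q, (y : Fin N → ℝ) i = 0) ∨ α y < 0) :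
    q ∈ stab k α β := by
  obtain ⟨W, hW⟩ := (vanishing k (coordSupp q)).exists_isCompl
  obtain ⟨y, hy⟩ := exists_isExpCritical (V := W) (l := fun i => (iotaU k i).comp W.subtypeL)
    (α := (Real.pi⁻¹ • α).comp W.subtypeL) (a := fun i => ‖q.1 i‖ ^ 2) (b := fun i => ‖q.2 i‖ ^ 2)
    (fun i => by positivity) (fun i => by positivity) (by
      intro y hy0 h1 h2
      have hc : InCone q ((y : k) : Fin N → ℝ) :=
        ⟨fun i hi => h1 i (by simpa using hi), fun i hi => h2 i (by simpa using hi)⟩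
      rcases hst y hc with h | h
      · exact absurd (Subtype.ext (Submodule.disjoint_def.1 hW.disjoint (y : k) h y.2)) hy0
      · simp only [ContinuousLinearMap.comp_apply, Submodule.subtypeL_apply, smul_apply, smul_eq_mul]
        exact mul_neg_of_pos_of_neg (inv_pos.2 Real.pi_pos) h)
  refine ⟨_, rexp_mem (y : k).2, mu1_eq_of_isCompl hW ?_ (fun x hx => h0 x hx)
    (isExpCritical_iff_mu1.1 hy), by rw [muC_act, hβ]⟩
  intro x hx i hi
  rw [coordSupp_act] at hi
  exact hx i hi

/-- Converse half. Paired with a direction y of the cone, μ₁ is a sum of nonpositive terms. A term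
with yᵢ ≠ 0 and i in the support is strictly negative, because then only one of zᵢ, wᵢ is non-zero.
-/
theorem of_mem_stab {q : HN N} (hq : q ∈ stab k α β) :
    (∀ y : k, (∀ i ∈ coordSupp q, (y : Fin N → ℝ) i = 0) → α y = 0 ∧ β y = 0) ∧
    ∀ y : k, InCone q y → (∀ i ∈ coordSupp q, (y : Fin N → ℝ) i = 0) ∨ α y < 0 := by
  obtain ⟨ζ, hζ, h⟩ := hq
  have h1 : ∀ i, (act ζ q).1 i ≠ 0 ↔ q.1 i ≠ 0 := fun i => by simp [act]
  have h2 : ∀ i, (act ζ q).2 i ≠ 0 ↔ q.2 i ≠ 0 := fun i => by simp [act]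
  have hs := coordSupp_act ζ q
  simp only [← hs]
  simp only [InCone, ← h1, ← h2]
  set p := act ζ q
  refine ⟨fun y hy => ⟨?_, ?_⟩, fun y hy => ?_⟩
  · rw [← h.1, mu1_apply, Finset.sum_eq_zero, mul_zero]
    intro i _
    by_cases hi : i ∈ coordSupp p
    · rw [hy i hi, mul_zero]
    · simp only [coordSupp, Set.mem_ofPred_eq, not_or, not_not] at hi
      simp [hi.1, hi.2]
  · rw [← h.2, muC_apply, Finset.sum_eq_zero, mul_zero]
    intro i _
    by_cases hi : i ∈ coordSupp p
    · rw [hy i hi]; simp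
    · simp only [coordSupp, Set.mem_ofPred_eq, not_or, not_not] at hi
      simp [hi.1, hi.2]
  · have hle : ∀ i, (‖p.1 i‖ ^ 2 - ‖p.2 i‖ ^ 2) * (y : Fin N → ℝ) i ≤ 0 := by
      intro i
      have e1 : ‖p.1 i‖ ^ 2 * (y : Fin N → ℝ) i ≤ 0 := by
        by_cases hz : p.1 i = 0
        · simp [hz]
        · exact mul_nonpos_of_nonneg_of_nonpos (by positivity) (hy.1 i hz)
      have e2 : 0 ≤ ‖p.2 i‖ ^ 2 * (y : Fin N → ℝ) i := by
        by_cases hz : p.2 i = 0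
        · simp [hz]
        · exact mul_nonneg (by positivity) (hy.2 i hz)
      rw [sub_mul]; linarith
    by_cases hex : ∀ i ∈ coordSupp p, (y : Fin N → ℝ) i = 0
    · exact Or.inl hex
    · right
      push Not at hex
      obtain ⟨i, hi, hyi⟩ := hex
      rw [← h.1, mu1_apply]
      refine mul_neg_of_pos_of_neg Real.pi_pos
        (Finset.sum_neg' (fun j _ => hle j) ⟨i, Finset.mem_univ i, ?_⟩)
      refine lt_of_le_of_ne (hle i) (mul_ne_zero ?_ hyi)
      intro hzero
      rcases hi with hz | hw
      · have hw : p.2 i = 0 := by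
          by_contra hw; exact hyi (le_antisymm (hy.1 i hz) (hy.2 i hw))
        rw [hw] at hzero; simp at hzero; exact hz hzero
      · have hz : p.1 i = 0 := by
          by_contra hz; exact hyi (le_antisymm (hy.1 i hz) (hy.2 i hw))
        rw [hz] at hzero; simp at hzero; exact hw hzero

/-- The points of `μ_ℂ⁻¹(β)` with coordinates outside `A` equal to zero. -/
def fiberOn (k : Submodule ℝ (Fin N → ℝ)) (β : k →L[ℝ] ℂ) (A : Set (Fin N)) : Set (HN N) :=
  {q | muC k q = β ∧ ∀ i ∉ A, q.1 i = 0 ∧ q.2 i = 0}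

theorem coordSupp_subset_of_mem_fiberOn {A : Set (Fin N)} {q : HN N} (hq : q ∈ fiberOn k β A) :
    coordSupp q ⊆ A := by
  intro i hi
  by_contra h
  rcases hi with h1 | h1
  · exact h1 (hq.2 i h).1
  · exact h1 (hq.2 i h).2

theorem act_mem_fiberOn {A : Set (Fin N)} (ζ : Fin N → ℂˣ) {q : HN N} (hq : q ∈ fiberOn k β A) :
    act ζ q ∈ fiberOn k β A :=
  ⟨(muC_act ζ q).trans hq.1, fun i hi => by simp [act, hq.2 i hi]⟩

theorem eventually_exists_mu1_eq {q₀ : HN N} (hq₀ : mu1 k q₀ = α) {W : Submodule ℝ k}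
    (hW : Disjoint (vanishing k (coordSupp q₀)) W) {ε : ℝ} (hε : 0 < ε) :
    ∀ᶠ q in 𝓝 q₀, ∃ y : W, ‖y‖ < ε ∧
      ∀ x : W, mu1 k (act (rexp ((y : k) : Fin N → ℝ)) q) x = α x := by
  have h0 : IsExpCritical (fun i => (iotaU k i).comp W.subtypeL) ((Real.pi⁻¹ • α).comp W.subtypeL)
      (fun i => ‖q₀.1 i‖ ^ 2) (fun i => ‖q₀.2 i‖ ^ 2) (0 : W) := by
    rw [isExpCritical_iff_mu1]
    intro x
    rw [Submodule.coe_zero, Submodule.coe_zero, rexp_zero, act_one, hq₀]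
  have hcrit := eventually_exists_isExpCritical
    (fun i => by positivity) (fun i => by positivity) h0 (fun y hy => by
      refine Subtype.ext (Submodule.disjoint_def.1 hW (y : k) (fun i hi => ?_) y.2)
      exact hy i (by simpa [coordSupp] using hi)) hε
  have hc2 : Continuous fun q : HN N =>
    (((fun i => ‖q.1 i‖ ^ 2), (fun i => ‖q.2 i‖ ^ 2)) : (Fin N → ℝ) × (Fin N → ℝ)) := by fun_prop
  filter_upwards [(hc2.tendsto q₀).eventually hcrit] with q hq
  obtain ⟨y, hyε, hy⟩ := hq
  exact ⟨y, hyε, isExpCritical_iff_mu1.1 hy⟩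

/-- The hypothesis `hreg` says that what fixes q₀ infinitesimally also fixes all points supported in
A. So one complement W serves for all nearby points, the minimum on it is strict at q₀, and a small
element of K_ℂ corrects the moment map. -/
theorem eventually_exists_act_mem_level {A : Set (Fin N)} {q₀ : HN N} (hq₀ : q₀ ∈ level k α β)
    (hreg : ∀ x ∈ k, (∀ i ∈ coordSupp q₀, x i = 0) → ∀ l ∈ A, x l = 0)
    {U : Set (HN N)} (hU : U ∈ 𝓝 q₀) :
    ∀ᶠ q in 𝓝[fiberOn k β A] q₀, ∃ ζ ∈ complexSubtorus k, act ζ q ∈ level k α β ∧ act ζ q ∈ U := by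
  obtain ⟨W, hW⟩ := (vanishing k (coordSupp q₀)).exists_isCompl
  have hcont : Filter.Tendsto (fun c : (Fin N → ℝ) × HN N => act (rexp c.1) c.2)
      (𝓝 (0, q₀)) (𝓝 q₀) := by
    have h := continuous_act_rexp.tendsto ((0 : Fin N → ℝ), q₀)
    simpa [rexp_zero, act_one] using h
  have hmem := hcont.eventually hU
  rw [nhds_prod_eq, Filter.eventually_prod_iff] at hmem
  obtain ⟨P, hP, R, hR, hPR⟩ := hmem
  obtain ⟨ε, hε, hball⟩ := Metric.eventually_nhds_iff.1 hP
  filter_upwards [nhdsWithin_le_nhds (eventually_exists_mu1_eq hq₀.1 hW.disjoint hε),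
    nhdsWithin_le_nhds hR, self_mem_nhdsWithin] with q hq hqR hqf
  obtain ⟨y, hyε, hy⟩ := hq
  have hy' : dist ((y : k) : Fin N → ℝ) 0 < ε := by rw [dist_zero_right]; exact hyε
  refine ⟨_, rexp_mem (y : k).2, ⟨mu1_eq_of_isCompl hW (fun x hx i hi => ?_) (fun x hx => ?_)
    hy, by rw [muC_act, hqf.1]⟩, hPR (hball hy') hqR⟩
  · rw [coordSupp_act] at hi
    exact hreg x x.2 hx i (coordSupp_subset_of_mem_fiberOn hqf hi)
  · exact ((of_mem_stab (level_subset_stab hq₀)).1 x hx).1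

/-! ## Uniqueness of points of the level set in orbit closures -/

/-- A lower bound that is quadratic near 0 and linear at infinity, so that it controls s without an
a priori bound. -/
theorem sq_div_le (s : ℝ) : s ^ 2 / (1 + |s|) ≤ (Real.exp s - 1) * s := by
  have h0 : 0 < 1 + |s| := by positivity
  rw [div_le_iff₀ h0]
  rcases le_or_gt 0 s with h | h
  · rw [abs_of_nonneg h]
    nlinarith [Real.add_one_le_exp s, mul_nonneg h h, mul_nonneg (mul_nonneg h h) h]
  · rw [abs_of_neg h]
    have h1 : Real.exp s * (1 - s) ≤ 1 := by
      have := Real.add_one_le_exp (-s)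
      have h2 : Real.exp s * Real.exp (-s) = 1 := by rw [← Real.exp_add]; simp
      nlinarith [Real.exp_pos s]
    nlinarith

theorem tendsto_zero_of_div_le {x η : ℕ → ℝ} (hx : ∀ n, 0 ≤ x n)
    (h : ∀ n, x n ≤ η n * (1 + x n)) (hη : Filter.Tendsto η Filter.atTop (𝓝 0)) :
    Filter.Tendsto x Filter.atTop (𝓝 0) := by
  have h2 : Filter.Tendsto (fun n => 2 * η n) Filter.atTop (𝓝 0) := by
    simpa using hη.const_mul 2
  refine tendsto_of_tendsto_of_tendsto_of_le_of_le' tendsto_const_nhds h2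
    (Filter.Eventually.of_forall hx) ?_
  filter_upwards [hη.eventually_lt_const (by norm_num : (0 : ℝ) < 1 / 2)] with n hn
  nlinarith [h n, hx n]

/-- Uniqueness in Kempf–Ness theory, valid even for orbit closures. Points κₙ exp(yₙ) p tending to q
are compared with p: equality of the moment maps of p and q turns convexity into a bound of yₙ, on
the support of p, by a discrepancy tending to zero. Hence yₙ → 0 there, and compactness of K
supplies a limit of κₙ. -/
theorem exists_mem_subtorus_of_mem_closure (hK : IsUnimodular k) {p q : HN N}
    (hp : p ∈ level k α β) (hq : q ∈ level k α β)
    (hpq : q ∈ closure {p' : HN N | ∃ ζ ∈ complexSubtorus k, p' = act ζ p}) :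
    ∃ κ ∈ subtorus k, act κ p = q := by
  classical
  obtain ⟨u, hu, hlim⟩ := mem_closure_iff_seq_limit.1 hpq
  have hex : ∀ n, ∃ κ ∈ subtorus k, ∃ y ∈ k, u n = act κ (act (rexp y) p) := by
    intro n
    obtain ⟨ζ, hζ, h⟩ := hu n
    obtain ⟨κ, hκ, y, hy, rfl⟩ := exists_polar hζ
    exact ⟨κ, hκ, y, hy, by rw [h, act_mul]⟩
  choose κ hκ y hy huκ using hex
  set a : Fin N → ℝ := fun i => ‖p.1 i‖ ^ 2 with ha
  set b : Fin N → ℝ := fun i => ‖p.2 i‖ ^ 2 with hb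
  set d : ℕ → Fin N → ℝ := fun n i => (a i * Real.exp (y n i) - b i * Real.exp (-y n i)) -
    (‖q.1 i‖ ^ 2 - ‖q.2 i‖ ^ 2) with hd
  have hun : ∀ n i, ‖(u n).1 i‖ ^ 2 = a i * Real.exp (y n i) ∧
      ‖(u n).2 i‖ ^ 2 = b i * Real.exp (-y n i) := by
    intro n i
    rw [huκ n, ← (normSq_act_rexp (y n) p i).1, ← (normSq_act_rexp (y n) p i).2]
    constructor <;> simp [act, norm_of_mem_subtorus (hκ n)]
  have hd0 : ∀ i, Filter.Tendsto (fun n => d n i) Filter.atTop (𝓝 0) := by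
    intro i
    have hc : Continuous fun r : HN N => ‖r.1 i‖ ^ 2 - ‖r.2 i‖ ^ 2 := by fun_prop
    have h1 := ((hc.tendsto q).comp hlim).sub_const (‖q.1 i‖ ^ 2 - ‖q.2 i‖ ^ 2)
    rw [sub_self] at h1
    refine h1.congr fun n => ?_
    simp only [hd, Function.comp_apply, (hun n i).1, (hun n i).2]
  set δ : ℕ → ℝ := fun n => ∑ i, |d n i| with hδ
  have hδ0 : Filter.Tendsto δ Filter.atTop (𝓝 0) := by
    have := tendsto_finsetSum Finset.univ fun i _ => (hd0 i).abs
    simpa using this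
  have hqsupp : ∀ i, i ∉ coordSupp p → q.1 i = 0 ∧ q.2 i = 0 := by
    intro i hi
    simp only [coordSupp, Set.mem_ofPred_eq, not_or, not_not] at hi
    have hc1 : IsClosed {r : HN N | r.1 i = 0 ∧ r.2 i = 0} :=
      (isClosed_eq (by fun_prop) continuous_const).inter (isClosed_eq (by fun_prop) continuous_const)
    refine closure_minimal ?_ hc1 hpq
    rintro _ ⟨ζ, -, rfl⟩
    simp [act, hi.1, hi.2]
  -- Since p and q have equal moment maps, pairing with yₙ ∈ k cancels everything but the
  -- exponential gaps, which `sq_div_le` bounds from below.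
  have hsum : ∀ n, ∑ i, (a i + b i) * (y n i ^ 2 / (1 + |y n i|)) ≤ ∑ i, d n i * y n i := by
    intro n
    have h1 : ∑ i, (a i - b i) * y n i = ∑ i, (‖q.1 i‖ ^ 2 - ‖q.2 i‖ ^ 2) * y n i := by
      have e1 := mu1_apply p ⟨y n, hy n⟩
      have e2 := mu1_apply q ⟨y n, hy n⟩
      rw [hp.1, ← hq.1, e2] at e1
      exact (mul_left_cancel₀ Real.pi_ne_zero e1).symm
    have h2 : ∑ i, d n i * y n i =
        ∑ i, (a i * ((Real.exp (y n i) - 1) * y n i) + b i * ((Real.exp (-y n i) - 1) * -y n i)) := by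
      have : ∀ i, d n i * y n i =
        (a i * ((Real.exp (y n i) - 1) * y n i) + b i * ((Real.exp (-y n i) - 1) * -y n i)) +
          ((a i - b i) * y n i - (‖q.1 i‖ ^ 2 - ‖q.2 i‖ ^ 2) * y n i) := by
        intro i; simp only [hd]; ring
      simp only [this]
      rw [Finset.sum_add_distrib, Finset.sum_sub_distrib, h1, sub_self, add_zero]
    rw [h2]
    refine Finset.sum_le_sum fun i _ => ?_
    have e1 := mul_le_mul_of_nonneg_left (sq_div_le (y n i)) (by positivity : 0 ≤ a i)
    have e2 := mul_le_mul_of_nonneg_left (sq_div_le (-y n i)) (by positivity : 0 ≤ b i)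
    rw [neg_sq, abs_neg] at e2
    rw [add_mul]
    exact add_le_add e1 e2
  have hab : ∀ i ∈ coordSupp p, 0 < a i + b i := by
    intro i hi
    rcases hi with h | h
    · have : 0 < a i := by positivity
      have : 0 ≤ b i := by positivity
      linarith
    · have : 0 < b i := by positivity
      have : 0 ≤ a i := by positivity
      linarith
  have hy0 : ∀ i ∈ coordSupp p, Filter.Tendsto (fun n => y n i) Filter.atTop (𝓝 0) := by
    intro i hi
    have hne : (Finset.univ.filter (· ∈ coordSupp p)).Nonempty := ⟨i, by simpa using hi⟩
    obtain ⟨i₁, hi₁, hmin⟩ := Finset.exists_min_image _ (fun i => a i + b i) hne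
    set c := a i₁ + b i₁ with hc
    have hc0 : 0 < c := hab i₁ (by simpa using hi₁)
    -- The inequality is exploited at the index where |yₙ| is largest: one term bounds the left side
    -- below, and |yₙ| there bounds the right side above.
    have hmx : ∀ n, ∃ j ∈ coordSupp p, ∀ j' ∈ coordSupp p, |y n j'| ≤ |y n j| := by
      intro n
      obtain ⟨j, hj, hmax⟩ := Finset.exists_max_image _ (fun i => |y n i|) hne
      exact ⟨j, by simpa using hj, fun j' hj' => hmax j' (by simpa using hj')⟩
    choose j hj hjm using hmx
    have hkey : ∀ n, |y n (j n)| ≤ (δ n / c) * (1 + |y n (j n)|) := by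
      intro n
      set m := |y n (j n)| with hm
      have hm0 : 0 ≤ m := abs_nonneg _
      have e1 : c * (m ^ 2 / (1 + m)) ≤ ∑ i, (a i + b i) * (y n i ^ 2 / (1 + |y n i|)) := by
        refine le_trans ?_ (Finset.single_le_sum (f := fun i => (a i + b i) * (y n i ^ 2 / (1 + |y n i|)))
          (fun i _ => by positivity) (Finset.mem_univ (j n)))
        rw [hm, sq_abs]
        exact mul_le_mul_of_nonneg_right (hmin _ (by simpa using hj n)) (by positivity)
      have e2 : ∑ i, d n i * y n i ≤ δ n * m := by
        rw [hδ, Finset.sum_mul]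
        refine Finset.sum_le_sum fun i _ => ?_
        by_cases hi : i ∈ coordSupp p
        · refine (le_abs_self _).trans ?_
          rw [abs_mul]
          exact mul_le_mul_of_nonneg_left (hjm n i hi) (abs_nonneg _)
        · have : d n i = 0 := by
            have h1 := hqsupp i hi
            simp only [coordSupp, Set.mem_ofPred_eq, not_or, not_not] at hi
            simp [hd, ha, hb, hi.1, hi.2, h1.1, h1.2]
          rw [this]; simp
      have e3 := e1.trans ((hsum n).trans e2)
      rcases hm0.eq_or_lt with h0 | h0
      · rw [← h0]
        have : 0 ≤ δ n := Finset.sum_nonneg fun i _ => abs_nonneg _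
        positivity
      · rw [div_mul_eq_mul_div, le_div_iff₀ hc0]
        rw [← mul_div_assoc, div_le_iff₀ (by positivity)] at e3
        have : m * (m * c) ≤ m * (δ n * (1 + m)) := by nlinarith
        exact le_of_mul_le_mul_left this h0
    have hlim0 := tendsto_zero_of_div_le (fun n => abs_nonneg _) hkey (by simpa using hδ0.div_const c)
    exact squeeze_zero_norm (fun n => hjm n i hi) hlim0
  have hact : Filter.Tendsto (fun n => act (rexp (y n)) p) Filter.atTop (𝓝 p) := by
    rw [nhds_prod_eq]
    refine Filter.Tendsto.prodMk (tendsto_pi_nhds.2 fun i => ?_) (tendsto_pi_nhds.2 fun i => ?_)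
    · simp only [rexp, Units.val_mk0]
      by_cases hi : i ∈ coordSupp p
      · have h1 : Continuous fun s : ℝ => p.1 i * Complex.exp ((s / 2 : ℝ) : ℂ) := by fun_prop
        simpa [Function.comp_def] using (h1.tendsto 0).comp (hy0 i hi)
      · simp only [coordSupp, Set.mem_ofPred_eq, not_or, not_not] at hi
        simp [hi.1]
    · simp only [rexp, Units.val_mk0, Units.val_inv_eq_inv_val, ← Complex.exp_neg]
      by_cases hi : i ∈ coordSupp p
      · have h1 : Continuous fun s : ℝ => p.2 i * Complex.exp (-((s / 2 : ℝ) : ℂ)) := by fun_prop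
        simpa [Function.comp_def] using (h1.tendsto 0).comp (hy0 i hi)
      · simp only [coordSupp, Set.mem_ofPred_eq, not_or, not_not] at hi
        simp [hi.2]
  -- A limit along an ultrafilter takes the place of a convergent subsequence of κₙ.
  obtain ⟨κ₀, hκ₀, hκlim⟩ := (isCompact_subtorus hK).ultrafilter_le_nhds
    ((Filter.hyperfilter ℕ).map κ) (by
      have h : ∀ᶠ n in (Filter.hyperfilter ℕ : Filter ℕ), κ n ∈ (subtorus k : Set (Fin N → ℂˣ)) :=
        Filter.Eventually.of_forall hκ
      exact Filter.tendsto_principal.2 h)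
  have hle : (Filter.hyperfilter ℕ : Filter ℕ) ≤ Filter.atTop := Nat.hyperfilter_le_atTop
  refine ⟨κ₀, hκ₀, ?_⟩
  have hκ' : Filter.Tendsto κ (Filter.hyperfilter ℕ) (𝓝 κ₀) := hκlim
  have h1 : Filter.Tendsto u (Filter.hyperfilter ℕ) (𝓝 (act κ₀ p)) := by
    have := (continuous_act.tendsto (κ₀, p)).comp (hκ'.prodMk_nhds (hact.mono_left hle))
    exact this.congr fun n => (huκ n).symm
  exact tendsto_nhds_unique h1 (hlim.mono_left hle)

/-! ## The quotient map from the stable points -/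

theorem isOpenMap_mk : IsOpenMap (X.mk : level k α β → X k α β) := by
  intro U hU
  have hq : Topology.IsQuotientMap (X.mk : level k α β → X k α β) := isQuotientMap_quotient_mk'
  rw [← hq.isOpen_preimage]
  have : X.mk ⁻¹' (X.mk '' U) = ⋃ ζ : subtorus k,
      (fun p : level k α β => (⟨act ζ p, act_mem_level ζ.2 p.2⟩ : level k α β)) ⁻¹' U := by
    ext p
    simp only [Set.mem_preimage, Set.mem_image, Set.mem_iUnion]
    constructor
    · rintro ⟨q, hq, hqp⟩
      obtain ⟨ζ, hζ, h⟩ := Quotient.exact hqp.symm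
      exact ⟨⟨ζ, hζ⟩, by convert hq⟩
    · rintro ⟨ζ, h⟩
      refine ⟨_, h, (Quotient.sound ?_).symm⟩
      exact ⟨ζ, ζ.2, rfl⟩
  rw [this]
  refine isOpen_iUnion fun ζ => hU.preimage ?_
  exact ((continuous_act_right _).comp continuous_subtype_val).subtype_mk _

theorem isOpenQuotientMap_mk : IsOpenQuotientMap (X.mk : level k α β → X k α β) :=
  ⟨Quotient.mk_surjective, continuous_quotient_mk', isOpenMap_mk⟩

/-- The orbit relation is closed, being the projection along the compact group K of the closed set
of triples (ζ, p, q) with ζ p = q. -/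
theorem t2Space_X (hK : IsUnimodular k) : T2Space (X k α β) := by
  rw [t2Space_iff_of_isOpenQuotientMap isOpenQuotientMap_mk]
  have : CompactSpace (subtorus k) := isCompact_iff_compactSpace.1 (isCompact_subtorus hK)
  have hc : IsClosed {c : subtorus k × (level k α β × level k α β) |
      act c.1 (c.2.1 : HN N) = c.2.2} := by
    refine isClosed_eq ?_ (by fun_prop)
    exact continuous_act.comp (by fun_prop : Continuous fun c : subtorus k × (level k α β × level k α β) =>
      ((c.1 : Fin N → ℂˣ), (c.2.1 : HN N)))
  convert isClosedMap_snd_of_compactSpace _ hc using 1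
  ext ⟨p, q⟩
  simp only [Set.mem_image, Prod.exists, exists_eq_right, Set.mem_ofPred_eq]
  constructor
  · intro h
    obtain ⟨ζ, hζ, h⟩ := Quotient.exact h
    exact ⟨⟨ζ, hζ⟩, h⟩
  · rintro ⟨ζ, h⟩
    exact Quotient.sound ⟨ζ, ζ.2, h⟩

open Classical in
/-- The class in `X(α, β)` of the points of the level set in the `K_ℂ`-orbit of `q`. -/
def Qm (k : Submodule ℝ (Fin N → ℝ)) (α : StrongDual ℝ k) (β : k →L[ℝ] ℂ) [Nonempty (X k α β)]
    (q : HN N) : X k α β :=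
  if h : q ∈ stab k α β then X.mk ⟨act h.choose q, h.choose_spec.2⟩ else Classical.arbitrary _

theorem subset_closure_orbit {ζ : Fin N → ℂˣ} (hζ : ζ ∈ complexSubtorus k) (p : HN N) :
    act ζ p ∈ closure {p' : HN N | ∃ ζ ∈ complexSubtorus k, p' = act ζ p} :=
  subset_closure ⟨ζ, hζ, rfl⟩

variable [Nonempty (X k α β)]

/-- Independence of the choice made in `Qm`: level points in one K_ℂ-orbit differ by an element of
K. -/
theorem Qm_eq_mk (hK : IsUnimodular k) {q : HN N} {ζ : Fin N → ℂˣ} (hζ : ζ ∈ complexSubtorus k)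
    (h : act ζ q ∈ level k α β) : Qm k α β q = X.mk ⟨act ζ q, h⟩ := by
  have hq : q ∈ stab k α β := ⟨ζ, hζ, h⟩
  rw [Qm, dif_pos hq]
  refine Quotient.sound ?_
  refine exists_mem_subtorus_of_mem_closure hK hq.choose_spec.2 h ?_
  have := subset_closure_orbit (k := k) (mul_mem hζ (inv_mem hq.choose_spec.1)) (act hq.choose q)
  rwa [act_mul, act_inv_act] at this

theorem Qm_of_mem_level (hK : IsUnimodular k) {q : HN N} (h : q ∈ level k α β) :
    Qm k α β q = X.mk ⟨q, h⟩ := by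
  have := Qm_eq_mk hK (one_mem (complexSubtorus k)) (by rwa [act_one] : act 1 q ∈ level k α β)
  rw [this]; congr 1; exact Subtype.ext (act_one q)

theorem Qm_eq_iff (hK : IsUnimodular k) {q q' : HN N} (hq : q ∈ stab k α β)
    (hq' : q' ∈ stab k α β) : Qm k α β q = Qm k α β q' ↔ ∃ ζ ∈ complexSubtorus k, act ζ q = q' := by
  obtain ⟨ζ, hζ, h⟩ := hq
  obtain ⟨ζ', hζ', h'⟩ := hq'
  rw [Qm_eq_mk hK hζ h, Qm_eq_mk hK hζ' h']
  constructor
  · intro he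
    obtain ⟨κ, hκ, hk⟩ := Quotient.exact he
    refine ⟨ζ'⁻¹ * (κ * ζ), mul_mem (inv_mem hζ') (mul_mem (subtorus_le hκ) hζ), ?_⟩
    rw [act_mul, act_mul]
    have hk' : act κ (act ζ q) = act ζ' q' := hk
    rw [hk', act_inv_act]
  · rintro ⟨η, hη, rfl⟩
    refine Quotient.sound (exists_mem_subtorus_of_mem_closure hK h h' ?_)
    have := subset_closure_orbit (k := k) (mul_mem (mul_mem hζ' hη) (inv_mem hζ)) (act ζ q)
    rwa [act_mul, act_inv_act, act_mul] at this

theorem Qm_act (hK : IsUnimodular k) {ζ : Fin N → ℂˣ} (hζ : ζ ∈ complexSubtorus k) {q : HN N}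
    (hq : q ∈ stab k α β) : Qm k α β (act ζ q) = Qm k α β q :=
  ((Qm_eq_iff hK hq (act_mem_stab hζ hq)).2 ⟨ζ, hζ, rfl⟩).symm

/-- After a translation of q₀ into the level set, nearby points return to the level set close to it
by `eventually_exists_act_mem_level`. This is the source of openness of the stable set and of
continuity of the quotient map. -/
theorem tendsto_Qm (hK : IsUnimodular k) {A : Set (Fin N)} {q₀ : HN N} (hq₀ : q₀ ∈ stab k α β)
    (hreg : ∀ x ∈ k, (∀ i ∈ coordSupp q₀, x i = 0) → ∀ l ∈ A, x l = 0) :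
    (∀ᶠ q in 𝓝[fiberOn k β A] q₀, q ∈ stab k α β) ∧
    Filter.Tendsto (Qm k α β) (𝓝[fiberOn k β A] q₀) (𝓝 (Qm k α β q₀)) := by
  obtain ⟨ζ, hζ, h⟩ := hq₀
  have hten : Filter.Tendsto (act ζ) (𝓝[fiberOn k β A] q₀) (𝓝[fiberOn k β A] (act ζ q₀)) :=
    ((continuous_act_right ζ).tendsto q₀).inf (Filter.tendsto_principal_principal.2
      fun q hq => act_mem_fiberOn ζ hq)
  have key := fun U (hU : U ∈ 𝓝 (act ζ q₀)) => hten.eventually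
    (eventually_exists_act_mem_level (A := A) h (by rwa [coordSupp_act]) hU)
  constructor
  · filter_upwards [key Set.univ Filter.univ_mem] with q hq
    obtain ⟨η, hη, hl, -⟩ := hq
    exact ⟨η * ζ, mul_mem hη hζ, by rwa [act_mul]⟩
  · rw [Qm_eq_mk hK hζ h]
    intro U hU
    have h1 : X.mk ⁻¹' U ∈ 𝓝 (⟨act ζ q₀, h⟩ : level k α β) :=
      (isOpenQuotientMap_mk (k := k) (α := α) (β := β)).continuous.continuousAt hU
    rw [nhds_subtype_eq_comap] at h1
    obtain ⟨U', hU', hsub⟩ := h1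
    rw [Filter.mem_map]
    filter_upwards [key U' hU'] with q hq
    obtain ⟨η, hη, hl, hlU⟩ := hq
    have : Qm k α β q = X.mk ⟨act η (act ζ q), hl⟩ := by
      have h2 : act (η * ζ) q ∈ level k α β := by rwa [act_mul]
      rw [Qm_eq_mk hK (mul_mem hη hζ) h2]
      congr 2; exact act_mul _ _ _
    rw [Set.mem_preimage, this]
    exact hsub (show (⟨act η (act ζ q), hl⟩ : level k α β) ∈ Subtype.val ⁻¹' U' from hlU)

end ToricHK

namespace ToricHK

variable {N : ℕ} {k : Submodule ℝ (Fin N → ℝ)} {α αp αm : StrongDual ℝ k} {β : k →L[ℝ] ℂ}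

/-! ## Rays of the cones -/

/-- `y` spans a line cut out of `k` by coordinate hyperplanes, and `β` vanishes on it. -/
def IsRay (k : Submodule ℝ (Fin N → ℝ)) (β : k →L[ℝ] ℂ) (y : k) : Prop :=
  y ≠ 0 ∧ β y = 0 ∧ ∀ x : k, (∀ i, (y : Fin N → ℝ) i = 0 → (x : Fin N → ℝ) i = 0) → ∃ c : ℝ, x = c • y

/-- The non-zero coordinates of `y`. -/
def nzCoords (y : Fin N → ℝ) : Finset (Fin N) := Finset.univ.filter fun i => y i ≠ 0

theorem mem_nzCoords {y : Fin N → ℝ} {i : Fin N} : i ∈ nzCoords y ↔ y i ≠ 0 := by simp [nzCoords]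

theorem coe_ne_zero {y : k} (h : y ≠ 0) : ∃ i, (y : Fin N → ℝ) i ≠ 0 := by
  by_contra! hcon
  exact h (Subtype.ext (funext hcon))

/-- Elimination: as long as the vanishing coordinates of x do not cut out a line, subtracting a
multiple of x from an independent vector with the same vanishing kills one more coordinate. -/
theorem exists_line {T : Set (Fin N)} {x : k} (hx : x ≠ 0) (hT : ∀ i ∈ T, (x : Fin N → ℝ) i = 0) :
    ∃ y : k, y ≠ 0 ∧ (∀ i ∈ T, (y : Fin N → ℝ) i = 0) ∧
      ∀ x : k, (∀ i, (y : Fin N → ℝ) i = 0 → (x : Fin N → ℝ) i = 0) → ∃ c : ℝ, x = c • y := by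
  induction hn : (nzCoords (x : Fin N → ℝ)).card using Nat.strong_induction_on generalizing x with
  | _ n ih =>
    by_cases hline : ∀ x' : k, (∀ i, (x : Fin N → ℝ) i = 0 → (x' : Fin N → ℝ) i = 0) → ∃ c : ℝ, x' = c • x
    · exact ⟨x, hx, hT, hline⟩
    · push Not at hline
      obtain ⟨x', hx', hne⟩ := hline
      obtain ⟨i, hi⟩ := coe_ne_zero hx
      set v : k := x' - ((x' : Fin N → ℝ) i / (x : Fin N → ℝ) i) • x with hv
      have hvi : ∀ j, (v : Fin N → ℝ) j = (x' : Fin N → ℝ) j -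
          ((x' : Fin N → ℝ) i / (x : Fin N → ℝ) i) * (x : Fin N → ℝ) j := fun j => by simp [hv]
      refine ih (nzCoords (v : Fin N → ℝ)).card ?_ (x := v) ?_ ?_ rfl
      · rw [← hn]
        refine Finset.card_lt_card ⟨fun j hj => ?_, fun hsub => ?_⟩
        · rw [mem_nzCoords] at hj ⊢
          intro h0; apply hj; rw [hvi, h0, hx' j h0]; simp
        · have := hsub (mem_nzCoords.2 hi)
          rw [mem_nzCoords, hvi] at this
          exact this (by field_simp; simp)
      · rw [hv]; intro h; exact hne _ (sub_eq_zero.1 h)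
      · intro j hj; rw [hvi, hT j hj, hx' j (hT j hj)]; simp

/-- Where zᵢ wᵢ ≠ 0 the two sign conditions force yᵢ = 0. This is why only the walls containing β
matter. -/
theorem beta_eq_zero_of_inCone {q : HN N} (hq : muC k q = β) {y : k} (hy : InCone q y) : β y = 0 := by
  rw [← hq, muC_apply, Finset.sum_eq_zero, mul_zero]
  intro i _
  by_cases h1 : q.1 i = 0
  · simp [h1]
  · by_cases h2 : q.2 i = 0
    · simp [h2]
    · simp [le_antisymm (hy.1 i h1) (hy.2 i h2)]

/-- Moving from y in the direction x until the first constraint violated by x becomes tight. -/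
theorem exists_max_shift {q : HN N} {y x : Fin N → ℝ} (hy : InCone q y)
    (hx : ∀ i, y i = 0 → x i = 0) (hnot : ¬ InCone q x) :
    ∃ t : ℝ, 0 < t ∧ InCone q (y + t • x) ∧ ∃ i, y i ≠ 0 ∧ y i + t * x i = 0 := by
  classical
  -- The indices whose constraint is violated by x; −yᵢ/xᵢ is the time at which such a constraint
  -- becomes tight.
  set F := Finset.univ.filter fun i => (q.1 i ≠ 0 ∧ 0 < x i) ∨ (q.2 i ≠ 0 ∧ x i < 0) with hF
  have hne : F.Nonempty := by
    by_contra hcon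
    rw [Finset.not_nonempty_iff_eq_empty, Finset.filter_eq_empty_iff] at hcon
    refine hnot ⟨fun i hi => ?_, fun i hi => ?_⟩
    · by_contra h; exact hcon (Finset.mem_univ i) (Or.inl ⟨hi, not_le.1 h⟩)
    · by_contra h; exact hcon (Finset.mem_univ i) (Or.inr ⟨hi, not_le.1 h⟩)
  have hxne : ∀ i ∈ F, x i ≠ 0 := by
    intro i hi
    simp only [hF, Finset.mem_filter, Finset.mem_univ, true_and] at hi
    rcases hi with h | h
    · exact h.2.ne'
    · exact h.2.ne
  obtain ⟨i₀, hi₀, hmin⟩ := Finset.exists_min_image F (fun i => -(y i) / x i) hne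
  have hy0 : y i₀ ≠ 0 := fun h => hxne i₀ hi₀ (hx i₀ h)
  have hpos : 0 < -(y i₀) / x i₀ := by
    have h := hi₀
    simp only [hF, Finset.mem_filter, Finset.mem_univ, true_and] at h
    rcases h with h | h
    · exact div_pos (neg_pos.2 (lt_of_le_of_ne (hy.1 i₀ h.1) hy0)) h.2
    · exact div_pos_of_neg_of_neg (neg_neg_iff_pos.2 (lt_of_le_of_ne (hy.2 i₀ h.1) hy0.symm)) h.2
  refine ⟨-(y i₀) / x i₀, hpos, ⟨fun i hi => ?_, fun i hi => ?_⟩, i₀, hy0, by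
    have := hxne i₀ hi₀; field_simp; ring⟩
  · simp only [Pi.add_apply, Pi.smul_apply, smul_eq_mul]
    rcases le_or_gt (x i) 0 with h | h
    · nlinarith [hy.1 i hi]
    · have := hmin i (by simp [hF, hi, h])
      rw [le_div_iff₀ h] at this; linarith
  · simp only [Pi.add_apply, Pi.smul_apply, smul_eq_mul]
    rcases le_or_gt 0 (x i) with h | h
    · nlinarith [hy.2 i hi]
    · have := hmin i (by simp [hF, hi, h])
      rw [le_div_iff_of_neg h] at this; linarith

/-- A property stable under positive combinations holds on a pointed cone if it holds on its rays. -/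
theorem inCone_induction {q : HN N} (hq : muC k q = β)
    (hfree : ∀ x : k, (∀ i ∈ coordSupp q, (x : Fin N → ℝ) i = 0) → x = 0) {P : k → Prop}
    (hadd : ∀ x y, P x → P y → P (x + y)) (hsmul : ∀ (c : ℝ) x, 0 < c → P x → P (c • x))
    (hray : ∀ y : k, IsRay k β y → InCone q y → P y) {y : k} (hy : InCone q y) (hy0 : y ≠ 0) : P y := by
  induction hn : (nzCoords (y : Fin N → ℝ)).card using Nat.strong_induction_on generalizing y with
  | _ n ih =>
    by_cases hline : ∀ x' : k, (∀ i, (y : Fin N → ℝ) i = 0 → (x' : Fin N → ℝ) i = 0) → ∃ c : ℝ, x' = c • y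
    · exact hray y ⟨hy0, beta_eq_zero_of_inCone hq hy, hline⟩ hy
    push Not at hline
    obtain ⟨x', hx', hne⟩ := hline
    obtain ⟨i, hi⟩ := coe_ne_zero hy0
    -- This x vanishes wherever y does and also at i. So x has fewer non-zero coordinates than y,
    -- while y + t x keeps its non-zero i-th coordinate.
    set x : k := x' - ((x' : Fin N → ℝ) i / (y : Fin N → ℝ) i) • y with hxdef
    have hxj : ∀ j, (x : Fin N → ℝ) j = (x' : Fin N → ℝ) j -
        ((x' : Fin N → ℝ) i / (y : Fin N → ℝ) i) * (y : Fin N → ℝ) j := fun j => by simp [hxdef]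
    have hxi : (x : Fin N → ℝ) i = 0 := by rw [hxj]; field_simp; simp
    have hxz : ∀ j, (y : Fin N → ℝ) j = 0 → (x : Fin N → ℝ) j = 0 := by
      intro j hj; rw [hxj, hj, hx' j hj]; simp
    have hx0 : x ≠ 0 := by rw [hxdef]; intro h; exact hne _ (sub_eq_zero.1 h)
    have hlt : ∀ v : k, (∀ j, (y : Fin N → ℝ) j = 0 → (v : Fin N → ℝ) j = 0) →
        (∃ j, (y : Fin N → ℝ) j ≠ 0 ∧ (v : Fin N → ℝ) j = 0) →
        (nzCoords (v : Fin N → ℝ)).card < n := by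
      rintro v hv ⟨j, hj, hvj⟩
      rw [← hn]
      refine Finset.card_lt_card ⟨fun j hj => ?_, fun hsub => ?_⟩
      · rw [mem_nzCoords] at hj ⊢
        exact fun h0 => hj (hv j h0)
      · exact mem_nzCoords.1 (hsub (mem_nzCoords.2 hj)) hvj
    have hneg : ∀ v : k, InCone q v → InCone q (-v : k) → v = 0 := by
      intro v h1 h2
      refine hfree v fun j hj => ?_
      have e : ((-v : k) : Fin N → ℝ) j = -(v : Fin N → ℝ) j := by simp
      rcases hj with h | h
      · have := h2.1 j h; rw [e] at this; linarith [h1.1 j h]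
      · have := h2.2 j h; rw [e] at this; linarith [h1.2 j h]
    have hstep : ∀ v : k, (v : Fin N → ℝ) i = 0 → v ≠ 0 →
        (∀ j, (y : Fin N → ℝ) j = 0 → (v : Fin N → ℝ) j = 0) → ¬ InCone q v →
        ∃ t : ℝ, 0 < t ∧ InCone q (y + t • v : k) ∧ P (y + t • v) := by
      intro v hvi hv0 hvz hnot
      obtain ⟨t, ht, hc, j, hj, hj0⟩ := exists_max_shift hy hvz hnot
      have hc' : InCone q (y + t • v : k) := by simpa using hc
      refine ⟨t, ht, hc', ?_⟩
      refine ih _ (hlt (y + t • v) (fun j' hj' => by simp [hj', hvz j' hj']) ⟨j, hj, by simpa using hj0⟩)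
        hc' ?_ rfl
      intro h0
      have := congrFun (congrArg Subtype.val h0) i
      simp [hvi] at this
      exact hi this
    -- If x or −x lies in the cone, y is the exit point in the opposite direction plus a positive
    -- multiple of it. Otherwise y lies between the exit points in both directions.
    by_cases hxc : InCone q x
    · have hnx : ¬ InCone q (-x : k) := fun h => hx0 (hneg x hxc h)
      obtain ⟨t, ht, -, hP⟩ := hstep (-x) (by simp [hxi]) (neg_ne_zero.2 hx0)
        (fun j hj => by simp [hxz j hj]) hnx
      have hPx : P x := ih _ (hlt x hxz ⟨i, hi, hxi⟩) hxc hx0 rfl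
      have : y = (y + t • (-x)) + t • x := by simp
      rw [this]
      exact hadd _ _ hP (hsmul t x ht hPx)
    · obtain ⟨t, ht, -, hP⟩ := hstep x hxi hx0 hxz hxc
      by_cases hnx : InCone q (-x : k)
      · have hPx : P (-x) := ih _ (hlt (-x) (fun j hj => by simp [hxz j hj]) ⟨i, hi, by simp [hxi]⟩)
          hnx (neg_ne_zero.2 hx0) rfl
        have : y = (y + t • x) + t • (-x) := by simp
        rw [this]
        exact hadd _ _ hP (hsmul t _ ht hPx)
      · obtain ⟨t', ht', -, hP'⟩ := hstep (-x) (by simp [hxi]) (neg_ne_zero.2 hx0)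
          (fun j hj => by simp [hxz j hj]) hnx
        have : y = (t' / (t + t')) • (y + t • x) + (t / (t + t')) • (y + t' • (-x)) := by
          have h0 : t + t' ≠ 0 := by positivity
          apply Subtype.ext; funext j
          simp
          field_simp
          ring
        rw [this]
        exact hadd _ _ (hsmul _ _ (by positivity) hP) (hsmul _ _ (by positivity) hP')

/-! ## Crossing a wall -/

/-- The combinatorial data of crossing the wall orthogonal to `Y`: the parameters `αp` and `αm` lie
on different sides of this wall and on the same side as `α` of the other walls. -/
structure WallCrossing (k : Submodule ℝ (Fin N → ℝ)) (β : k →L[ℝ] ℂ) (α αp αm : StrongDual ℝ k)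
    (Y : Fin N → ℤ) : Prop where
  unit : ∀ i, Y i = 0 ∨ Y i = 1 ∨ Y i = -1
  mem : (fun i => (Y i : ℝ)) ∈ k
  beta : β ⟨_, mem⟩ = 0
  wall : α ⟨_, mem⟩ = 0
  pos : 0 < αp ⟨_, mem⟩
  neg : αm ⟨_, mem⟩ < 0
  line : ∀ x : k, (∀ i, Y i = 0 → (x : Fin N → ℝ) i = 0) → ∃ c : ℝ, x = c • ⟨_, mem⟩
  ray : ∀ y : k, IsRay k β y → (¬ ∃ c : ℝ, y = c • ⟨_, mem⟩) →
    α y ≠ 0 ∧ (αp y < 0 ↔ α y < 0) ∧ (αm y < 0 ↔ α y < 0)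

/-- Every statement about α₊ and Y yields one about α₋ and −Y, so only one side of the wall is
treated below. -/
theorem WallCrossing.swap {Y : Fin N → ℤ} (W : WallCrossing k β α αp αm Y) :
    WallCrossing k β α αm αp (-Y) := by
  have hm : (fun i => (((-Y) i : ℤ) : ℝ)) ∈ k := by
    convert k.neg_mem W.mem using 1; funext i; simp
  have he : (⟨_, hm⟩ : k) = -⟨_, W.mem⟩ := by apply Subtype.ext; funext i; simp
  have hs : ∀ y : k, (∃ c : ℝ, y = c • (⟨_, hm⟩ : k)) ↔ ∃ c : ℝ, y = c • (⟨_, W.mem⟩ : k) := by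
    intro y
    rw [he]
    constructor <;> rintro ⟨c, rfl⟩ <;> exact ⟨-c, Subtype.ext (funext fun i => by simp)⟩
  refine ⟨fun i => ?_, hm, ?_, ?_, ?_, ?_, fun x hx => ?_, fun y hy hn => ?_⟩
  · rcases W.unit i with h | h | h <;> simp [h]
  · rw [he, map_neg, W.beta, neg_zero]
  · rw [he, map_neg, W.wall, neg_zero]
  · rw [he, map_neg]; linarith [W.neg]
  · rw [he, map_neg]; linarith [W.pos]
  · rw [hs]; exact W.line x fun i hi => hx i (by simp [hi])
  · rw [hs] at hn
    obtain ⟨h1, h2, h3⟩ := W.ray y hy hn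
    exact ⟨h1, h3, h2⟩

/-- The coordinates of negative weight under the one-parameter group generated by `Y` vanish. -/
def YVanish (Y : Fin N → ℤ) (q : HN N) : Prop :=
  ∀ i, (Y i = 1 → q.2 i = 0) ∧ (Y i = -1 → q.1 i = 0)

/-- Multiply the coordinates of negative weight by `t`. -/
def blw (Y : Fin N → ℤ) (t : ℂ) (q : HN N) : HN N :=
  (fun i => if Y i = -1 then t * q.1 i else q.1 i, fun i => if Y i = 1 then t * q.2 i else q.2 i)

/-- Replace the coordinates of non-zero weight by zero. -/
def proj0 (Y : Fin N → ℤ) (q : HN N) : HN N :=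
  (fun i => if Y i = 0 then q.1 i else 0, fun i => if Y i = 0 then q.2 i else 0)

section

variable {Y : Fin N → ℤ} (W : WallCrossing k β α αp αm Y)
include W

theorem WallCrossing.exists_ne : ∃ i, Y i ≠ 0 := by
  by_contra! h
  have : (⟨_, W.mem⟩ : k) = 0 := by apply Subtype.ext; funext i; simp [h i]
  have hp := W.pos
  rw [this, map_zero] at hp
  exact lt_irrefl _ hp

/-- A non-zero infinitesimal stabilizer contains a line cut out by coordinates, on which α₊ and β
vanish. It is not the line of Y, as α₊(Y) > 0. On any other such line, comparing signs at ±y makes α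
vanish, which is excluded. -/
theorem WallCrossing.free {q : HN N} (hq : q ∈ stab k αp β) :
    ∀ x : k, (∀ i ∈ coordSupp q, (x : Fin N → ℝ) i = 0) → x = 0 := by
  intro x hx
  by_contra hx0
  obtain ⟨y, hy0, hyT, hyl⟩ := exists_line hx0 hx
  obtain ⟨h1, h2⟩ := (of_mem_stab hq).1 y hyT
  by_cases hc : ∃ c : ℝ, y = c • (⟨_, W.mem⟩ : k)
  · obtain ⟨c, rfl⟩ := hc
    rw [map_smul, smul_eq_mul, mul_eq_zero] at h1
    rcases h1 with h1 | h1
    · rw [h1, zero_smul] at hy0; exact hy0 rfl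
    · exact W.pos.ne' h1
  · have hr : IsRay k β y := ⟨hy0, h2, hyl⟩
    have hr' : IsRay k β (-y) := by
      refine ⟨neg_ne_zero.2 hy0, by rw [map_neg, h2, neg_zero], fun x hx => ?_⟩
      obtain ⟨c, rfl⟩ := hyl x fun i hi => hx i (by simp [hi])
      exact ⟨-c, by simp⟩
    have hc' : ¬ ∃ c : ℝ, -y = c • (⟨_, W.mem⟩ : k) := by
      rintro ⟨c, h⟩; exact hc ⟨-c, Subtype.ext (funext fun i => by
        have := congrFun (congrArg Subtype.val h) i; simp at this ⊢; linarith)⟩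
    obtain ⟨e1, e2, -⟩ := W.ray y hr hc
    obtain ⟨-, e2', -⟩ := W.ray _ hr' hc'
    simp only [map_neg, h1, neg_zero, lt_irrefl, false_iff, not_lt] at e2 e2'
    exact e1 (by linarith)

/-- Over the fixed locus the infinitesimal stabilizer is only the line of Y: otherwise, after
correction by a multiple of Y, it would contain a second ray, and α would vanish on that ray. -/
theorem WallCrossing.coordSupp_det {q : HN N} (hq : q ∈ stab k α β) (h0 : ∀ i, Y i ≠ 0 → q.1 i = 0 ∧ q.2 i = 0) :
    ∀ x : k, (∀ i ∈ coordSupp q, (x : Fin N → ℝ) i = 0) → ∃ c : ℝ, x = c • (⟨_, W.mem⟩ : k) := by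
  intro x hx
  obtain ⟨j, hj⟩ := W.exists_ne
  have hjr : (Y j : ℝ) ≠ 0 := by exact_mod_cast hj
  by_contra hcon
  set v : k := x - ((x : Fin N → ℝ) j / Y j) • ⟨_, W.mem⟩ with hv
  have hvi : ∀ i, (v : Fin N → ℝ) i = (x : Fin N → ℝ) i - ((x : Fin N → ℝ) j / Y j) * Y i :=
    fun i => by simp [hv]
  have hv0 : v ≠ 0 := fun h => hcon ⟨_, sub_eq_zero.1 h⟩
  have hvT : ∀ i ∈ coordSupp q ∪ {j}, (v : Fin N → ℝ) i = 0 := by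
    rintro i (hi | hi)
    · have : Y i = 0 := by
        by_contra h
        rcases hi with h' | h'
        · exact h' (h0 i h).1
        · exact h' (h0 i h).2
      rw [hvi, hx i hi, this]; simp
    · rw [Set.mem_singleton_iff] at hi
      rw [hvi, hi]; field_simp; simp
  obtain ⟨y, hy0, hyT, hyl⟩ := exists_line hv0 hvT
  obtain ⟨h1, h2⟩ := (of_mem_stab hq).1 y fun i hi => hyT i (Or.inl hi)
  refine (W.ray y ⟨hy0, h2, hyl⟩ ?_).1 h1
  rintro ⟨c, rfl⟩
  have := hyT j (Or.inr rfl)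
  simp [hj] at this
  rw [this, zero_smul] at hy0; exact hy0 rfl

theorem WallCrossing.inCone_Y {q : HN N} (h : YVanish (-Y) q) : InCone q (⟨_, W.mem⟩ : k) := by
  refine ⟨fun i hi => ?_, fun i hi => ?_⟩ <;> rcases W.unit i with hY | hY | hY <;> simp only [hY] <;>
    norm_num
  · exact hi ((h i).2 (by simp [hY]))
  · exact hi ((h i).1 (by simp [hY]))

theorem WallCrossing.yVanish_of_inCone {q : HN N} {c : ℝ} (hc : c < 0)
    (h : InCone q (c • (⟨_, W.mem⟩ : k) : k)) : YVanish Y q := by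
  intro i
  constructor
  · intro hY; by_contra h2
    have := h.2 i h2
    simp [hY] at this; linarith
  · intro hY; by_contra h1
    have := h.1 i h1
    simp [hY] at this; linarith

/-- If all coordinates of positive weight vanished, Y would belong to the cone although α₊(Y) > 0.
-/
theorem WallCrossing.not_yVanish_neg {q : HN N} (hq : q ∈ stab k αp β) : ¬ YVanish (-Y) q := by
  intro h
  rcases (of_mem_stab hq).2 _ (W.inCone_Y h) with h1 | h1
  · have := ((of_mem_stab hq).1 _ h1).1
    exact W.pos.ne' this
  · exact lt_asymm W.pos h1

/-- A multiple of Y in the cone has a negative factor, since a positive one would kill the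
coordinates of positive weight; and a negative one kills those of negative weight. On the other rays
the signs of the three parameters agree. -/
theorem WallCrossing.ray_cases {q : HN N} (hq : q ∈ stab k αp β) {y : k} (hr : IsRay k β y)
    (hy : InCone q y) : (α y < 0 ∧ αm y < 0) ∨
      (YVanish Y q ∧ ∃ c : ℝ, y = c • (⟨_, W.mem⟩ : k)) := by
  by_cases hc : ∃ c : ℝ, y = c • (⟨_, W.mem⟩ : k)
  · right
    refine ⟨?_, hc⟩
    obtain ⟨c, rfl⟩ := hc
    rcases lt_trichotomy c 0 with h | h | h
    · exact W.yVanish_of_inCone h hy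
    · exact absurd (by rw [h, zero_smul]) hr.1
    · refine absurd ?_ (W.not_yVanish_neg hq)
      have := W.swap.yVanish_of_inCone (q := q) (neg_lt_zero.2 h)
      apply this
      convert hy using 1
      funext i; simp
  · left
    obtain ⟨h1, h2, h3⟩ := W.ray y hr hc
    have : αp y < 0 := by
      rcases (of_mem_stab hq).2 y hy with h | h
      · exact absurd (W.free hq y h) hr.1
      · exact h
    exact ⟨h2.1 this, h3.2 (h2.1 this)⟩

/-- No multiple of Y is a ray of the cone here, so every ray has negative α and α₋, and
`inCone_induction` spreads this to the whole cone. -/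
theorem WallCrossing.mem_stab_of_not_yVanish {q : HN N} (hq : q ∈ stab k αp β) (h : ¬ YVanish Y q) :
    q ∈ stab k α β ∧ q ∈ stab k αm β := by
  have hf := W.free hq
  have key : ∀ γ : StrongDual ℝ k, (∀ y : k, α y < 0 ∧ αm y < 0 → γ y < 0) → q ∈ stab k γ β := by
    intro γ hγ
    refine mem_stab_of_inCone (muC_of_mem_stab hq) (fun y hy => by rw [hf y hy, map_zero]) fun y hy => ?_
    by_cases hy0 : y = 0
    · left; intro i _; rw [hy0]; rfl
    · right
      refine inCone_induction (muC_of_mem_stab hq) hf (P := fun y => γ y < 0) (fun x y hx hy => ?_)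
        (fun c x hc hx => ?_) (fun y hr hy => ?_) hy hy0
      · rw [map_add]; linarith
      · rw [map_smul]; exact mul_neg_of_pos_of_neg hc hx
      · rcases W.ray_cases hq hr hy with h1 | h1
        · exact hγ y h1
        · exact absurd h1.1 h
  exact ⟨key α fun y hy => hy.1, key αm fun y hy => hy.2⟩

omit W in
theorem coordSupp_proj0 {q : HN N} : coordSupp (proj0 Y q) = coordSupp q ∩ {i | Y i = 0} := by
  ext i
  by_cases h : Y i = 0 <;> simp [coordSupp, proj0, h]

omit W in
theorem muC_proj0 {q : HN N} (hY : YVanish Y q ∨ YVanish (-Y) q) (hu : ∀ i, Y i = 0 ∨ Y i = 1 ∨ Y i = -1) :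
    muC k (proj0 Y q) = muC k q := by
  ext x
  rw [muC_apply, muC_apply]
  congr 1
  refine Finset.sum_congr rfl fun i _ => ?_
  rcases hu i with h | h | h
  · simp [proj0, h]
  · rcases hY with hY | hY
    · simp [proj0, h, (hY i).1 h]
    · simp [proj0, h, (hY i).2 (by simp [h])]
  · rcases hY with hY | hY
    · simp [proj0, h, (hY i).2 h]
    · simp [proj0, h, (hY i).1 (by simp [h])]

/-- Erasing the coordinates of non-zero weight enlarges the cone only by multiples of Y, which α
does not see. -/
theorem WallCrossing.proj0_mem_stab {q : HN N} (hq : q ∈ stab k αp β) (h : YVanish Y q) :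
    proj0 Y q ∈ stab k α β := by
  have hf := W.free hq
  have hcone : ∀ y : k, InCone q y → y ≠ 0 → α y < 0 ∨ ∃ c : ℝ, y = c • (⟨_, W.mem⟩ : k) := by
    intro y hy hy0
    have := inCone_induction (muC_of_mem_stab hq) hf
      (P := fun y => α y < 0 ∨ ∃ c : ℝ, y = c • (⟨_, W.mem⟩ : k)) ?_ ?_ ?_ hy hy0
    · exact this
    · rintro x y (hx | ⟨c, rfl⟩) (hy | ⟨d, rfl⟩)
      · left; rw [map_add]; linarith
      · left; rw [map_add, map_smul, W.wall]; simpa using hx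
      · left; rw [map_add, map_smul, W.wall]; simpa using hy
      · right; exact ⟨c + d, by rw [add_smul]⟩
    · rintro c x hc (hx | ⟨d, rfl⟩)
      · left; rw [map_smul]; exact mul_neg_of_pos_of_neg hc hx
      · right; exact ⟨c * d, by rw [smul_smul]⟩
    · intro y hr hy
      rcases W.ray_cases hq hr hy with h1 | h1
      · exact Or.inl h1.1
      · exact Or.inr h1.2
  have hshift : ∀ y : k, InCone (proj0 Y q) y → ∃ c : ℝ, InCone q (y + c • (⟨_, W.mem⟩ : k) : k) := by
    intro y hy
    -- This multiple of Y outweighs yᵢ wherever Yᵢ ≠ 0 and changes nothing where Yᵢ = 0.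
    refine ⟨-∑ i, |(y : Fin N → ℝ) i|, fun i hi => ?_, fun i hi => ?_⟩
    all_goals
      have hle : |(y : Fin N → ℝ) i| ≤ ∑ i, |(y : Fin N → ℝ) i| :=
        Finset.single_le_sum (f := fun i => |(y : Fin N → ℝ) i|) (fun j _ => abs_nonneg _) (Finset.mem_univ i)
      have e : ((y + (-∑ i, |(y : Fin N → ℝ) i|) • (⟨_, W.mem⟩ : k) : k) : Fin N → ℝ) i =
        (y : Fin N → ℝ) i - (∑ i, |(y : Fin N → ℝ) i|) * Y i := by simp; ring
      rw [e]
      rcases W.unit i with hY | hY | hY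
    · have := hy.1 i (by simpa [proj0, hY] using hi); simpa [hY] using this
    · rw [hY]; push_cast; linarith [le_abs_self ((y : Fin N → ℝ) i)]
    · exact absurd ((h i).2 hY) hi
    · have := hy.2 i (by simpa [proj0, hY] using hi); simpa [hY] using this
    · exact absurd ((h i).1 hY) hi
    · rw [hY]; push_cast; linarith [neg_abs_le ((y : Fin N → ℝ) i)]
  have hfix : ∀ y : k, (∃ c : ℝ, y = c • (⟨_, W.mem⟩ : k)) →
      ∀ i ∈ coordSupp (proj0 Y q), (y : Fin N → ℝ) i = 0 := by
    rintro y ⟨c, rfl⟩ i hi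
    rw [coordSupp_proj0] at hi
    have : Y i = 0 := hi.2
    simp [this]
  have hmain : ∀ y : k, InCone (proj0 Y q) y →
      (∀ i ∈ coordSupp (proj0 Y q), (y : Fin N → ℝ) i = 0) ∨ α y < 0 := by
    intro y hy
    obtain ⟨c, hc⟩ := hshift y hy
    by_cases h0 : y + c • (⟨_, W.mem⟩ : k) = 0
    · left; exact hfix y ⟨-c, Subtype.ext (funext fun i => by
        have := congrFun (congrArg Subtype.val h0) i; simp at this ⊢; linarith)⟩
    · rcases hcone _ hc h0 with h1 | ⟨d, hd⟩
      · right; rw [map_add, map_smul, W.wall] at h1; simpa using h1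
      · left; exact hfix y ⟨d - c, Subtype.ext (funext fun i => by
          have := congrFun (congrArg Subtype.val hd) i; simp at this ⊢; linarith)⟩
  refine mem_stab_of_inCone ((muC_proj0 (Or.inl h) W.unit).trans (muC_of_mem_stab hq)) (fun y hy => ?_) hmain
  have hin : ∀ v : k, (∀ i ∈ coordSupp (proj0 Y q), (v : Fin N → ℝ) i = 0) → InCone (proj0 Y q) v :=
    fun v hv => ⟨fun i hi => (hv i (Or.inl hi)).le, fun i hi => (hv i (Or.inr hi)).ge⟩
  -- The inequality is used for v and for −v, which gives α(v) = 0 on the stabilizer.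
  have hle : ∀ v : k, (∀ i ∈ coordSupp (proj0 Y q), (v : Fin N → ℝ) i = 0) → α v ≤ 0 := by
    intro v hv
    obtain ⟨c, hc⟩ := hshift v (hin v hv)
    by_cases h0 : v + c • (⟨_, W.mem⟩ : k) = 0
    · rw [eq_neg_of_add_eq_zero_left h0, map_neg, map_smul, W.wall]; simp
    · rcases hcone _ hc h0 with h1 | ⟨d, hd⟩
      · rw [map_add, map_smul, W.wall] at h1; simpa using h1.le
      · have : v = (d - c) • (⟨_, W.mem⟩ : k) := Subtype.ext (funext fun i => by
          have := congrFun (congrArg Subtype.val hd) i; simp at this ⊢; linarith)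
        rw [this, map_smul, W.wall]; simp
  have h1 := hle y hy
  have h2 := hle (-y) fun i hi => by simp [hy i hi]
  rw [map_neg] at h2
  linarith

/-- Converse of `WallCrossing.proj0_mem_stab`. A ray of the cone of q that is not a multiple of Y is
tested by the α-stability of the projected point. A multiple of Y must be negative, because some
coordinate of positive weight is non-zero, and α₊ is negative on it. -/
theorem WallCrossing.mem_stab_of_proj0 {q : HN N} (hq : proj0 Y q ∈ stab k α β) (h : YVanish Y q)
    (h' : ¬ YVanish (-Y) q) : q ∈ stab k αp β := by
  have hβ : muC k q = β := (muC_proj0 (Or.inl h) W.unit).symm.trans (muC_of_mem_stab hq)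
  have hdet := W.coordSupp_det hq fun i hi => by simp [proj0, hi]
  have hf : ∀ x : k, (∀ i ∈ coordSupp q, (x : Fin N → ℝ) i = 0) → x = 0 := by
    intro x hx
    obtain ⟨c, rfl⟩ := hdet x fun i hi => hx i (by rw [coordSupp_proj0] at hi; exact hi.1)
    by_contra hc
    have hc0 : c ≠ 0 := by rintro rfl; exact hc (zero_smul _ _)
    refine h' fun i => ⟨fun hY => ?_, fun hY => ?_⟩
    · by_contra h2
      have hY' : Y i = -1 := by simp at hY; omega
      have := hx i (Or.inr h2)
      simp [hY', hc0] at this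
    · by_contra h2
      have hY' : Y i = 1 := by simp at hY; omega
      have := hx i (Or.inl h2)
      simp [hY', hc0] at this
  refine mem_stab_of_inCone hβ (fun y hy => by rw [hf y hy, map_zero]) fun y hy => ?_
  by_cases hy0 : y = 0
  · left; intro i _; rw [hy0]; rfl
  right
  refine inCone_induction hβ hf (P := fun y => αp y < 0) (fun x y hx hy => ?_)
        (fun c x hc hx => ?_) (fun y hr hy => ?_) hy hy0
  · rw [map_add]; linarith
  · rw [map_smul]; exact mul_neg_of_pos_of_neg hc hx
  · by_cases hc : ∃ c : ℝ, y = c • (⟨_, W.mem⟩ : k)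
    · obtain ⟨c, rfl⟩ := hc
      have hcneg : c < 0 := by
        rcases lt_trichotomy c 0 with h | h | h
        · exact h
        · exact absurd (by rw [h, zero_smul]) hr.1
        · refine absurd (W.swap.yVanish_of_inCone (q := q) (neg_lt_zero.2 h) ?_) h'
          convert hy using 1
          funext i; simp
      rw [map_smul]; exact mul_neg_of_neg_of_pos hcneg W.pos
    · refine (W.ray y hr hc).2.1.2 ?_
      have hy' : InCone (proj0 Y q) y := by
        refine ⟨fun i hi => hy.1 i ?_, fun i hi => hy.2 i ?_⟩ <;>
        · intro h0; apply hi; simp [proj0, h0]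
      rcases (of_mem_stab hq).2 y hy' with h1 | h1
      · exact absurd (hdet y h1) hc
      · exact h1

end

end ToricHK

namespace ToricHK

variable {N : ℕ} {k : Submodule ℝ (Fin N → ℝ)} {α αp αm : StrongDual ℝ k} {β : k →L[ℝ] ℂ}

/-! ## Walls and chambers -/

theorem torusExp_toC_eq_one_iff {x : Fin N → ℝ} {i : Fin N} :
    (torusExp (toC x) i : ℂ) = 1 ↔ ∃ m : ℤ, x i = m := by
  simp only [torusExp, toC, Units.val_mk0]
  rw [Complex.exp_eq_one_iff]
  have h : (2 * Real.pi * Complex.I : ℂ) ≠ 0 := by simp [Real.pi_ne_zero]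
  refine exists_congr fun m => ?_
  rw [mul_comm, mul_left_inj' h]
  exact_mod_cast Iff.rfl

theorem act_eq_self_iff {ζ : Fin N → ℂˣ} {p : HN N} :
    act ζ p = p ↔ ∀ i ∈ coordSupp p, (ζ i : ℂ) = 1 := by
  constructor
  · intro h i hi
    rcases hi with hi | hi
    · have := congrFun (congrArg Prod.fst h) i
      simp only [act] at this
      exact (mul_eq_left₀ hi).1 this
    · have := congrFun (congrArg Prod.snd h) i
      simp only [act, Units.val_inv_eq_inv_val] at this
      exact inv_eq_one.1 ((mul_eq_left₀ hi).1 this)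
  · intro h
    ext i
    · by_cases hi : p.1 i = 0
      · simp [act, hi]
      · simp [act, h i (Or.inl hi)]
    · by_cases hi : p.2 i = 0
      · simp [act, hi]
      · simp [act, h i (Or.inr hi)]

theorem exists_torusExp_smul_ne_one {x : Fin N → ℝ} {i : Fin N} (hx : x i ≠ 0) :
    ∃ t : ℝ, (torusExp (toC (t • x)) i : ℂ) ≠ 1 := by
  refine ⟨1 / (2 * x i), fun h => ?_⟩
  obtain ⟨m, hm⟩ := torusExp_toC_eq_one_iff.1 h
  have h1 : (1 / (2 * x i)) • x i = (1 : ℝ) / 2 := by simp only [smul_eq_mul]; field_simp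
  rw [Pi.smul_apply, h1] at hm
  have h2 : (2 * m : ℝ) = 1 := by linarith
  have h3 : (2 * m : ℤ) = 1 := by exact_mod_cast h2
  omega

/-- A cardinality argument: each t gives an integral vector m(t) with t x − m(t) ∈ k. Two of the
uncountably many t share this vector, and the difference is a non-zero multiple of x in k. -/
theorem mem_of_forall_torusExp_mem {x : Fin N → ℝ} (h : ∀ t : ℝ, torusExp (toC (t • x)) ∈ subtorus k) :
    x ∈ k := by
  have hex : ∀ t : ℝ, ∃ m : Fin N → ℤ, t • x - (fun i => (m i : ℝ)) ∈ k := by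
    intro t
    obtain ⟨y, hy, he⟩ := h t
    have : ∀ i, ∃ m : ℤ, (t • x - y) i = m := by
      intro i
      rw [← torusExp_toC_eq_one_iff, sub_eq_add_neg, toC_add, toC_neg, torusExp_add, torusExp_neg, he]
      simp
    choose m hm using this
    refine ⟨m, ?_⟩
    have h2 : (fun i => (m i : ℝ)) = t • x - y := funext fun i => (hm i).symm
    rw [h2]; simpa using hy
  choose m hm using hex
  have hni : ¬ Function.Injective m := fun hinj => by
    have : Countable ℝ := hinj.countable
    exact not_countable this
  rw [Function.not_injective_iff] at hni
  obtain ⟨t, s, hts, hne⟩ := hni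
  have h1 := k.sub_mem (hm t) (hm s)
  rw [hts, sub_sub_sub_cancel_right, ← sub_smul] at h1
  have := k.smul_mem (t - s)⁻¹ h1
  rwa [smul_smul, inv_mul_cancel₀ (sub_ne_zero.2 hne), one_smul] at this

theorem mem_lieAlg_isotropy {p : HN N} {x : Fin N → ℝ} :
    x ∈ lieAlg (isotropy k p) ↔ x ∈ k ∧ ∀ i ∈ coordSupp p, x i = 0 := by
  constructor
  · intro h
    refine ⟨mem_of_forall_torusExp_mem fun t => (h t).1, fun i hi => ?_⟩
    by_contra hx
    obtain ⟨t, ht⟩ := exists_torusExp_smul_ne_one hx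
    exact ht (act_eq_self_iff.1 (h t).2 i hi)
  · rintro ⟨hx, h0⟩ t
    refine ⟨⟨t • x, k.smul_mem t hx, rfl⟩, act_eq_self_iff.2 fun i hi => ?_⟩
    rw [torusExp_toC_eq_one_iff]
    exact ⟨0, by simp [h0 i hi]⟩

theorem exists_smul_of_isotropyOne {H : Subgroup (Fin N → ℂˣ)} (hH : H ∈ isotropyOne k)
    {y : Fin N → ℝ} (hy : y ∈ lieAlg H) (hy0 : y ≠ 0) {x : Fin N → ℝ} (hx : x ∈ lieAlg H) :
    ∃ c : ℝ, x = c • y := by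
  have := (finrank_eq_one_iff_of_nonzero' (⟨y, hy⟩ : lieAlg H) (fun h => hy0 (congrArg Subtype.val h))).1
    hH.2 ⟨x, hx⟩
  obtain ⟨c, hc⟩ := this
  exact ⟨c, (congrArg Subtype.val hc).symm⟩

theorem lieAlg_le_of_isotropyOne {H : Subgroup (Fin N → ℂˣ)} (hH : H ∈ isotropyOne k)
    {y : Fin N → ℝ} (hy : y ∈ lieAlg H) : y ∈ k := by
  obtain ⟨⟨p, rfl⟩, -⟩ := hH
  exact (mem_lieAlg_isotropy.1 hy).1

theorem apply_ne_zero_of_not_mem_wall {H : Subgroup (Fin N → ℂˣ)} (hH : H ∈ isotropyOne k) {y : k}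
    (hy : (y : Fin N → ℝ) ∈ lieAlg H) (hy0 : y ≠ 0) {γ : StrongDual ℝ k} (hγ : γ ∉ wall k H) : γ y ≠ 0 := by
  intro h
  refine hγ fun x hx => ?_
  obtain ⟨c, hc⟩ := exists_smul_of_isotropyOne hH hy (fun h => hy0 (Subtype.ext h)) hx
  have : x = c • y := Subtype.ext hc
  rw [this, map_smul, h, smul_zero]

/-- A point with zᵢ = 1 exactly where yᵢ = 0 has the line of y as its isotropy algebra. So the rays
are tested precisely by the walls in S_β. -/
theorem IsRay.exists_wallIndex {y : k} (hy : IsRay k β y) :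
    ∃ H ∈ wallIndex k β, ∀ x : Fin N → ℝ, x ∈ lieAlg H ↔ ∃ c : ℝ, x = c • (y : Fin N → ℝ) := by
  classical
  set p : HN N := (fun i => if (y : Fin N → ℝ) i = 0 then 1 else 0, 0) with hp
  have hsupp : ∀ i, i ∈ coordSupp p ↔ (y : Fin N → ℝ) i = 0 := fun i => by simp [coordSupp, hp]
  have hmem : ∀ x : Fin N → ℝ, x ∈ lieAlg (isotropy k p) ↔ ∃ c : ℝ, x = c • (y : Fin N → ℝ) := by
    intro x
    rw [mem_lieAlg_isotropy]
    constructor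
    · rintro ⟨hx, h0⟩
      obtain ⟨c, hc⟩ := hy.2.2 ⟨x, hx⟩ fun i hi => h0 i ((hsupp i).2 hi)
      exact ⟨c, congrArg Subtype.val hc⟩
    · rintro ⟨c, rfl⟩
      exact ⟨k.smul_mem c y.2, fun i hi => by simp [(hsupp i).1 hi]⟩
  refine ⟨isotropy k p, ⟨⟨⟨p, rfl⟩, ?_⟩, fun x hx => ?_⟩, hmem⟩
  · have hyL : (y : Fin N → ℝ) ∈ lieAlg (isotropy k p) := (hmem _).2 ⟨1, by simp⟩
    refine finrank_eq_one (⟨y, hyL⟩ : lieAlg (isotropy k p)) ?_ ?_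
    · intro h; exact hy.1 (Subtype.ext (congrArg (fun z : lieAlg (isotropy k p) => (z : Fin N → ℝ)) h))
    · rintro ⟨x, hx⟩
      obtain ⟨c, rfl⟩ := (hmem x).1 hx
      exact ⟨c, rfl⟩
  · obtain ⟨c, hc⟩ := (hmem x).1 hx
    have : x = c • y := Subtype.ext hc
    rw [this, map_smul, hy.2.1, smul_zero]

theorem isRay_of_mem_wallIndex {H : Subgroup (Fin N → ℂˣ)} (hH : H ∈ wallIndex k β) {y : k}
    (hy : (y : Fin N → ℝ) ∈ lieAlg H) (hy0 : y ≠ 0) : IsRay k β y := by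
  refine ⟨hy0, hH.2 y hy, fun x hx => ?_⟩
  have hx' : (x : Fin N → ℝ) ∈ lieAlg H := by
    obtain ⟨p, hp⟩ := hH.1.1
    rw [hp, mem_lieAlg_isotropy] at hy ⊢
    exact ⟨x.2, fun i hi => hx i (hy.2 i hi)⟩
  obtain ⟨c, hc⟩ := exists_smul_of_isotropyOne hH.1 hy (fun h => hy0 (Subtype.ext h)) hx'
  exact ⟨c, Subtype.ext hc⟩

/-- Evaluation at y has no zero on a chamber, so by connectedness it keeps its sign there, and a
negative value on the closure decides which sign. -/
theorem IsChamber.neg_of_neg {C : Set (StrongDual ℝ k)} (hC : IsChamber k β C)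
    {H : Subgroup (Fin N → ℂˣ)} (hH : H ∈ wallIndex k β) {y : k}
    (hy : (y : Fin N → ℝ) ∈ lieAlg H) (hy0 : y ≠ 0) {γ : StrongDual ℝ k} (hγ : γ ∈ closure C)
    (hγy : γ y < 0) {γ' : StrongDual ℝ k} (hγ' : γ' ∈ C) : γ' y < 0 := by
  obtain ⟨v, -, rfl⟩ := hC
  have hcont : Continuous fun δ : StrongDual ℝ k => δ y := (ContinuousLinearMap.apply ℝ ℝ y).continuous
  obtain ⟨δ, hδ, hδC⟩ := mem_closure_iff.1 hγ {δ | δ y < 0} (isOpen_lt hcont continuous_const) hγy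
  by_contra hcon
  rw [not_lt] at hcon
  obtain ⟨ε, hε, h0⟩ := isPreconnected_connectedComponentIn.intermediate_value hδC hγ'
    hcont.continuousOn ⟨le_of_lt hδ, hcon⟩
  exact apply_ne_zero_of_not_mem_wall hH.1 hy hy0 (connectedComponentIn_subset _ _ hε H hH) h0

theorem IsChamber.neg_iff {C : Set (StrongDual ℝ k)} (hC : IsChamber k β C)
    {H : Subgroup (Fin N → ℂˣ)} (hH : H ∈ wallIndex k β) {y : k}
    (hy : (y : Fin N → ℝ) ∈ lieAlg H) (hy0 : y ≠ 0) {γ : StrongDual ℝ k} (hγ : γ ∈ closure C)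
    (hγy : γ y ≠ 0) {γ' : StrongDual ℝ k} (hγ' : γ' ∈ C) : γ' y < 0 ↔ γ y < 0 := by
  refine ⟨fun h => ?_, fun h => hC.neg_of_neg hH hy hy0 hγ h hγ'⟩
  by_contra hcon
  have hpos : 0 < γ y := lt_of_le_of_ne (not_lt.1 hcon) hγy.symm
  have := hC.neg_of_neg hH (y := -y) (by simpa using (lieAlg H).neg_mem hy) (neg_ne_zero.2 hy0) hγ
    (by rw [map_neg]; linarith) hγ'
  rw [map_neg] at this
  linarith

/-- Take a frame containing j whose other indices lie in the support of a point with isotropy H. As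
Y vanishes on that support, Y − Yⱼ eⱼ vanishes on the frame and hence everywhere. -/
theorem exists_intCast_eq (hK : IsUnimodular k) {H : Subgroup (Fin N → ℂˣ)} (hH : H ∈ isotropyOne k)
    {Y : Fin N → ℝ} (hY : Y ∈ lieAlg H) {j : Fin N} (hj : Y j ≠ 0) :
    ∃ e : Fin N → ℤ, e j = 1 ∧ Y = Y j • fun i => (e i : ℝ) := by
  have hY0 : Y ≠ 0 := by rintro rfl; exact hj rfl
  have hYk := lieAlg_le_of_isotropyOne hH hY
  obtain ⟨p, hp⟩ := hH.1
  have hYp : ∀ i ∈ coordSupp p, Y i = 0 := by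
    rw [hp] at hY; exact (mem_lieAlg_isotropy.1 hY).2
  have hdet : ∀ x ∈ k, (∀ i ∈ coordSupp p ∪ {j}, x i = 0) → ∀ l ∈ Set.univ, x l = 0 := by
    intro x hx h0 l _
    have hxL : x ∈ lieAlg H := by
      rw [hp]; exact mem_lieAlg_isotropy.2 ⟨hx, fun i hi => h0 i (Or.inl hi)⟩
    obtain ⟨c, rfl⟩ := exists_smul_of_isotropyOne hH hY hY0 hxL
    have := h0 j (Or.inr rfl)
    simp only [Pi.smul_apply, smul_eq_mul, mul_eq_zero, hj, or_false] at this
    simp [this]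
  obtain ⟨B, e, hB, hjB, hBT⟩ := exists_frame hK (A := Set.univ) (T := coordSupp p ∪ {j}) (B₀ := {j})
    (Set.subset_univ _) hdet (by simp) (by
      have hne : iotaU k j ≠ 0 := fun h =>
        hj (congrArg (fun f : StrongDual ℝ k => f ⟨Y, hYk⟩) h)
      have := linearIndepOn_singleton_iff (R := ℝ) (M := StrongDual ℝ k) (v := iotaU k) (i := j)
      exact this.2 hne)
  have hjB' : j ∈ B := hjB rfl
  refine ⟨e j, by simp [hB.dual j hjB' j hjB'], ?_⟩
  have h := hB.det (Y - Y j • fun i => (e j i : ℝ)) (k.sub_mem hYk (k.smul_mem _ (hB.mem j hjB'))) ?_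
  · funext l
    have := h l trivial
    simpa [sub_eq_zero] using this
  · intro i hi
    by_cases hij : i = j
    · simp [hij, hB.dual j hjB' j hjB']
    · have h1 : i ∈ coordSupp p := by
        rcases hBT hi with h | h
        · exact h
        · exact absurd h hij
      simp [hYp i h1, hB.dual j hjB' i hi, Ne.symm hij]

theorem tendsto_add_smul_zero {V : Type*} [AddCommGroup V] [Module ℝ V] [TopologicalSpace V]
    [ContinuousAdd V] [ContinuousSMul ℝ V] (x y : V) :
    Filter.Tendsto (fun t : ℝ => x + t • y) (𝓝 0) (𝓝 x) := by
  have : Continuous fun t : ℝ => x + t • y := by fun_prop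
  simpa using this.tendsto 0

theorem connectedComponentIn_eq_of_segment {V : Type*} [AddCommGroup V] [Module ℝ V] [TopologicalSpace V]
    [ContinuousAdd V] [ContinuousSMul ℝ V] {s : Set V} {x y : V}
    (h : ∀ a b : ℝ, 0 ≤ a → 0 ≤ b → a + b = 1 → a • x + b • y ∈ s) :
    connectedComponentIn s x = connectedComponentIn s y := by
  have hseg : segment ℝ x y ⊆ s := by
    rintro _ ⟨a, b, ha, hb, hab, rfl⟩; exact h a b ha hb hab
  have hpre : IsPreconnected (segment ℝ x y) := by
    rw [segment_eq_image]
    exact isPreconnected_Icc.image _ (by fun_prop)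
  exact connectedComponentIn_eq
    (hpre.subset_connectedComponentIn (left_mem_segment ℝ x y) hseg (right_mem_segment ℝ x y))

/-- Chamber geometry reduced to signs on rays. Off the line of Y a sign passes from α to `Cp`
through the closure, and on to `Cm` through a common point of both closures on the facet. On Y the
signs are opposite, since otherwise no wall would separate the two chambers. -/
theorem exists_wallCrossing (hK : IsUnimodular k) {H₀ : Subgroup (Fin N → ℂˣ)}
    {Cp Cm : Set (StrongDual ℝ k)} (hC : AreAdjacent k β H₀ Cp Cm) {Y : Fin N → ℝ} (hY : Y ∈ lieAlg H₀)
    (hY0 : Y ≠ 0) (hαp : αp ∈ Cp) (hαm : αm ∈ Cm) (hα : α ∈ closure Cp ∩ wall k H₀)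
    (hα' : ∀ H ∈ wallIndex k β, H ≠ H₀ → α ∉ wall k H) :
    ∃ Y' : Fin N → ℤ, WallCrossing k β α αp αm Y' ∧ (∀ i, Y' i ≠ 0 ↔ Y i ≠ 0) := by
  have hH := hC.mem.1
  have hYk := lieAlg_le_of_isotropyOne hH hY
  obtain ⟨j, hj⟩ := Function.ne_iff.1 hY0
  rw [Pi.zero_apply] at hj
  obtain ⟨e, hej, he⟩ := exists_intCast_eq hK hH hY hj
  have hei : ∀ i, Y i = Y j * e i := fun i => congrFun he i
  have hunit : ∀ i, e i = 0 ∨ e i = 1 ∨ e i = -1 := by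
    intro i
    by_cases h0 : e i = 0
    · exact Or.inl h0
    · right
      have hYi : Y i ≠ 0 := by
        rw [hei]; exact mul_ne_zero hj (by exact_mod_cast h0)
      -- With i and j interchanged, the ratio and its inverse are both integers, so the ratio is ±1.
      obtain ⟨f, hf, hf'⟩ := exists_intCast_eq hK hH hY hYi
      have h1 : Y j = Y i * f j := congrFun hf' j
      have h2 : (e i : ℝ) * f j = 1 := by
        rw [hei i] at h1
        have : Y j * (e i * f j) = Y j * 1 := by linarith
        exact mul_left_cancel₀ hj this
      have h3 : e i * f j = 1 := by exact_mod_cast h2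
      exact Int.isUnit_iff.1 (IsUnit.of_mul_eq_one _ h3)
  have hee : (fun i => (e i : ℝ)) = (Y j)⁻¹ • Y := by
    funext i; rw [Pi.smul_apply, hei i, smul_eq_mul, inv_mul_cancel_left₀ hj]
  have hek : (fun i => (e i : ℝ)) ∈ k := by rw [hee]; exact k.smul_mem _ hYk
  set y₀ : k := ⟨_, hek⟩ with hy₀
  have hy₀L : (y₀ : Fin N → ℝ) ∈ lieAlg H₀ := by
    change (fun i => (e i : ℝ)) ∈ _
    rw [hee]; exact (lieAlg H₀).smul_mem _ hY
  have hy₀0 : y₀ ≠ 0 := by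
    intro h
    have := congrFun (congrArg Subtype.val h) j
    simp [hy₀, hej] at this
  have hαpW : αp ∈ wallComplement k β := by
    obtain ⟨v, -, rfl⟩ := hC.chamber_plus; exact connectedComponentIn_subset _ _ hαp
  have hαmW : αm ∈ wallComplement k β := by
    obtain ⟨v, -, rfl⟩ := hC.chamber_minus; exact connectedComponentIn_subset _ _ hαm
  have hp0 : αp y₀ ≠ 0 := apply_ne_zero_of_not_mem_wall hH hy₀L hy₀0 (hαpW H₀ hC.mem)
  have hm0 : αm y₀ ≠ 0 := apply_ne_zero_of_not_mem_wall hH hy₀L hy₀0 (hαmW H₀ hC.mem)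
  have hray : ∀ y : k, IsRay k β y → (¬ ∃ c : ℝ, y = c • y₀) →
      α y ≠ 0 ∧ (αp y < 0 ↔ α y < 0) ∧ (αm y < 0 ↔ α y < 0) := by
    intro y hy hn
    obtain ⟨H, hHβ, hHy⟩ := hy.exists_wallIndex
    have hyL : (y : Fin N → ℝ) ∈ lieAlg H := (hHy _).2 ⟨1, by simp⟩
    have hne : H ≠ H₀ := by
      rintro rfl
      obtain ⟨c, hc⟩ := exists_smul_of_isotropyOne hH hy₀L (fun h => hy₀0 (Subtype.ext h)) hyL
      exact hn ⟨c, Subtype.ext hc⟩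
    have hαy : α y ≠ 0 := apply_ne_zero_of_not_mem_wall hHβ.1 hyL hy.1 (hα' H hHβ hne)
    have h1 := hC.chamber_plus.neg_iff hHβ hyL hy.1 hα.1 hαy hαp
    refine ⟨hαy, h1, ?_⟩
    -- α is only known to lie in the closure of `Cp`. A point of the common facet, pushed slightly
    -- along α within the wall, lies in both closures and off the wall of y.
    obtain ⟨U, hU, ⟨u, huU, huW⟩, hsub⟩ := hC.facet
    have hev : ∀ᶠ t in 𝓝[>] (0 : ℝ), u + t • α ∈ U :=
      nhdsWithin_le_nhds ((tendsto_add_smul_zero u α).eventually (hU.mem_nhds huU))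
    have hev2 : ∀ᶠ t in 𝓝[>] (0 : ℝ), u y + t * α y ≠ 0 := by
      by_cases hu : u y = 0
      · filter_upwards [self_mem_nhdsWithin] with t ht
        rw [hu, zero_add]; exact mul_ne_zero (ne_of_gt ht) hαy
      · have hc2 : Continuous fun t : ℝ => u y + t * α y := by fun_prop
        refine nhdsWithin_le_nhds ((hc2.tendsto 0).eventually (isOpen_ne.mem_nhds ?_))
        simpa using hu
    obtain ⟨t, ht1, ht2⟩ := (hev.and hev2).exists
    have hW : u + t • α ∈ wall k H₀ := by
      intro x hx
      have e1 := huW x hx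
      have e2 := hα.2 x hx
      simp [e1, e2]
    obtain ⟨hcp, hcm⟩ := hsub ⟨ht1, hW⟩
    have hval : (u + t • α) y ≠ 0 := by simpa using ht2
    rw [hC.chamber_minus.neg_iff hHβ hyL hy.1 hcm hval hαm,
      ← hC.chamber_plus.neg_iff hHβ hyL hy.1 hcp hval hαp, h1]
  -- On one side of the wall, α₊ and α₋ would have equal signs on all rays; the segment between them
  -- would avoid every wall and the chambers would coincide.
  have hopp : αp y₀ * αm y₀ < 0 := by
    by_contra hcon
    have hpos : 0 < αp y₀ * αm y₀ := lt_of_le_of_ne (not_lt.1 hcon) (mul_ne_zero hp0 hm0).symm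
    refine hC.ne ?_
    have hsign : ∀ y : k, IsRay k β y → 0 < αp y * αm y := by
      intro y hy
      by_cases hc : ∃ c : ℝ, y = c • y₀
      · obtain ⟨c, rfl⟩ := hc
        have hc0 : c ≠ 0 := by rintro rfl; exact hy.1 (zero_smul _ _)
        simp only [map_smul, smul_eq_mul]
        have : c * αp y₀ * (c * αm y₀) = c ^ 2 * (αp y₀ * αm y₀) := by ring
        rw [this]; positivity
      · obtain ⟨H, hHβ, hHy⟩ := hy.exists_wallIndex
        have hyL : (y : Fin N → ℝ) ∈ lieAlg H := (hHy _).2 ⟨1, by simp⟩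
        have e1 := apply_ne_zero_of_not_mem_wall hHβ.1 hyL hy.1 (hαpW H hHβ)
        have e2 := apply_ne_zero_of_not_mem_wall hHβ.1 hyL hy.1 (hαmW H hHβ)
        obtain ⟨-, h1, h2⟩ := hray y hy hc
        rcases lt_or_gt_of_ne e1 with h | h
        · exact mul_pos_of_neg_of_neg h (h2.2 (h1.1 h))
        · have : ¬ αm y < 0 := fun h' => lt_asymm h (h1.2 (h2.1 h'))
          exact mul_pos h (lt_of_le_of_ne (not_lt.1 this) e2.symm)
    have hseg : ∀ a b : ℝ, 0 ≤ a → 0 ≤ b → a + b = 1 → a • αp + b • αm ∈ wallComplement k β := by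
      intro a b ha hb hab H hHβ hw
      have : ∃ y : k, (y : Fin N → ℝ) ∈ lieAlg H ∧ y ≠ 0 := by
        have hpos : 0 < Module.finrank ℝ (lieAlg H) := by rw [hHβ.1.2]; norm_num
        have := Module.finrank_pos_iff.1 hpos
        obtain ⟨y, hy⟩ := exists_ne (0 : lieAlg H)
        exact ⟨⟨y, lieAlg_le_of_isotropyOne hHβ.1 y.2⟩, y.2, fun h => hy (Subtype.ext (congrArg (fun z : k => (z : Fin N → ℝ)) h))⟩
      obtain ⟨y, hyL, hy0⟩ := this
      have h1 := hsign y (isRay_of_mem_wallIndex hHβ hyL hy0)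
      have h2 := hw y hyL
      simp only [add_apply, smul_apply, smul_eq_mul] at h2
      have h3 : a * (αp y * αp y) + b * (αp y * αm y) = 0 := by
        have : αp y * (a * αp y + b * αm y) = 0 := by rw [h2, mul_zero]
        linarith
      have h4 : 0 < αp y * αp y := mul_self_pos.2 (left_ne_zero_of_mul h1.ne')
      rcases ha.eq_or_lt with h | h
      · rw [← h, zero_add] at hab; rw [← h, hab] at h3; linarith
      · nlinarith [mul_pos h h4, mul_nonneg hb h1.le]
    have h1 : Cp = connectedComponentIn (wallComplement k β) αp := by
      obtain ⟨v, -, rfl⟩ := hC.chamber_plus; exact connectedComponentIn_eq hαp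
    have h2 : Cm = connectedComponentIn (wallComplement k β) αm := by
      obtain ⟨v, -, rfl⟩ := hC.chamber_minus; exact connectedComponentIn_eq hαm
    rw [h1, h2]
    exact connectedComponentIn_eq_of_segment hseg
  have hline : ∀ x : k, (∀ i, e i = 0 → (x : Fin N → ℝ) i = 0) → ∃ c : ℝ, x = c • y₀ := by
    intro x hx
    refine (isRay_of_mem_wallIndex hC.mem hy₀L hy₀0).2.2 x fun i hi => hx i ?_
    have hi' : (e i : ℝ) = 0 := hi
    exact_mod_cast hi'
  have hnz : ∀ i, e i ≠ 0 ↔ Y i ≠ 0 := by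
    intro i; rw [hei i]; simp [hj]
  -- The integral generator is determined up to sign, and is oriented so that α₊ is positive on it.
  rcases lt_or_gt_of_ne hp0 with h | h
  · have hm : 0 < αm y₀ := by
      by_contra hh
      nlinarith [not_lt.1 hh]
    have W : WallCrossing k β α αm αp e := ⟨hunit, hek, hC.mem.2 _ hy₀L, hα.2 _ hy₀L, hm, h, hline,
      fun y hy hn => ⟨(hray y hy hn).1, (hray y hy hn).2.2, (hray y hy hn).2.1⟩⟩
    exact ⟨-e, W.swap, fun i => by simpa using hnz i⟩
  · have hm : αm y₀ < 0 := by
      by_contra hh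
      nlinarith [not_lt.1 hh]
    exact ⟨e, ⟨hunit, hek, hC.mem.2 _ hy₀L, hα.2 _ hy₀L, h, hm, hline, hray⟩, hnz⟩

/-- The Lie algebra detects the whole group. A frame for the weight-zero indices can be chosen
inside the support of a point with isotropy H, where elements of H are 1; hence they are 1 at every
index of weight zero. -/
theorem forall_act_eq_iff (hK : IsUnimodular k) {H : Subgroup (Fin N → ℂˣ)} (hH : H ∈ isotropyOne k)
    {Y : Fin N → ℝ} (hY : Y ∈ lieAlg H) (hY0 : Y ≠ 0) (p : HN N) :
    (∀ ζ ∈ H, act ζ p = p) ↔ ∀ i, Y i ≠ 0 → p.1 i = 0 ∧ p.2 i = 0 := by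
  constructor
  · intro h i hi
    obtain ⟨t, ht⟩ := exists_torusExp_smul_ne_one hi
    by_contra hcon
    rw [not_and_or] at hcon
    exact ht (act_eq_self_iff.1 (h _ (hY t)) i hcon)
  · intro h ζ hζ
    obtain ⟨p', hp'⟩ := hH.1
    have hYp : ∀ i ∈ coordSupp p', Y i = 0 := by
      rw [hp'] at hY; exact (mem_lieAlg_isotropy.1 hY).2
    obtain ⟨B, e, hB, -, hBT⟩ := exists_frame hK (A := {i | Y i = 0}) (T := coordSupp p') (B₀ := ∅)
      hYp (fun x hx h0 l hl => by
        have hxL : x ∈ lieAlg H := by rw [hp']; exact mem_lieAlg_isotropy.2 ⟨hx, h0⟩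
        obtain ⟨c, rfl⟩ := exists_smul_of_isotropyOne hH hY hY0 hxL
        have : Y l = 0 := hl
        simp [this]) (Set.empty_subset _) (linearIndepOn_empty ℝ _)
    rw [hp'] at hζ
    refine act_eq_self_iff.2 fun i hi => ?_
    have hi0 : Y i = 0 := by
      by_contra hne
      rcases hi with h' | h'
      · exact h' (h i hne).1
      · exact h' (h i hne).2
    rw [hB.torus_expand (subtorus_le hζ.1) (show i ∈ {i | Y i = 0} from hi0)]
    refine Finset.prod_eq_one fun j hj => ?_
    rw [act_eq_self_iff.1 hζ.2 j (hBT hj), one_zpow]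

end ToricHK

namespace ToricHK

variable {N : ℕ} {k : Submodule ℝ (Fin N → ℝ)} {α αp αm : StrongDual ℝ k} {β : k →L[ℝ] ℂ}
  {Y : Fin N → ℤ}

/-! ## The natural morphisms -/

/-- The element `(s ^ Yᵢ)ᵢ` of the complex torus. -/
def expY (Y : Fin N → ℤ) (s : ℂˣ) : Fin N → ℂˣ := fun i => s ^ Y i

theorem expY_mem (hY : (fun i => (Y i : ℝ)) ∈ k) (s : ℂˣ) : expY Y s ∈ complexSubtorus k := by
  obtain ⟨a, b, h⟩ := exists_exp_eq s.ne_zero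
  refine ⟨a • fun i => (Y i : ℝ), k.smul_mem _ hY, b • fun i => (Y i : ℝ), k.smul_mem _ hY, ?_⟩
  funext i; ext
  simp only [expY, torusExp, toC, Units.val_mk0, Units.val_zpow_eq_zpow_val, Pi.add_apply,
    Pi.smul_apply, smul_eq_mul, ← h, ← Complex.exp_int_mul]
  congr 1; push_cast; ring

theorem yVanish_act (ζ : Fin N → ℂˣ) (q : HN N) : YVanish Y (act ζ q) ↔ YVanish Y q := by
  simp [YVanish, act]

theorem proj0_act (ζ : Fin N → ℂˣ) (q : HN N) : proj0 Y (act ζ q) = act ζ (proj0 Y q) := by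
  ext i <;> by_cases h : Y i = 0 <;> simp [proj0, act, h]

open Classical in
/-- The point of the orbit closure of `q` that is relevant for the parameter on the wall. -/
def toWall (Y : Fin N → ℤ) (q : HN N) : HN N := if YVanish Y q then proj0 Y q else q

theorem toWall_act (ζ : Fin N → ℂˣ) (q : HN N) : toWall Y (act ζ q) = act ζ (toWall Y q) := by
  unfold toWall
  by_cases h : YVanish Y q
  · rw [if_pos ((yVanish_act ζ q).2 h), if_pos h, proj0_act]
  · rw [if_neg (fun h' => h ((yVanish_act ζ q).1 h')), if_neg h]

theorem act_mem_closure_orbit {ζ : Fin N → ℂˣ} (hζ : ζ ∈ complexSubtorus k) {p q : HN N}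
    (hq : q ∈ closure {p' : HN N | ∃ ζ ∈ complexSubtorus k, p' = act ζ p}) :
    act ζ q ∈ closure {p' : HN N | ∃ ζ ∈ complexSubtorus k, p' = act ζ p} := by
  have h := image_closure_subset_closure_image (continuous_act_right ζ) ⟨q, hq, rfl⟩
  refine closure_mono ?_ h
  rintro _ ⟨_, ⟨η, hη, rfl⟩, rfl⟩
  exact ⟨ζ * η, mul_mem hζ hη, by rw [act_mul]⟩

theorem closure_orbit_act {ζ : Fin N → ℂˣ} (hζ : ζ ∈ complexSubtorus k) (p : HN N) :
    closure {p' : HN N | ∃ η ∈ complexSubtorus k, p' = act η (act ζ p)} =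
      closure {p' : HN N | ∃ η ∈ complexSubtorus k, p' = act η p} := by
  congr 1
  ext p'
  constructor
  · rintro ⟨η, hη, rfl⟩; exact ⟨η * ζ, mul_mem hη hζ, by rw [act_mul]⟩
  · rintro ⟨η, hη, rfl⟩
    exact ⟨η * ζ⁻¹, mul_mem hη (inv_mem hζ), by rw [act_mul, act_inv_act]⟩

/-- If the coordinates of weight −1 vanish, letting s → 0 in the group generated by Y sends those of
weight +1 to zero. -/
theorem toWall_mem_closure (hY : (fun i => (Y i : ℝ)) ∈ k) (hu : ∀ i, Y i = 0 ∨ Y i = 1 ∨ Y i = -1)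
    (q : HN N) : toWall Y q ∈ closure {p' : HN N | ∃ ζ ∈ complexSubtorus k, p' = act ζ q} := by
  unfold toWall
  split_ifs with h
  swap
  · exact subset_closure ⟨1, one_mem _, (act_one q).symm⟩
  let g : ℂ → HN N := fun s => (fun i => if Y i = 0 then q.1 i else s * q.1 i,
    fun i => if Y i = 0 then q.2 i else s * q.2 i)
  have hg : Continuous g := by
    refine Continuous.prodMk (continuous_pi fun i => ?_) (continuous_pi fun i => ?_) <;>
    · by_cases hi : Y i = 0
      · simp only [hi, if_true]; exact continuous_const
      · simp only [hi, if_false]; fun_prop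
  have hg0 : g 0 = proj0 Y q := by simp [g, proj0]
  rw [← hg0]
  refine mem_closure_of_tendsto ((hg.tendsto 0).mono_left (nhdsWithin_le_nhds (s := {0}ᶜ))) ?_
  filter_upwards [self_mem_nhdsWithin] with s hs
  have hs0 : s ≠ 0 := hs
  refine ⟨expY Y (Units.mk0 s hs0), expY_mem hY _, ?_⟩
  ext i
  · rcases hu i with hi | hi | hi
    · simp [g, act, expY, hi]
    · simp [g, act, expY, hi, mul_comm]
    · simp [g, act, (h i).2 hi]
  · rcases hu i with hi | hi | hi
    · simp [g, act, expY, hi]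
    · simp [g, act, (h i).1 hi]
    · simp [g, act, expY, hi, mul_comm]

theorem continuous_proj0 : Continuous (proj0 Y) := by
  refine Continuous.prodMk (continuous_pi fun i => ?_) (continuous_pi fun i => ?_) <;>
  · by_cases hi : Y i = 0
    · simp only [hi, if_true]; fun_prop
    · simp only [hi, if_false]; fun_prop

theorem isClosed_yVanish : IsClosed {q : HN N | YVanish Y q} := by
  simp only [YVanish, Set.ofPred_forall, Set.ofPred_and]
  refine isClosed_iInter fun i => IsClosed.inter ?_ ?_ <;>
  · refine isClosed_iInter fun _ => isClosed_eq (by fun_prop) continuous_const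

/-- Evaluated at Y, the equation μ₁ = α is a sum of nonnegative terms equal to α(Y) = 0. -/
theorem WallCrossing.eq_zero_of_level (W : WallCrossing k β α αp αm Y) {q : HN N}
    (hq : q ∈ level k α β) (h : YVanish Y q) : ∀ i, Y i ≠ 0 → q.1 i = 0 ∧ q.2 i = 0 := by
  have h0 : mu1 k q ⟨_, W.mem⟩ = 0 := by rw [hq.1]; exact W.wall
  rw [mu1_apply, mul_eq_zero, or_iff_right Real.pi_ne_zero] at h0
  have hnn : ∀ i, 0 ≤ (‖q.1 i‖ ^ 2 - ‖q.2 i‖ ^ 2) * (Y i : ℝ) := by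
    intro i
    rcases W.unit i with hi | hi | hi
    · simp [hi]
    · simp [hi, (h i).1 hi]
    · simp [hi, (h i).2 hi]
  intro i hi
  have := (Finset.sum_eq_zero_iff_of_nonneg fun i _ => hnn i).1 h0 i (Finset.mem_univ i)
  rcases W.unit i with hi' | hi' | hi'
  · exact absurd hi' hi
  · simp [hi', (h i).1 hi'] at this; exact ⟨this, (h i).1 hi'⟩
  · simp [hi', (h i).2 hi'] at this; exact ⟨(h i).2 hi', this⟩

theorem proj0_eq_self {q : HN N} (h : ∀ i, Y i ≠ 0 → q.1 i = 0 ∧ q.2 i = 0) : proj0 Y q = q := by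
  ext i <;> by_cases hi : Y i = 0
  · simp [proj0, hi]
  · simp [proj0, hi, (h i hi).1]
  · simp [proj0, hi]
  · simp [proj0, hi, (h i hi).2]

theorem WallCrossing.toWall_mem_stab (W : WallCrossing k β α αp αm Y) {q : HN N}
    (hq : q ∈ stab k αp β) : toWall Y q ∈ stab k α β := by
  unfold toWall
  split_ifs with h
  · exact W.proj0_mem_stab hq h
  · exact (W.mem_stab_of_not_yVanish hq h).1

variable [Nonempty (X k α β)]

/-- If the negative coordinates of p vanish, so do those of q, by closedness; the level equation
then makes q invariant under `proj0`, and continuity of `proj0` puts q into the orbit closure of the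
projected point. Uniqueness of level points in orbit closures concludes. -/
theorem WallCrossing.Qm_toWall_eq_iff (W : WallCrossing k β α αp αm Y) (hK : IsUnimodular k) {p : HN N}
    (hp : p ∈ stab k αp β) (q : level k α β) :
    Qm k α β (toWall Y p) = X.mk q ↔
      (q : HN N) ∈ closure {p' : HN N | ∃ ζ ∈ complexSubtorus k, p' = act ζ p} := by
  have hst := W.toWall_mem_stab hp
  rw [← Qm_of_mem_level hK q.2, Qm_eq_iff hK hst (level_subset_stab q.2)]
  constructor
  · rintro ⟨ζ, hζ, h⟩
    rw [← h]
    exact act_mem_closure_orbit hζ (toWall_mem_closure W.mem W.unit p)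
  · intro h
    obtain ⟨ζ, hζ, hl⟩ := hst
    suffices hcl : (q : HN N) ∈ closure {p' : HN N | ∃ η ∈ complexSubtorus k, p' = act η (toWall Y p)} by
      rw [← closure_orbit_act hζ] at hcl
      obtain ⟨κ, hκ, he⟩ := exists_mem_subtorus_of_mem_closure hK hl q.2 hcl
      exact ⟨κ * ζ, mul_mem (subtorus_le hκ) hζ, by rw [act_mul, he]⟩
    by_cases hv : YVanish Y p
    · have hqv : YVanish Y (q : HN N) := by
        refine closure_minimal ?_ (isClosed_yVanish (Y := Y)) h
        rintro _ ⟨η, -, rfl⟩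
        exact (yVanish_act η p).2 hv
      have hq0 := proj0_eq_self (W.eq_zero_of_level q.2 hqv)
      rw [← hq0]
      have := image_closure_subset_closure_image (continuous_proj0 (Y := Y)) ⟨_, h, rfl⟩
      refine closure_mono ?_ this
      rintro _ ⟨_, ⟨η, hη, rfl⟩, rfl⟩
      exact ⟨η, hη, by rw [proj0_act, toWall, if_pos hv]⟩
    · rwa [toWall, if_neg hv]

/-- The natural morphism `X(α₊, β) → X(α, β)`. -/
def natMor (Y : Fin N → ℤ) (α αp : StrongDual ℝ k) [Nonempty (X k α β)] (x : X k αp β) : X k α β :=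
  Qm k α β (toWall Y (Quotient.out x : level k αp β))

theorem WallCrossing.natMor_Qm (W : WallCrossing k β α αp αm Y) (hK : IsUnimodular k)
    [Nonempty (X k αp β)] {q : HN N} (hq : q ∈ stab k αp β) :
    natMor Y α αp (Qm k αp β q) = Qm k α β (toWall Y q) := by
  unfold natMor
  set p : level k αp β := Quotient.out (Qm k αp β q) with hp
  have h1 : Qm k αp β q = Qm k αp β p := by
    rw [Qm_of_mem_level hK p.2]
    exact (Quotient.out_eq _).symm
  obtain ⟨ζ, hζ, h⟩ := (Qm_eq_iff hK hq (level_subset_stab p.2)).1 h1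
  rw [← h, toWall_act, Qm_act hK hζ (W.toWall_mem_stab hq)]

theorem WallCrossing.isNaturalMorphism (W : WallCrossing k β α αp αm Y) (hK : IsUnimodular k)
    [Nonempty (X k αp β)] :
    IsNaturalMorphism (natMor Y α αp : X k αp β → X k α β) := by
  intro p q
  rw [← Qm_of_mem_level hK p.2, W.natMor_Qm hK (level_subset_stab p.2),
    W.Qm_toWall_eq_iff hK (level_subset_stab p.2)]

theorem Qm_mem_fixedLocus_iff (hK : IsUnimodular k) {H₀ : Subgroup (Fin N → ℂˣ)}
    (hF : ∀ p : HN N, (∀ ζ ∈ H₀, act ζ p = p) ↔ ∀ i, Y i ≠ 0 → p.1 i = 0 ∧ p.2 i = 0) {q : HN N}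
    (hq : q ∈ stab k α β) :
    Qm k α β q ∈ fixedLocus k α β H₀ ↔ ∀ i, Y i ≠ 0 → q.1 i = 0 ∧ q.2 i = 0 := by
  have hact : ∀ (ζ : Fin N → ℂˣ) (p : HN N), (∀ i, Y i ≠ 0 → (act ζ p).1 i = 0 ∧ (act ζ p).2 i = 0) ↔
      ∀ i, Y i ≠ 0 → p.1 i = 0 ∧ p.2 i = 0 := by intro ζ p; simp [act]
  constructor
  · rintro ⟨p, hp, h⟩
    rw [hF] at h
    rw [← Qm_of_mem_level hK p.2, Qm_eq_iff hK hq (level_subset_stab p.2)] at hp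
    obtain ⟨ζ, -, he⟩ := hp
    rw [← he] at h
    exact (hact ζ q).1 h
  · intro h
    obtain ⟨ζ, hζ, hl⟩ := hq
    refine ⟨⟨_, hl⟩, Qm_eq_mk hK hζ hl, ?_⟩
    rw [hF]
    exact (hact ζ q).2 h

theorem WallCrossing.natMor_mem_fixedLocus_iff (W : WallCrossing k β α αp αm Y) (hK : IsUnimodular k)
    [Nonempty (X k αp β)] {H₀ : Subgroup (Fin N → ℂˣ)}
    (hF : ∀ p : HN N, (∀ ζ ∈ H₀, act ζ p = p) ↔ ∀ i, Y i ≠ 0 → p.1 i = 0 ∧ p.2 i = 0) {q : HN N}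
    (hq : q ∈ stab k αp β) :
    natMor Y α αp (Qm k αp β q) ∈ fixedLocus k α β H₀ ↔ YVanish Y q := by
  rw [W.natMor_Qm hK hq, Qm_mem_fixedLocus_iff hK hF (W.toWall_mem_stab hq), toWall]
  split_ifs with h
  · exact ⟨fun _ => h, fun _ i hi => by simp [proj0, hi]⟩
  · refine ⟨fun h0 => absurd (fun i => ⟨fun hi => (h0 i (by simp [hi])).2, fun hi =>
      (h0 i (by simp [hi])).1⟩) h, fun h' => absurd h' h⟩

end ToricHK

namespace ToricHK

/-! ## Complex manifolds presented as quotients of subsets of vector spaces -/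

section HolQuot

variable {d : ℕ} {E G M : Type} [NormedAddCommGroup E] [NormedSpace ℂ E] [NormedAddCommGroup G]
  [NormedSpace ℂ G] [TopologicalSpace M]

/-- A chart of `M` with a holomorphic section `s` through `p` of the map `Q : S → M`, such that the
coordinates of `Q q` are locally holomorphic functions of `q ∈ S`. -/
structure LocalChart (G : Type) [NormedAddCommGroup G] [NormedSpace ℂ G] (S : Set E) (Q : E → M) (p : E) where
  /-- The chart. -/
  e : OpenPartialHomeomorph M G
  /-- The section. -/
  s : G → E
  mem : Q p ∈ e.source
  s_an : ContDiffOn ℂ ω s e.target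
  s_p : s (e (Q p)) = p
  s_mem : ∀ a ∈ e.target, s a ∈ S
  Q_s : ∀ a ∈ e.target, Q (s a) = e.symm a
  loc : ∀ q ∈ S, Q q ∈ e.source → ∃ F : E → G, ContDiffAt ℂ ω F q ∧
    ∀ᶠ q' in 𝓝[S] q, F q' = e (Q q')

variable {S : Set E} {Q : E → M}

/-- A transition map is a local invariant coordinate function composed with a holomorphic section.
-/
theorem LocalChart.contDiffOn_trans {p p' : E} (c : LocalChart G S Q p) (c' : LocalChart G S Q p') :
    ContDiffOn ℂ ω (c'.e ∘ c.e.symm) (c.e.symm ≫ₕ c'.e).source := by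
  intro a ha
  have ha1 : a ∈ c.e.target := ha.1
  have ha2 : c.e.symm a ∈ c'.e.source := ha.2
  have hopen : c.e.target ∈ 𝓝 a := c.e.open_target.mem_nhds ha1
  have hs : ContDiffAt ℂ ω c.s a := (c.s_an a ha1).contDiffAt hopen
  obtain ⟨F, hF, hFe⟩ := c'.loc (c.s a) (c.s_mem a ha1) (by rw [c.Q_s a ha1]; exact ha2)
  have hten : Filter.Tendsto c.s (𝓝 a) (𝓝[S] (c.s a)) :=
    tendsto_nhdsWithin_iff.2 ⟨hs.continuousAt, by filter_upwards [hopen] with b hb using c.s_mem b hb⟩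
  have heq : c'.e ∘ c.e.symm =ᶠ[𝓝 a] F ∘ c.s := by
    filter_upwards [hten.eventually hFe, hopen] with b hb hb'
    simp only [Function.comp_apply]
    rw [hb, c.Q_s b hb']
  exact ((hF.comp a hs).congr_of_eventuallyEq heq).contDiffWithinAt

/-- A local chart given by invariant holomorphic coordinates `F` on `D ∩ S` with a holomorphic
section `s`. -/
def LocalChart.ofInvariant (hQ : Topology.IsQuotientMap (S.domRestrict Q)) {D : Set E} (hD : IsOpen D)
    {T : Set G} (hT : IsOpen T) {F : E → G} {s : G → E} {p : E}
    (hF : ∀ q ∈ D, ContDiffAt ℂ ω F q) (hs : ContDiffOn ℂ ω s T)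
    (hsS : ∀ a ∈ T, s a ∈ S ∧ s a ∈ D ∧ F (s a) = a)
    (hFT : ∀ q ∈ S, q ∈ D → F q ∈ T ∧ Q (s (F q)) = Q q)
    (hinv : ∀ q ∈ S, ∀ q' ∈ S, Q q = Q q' → q ∈ D → q' ∈ D ∧ F q' = F q)
    (hp : p ∈ S) (hpD : p ∈ D) (hsp : s (F p) = p) :
    {c : LocalChart G S Q p // c.s = s ∧ c.e.target = T ∧
      ∀ q ∈ S, (Q q ∈ c.e.source ↔ q ∈ D) ∧ (q ∈ D → c.e (Q q) = F q)} :=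
  have hex : ∀ x : M, ∃ q : S, Q q = x := fun x => by
    obtain ⟨q, hq⟩ := hQ.surjective x; exact ⟨q, hq⟩
  let rep : M → E := fun x => (hex x).choose
  have hrepS : ∀ x, rep x ∈ S := fun x => (hex x).choose.2
  have hrep : ∀ x, Q (rep x) = x := fun x => (hex x).choose_spec
  have hrepD : ∀ q ∈ S, rep (Q q) ∈ D ↔ q ∈ D := fun q hq =>
    ⟨fun h => (hinv _ (hrepS _) _ hq (hrep _) h).1, fun h => (hinv _ hq _ (hrepS _) (hrep _).symm h).1⟩
  have hrepF : ∀ q ∈ S, q ∈ D → F (rep (Q q)) = F q := fun q hq h =>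
    (hinv _ hq _ (hrepS _) (hrep _).symm h).2
  have hopen : IsOpen {x | rep x ∈ D} := by
    rw [← hQ.isOpen_preimage]
    convert hD.preimage continuous_subtype_val using 1
    ext q
    exact hrepD q q.2
  ⟨{
    e :=
      { toFun := fun x => F (rep x)
        invFun := fun a => Q (s a)
        source := {x | rep x ∈ D}
        target := T
        map_source' := fun x hx => (hFT _ (hrepS x) hx).1
        map_target' := fun a ha => (hrepD _ (hsS a ha).1).2 (hsS a ha).2.1
        left_inv' := fun x hx => by rw [(hFT _ (hrepS x) hx).2, hrep]
        right_inv' := fun a ha => by rw [hrepF _ (hsS a ha).1 (hsS a ha).2.1, (hsS a ha).2.2]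
        open_source := hopen
        open_target := hT
        continuousOn_toFun := by
          refine (hQ.continuousOn_isOpen_iff hopen).2 ?_
          intro q hq
          have hqD : (q : E) ∈ D := (hrepD q q.2).1 hq
          have h1 : ContinuousWithinAt (fun q : S => F q) (S.domRestrict Q ⁻¹' {x | rep x ∈ D}) q :=
            ((hF q hqD).continuousAt.comp continuous_subtype_val.continuousAt).continuousWithinAt
          refine h1.congr (fun q' hq' => ?_) ?_
          · exact hrepF q' q'.2 ((hrepD q' q'.2).1 hq')
          · exact hrepF q q.2 hqD
        continuousOn_invFun := by
          have h1 : Continuous (S.domRestrict Q) := hQ.continuous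
          have h2 : ContinuousOn Q S := continuousOn_iff_continuous_domRestrict.2 h1
          exact h2.comp hs.continuousOn fun a ha => (hsS a ha).1 }
    s := s
    mem := (hrepD p hp).2 hpD
    s_an := hs
    s_p := by
      change s (F (rep (Q p))) = p
      rw [hrepF p hp hpD, hsp]
    s_mem := fun a ha => (hsS a ha).1
    Q_s := fun a _ => rfl
    loc := fun q hq hqD => ⟨F, hF q ((hrepD q hq).1 hqD), by
      filter_upwards [self_mem_nhdsWithin, mem_nhdsWithin_of_mem_nhds (hD.mem_nhds ((hrepD q hq).1 hqD))]
        with q' hq' hq'D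
      exact (hrepF q' hq' hq'D).symm⟩ }, rfl, rfl, fun q hq => ⟨hrepD q hq, hrepF q hq⟩⟩

/-- The charted space defined by local charts through all points of `S`. -/
@[reducible] def chartedSpaceOf (lc : ∀ p ∈ S, LocalChart (Fin d → ℂ) S Q p) (hs : ∀ x, ∃ p ∈ S, Q p = x) :
    ChartedSpace (Fin d → ℂ) M where
  atlas := {e | ∃ p hp, e = (lc p hp).e}
  chartAt x := (lc (hs x).choose (hs x).choose_spec.1).e
  mem_chart_source x := by
    exact (congrArg (· ∈ (lc (hs x).choose (hs x).choose_spec.1).e.source)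
      (hs x).choose_spec.2).mp (lc (hs x).choose (hs x).choose_spec.1).mem
  chart_mem_atlas x := ⟨_, _, rfl⟩

/-- `Q : S → M` presents the complex manifold `M` as a quotient of `S`: it is continuous and
surjective, has holomorphic local sections through all points of `S`, and the coordinates of `Q q` are
locally holomorphic functions of `q`. -/
structure IsHolQuot (d : ℕ) (S : Set E) (Q : E → M) [ChartedSpace (Fin d → ℂ) M] : Prop where
  isManifold : IsManifold 𝓘(ℂ, Fin d → ℂ) ω M
  surj : ∀ x, ∃ p ∈ S, Q p = x
  cont : ContinuousOn Q S
  sec : ∀ p ∈ S, ∃ σ : M → E, ContMDiffAt 𝓘(ℂ, Fin d → ℂ) 𝓘(ℂ, E) ω σ (Q p) ∧ σ (Q p) = p ∧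
    ∀ᶠ x in 𝓝 (Q p), σ x ∈ S ∧ Q (σ x) = x
  inv : ∀ p ∈ S, ∃ F : E → (Fin d → ℂ), ContDiffAt ℂ ω F p ∧
    ∀ᶠ q in 𝓝[S] p, F q = chartAt (Fin d → ℂ) (Q p) (Q q)

theorem isHolQuot_chartedSpaceOf (lc : ∀ p ∈ S, LocalChart (Fin d → ℂ) S Q p) (hs : ∀ x, ∃ p ∈ S, Q p = x)
    (hQ : ContinuousOn Q S) :
    let := chartedSpaceOf lc hs
    IsHolQuot d S Q := by
  let := chartedSpaceOf lc hs
  have hman : IsManifold 𝓘(ℂ, Fin d → ℂ) ω M := by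
    refine isManifold_of_contDiffOn _ _ _ ?_
    rintro e e' ⟨p, hp, rfl⟩ ⟨p', hp', rfl⟩
    simpa using (lc p hp).contDiffOn_trans (lc p' hp')
  refine ⟨hman, hs, hQ, fun p hp => ?_, fun p hp => ?_⟩
  · set c := lc p hp
    have hmax : c.e ∈ IsManifold.maximalAtlas 𝓘(ℂ, Fin d → ℂ) ω M :=
      IsManifold.subset_maximalAtlas ⟨p, hp, rfl⟩
    have hte : c.e.target ∈ 𝓝 (c.e (Q p)) := c.e.open_target.mem_nhds (c.e.map_source c.mem)
    have h1 := contMDiffAt_of_mem_maximalAtlas hmax c.mem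
    have h2 : ContMDiffAt 𝓘(ℂ, Fin d → ℂ) 𝓘(ℂ, E) ω c.s (c.e (Q p)) :=
      ((c.s_an _ (c.e.map_source c.mem)).contDiffAt hte).contMDiffAt
    refine ⟨c.s ∘ c.e, h2.comp _ h1, c.s_p, ?_⟩
    filter_upwards [c.e.open_source.mem_nhds c.mem] with x hx
    exact ⟨c.s_mem _ (c.e.map_source hx), by
      simp only [Function.comp_apply]; rw [c.Q_s _ (c.e.map_source hx), c.e.left_inv hx]⟩
  · exact (lc (hs (Q p)).choose (hs (Q p)).choose_spec.1).loc p hp (mem_chart_source _ (Q p))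

variable [ChartedSpace (Fin d → ℂ) M]

theorem IsHolQuot.contMDiffAt_comp (h : IsHolQuot d S Q) {E' H' N' : Type*} [NormedAddCommGroup E']
    [NormedSpace ℂ E'] [TopologicalSpace H'] {I : ModelWithCorners ℂ E' H'} [TopologicalSpace N']
    [ChartedSpace H' N'] {f : N' → E} {x : N'} (hf : ContMDiffAt I 𝓘(ℂ, E) ω f x)
    (hfS : ∀ᶠ y in 𝓝 x, f y ∈ S) : ContMDiffAt I 𝓘(ℂ, Fin d → ℂ) ω (fun y => Q (f y)) x := by
  have hxS : f x ∈ S := hfS.self_of_nhds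
  obtain ⟨F, hF, hFe⟩ := h.inv (f x) hxS
  have hten : Filter.Tendsto f (𝓝 x) (𝓝[S] (f x)) :=
    tendsto_nhdsWithin_iff.2 ⟨hf.continuousAt, hfS⟩
  rw [contMDiffAt_iff_target]
  refine ⟨(h.cont (f x) hxS).tendsto.comp hten, ?_⟩
  have h1 : ContMDiffAt I 𝓘(ℂ, Fin d → ℂ) ω (F ∘ f) x := hF.contMDiffAt.comp x hf
  refine h1.congr_of_eventuallyEq ?_
  filter_upwards [hten.eventually hFe] with y hy
  simpa using hy.symm

/-- Near Q p the map f equals Q' ∘ g ∘ σ, with σ a local holomorphic section of Q. -/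
theorem IsHolQuot.contMDiffAt_lift (h : IsHolQuot d S Q) {d' : ℕ} {E' M' : Type} [NormedAddCommGroup E']
    [NormedSpace ℂ E'] [TopologicalSpace M'] [ChartedSpace (Fin d' → ℂ) M'] {S' : Set E'} {Q' : E' → M'}
    (h' : IsHolQuot d' S' Q') {f : M → M'} {g : E → E'} {p : E} (hp : p ∈ S) (hg : ContDiffAt ℂ ω g p)
    (hfg : ∀ᶠ q in 𝓝[S] p, g q ∈ S' ∧ f (Q q) = Q' (g q)) :
    ContMDiffAt 𝓘(ℂ, Fin d → ℂ) 𝓘(ℂ, Fin d' → ℂ) ω f (Q p) := by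
  obtain ⟨σ, hσ, hσp, hσS⟩ := h.sec p hp
  have hten : Filter.Tendsto σ (𝓝 (Q p)) (𝓝[S] p) := by
    refine tendsto_nhdsWithin_iff.2 ⟨?_, hσS.mono fun x hx => hx.1⟩
    have := hσ.continuousAt.tendsto; rwa [hσp] at this
  have h1 : ContMDiffAt 𝓘(ℂ, Fin d → ℂ) 𝓘(ℂ, E') ω (g ∘ σ) (Q p) :=
    ContMDiffAt.comp (Q p) (by rw [hσp]; exact hg.contMDiffAt) hσ
  have h2 := h'.contMDiffAt_comp h1 ((hten.eventually hfg).mono fun x hx => hx.1)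
  refine h2.congr_of_eventuallyEq ?_
  filter_upwards [hten.eventually hfg, hσS] with x hx hx'
  have := hx.2
  rw [hx'.2] at this
  exact this

/-- Invariant holomorphic functions do not vary in directions that are collapsed by the quotient map. -/
theorem IsHolQuot.mfderiv_invariant (h : IsHolQuot d S Q) {E' H' N' : Type*} [NormedAddCommGroup E']
    [NormedSpace ℂ E'] [TopologicalSpace H'] {I : ModelWithCorners ℂ E' H'} [TopologicalSpace N']
    [ChartedSpace H' N'] {f : N' → E} {x : N'} (hf : ContMDiffAt I 𝓘(ℂ, E) ω f x)
    (hfS : ∀ᶠ y in 𝓝 x, f y ∈ S) {g : E → G} {D : Set E} (hD : IsOpen D) (hx : f x ∈ D)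
    (hg : ContDiffAt ℂ ω g (f x))
    (hinv : ∀ q ∈ S, ∀ q' ∈ S, Q q = Q q' → q ∈ D → q' ∈ D → g q = g q') {u : TangentSpace I x}
    (hu : mfderiv I 𝓘(ℂ, Fin d → ℂ) (fun y => Q (f y)) x u = 0) :
    mfderiv I 𝓘(ℂ, G) (fun y => g (f y)) x u = 0 := by
  have hxS : f x ∈ S := hfS.self_of_nhds
  obtain ⟨σ, hσ, hσp, hσS⟩ := h.sec (f x) hxS
  have hQf := h.contMDiffAt_comp hf hfS
  have hgσ : ContMDiffAt 𝓘(ℂ, Fin d → ℂ) 𝓘(ℂ, G) ω (g ∘ σ) (Q (f x)) :=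
    ContMDiffAt.comp _ (by rw [hσp]; exact hg.contMDiffAt) hσ
  have hσD : ∀ᶠ z in 𝓝 (Q (f x)), σ z ∈ D := hσ.continuousAt.eventually_mem
    (by rw [hσp]; exact hD.mem_nhds hx)
  have heq : (fun y => g (f y)) =ᶠ[𝓝 x] (g ∘ σ) ∘ fun y => Q (f y) := by
    filter_upwards [hfS, hQf.continuousAt.eventually hσS, hQf.continuousAt.eventually hσD,
      hf.continuousAt.eventually_mem (hD.mem_nhds hx)] with y h1 h2 h3 h4
    exact hinv _ h1 _ h2.1 h2.2.symm h4 h3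
  rw [heq.mfderiv_eq, mfderiv_comp x (hgσ.mdifferentiableAt (by simp)) (hQf.mdifferentiableAt (by simp))]
  exact (congrArg (mfderiv 𝓘(ℂ, Fin d → ℂ) 𝓘(ℂ, G) (g ∘ σ) (Q (f x))) hu).trans
    (ContinuousLinearMap.map_zero _)

theorem LocalChart.contMDiffOn_symm (h : IsHolQuot d S Q) {p : E} (c : LocalChart G S Q p) :
    ContMDiffOn 𝓘(ℂ, G) 𝓘(ℂ, Fin d → ℂ) ω c.e.symm c.e.target := by
  intro a ha
  have hte : c.e.target ∈ 𝓝 a := c.e.open_target.mem_nhds ha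
  have h1 := h.contMDiffAt_comp (f := c.s) (x := a) ((c.s_an a ha).contDiffAt hte).contMDiffAt
    (by filter_upwards [hte] with b hb using c.s_mem b hb)
  refine (h1.congr_of_eventuallyEq ?_).contMDiffWithinAt
  filter_upwards [hte] with b hb using (c.Q_s b hb).symm

theorem LocalChart.contMDiffOn (h : IsHolQuot d S Q) {p : E} (c : LocalChart G S Q p) :
    ContMDiffOn 𝓘(ℂ, Fin d → ℂ) 𝓘(ℂ, G) ω c.e c.e.source := by
  intro x hx
  obtain ⟨q, hq, rfl⟩ := h.surj x
  obtain ⟨σ, hσ, hσp, hσS⟩ := h.sec q hq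
  obtain ⟨F, hF, hFe⟩ := c.loc q hq hx
  have hten : Filter.Tendsto σ (𝓝 (Q q)) (𝓝[S] q) := by
    refine tendsto_nhdsWithin_iff.2 ⟨?_, hσS.mono fun x hx => hx.1⟩
    have := hσ.continuousAt.tendsto; rwa [hσp] at this
  have h1 : ContMDiffAt 𝓘(ℂ, Fin d → ℂ) 𝓘(ℂ, G) ω (F ∘ σ) (Q q) :=
    ContMDiffAt.comp (Q q) (by rw [hσp]; exact hF.contMDiffAt) hσ
  refine (h1.congr_of_eventuallyEq ?_).contMDiffWithinAt
  filter_upwards [hten.eventually hFe, hσS] with x hx hx'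
  simp only [Function.comp_apply]
  rw [hx, hx'.2]

end HolQuot

end ToricHK

namespace ToricHK

variable {N : ℕ} {k : Submodule ℝ (Fin N → ℝ)} {β : k →L[ℝ] ℂ} {A : Set (Fin N)}

/-! ## Slices of the action of `K_ℂ` -/

/-- The coordinate `zᵢ` or `wᵢ` of `q`, according to `ε i`. -/
def raw (ε : Fin N → Bool) (q : HN N) (i : Fin N) : ℂ := if ε i then q.1 i else q.2 i

/-- A frame together with the normalization `raw ε q i = c i`, `i ∈ B`, of the points in the orbits of
`K_ℂ`, and the expression of the equation `μ_ℂ = β` in terms of the frame. -/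
structure Gauge (k : Submodule ℝ (Fin N → ℝ)) (β : k →L[ℝ] ℂ) (A : Set (Fin N)) where
  /-- The index set of the frame. -/
  B : Finset (Fin N)
  /-- The frame. -/
  e : Fin N → Fin N → ℤ
  /-- The choice of coordinates. -/
  ε : Fin N → Bool
  /-- The normalized values. -/
  c : Fin N → ℂ
  /-- The values of the moment map on the frame. -/
  b : Fin N → ℂ
  frame : Frame k A B e
  ne : ∀ i ∈ B, c i ≠ 0
  muC_iff : ∀ q : HN N, (∀ l ∉ A, q.1 l = 0 ∧ q.2 l = 0) →
    (muC k q = β ↔ ∀ i ∈ B, ∑ l, q.1 l * q.2 l * (e i l : ℂ) = b i)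

theorem muC_eq_muC_iff {B : Finset (Fin N)} {e : Fin N → Fin N → ℤ} (hB : Frame k A B e) {p q : HN N}
    (hp : ∀ l ∉ A, p.1 l = 0 ∧ p.2 l = 0) (hq : ∀ l ∉ A, q.1 l = 0 ∧ q.2 l = 0) :
    muC k q = muC k p ↔
      ∀ i ∈ B, ∑ l, q.1 l * q.2 l * (e i l : ℂ) = ∑ l, p.1 l * p.2 l * (e i l : ℂ) := by
  constructor
  · intro h i hi
    have := DFunLike.congr_fun h (⟨_, hB.mem i hi⟩ : k)
    rw [muC_apply, muC_apply] at this
    simpa using mul_left_cancel₀ two_pi_I_ne_zero this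
  · intro h
    ext x
    rw [muC_apply, muC_apply]
    congr 1
    have key : ∀ r : HN N, (∀ l ∉ A, r.1 l = 0 ∧ r.2 l = 0) →
        ∑ l, r.1 l * r.2 l * (((x : Fin N → ℝ) l : ℝ) : ℂ) =
          ∑ i ∈ B, ((x : Fin N → ℝ) i : ℂ) * ∑ l, r.1 l * r.2 l * (e i l : ℂ) := by
      intro r hr
      simp only [Finset.mul_sum]
      rw [Finset.sum_comm]
      refine Finset.sum_congr rfl fun l _ => ?_
      by_cases hl : l ∈ A
      · rw [hB.expand x.2 hl]
        push_cast
        rw [Finset.mul_sum]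
        exact Finset.sum_congr rfl fun i _ => by ring
      · simp [(hr l hl).1]
    rw [key q hq, key p hp]
    exact Finset.sum_congr rfl fun i hi => by rw [h i hi]

/-- The gauge normalizing to the coordinates of `p`. -/
def Gauge.ofPoint {B : Finset (Fin N)} {e : Fin N → Fin N → ℤ} (hB : Frame k A B e) (ε : Fin N → Bool)
    {p : HN N} (hp : p ∈ fiberOn k β A) (hne : ∀ i ∈ B, raw ε p i ≠ 0) : Gauge k β A where
  B := B
  e := e
  ε := ε
  c := raw ε p
  b i := ∑ l, p.1 l * p.2 l * (e i l : ℂ)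
  frame := hB
  ne := hne
  muC_iff q hq := by rw [← hp.1]; exact muC_eq_muC_iff hB hp.2 hq

namespace Gauge

variable (G : Gauge k β A)

/-- The points with non-zero normalized coordinates. -/
def dom : Set (HN N) := {q | ∀ i ∈ G.B, raw G.ε q i ≠ 0}

/-- The factor by which the `i`-th coordinate has to be multiplied. -/
def fac (q : HN N) (i : Fin N) : ℂ := if G.ε i then G.c i / q.1 i else q.2 i / G.c i

/-- The element of `K_ℂ` that normalizes `q`. -/
def gam (q : HN N) (l : Fin N) : ℂ := ∏ i ∈ G.B, G.fac q i ^ G.e i l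

/-- The normalization of `q`. -/
def nrm (q : HN N) : HN N := (fun l => q.1 l * G.gam q l, fun l => q.2 l * (G.gam q l)⁻¹)

/-- The point of the slice with the free coordinates of `a`. -/
def slc (a : HN N) : HN N :=
  (fun l => if l ∈ G.B then if G.ε l then G.c l else
      (G.b l - ∑ j ∈ G.Bᶜ, a.1 j * a.2 j * (G.e l j : ℂ)) / G.c l else a.1 l,
   fun l => if l ∈ G.B then if G.ε l then
      (G.b l - ∑ j ∈ G.Bᶜ, a.1 j * a.2 j * (G.e l j : ℂ)) / G.c l else G.c l else a.2 l)

variable {G}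

theorem isOpen_dom : IsOpen G.dom := by
  have : G.dom = ⋂ i ∈ G.B, {q | raw G.ε q i ≠ 0} := by ext; simp [dom]
  rw [this]
  refine isOpen_biInter_finset fun i _ => ?_
  unfold raw
  by_cases h : G.ε i = true
  · simp only [h, if_true]; exact isOpen_ne_fun (by fun_prop) continuous_const
  · simp only [h, Bool.false_eq_true, if_false]; exact isOpen_ne_fun (by fun_prop) continuous_const

theorem fac_ne {q : HN N} (hq : q ∈ G.dom) {i : Fin N} (hi : i ∈ G.B) : G.fac q i ≠ 0 := by
  have h1 := hq i hi
  have h2 := G.ne i hi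
  unfold fac; unfold raw at h1
  split_ifs at h1 ⊢
  · exact div_ne_zero h2 h1
  · exact div_ne_zero h1 h2

theorem gam_ne {q : HN N} (hq : q ∈ G.dom) (l : Fin N) : G.gam q l ≠ 0 :=
  Finset.prod_ne_zero_iff.2 fun _ hi => zpow_ne_zero _ (fac_ne hq hi)

theorem gam_of_mem (q : HN N) {j : Fin N} (hj : j ∈ G.B) : G.gam q j = G.fac q j := by
  unfold gam
  rw [Finset.prod_eq_single j]
  · simp [G.frame.dual j hj j hj]
  · intro i hi hij; simp [G.frame.dual i hi j hj, hij]
  · intro h; exact absurd hj h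

theorem exists_nrm_eq_act {q : HN N} (hq : q ∈ G.dom) :
    ∃ ζ ∈ complexSubtorus k, (∀ l, (ζ l : ℂ) = G.gam q l) ∧ G.nrm q = act ζ q := by
  obtain ⟨ζ, hζ, h⟩ := G.frame.exists_monomial (G.fac q) fun i hi => fac_ne hq hi
  refine ⟨ζ, hζ, h, ?_⟩
  ext l
  · simp only [nrm, act, h]; rfl
  · simp only [nrm, act, Units.val_inv_eq_inv_val, h]; rfl

theorem raw_nrm {q : HN N} (hq : q ∈ G.dom) {i : Fin N} (hi : i ∈ G.B) :
    raw G.ε (G.nrm q) i = G.c i := by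
  have h1 := hq i hi
  have h2 := G.ne i hi
  unfold raw nrm
  simp only []
  rw [gam_of_mem q hi]
  unfold fac; unfold raw at h1
  split_ifs at h1 ⊢
  · field_simp
  · field_simp

theorem nrm_eq_self {q : HN N} (hq : ∀ i ∈ G.B, raw G.ε q i = G.c i) : G.nrm q = q := by
  have : ∀ l, G.gam q l = 1 := by
    intro l
    refine Finset.prod_eq_one fun i hi => ?_
    have h1 := hq i hi
    have h2 := G.ne i hi
    have : G.fac q i = 1 := by
      unfold fac; unfold raw at h1
      split_ifs at h1 ⊢
      · rw [h1, div_self h2]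
      · rw [h1, div_self h2]
    rw [this, one_zpow]
  ext l <;> simp [nrm, this]

theorem act_mem_dom {q : HN N} (ζ : Fin N → ℂˣ) : act ζ q ∈ G.dom ↔ q ∈ G.dom := by
  refine forall₂_congr fun i _ => ?_
  unfold raw
  split_ifs <;> simp [act]

/-- On A an element of K_ℂ is the monomial of its own coordinates in B, and `fac` changes by exactly
the inverses of these. -/
theorem gam_act {ζ : Fin N → ℂˣ} (hζ : ζ ∈ complexSubtorus k) (q : HN N) {l : Fin N} (hl : l ∈ A) :
    G.gam (act ζ q) l * ζ l = G.gam q l := by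
  rw [G.frame.torus_expand hζ hl]
  unfold gam
  rw [← Finset.prod_mul_distrib]
  refine Finset.prod_congr rfl fun i _ => ?_
  rw [← mul_zpow]
  congr 1
  have := (ζ i).ne_zero
  unfold fac
  split_ifs <;> simp [act] <;> field_simp

theorem nrm_act {ζ : Fin N → ℂˣ} (hζ : ζ ∈ complexSubtorus k) {q : HN N}
    (hA : ∀ l ∉ A, q.1 l = 0 ∧ q.2 l = 0) : G.nrm (act ζ q) = G.nrm q := by
  ext l
  · by_cases hl : l ∈ A
    · simp only [nrm]; rw [← gam_act hζ q hl]; simp only [act]; ring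
    · simp [nrm, act, hA l hl]
  · by_cases hl : l ∈ A
    · simp only [nrm]; rw [← gam_act hζ q hl]; simp only [act, Units.val_inv_eq_inv_val, mul_inv]; ring
    · simp [nrm, act, hA l hl]

theorem slc_of_notMem (a : HN N) {l : Fin N} (hl : l ∉ G.B) :
    (G.slc a).1 l = a.1 l ∧ (G.slc a).2 l = a.2 l := by simp [slc, hl]

theorem raw_slc (a : HN N) {i : Fin N} (hi : i ∈ G.B) : raw G.ε (G.slc a) i = G.c i := by
  unfold raw slc
  by_cases h : G.ε i = true <;> simp [h, hi]

theorem slc_mem_dom (a : HN N) : G.slc a ∈ G.dom := fun i hi => by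
  rw [raw_slc a hi]; exact G.ne i hi

theorem nrm_slc (a : HN N) : G.nrm (G.slc a) = G.slc a := nrm_eq_self fun _ hi => raw_slc a hi

theorem slc_mul (a : HN N) {i : Fin N} (hi : i ∈ G.B) : (G.slc a).1 i * (G.slc a).2 i =
    G.b i - ∑ j ∈ G.Bᶜ, a.1 j * a.2 j * (G.e i j : ℂ) := by
  have := G.ne i hi
  unfold slc
  by_cases h : G.ε i = true
  · simp only [h, hi, if_true]; field_simp
  · simp only [h, hi, if_true, Bool.false_eq_true, if_false]; field_simp

/-- By duality the equation of the i-th frame vector involves no other index of B, so it can be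
solved for the partner of the i-th normalized coordinate. -/
theorem sum_frame (q : HN N) {i : Fin N} (hi : i ∈ G.B) : ∑ l, q.1 l * q.2 l * (G.e i l : ℂ) =
    q.1 i * q.2 i + ∑ j ∈ G.Bᶜ, q.1 j * q.2 j * (G.e i j : ℂ) := by
  rw [← Finset.sum_add_sum_compl G.B]
  congr 1
  rw [Finset.sum_eq_single i]
  · simp [G.frame.dual i hi i hi]
  · intro j hj hij; simp [G.frame.dual i hi j hj, hij.symm]
  · intro h; exact absurd hi h

theorem muC_slc {a : HN N} (ha : ∀ l ∉ A, a.1 l = 0 ∧ a.2 l = 0) : G.slc a ∈ fiberOn k β A := by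
  have h : ∀ l ∉ A, (G.slc a).1 l = 0 ∧ (G.slc a).2 l = 0 := by
    intro l hl
    rw [(slc_of_notMem a fun h => hl (G.frame.sub l h)).1, (slc_of_notMem a fun h => hl (G.frame.sub l h)).2]
    exact ha l hl
  refine ⟨(G.muC_iff _ h).2 fun i hi => ?_, h⟩
  rw [sum_frame _ hi, slc_mul a hi]
  have : ∑ j ∈ G.Bᶜ, (G.slc a).1 j * (G.slc a).2 j * (G.e i j : ℂ) =
      ∑ j ∈ G.Bᶜ, a.1 j * a.2 j * (G.e i j : ℂ) := Finset.sum_congr rfl fun j hj => by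
    rw [Finset.mem_compl] at hj
    rw [(slc_of_notMem a hj).1, (slc_of_notMem a hj).2]
  rw [this]; ring

/-- Normalized and free coordinates determine a point of the fibre, since the moment equations give
the partners of the normalized ones. -/
theorem slc_eq_self {q a : HN N} (hq : q ∈ fiberOn k β A) (hc : ∀ i ∈ G.B, raw G.ε q i = G.c i)
    (ha : ∀ l ∉ G.B, a.1 l = q.1 l ∧ a.2 l = q.2 l) : G.slc a = q := by
  have hm : ∀ i ∈ G.B, G.b i - ∑ j ∈ G.Bᶜ, a.1 j * a.2 j * (G.e i j : ℂ) = q.1 i * q.2 i := by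
    intro i hi
    have h1 := (G.muC_iff q hq.2).1 hq.1 i hi
    rw [sum_frame _ hi] at h1
    rw [← h1]
    have : ∑ j ∈ G.Bᶜ, a.1 j * a.2 j * (G.e i j : ℂ) = ∑ j ∈ G.Bᶜ, q.1 j * q.2 j * (G.e i j : ℂ) :=
      Finset.sum_congr rfl fun j hj => by
        rw [Finset.mem_compl] at hj
        rw [(ha j hj).1, (ha j hj).2]
    rw [this]; ring
  ext l
  · by_cases hl : l ∈ G.B
    · have h1 := hc l hl
      have h2 := G.ne l hl
      have h3 := hm l hl
      unfold raw at h1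
      simp only [slc, hl, if_true, h3]
      split_ifs at h1 ⊢
      · exact h1.symm
      · rw [← h1] at h2 ⊢; field_simp
    · rw [(slc_of_notMem a hl).1, (ha l hl).1]
  · by_cases hl : l ∈ G.B
    · have h1 := hc l hl
      have h2 := G.ne l hl
      have h3 := hm l hl
      unfold raw at h1
      simp only [slc, hl, if_true, h3]
      split_ifs at h1 ⊢
      · rw [← h1] at h2 ⊢; field_simp
      · exact h1.symm
    · rw [(slc_of_notMem a hl).2, (ha l hl).2]

theorem contDiff_slc : ContDiff ℂ ω G.slc := by
  refine ContDiff.prodMk (contDiff_pi.2 fun l => ?_) (contDiff_pi.2 fun l => ?_) <;>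
  · by_cases hl : l ∈ G.B
    · by_cases h : G.ε l = true
      · simp only [hl, h, if_true]; fun_prop
      · simp only [hl, h, if_true, Bool.false_eq_true, if_false]; fun_prop
    · simp only [hl, if_false]; fun_prop

theorem contDiffAt_fac {q : HN N} (hq : q ∈ G.dom) {i : Fin N} (hi : i ∈ G.B) :
    ContDiffAt ℂ ω (fun q => G.fac q i) q := by
  have h1 := hq i hi
  unfold fac; unfold raw at h1
  by_cases h : G.ε i = true
  · simp only [h, if_true] at h1 ⊢
    exact ContDiffAt.div (by fun_prop) (by fun_prop) h1
  · simp only [h, Bool.false_eq_true, if_false] at h1 ⊢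
    simp only [div_eq_mul_inv]; fun_prop

theorem contDiffAt_gam {q : HN N} (hq : q ∈ G.dom) (l : Fin N) : ContDiffAt ℂ ω (fun q => G.gam q l) q := by
  refine contDiffAt_prod fun i hi => ?_
  exact ((contDiffAt_fac hq hi).analyticAt.zpow (n := G.e i l) (fac_ne hq hi)).contDiffAt

theorem contDiffAt_nrm {q : HN N} (hq : q ∈ G.dom) : ContDiffAt ℂ ω G.nrm q := by
  refine ContDiffAt.prodMk (contDiffAt_pi.2 fun l => ?_) (contDiffAt_pi.2 fun l => ?_)
  · exact ContDiffAt.mul (by fun_prop) (contDiffAt_gam hq l)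
  · exact ContDiffAt.mul (by fun_prop) ((contDiffAt_gam hq l).inv (gam_ne hq l))

end Gauge

/-! ## Local charts of the quotients by `K_ℂ` -/

/-- Linear coordinates for the free coordinates `zₗ`, `wₗ`, `l ∈ A \ B`. -/
structure Slots (A : Set (Fin N)) (B : Finset (Fin N)) (F : Type) [NormedAddCommGroup F]
    [NormedSpace ℂ F] where
  /-- The coordinates of a point. -/
  κ : HN N →L[ℂ] F
  /-- The point with given coordinates. -/
  ρ : F →L[ℂ] HN N
  κ_ρ : ∀ a, κ (ρ a) = a
  ρ_κ : ∀ q l, l ∈ A → l ∉ B → (ρ (κ q)).1 l = q.1 l ∧ (ρ (κ q)).2 l = q.2 l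
  ρ_zero : ∀ a l, l ∉ A ∨ l ∈ B → (ρ a).1 l = 0 ∧ (ρ a).2 l = 0

variable {F : Type} [NormedAddCommGroup F] [NormedSpace ℂ F] {B : Finset (Fin N)}

theorem Slots.κ_congr (sl : Slots A B F) {q q' : HN N}
    (h : ∀ l ∈ A, l ∉ B → q.1 l = q'.1 l ∧ q.2 l = q'.2 l) : sl.κ q = sl.κ q' := by
  have : sl.ρ (sl.κ q) = sl.ρ (sl.κ q') := by
    ext l <;> by_cases hl : l ∈ A ∧ l ∉ B
    · rw [(sl.ρ_κ q l hl.1 hl.2).1, (sl.ρ_κ q' l hl.1 hl.2).1, (h l hl.1 hl.2).1]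
    · have : l ∉ A ∨ l ∈ B := by tauto
      rw [(sl.ρ_zero _ l this).1, (sl.ρ_zero _ l this).1]
    · rw [(sl.ρ_κ q l hl.1 hl.2).2, (sl.ρ_κ q' l hl.1 hl.2).2, (h l hl.1 hl.2).2]
    · have : l ∉ A ∨ l ∈ B := by tauto
      rw [(sl.ρ_zero _ l this).2, (sl.ρ_zero _ l this).2]
  rw [← sl.κ_ρ (sl.κ q), this, sl.κ_ρ]

/-- `Q : S → M` is the quotient of an open invariant part `S` of `{μ_ℂ = β}`, in the coordinate subspace
given by `A`, by the action of `K_ℂ`. -/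
structure TorusQuot {M : Type} [TopologicalSpace M] (k : Submodule ℝ (Fin N → ℝ)) (β : k →L[ℝ] ℂ)
    (A : Set (Fin N)) (S : Set (HN N)) (Q : HN N → M) : Prop where
  sub : S ⊆ fiberOn k β A
  isOpen : ∀ q ∈ S, ∀ᶠ q' in 𝓝[fiberOn k β A] q, q' ∈ S
  act_mem : ∀ ζ ∈ complexSubtorus k, ∀ q ∈ S, act ζ q ∈ S
  eq_iff : ∀ q ∈ S, ∀ q' ∈ S, Q q = Q q' ↔ ∃ ζ ∈ complexSubtorus k, act ζ q = q'
  quot : Topology.IsQuotientMap (S.domRestrict Q)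

variable {M : Type} [TopologicalSpace M] {S : Set (HN N)} {Q : HN N → M}

theorem TorusQuot.Q_act (hS : TorusQuot k β A S Q) {ζ : Fin N → ℂˣ} (hζ : ζ ∈ complexSubtorus k)
    {q : HN N} (hq : q ∈ S) : Q (act ζ q) = Q q :=
  ((hS.eq_iff q hq _ (hS.act_mem ζ hζ q hq)).2 ⟨ζ, hζ, rfl⟩).symm

theorem TorusQuot.Q_nrm (hS : TorusQuot k β A S Q) (G : Gauge k β A) {q : HN N} (hq : q ∈ S)
    (hd : q ∈ G.dom) : G.nrm q ∈ S ∧ Q (G.nrm q) = Q q := by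
  obtain ⟨ζ, hζ, -, h⟩ := Gauge.exists_nrm_eq_act hd
  rw [h]
  exact ⟨hS.act_mem ζ hζ q hq, hS.Q_act hζ hq⟩

theorem Gauge.slc_nrm (G : Gauge k β A) (sl : Slots A G.B F) {q : HN N} (hq : q ∈ fiberOn k β A)
    (hd : q ∈ G.dom) : G.slc (sl.ρ (sl.κ (G.nrm q))) = G.nrm q := by
  have hf : G.nrm q ∈ fiberOn k β A := by
    obtain ⟨ζ, hζ, -, h⟩ := Gauge.exists_nrm_eq_act hd
    rw [h]; exact act_mem_fiberOn ζ hq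
  refine Gauge.slc_eq_self hf (fun i hi => Gauge.raw_nrm hd hi) fun l hl => ?_
  by_cases hA : l ∈ A
  · exact sl.ρ_κ _ l hA hl
  · rw [(sl.ρ_zero _ l (Or.inl hA)).1, (sl.ρ_zero _ l (Or.inl hA)).2, (hf.2 l hA).1, (hf.2 l hA).2]
    exact ⟨rfl, rfl⟩

theorem Gauge.κ_slc (G : Gauge k β A) (sl : Slots A G.B F) (a : F) : sl.κ (G.slc (sl.ρ a)) = a := by
  rw [sl.κ_congr (q' := sl.ρ a), sl.κ_ρ]
  exact fun l _ hl => Gauge.slc_of_notMem _ hl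

theorem Gauge.slc_ρ_mem (G : Gauge k β A) (sl : Slots A G.B F) (a : F) :
    G.slc (sl.ρ a) ∈ fiberOn k β A :=
  Gauge.muC_slc fun l hl => sl.ρ_zero a l (Or.inl hl)

theorem TorusQuot.isOpen_slc (hS : TorusQuot k β A S Q) (G : Gauge k β A) (sl : Slots A G.B F) :
    IsOpen {a | G.slc (sl.ρ a) ∈ S} := by
  rw [isOpen_iff_mem_nhds]
  intro a ha
  have hcont : Filter.Tendsto (fun a => G.slc (sl.ρ a)) (𝓝 a) (𝓝[fiberOn k β A] (G.slc (sl.ρ a))) :=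
    tendsto_nhdsWithin_iff.2 ⟨(Gauge.contDiff_slc.continuous.comp sl.ρ.continuous).continuousAt,
      Filter.Eventually.of_forall fun a => G.slc_ρ_mem sl a⟩
  exact hcont.eventually (hS.isOpen _ ha)

/-- The local chart of `M` defined by a gauge. -/
def TorusQuot.chart (hS : TorusQuot k β A S Q) (G : Gauge k β A) (sl : Slots A G.B F) {p : HN N}
    (hp : p ∈ S) (hc : ∀ i ∈ G.B, raw G.ε p i = G.c i) :
    {c : LocalChart F S Q p // c.s = (fun a => G.slc (sl.ρ a)) ∧
      c.e.target = {a | G.slc (sl.ρ a) ∈ S} ∧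
      ∀ q ∈ S, (Q q ∈ c.e.source ↔ q ∈ G.dom) ∧ (q ∈ G.dom → c.e (Q q) = sl.κ (G.nrm q))} := by
  refine LocalChart.ofInvariant (F := fun q => sl.κ (G.nrm q)) hS.quot Gauge.isOpen_dom
    (hS.isOpen_slc G sl) (fun q hq => ?_) ?_ (fun a ha => ⟨ha, Gauge.slc_mem_dom _, ?_⟩)
    (fun q hq hd => ?_) (fun q hq q' hq' h hd => ?_) hp (fun i hi => by rw [hc i hi]; exact G.ne i hi) ?_
  · exact sl.κ.contDiff.contDiffAt.comp q (Gauge.contDiffAt_nrm hq)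
  · exact (Gauge.contDiff_slc.comp sl.ρ.contDiff).contDiffOn
  · rw [Gauge.nrm_slc, G.κ_slc]
  · simp only [Set.mem_ofPred_eq]
    rw [G.slc_nrm sl (hS.sub hq) hd]
    exact hS.Q_nrm G hq hd
  · obtain ⟨ζ, hζ, rfl⟩ := (hS.eq_iff q hq q' hq').1 h
    refine ⟨(Gauge.act_mem_dom ζ).2 hd, ?_⟩
    rw [Gauge.nrm_act hζ (hS.sub hq).2]
  · have : p ∈ G.dom := fun i hi => by rw [hc i hi]; exact G.ne i hi
    rw [G.slc_nrm sl (hS.sub hp) this, Gauge.nrm_eq_self hc]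

end ToricHK

namespace ToricHK

variable {N : ℕ} {k : Submodule ℝ (Fin N → ℝ)} {α αp αm : StrongDual ℝ k} {β : k →L[ℝ] ℂ}
  {A : Set (Fin N)} {B : Finset (Fin N)} {Y : Fin N → ℤ}

/-! ## Coordinates on the slices -/

/-- The coordinate `zᵢ` or `wᵢ` as a linear form. -/
def coordL (s : Fin N × Bool) : HN N →L[ℂ] ℂ :=
  if s.2 then (ContinuousLinearMap.proj s.1).comp (ContinuousLinearMap.fst ℂ _ _)
  else (ContinuousLinearMap.proj s.1).comp (ContinuousLinearMap.snd ℂ _ _)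

theorem coordL_true (i : Fin N) (q : HN N) : coordL (i, true) q = q.1 i := rfl

theorem coordL_false (i : Fin N) (q : HN N) : coordL (i, false) q = q.2 i := rfl

open Classical in
/-- The coordinates on the slice given by an enumeration of the free coordinates. -/
def Slots.ofEquiv {ι : Type} [Fintype ι] (θ : ι ≃ {s : Fin N × Bool // s.1 ∈ A ∧ s.1 ∉ B}) :
    Slots A B (ι → ℂ) where
  κ := ContinuousLinearMap.pi fun j => coordL (θ j)
  ρ := (ContinuousLinearMap.pi fun l => if h : l ∈ A ∧ l ∉ B then
      ContinuousLinearMap.proj (θ.symm ⟨(l, true), h⟩) else 0).prod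
    (ContinuousLinearMap.pi fun l => if h : l ∈ A ∧ l ∉ B then
      ContinuousLinearMap.proj (θ.symm ⟨(l, false), h⟩) else 0)
  κ_ρ a := by
    funext j
    obtain ⟨⟨⟨l, b⟩, hl⟩, rfl⟩ := θ.symm.surjective j
    cases b
    · simp [coordL_false, hl.1, show l ∉ B from hl.2]
    · simp [coordL_true, hl.1, show l ∉ B from hl.2]
  ρ_κ q l hA hB := by
    simp [hA, hB, coordL_false, coordL_true]
  ρ_zero a l h := by
    have : ¬ (l ∈ A ∧ l ∉ B) := by tauto
    simp [this]

/-- Transport of coordinates along a linear isomorphism. -/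
def Slots.map {F F' : Type} [NormedAddCommGroup F] [NormedSpace ℂ F] [NormedAddCommGroup F']
    [NormedSpace ℂ F'] (sl : Slots A B F) (L : F ≃L[ℂ] F') : Slots A B F' where
  κ := (L : F →L[ℂ] F').comp sl.κ
  ρ := sl.ρ.comp (L.symm : F' →L[ℂ] F)
  κ_ρ a := by simp [sl.κ_ρ]
  ρ_κ q l hA hB := by simpa using sl.ρ_κ q l hA hB
  ρ_zero a l h := by simpa using sl.ρ_zero (L.symm a) l h

/-- Each index of A outside B contributes the two coordinates z and w; with #B = dim k and A
everything, this is dimension 2n. -/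
theorem card_slots (hB : ∀ i ∈ B, i ∈ A) :
    Nat.card {s : Fin N × Bool // s.1 ∈ A ∧ s.1 ∉ B} + 2 * B.card = 2 * A.ncard := by
  classical
  rw [Nat.card_eq_fintype_card, Fintype.card_subtype, Set.ncard_eq_toFinset_card']
  have : (Finset.univ.filter fun s : Fin N × Bool => s.1 ∈ A ∧ s.1 ∉ B) =
      (A.toFinset \ B) ×ˢ Finset.univ := by
    ext s; simp
  rw [this, Finset.card_product]
  have h2 := Finset.card_sdiff_add_card_eq_card (s := B) (t := A.toFinset)
    (fun i hi => by simpa using hB i hi)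
  simp only [Finset.card_univ, Fintype.card_bool]
  omega

theorem ncard_eq_zero_add_card_ne (Y : Fin N → ℤ) :
    {i | Y i = 0}.ncard + (Finset.univ.filter fun i => Y i ≠ 0).card = N := by
  have h3 := Finset.card_filter_add_card_filter_not (s := (Finset.univ : Finset (Fin N))) (fun i => Y i = 0)
  rw [Finset.card_univ, Fintype.card_fin] at h3
  rw [Set.ncard_eq_toFinset_card']
  convert h3 using 2
  congr 1; ext; simp

/-! ## The toric hyperkähler varieties and the fixed loci as quotients by `K_ℂ` -/

theorem exists_gauge (hK : IsUnimodular k) {p : HN N} (hp : p ∈ fiberOn k β A)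
    (hreg : ∀ x ∈ k, (∀ i ∈ coordSupp p, x i = 0) → ∀ l ∈ A, x l = 0) :
    ∃ G : Gauge k β A, ∀ i ∈ G.B, raw G.ε p i = G.c i := by
  classical
  obtain ⟨B, e, hB, -, hBT⟩ := exists_frame hK (A := A) (T := coordSupp p) (B₀ := ∅)
    (coordSupp_subset_of_mem_fiberOn hp) hreg (Set.empty_subset _) (linearIndepOn_empty ℝ _)
  refine ⟨Gauge.ofPoint hB (fun i => decide (p.1 i ≠ 0)) hp fun i hi => ?_, fun i hi => rfl⟩
  have h := hBT hi
  unfold raw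
  by_cases h1 : p.1 i = 0
  · rcases h with h | h
    · exact absurd h1 h
    · simpa [h1] using h
  · simp [h1]

theorem Frame.card_univ {e : Fin N → Fin N → ℤ} (hB : Frame k Set.univ B e) :
    B.card = Module.finrank ℝ k := by
  have := hB.card_add (m := 0) ⊥ (fun x => ?_) (by simp)
  · simpa using this
  · simp only [Submodule.mem_bot, Set.mem_univ, forall_true_left]
    exact ⟨fun h => by rw [h]; exact ⟨k.zero_mem, fun _ => rfl⟩, fun h => funext h.2⟩

theorem torusQuot_X (hK : IsUnimodular k) [Nonempty (X k α β)]
    (hfree : ∀ q ∈ stab k α β, ∀ x : k, (∀ i ∈ coordSupp q, (x : Fin N → ℝ) i = 0) → x = 0) :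
    TorusQuot k β Set.univ (stab k α β) (Qm k α β) := by
  have hsub : stab k α β ⊆ fiberOn k β Set.univ := fun q hq =>
    ⟨muC_of_mem_stab hq, fun l hl => absurd (Set.mem_univ l) hl⟩
  have hreg : ∀ q ∈ stab k α β, ∀ x ∈ k, (∀ i ∈ coordSupp q, x i = 0) → ∀ l ∈ Set.univ, x l = 0 := by
    intro q hq x hx h l _
    exact congrFun (congrArg Subtype.val (hfree q hq ⟨x, hx⟩ h)) l
  refine ⟨hsub, fun q hq => (tendsto_Qm hK hq (hreg q hq)).1, fun ζ hζ q hq => act_mem_stab hζ hq,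
    fun q hq q' hq' => Qm_eq_iff hK hq hq', ?_⟩
  have hc : ContinuousOn (Qm k α β) (stab k α β) := fun q hq =>
    (tendsto_Qm hK hq (hreg q hq)).2.mono_left (nhdsWithin_mono _ hsub)
  -- On the level set `Qm` is the orbit map, already a quotient map; hence so is the continuous
  -- extension to the stable set.
  refine Topology.IsQuotientMap.of_comp (f := Set.inclusion (level_subset_stab (k := k) (α := α) (β := β)))
    (continuous_inclusion _) (continuousOn_iff_continuous_domRestrict.1 hc) ?_
  convert (isOpenQuotientMap_mk (k := k) (α := α) (β := β)).isQuotientMap using 1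
  funext p
  exact Qm_of_mem_level hK p.2

open Classical in
/-- The map to the fixed locus. -/
def Qfix (α : StrongDual ℝ k) (β : k →L[ℝ] ℂ) (H₀ : Subgroup (Fin N → ℂˣ)) [Nonempty (X k α β)]
    [Nonempty (fixedLocus k α β H₀)] (q : HN N) : fixedLocus k α β H₀ :=
  if h : Qm k α β q ∈ fixedLocus k α β H₀ then ⟨_, h⟩ else Classical.arbitrary _

/-- The points over the fixed locus with closed `K_ℂ`-orbit. -/
def stabFix (k : Submodule ℝ (Fin N → ℝ)) (α : StrongDual ℝ k) (β : k →L[ℝ] ℂ) (Y : Fin N → ℤ) :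
    Set (HN N) :=
  {q | q ∈ stab k α β ∧ ∀ i, Y i ≠ 0 → q.1 i = 0 ∧ q.2 i = 0}

theorem coe_Qfix (hK : IsUnimodular k) {H₀ : Subgroup (Fin N → ℂˣ)} [Nonempty (X k α β)]
    [Nonempty (fixedLocus k α β H₀)]
    (hF : ∀ p : HN N, (∀ ζ ∈ H₀, act ζ p = p) ↔ ∀ i, Y i ≠ 0 → p.1 i = 0 ∧ p.2 i = 0) {q : HN N}
    (hq : q ∈ stabFix k α β Y) : (Qfix α β H₀ q : X k α β) = Qm k α β q := by
  rw [Qfix, dif_pos ((Qm_mem_fixedLocus_iff hK hF hq.1).2 hq.2)]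

theorem WallCrossing.stabFix_reg (W : WallCrossing k β α αp αm Y) {q : HN N} (hq : q ∈ stabFix k α β Y) :
    ∀ x ∈ k, (∀ i ∈ coordSupp q, x i = 0) → ∀ l ∈ {i | Y i = 0}, x l = 0 := by
  intro x hx h l hl
  obtain ⟨c, hc⟩ := W.coordSupp_det hq.1 hq.2 ⟨x, hx⟩ h
  have := congrFun (congrArg Subtype.val hc) l
  simp only [Set.mem_ofPred_eq] at hl
  simpa [hl] using this

theorem stabFix_subset : stabFix k α β Y ⊆ fiberOn k β {i | Y i = 0} := fun _ hq =>
  ⟨muC_of_mem_stab hq.1, fun l hl => hq.2 l hl⟩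

theorem WallCrossing.torusQuot_fix (W : WallCrossing k β α αp αm Y) (hK : IsUnimodular k)
    {H₀ : Subgroup (Fin N → ℂˣ)} [Nonempty (X k α β)] [Nonempty (fixedLocus k α β H₀)]
    (hF : ∀ p : HN N, (∀ ζ ∈ H₀, act ζ p = p) ↔ ∀ i, Y i ≠ 0 → p.1 i = 0 ∧ p.2 i = 0) :
    TorusQuot k β {i | Y i = 0} (stabFix k α β Y) (Qfix α β H₀) := by
  refine ⟨stabFix_subset, fun q hq => ?_, fun ζ hζ q hq => ⟨act_mem_stab hζ hq.1, fun i hi => ?_⟩,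
    fun q hq q' hq' => ?_, ?_⟩
  · filter_upwards [(tendsto_Qm hK hq.1 (W.stabFix_reg hq)).1, self_mem_nhdsWithin] with q' h1 h2
    exact ⟨h1, fun i hi => h2.2 i hi⟩
  · simp [act, hq.2 i hi]
  · rw [← Subtype.coe_inj, coe_Qfix hK hF hq, coe_Qfix hK hF hq', Qm_eq_iff hK hq.1 hq'.1]
  · have hc : Continuous ((stabFix k α β Y).domRestrict (Qfix α β H₀)) := by
      rw [continuous_induced_rng, ]
      have : ContinuousOn (Qm k α β) (stabFix k α β Y) := fun q hq =>
        (tendsto_Qm hK hq.1 (W.stabFix_reg hq)).2.mono_left (nhdsWithin_mono _ stabFix_subset)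
      convert continuousOn_iff_continuous_domRestrict.1 this using 1
      funext q
      exact coe_Qfix hK hF q.2
    let P : Set (level k α β) := X.mk ⁻¹' fixedLocus k α β H₀
    have hP : ∀ p : P, (p : HN N) ∈ stabFix k α β Y := fun p => by
      have h1 : X.mk (p : level k α β) ∈ fixedLocus k α β H₀ := p.2
      rw [← Qm_of_mem_level hK p.1.2] at h1
      exact ⟨level_subset_stab p.1.2, (Qm_mem_fixedLocus_iff hK hF (level_subset_stab p.1.2)).1 h1⟩
    let f : P → stabFix k α β Y := fun p => ⟨p, hP p⟩
    have hf : Continuous f := by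
      refine Continuous.subtype_mk ?_ _
      exact continuous_subtype_val.comp continuous_subtype_val
    refine Topology.IsQuotientMap.of_comp hf hc ?_
    have h1 : IsOpenMap ((fixedLocus k α β H₀).restrictPreimage (X.mk : level k α β → X k α β)) :=
      isOpenMap_mk.restrictPreimage _
    have h2 : Continuous ((fixedLocus k α β H₀).restrictPreimage (X.mk : level k α β → X k α β)) :=
      (isOpenQuotientMap_mk (k := k) (α := α) (β := β)).continuous.restrictPreimage
    have h3 : Function.Surjective ((fixedLocus k α β H₀).restrictPreimage (X.mk : level k α β → X k α β)) :=
      Set.restrictPreimage_surjective _ (isOpenQuotientMap_mk (k := k) (α := α) (β := β)).surjective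
    convert h1.isQuotientMap h2 h3 using 1
    funext p
    apply Subtype.ext
    change ((Qfix α β H₀ (p : HN N) : fixedLocus k α β H₀) : X k α β) = X.mk (p : level k α β)
    rw [coe_Qfix hK hF (hP p), Qm_of_mem_level hK p.1.2]

/-- A gauge through `p`, with `d` free coordinates. -/
structure GaugeAt (k : Submodule ℝ (Fin N → ℝ)) (β : k →L[ℝ] ℂ) (A : Set (Fin N)) (d : ℕ) (p : HN N) where
  /-- The gauge. -/
  G : Gauge k β A
  /-- The free coordinates. -/
  sl : Slots A G.B (Fin d → ℂ)
  hc : ∀ i ∈ G.B, raw G.ε p i = G.c i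

theorem nonempty_gaugeAt_of_card (hK : IsUnimodular k) {p : HN N} (hp : p ∈ fiberOn k β A)
    (hreg : ∀ x ∈ k, (∀ i ∈ coordSupp p, x i = 0) → ∀ l ∈ A, x l = 0) {d : ℕ}
    (hd : ∀ B e, Frame k A B e → Nat.card {s : Fin N × Bool // s.1 ∈ A ∧ s.1 ∉ B} = d) :
    Nonempty (GaugeAt k β A d p) := by
  classical
  obtain ⟨G, hG⟩ := exists_gauge hK hp hreg
  have h := hd G.B G.e G.frame
  rw [Nat.card_eq_fintype_card] at h
  exact ⟨⟨G, Slots.ofEquiv (Fintype.equivFinOfCardEq h).symm, hG⟩⟩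

theorem nonempty_gaugeAt_X {n : ℕ} (hn : Module.finrank ℝ k + n = N) (hK : IsUnimodular k)
    (hfree : ∀ q ∈ stab k α β, ∀ x : k, (∀ i ∈ coordSupp q, (x : Fin N → ℝ) i = 0) → x = 0) {p : HN N}
    (hp : p ∈ stab k α β) : Nonempty (GaugeAt k β Set.univ (2 * n) p) := by
  classical
  refine nonempty_gaugeAt_of_card hK ⟨muC_of_mem_stab hp, fun l hl => absurd (Set.mem_univ l) hl⟩
    (fun x hx h l _ => congrFun (congrArg Subtype.val (hfree p hp ⟨x, hx⟩ h)) l) fun B e hB => ?_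
  have h1 := card_slots hB.sub
  have h2 := hB.card_univ
  rw [Set.ncard_univ, Nat.card_fin] at h1
  omega

/-- The elements of k vanishing at all weight-zero indices form the line of Y, which accounts for
the missing frame vector. -/
theorem WallCrossing.card_frame (W : WallCrossing k β α αp αm Y) {e : Fin N → Fin N → ℤ}
    (hB : Frame k {i | Y i = 0} B e) : B.card + 1 = Module.finrank ℝ k := by
  refine hB.card_add (Submodule.span ℝ {fun i => (Y i : ℝ)}) (fun x => ?_) ?_
  · rw [Submodule.mem_span_singleton]
    constructor
    · rintro ⟨c, rfl⟩
      refine ⟨k.smul_mem _ W.mem, fun l hl => ?_⟩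
      simp only [Set.mem_ofPred_eq] at hl
      simp [hl]
    · rintro ⟨hx, h⟩
      obtain ⟨c, hc⟩ := W.line ⟨x, hx⟩ h
      exact ⟨c, (congrArg Subtype.val hc).symm⟩
  · refine finrank_span_singleton fun h => ?_
    obtain ⟨i, hi⟩ := W.exists_ne
    have := congrFun h i
    simp at this
    exact hi this

theorem WallCrossing.nonempty_gaugeAt_fix (W : WallCrossing k β α αp αm Y) {n m r : ℕ}
    (hn : Module.finrank ℝ k + n = N) (hK : IsUnimodular k)
    (hr : (Finset.univ.filter fun i => Y i ≠ 0).card = r + 1) (hm : m + 2 * r = 2 * n) {p : HN N}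
    (hp : p ∈ stabFix k α β Y) : Nonempty (GaugeAt k β {i | Y i = 0} m p) := by
  classical
  refine nonempty_gaugeAt_of_card hK (stabFix_subset hp) (W.stabFix_reg hp) fun B e hB => ?_
  have h1 := card_slots hB.sub
  have h2 := W.card_frame hB
  have h3 := ncard_eq_zero_add_card_ne Y
  omega

end ToricHK

namespace ToricHK

variable {N : ℕ} {k : Submodule ℝ (Fin N → ℝ)} {β : k →L[ℝ] ℂ} {A : Set (Fin N)}

/-! ## The symplectic form and the normalization map -/

/-- The form `∑ dzᵢ ∧ dwᵢ` as an alternating form. -/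
def cform (N : ℕ) : HN N [⋀^Fin 2]→L[ℂ] ℂ where
  toFun m := complexForm (m 0) (m 1)
  map_update_add' := by
    intro inst m i x y
    rw [Subsingleton.elim inst (instDecidableEqFin 2)]
    fin_cases i <;>
    · simp only [complexForm, ← Finset.sum_add_distrib]
      refine Finset.sum_congr rfl fun i _ => ?_
      simp [Function.update]; ring
  map_update_smul' := by
    intro inst m i c x
    rw [Subsingleton.elim inst (instDecidableEqFin 2)]
    fin_cases i <;>
    · simp only [complexForm, Finset.smul_sum]
      refine Finset.sum_congr rfl fun i _ => ?_
      simp [Function.update]; ring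
  cont := by
    simp only [complexForm]
    fun_prop
  map_eq_zero_of_eq' := by
    intro v i j h hij
    have : v 0 = v 1 := by
      fin_cases i <;> fin_cases j
      · exact absurd rfl hij
      · exact h
      · exact h.symm
      · exact absurd rfl hij
    simp only [this, complexForm]
    exact Finset.sum_eq_zero fun i _ => by ring

/-- `v` is tangent at `q` to the fibre of `μ_ℂ`. -/
def TanK (k : Submodule ℝ (Fin N → ℝ)) (q v : HN N) : Prop :=
  ∀ x ∈ k, ∑ l, (v.1 l * q.2 l + q.1 l * v.2 l) * (x l : ℂ) = 0

theorem hasFDerivAt_prod_zpow {ι E : Type*} [NormedAddCommGroup E] [NormedSpace ℂ E] (s : Finset ι)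
    {f : ι → E → ℂ} {L : ι → E →L[ℂ] ℂ} {x : E} (n : ι → ℤ)
    (hf : ∀ i ∈ s, HasFDerivAt (f i) (f i x • L i) x) (hne : ∀ i ∈ s, f i x ≠ 0) :
    HasFDerivAt (fun y => ∏ i ∈ s, f i y ^ n i) ((∏ i ∈ s, f i x ^ n i) • ∑ i ∈ s, (n i : ℂ) • L i) x := by
  classical
  induction s using Finset.induction_on with
  | empty => simpa using hasFDerivAt_const (1 : ℂ) x
  | insert i s hi ih =>
    have h1 := ih (fun j hj => hf j (Finset.mem_insert_of_mem hj))
      (fun j hj => hne j (Finset.mem_insert_of_mem hj))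
    have hfi := hne i (Finset.mem_insert_self i s)
    have h2 : HasFDerivAt (fun y => f i y ^ n i) ((f i x ^ n i * n i) • L i) x := by
      have := (hasDerivAt_zpow (n i) (f i x) (Or.inl hfi)).comp_hasFDerivAt x
        (hf i (Finset.mem_insert_self i s))
      refine this.congr_fderiv ?_
      rw [smul_smul, zpow_sub_one₀ hfi]
      congr 1; field_simp
    simp only [Finset.prod_insert hi, Finset.sum_insert hi]
    refine (h2.mul h1).congr_fderiv ?_
    ext v
    simp only [add_apply, smul_apply, smul_eq_mul]
    ring

namespace Gauge

variable {G : Gauge k β A}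

theorem hasFDerivAt_fac {q : HN N} (hq : q ∈ G.dom) {i : Fin N} (hi : i ∈ G.B) :
    ∃ L : HN N →L[ℂ] ℂ, HasFDerivAt (fun q => G.fac q i) (G.fac q i • L) q := by
  have h := (contDiffAt_fac hq hi).differentiableAt (by simp)
  refine ⟨(G.fac q i)⁻¹ • fderiv ℂ (fun q => G.fac q i) q, ?_⟩
  rw [smul_smul, mul_inv_cancel₀ (fac_ne hq hi), one_smul]
  exact h.hasFDerivAt

/-- Logarithmic differentiation of the normalizing monomial: up to the action of `gam`, the
derivative adds to v an infinitesimal K_ℂ-motion with parameters tᵢ. -/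
theorem fderiv_nrm {q : HN N} (hq : q ∈ G.dom) (v : HN N) : ∃ t : Fin N → ℂ, ∀ l,
    (fderiv ℂ G.nrm q v).1 l = G.gam q l * (v.1 l + q.1 l * ∑ i ∈ G.B, t i * G.e i l) ∧
    (fderiv ℂ G.nrm q v).2 l = (G.gam q l)⁻¹ * (v.2 l - q.2 l * ∑ i ∈ G.B, t i * G.e i l) := by
  have hex : ∀ i, ∃ L : HN N →L[ℂ] ℂ, i ∈ G.B → HasFDerivAt (fun q => G.fac q i) (G.fac q i • L) q := by
    intro i
    by_cases hi : i ∈ G.B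
    · obtain ⟨L, hL⟩ := hasFDerivAt_fac hq hi; exact ⟨L, fun _ => hL⟩
    · exact ⟨0, fun h => absurd h hi⟩
  choose L hL using hex
  have hgam : ∀ l, HasFDerivAt (fun q => G.gam q l) (G.gam q l • ∑ i ∈ G.B, (G.e i l : ℂ) • L i) q :=
    fun l => hasFDerivAt_prod_zpow G.B (f := fun i q => G.fac q i) (fun i => G.e i l) (fun i hi => hL i hi)
      fun i hi => fac_ne hq hi
  refine ⟨fun i => L i v, fun l => ?_⟩
  have hn : HasFDerivAt G.nrm (fderiv ℂ G.nrm q) q :=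
    ((contDiffAt_nrm hq).differentiableAt (by simp)).hasFDerivAt
  have hg := gam_ne hq l
  have hsum : (∑ i ∈ G.B, (G.e i l : ℂ) • L i) v = ∑ i ∈ G.B, L i v * G.e i l := by
    simp only [sum_apply, smul_apply, smul_eq_mul]
    exact Finset.sum_congr rfl fun i _ => mul_comm _ _
  constructor
  · have h1 : HasFDerivAt (fun q => (G.nrm q).1 l) ((coordL (l, true)).comp (fderiv ℂ G.nrm q)) q :=
      (coordL (l, true)).hasFDerivAt.comp q hn
    have h2 : HasFDerivAt (fun q : HN N => q.1 l * G.gam q l) _ q :=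
      (coordL (l, true)).hasFDerivAt.mul (hgam l)
    have := congrArg (fun T : HN N →L[ℂ] ℂ => T v) (h1.unique h2)
    simp only [ContinuousLinearMap.comp_apply, add_apply, smul_apply, coordL_true, smul_eq_mul] at this
    rw [this, hsum]; ring
  · have h1 : HasFDerivAt (fun q => (G.nrm q).2 l) ((coordL (l, false)).comp (fderiv ℂ G.nrm q)) q :=
      (coordL (l, false)).hasFDerivAt.comp q hn
    have h2 : HasFDerivAt (fun q : HN N => q.2 l * (G.gam q l)⁻¹) _ q :=
      (coordL (l, false)).hasFDerivAt.mul ((hasDerivAt_inv hg).comp_hasFDerivAt q (hgam l))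
    have := congrArg (fun T : HN N →L[ℂ] ℂ => T v) (h1.unique h2)
    simp only [ContinuousLinearMap.comp_apply, add_apply, smul_apply, coordL_false, smul_eq_mul] at this
    rw [this, hsum]
    field_simp; ring

theorem raw_fderiv_nrm {q : HN N} (hq : q ∈ G.dom) (v : HN N) {i : Fin N} (hi : i ∈ G.B) :
    raw G.ε (fderiv ℂ G.nrm q v) i = 0 := by
  have hn : HasFDerivAt G.nrm (fderiv ℂ G.nrm q) q :=
    ((contDiffAt_nrm hq).differentiableAt (by simp)).hasFDerivAt
  have h1 : HasFDerivAt (fun q => coordL (i, G.ε i) (G.nrm q)) ((coordL (i, G.ε i)).comp (fderiv ℂ G.nrm q)) q :=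
    (coordL (i, G.ε i)).hasFDerivAt.comp q hn
  have hraw : ∀ q : HN N, coordL (i, G.ε i) q = raw G.ε q i := by
    intro q; unfold raw
    cases h : G.ε i
    · simp [coordL_false]
    · simp [coordL_true]
  have h2 : HasFDerivAt (fun q => coordL (i, G.ε i) (G.nrm q)) (0 : HN N →L[ℂ] ℂ) q := by
    refine (hasFDerivAt_const (G.c i) q).congr_of_eventuallyEq ?_
    filter_upwards [isOpen_dom.mem_nhds hq] with q' hq'
    rw [hraw, raw_nrm hq' hi]
  have := congrArg (fun T : HN N →L[ℂ] ℂ => T v) (h1.unique h2)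
  simp only [ContinuousLinearMap.comp_apply, hraw] at this
  exact this

/-- The defining property of a moment map: vectors tangent to a fibre of μ_ℂ are symplectically
orthogonal to the orbit directions. -/
theorem complexForm_infAct {q v : HN N} (hv : TanK k q v) (hB : ∀ i ∈ G.B, (fun l => (G.e i l : ℝ)) ∈ k)
    (t : Fin N → ℂ) :
    ∑ l, (v.1 l * q.2 l + q.1 l * v.2 l) * ∑ i ∈ G.B, t i * (G.e i l : ℂ) = 0 := by
  simp only [Finset.mul_sum]
  rw [Finset.sum_comm]
  refine Finset.sum_eq_zero fun i hi => ?_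
  have := hv _ (hB i hi)
  calc _ = t i * ∑ l, (v.1 l * q.2 l + q.1 l * v.2 l) * (((G.e i l : ℝ)) : ℂ) := by
        rw [Finset.mul_sum]
        exact Finset.sum_congr rfl fun l _ => by push_cast; ring
    _ = 0 := by rw [this, mul_zero]

/-- The torus preserves the form, orbit directions pair to zero with tangent vectors of the fibre,
and terms with two orbit directions cancel in each coordinate. -/
theorem complexForm_fderiv_nrm {q v v' : HN N} (hq : q ∈ G.dom) (hv : TanK k q v) (hv' : TanK k q v') :
    complexForm (fderiv ℂ G.nrm q v) (fderiv ℂ G.nrm q v') = complexForm v v' := by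
  obtain ⟨t, ht⟩ := fderiv_nrm hq v
  obtain ⟨t', ht'⟩ := fderiv_nrm hq v'
  have h1 := complexForm_infAct (G := G) hv G.frame.mem t'
  have h2 := complexForm_infAct (G := G) hv' G.frame.mem t
  unfold complexForm
  calc _ = ∑ l, ((v.1 l * v'.2 l - v.2 l * v'.1 l)
          + (v'.1 l * q.2 l + q.1 l * v'.2 l) * (∑ i ∈ G.B, t i * (G.e i l : ℂ))
          - (v.1 l * q.2 l + q.1 l * v.2 l) * ∑ i ∈ G.B, t' i * (G.e i l : ℂ)) := by
        refine Finset.sum_congr rfl fun l _ => ?_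
        rw [(ht l).1, (ht l).2, (ht' l).1, (ht' l).2]
        have hg := gam_ne hq l
        field_simp; ring
    _ = _ := by rw [Finset.sum_sub_distrib, Finset.sum_add_distrib, h1, h2]; ring

end Gauge

/-- At a frame index one of z, w is constant on the slice, so its summand of the form drops out and
only free coordinates remain. -/
theorem Slots.complexForm_ρ_κ {F : Type} [NormedAddCommGroup F] [NormedSpace ℂ F] {B : Finset (Fin N)}
    (sl : Slots Set.univ B F) {ε : Fin N → Bool} {u u' : HN N}
    (hu : ∀ i ∈ B, raw ε u i = 0) (hu' : ∀ i ∈ B, raw ε u' i = 0) :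
    complexForm (sl.ρ (sl.κ u)) (sl.ρ (sl.κ u')) = complexForm u u' := by
  unfold complexForm
  refine Finset.sum_congr rfl fun l _ => ?_
  by_cases hl : l ∈ B
  · have h1 := hu l hl
    have h2 := hu' l hl
    unfold raw at h1 h2
    simp only [(sl.ρ_zero _ l (Or.inr hl)).1, (sl.ρ_zero _ l (Or.inr hl)).2]
    split_ifs at h1 h2 <;> simp [h1, h2]
  · rw [(sl.ρ_κ u l trivial hl).1, (sl.ρ_κ u l trivial hl).2, (sl.ρ_κ u' l trivial hl).1,
      (sl.ρ_κ u' l trivial hl).2]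

theorem complexForm_chart {G : Gauge k β Set.univ} {F : Type} [NormedAddCommGroup F] [NormedSpace ℂ F]
    (sl : Slots Set.univ G.B F) {q v v' : HN N} (hq : q ∈ G.dom) (hv : TanK k q v) (hv' : TanK k q v') :
    complexForm (sl.ρ (fderiv ℂ (fun q => sl.κ (G.nrm q)) q v)) (sl.ρ (fderiv ℂ (fun q => sl.κ (G.nrm q)) q v')) =
      complexForm v v' := by
  have h : ∀ v, fderiv ℂ (fun q => sl.κ (G.nrm q)) q v = sl.κ (fderiv ℂ G.nrm q v) := by
    intro v
    have := (sl.κ.hasFDerivAt.comp q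
      ((Gauge.contDiffAt_nrm hq).differentiableAt (by simp)).hasFDerivAt).fderiv
    change fderiv ℂ (sl.κ ∘ G.nrm) q v = _
    rw [this]; rfl
  rw [h, h, sl.complexForm_ρ_κ (fun i hi => Gauge.raw_fderiv_nrm hq v hi)
    (fun i hi => Gauge.raw_fderiv_nrm hq v' hi), Gauge.complexForm_fderiv_nrm hq hv hv']

theorem tanK_mfderiv {E' H' N' : Type*} [NormedAddCommGroup E'] [NormedSpace ℂ E'] [TopologicalSpace H']
    {I : ModelWithCorners ℂ E' H'} [TopologicalSpace N'] [ChartedSpace H' N'] {f : N' → HN N} {x : N'}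
    (hf : MDifferentiableAt I 𝓘(ℂ, HN N) f x) (hfS : ∀ᶠ y in 𝓝 x, muC k (f y) = β) (u : TangentSpace I x) :
    TanK k (f x) (mfderiv I 𝓘(ℂ, HN N) f x u) := by
  intro y hy
  let g : HN N → ℂ := fun q => ∑ l, q.1 l * q.2 l * (y l : ℂ)
  have hg : HasFDerivAt g (∑ l, (y l : ℂ) • ((f x).1 l • coordL (l, false) + (f x).2 l • coordL (l, true)))
      (f x) := by
    refine HasFDerivAt.fun_sum fun l _ => ?_
    exact ((coordL (l, true)).hasFDerivAt.mul (coordL (l, false)).hasFDerivAt).mul_const _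
  have h1 : HasMFDerivAt I 𝓘(ℂ, ℂ) (g ∘ f) x _ := hg.hasMFDerivAt.comp x hf.hasMFDerivAt
  have h2 : HasMFDerivAt I 𝓘(ℂ, ℂ) (g ∘ f) x 0 := by
    refine (hasMFDerivAt_const (g (f x)) x).congr_of_eventuallyEq ?_
    filter_upwards [hfS] with z hz
    have e1 := muC_apply (f z) ⟨y, hy⟩
    have e2 := muC_apply (f x) ⟨y, hy⟩
    rw [hz] at e1
    rw [hfS.self_of_nhds, e1] at e2
    exact mul_left_cancel₀ two_pi_I_ne_zero e2
  have := congrArg (fun T : E' →L[ℂ] ℂ => T u) (hasMFDerivAt_unique h1 h2)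
  have key : ∀ w : HN N, (∑ l, (y l : ℂ) • ((f x).1 l • coordL (l, false) +
      (f x).2 l • coordL (l, true))) w = 0 →
      ∑ l, (w.1 l * (f x).2 l + (f x).1 l * w.2 l) * (y l : ℂ) = 0 := by
    intro w hw
    simp only [sum_apply, smul_apply, add_apply, coordL_true, coordL_false, smul_eq_mul] at hw
    rw [← hw]
    exact Finset.sum_congr rfl fun l _ => by ring
  exact key _ this

end ToricHK

namespace ToricHK

variable {N : ℕ} {k : Submodule ℝ (Fin N → ℝ)} {β : k →L[ℝ] ℂ} {A : Set (Fin N)}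
  {M : Type} [TopologicalSpace M] {S : Set (HN N)} {Q : HN N → M} {d : ℕ}

/-! ## Complex structures and symplectic forms on the quotients -/

theorem TorusQuot.surj (hS : TorusQuot k β A S Q) (x : M) : ∃ p ∈ S, Q p = x := by
  obtain ⟨p, hp⟩ := hS.quot.surjective x
  exact ⟨p, p.2, hp⟩

theorem TorusQuot.continuousOn (hS : TorusQuot k β A S Q) : ContinuousOn Q S :=
  continuousOn_iff_continuous_domRestrict.2 hS.quot.continuous

/-- The charts given by a choice of gauges. -/
def TorusQuot.localChart (hS : TorusQuot k β A S Q) (ga : ∀ p ∈ S, GaugeAt k β A d p) (p : HN N)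
    (hp : p ∈ S) : LocalChart (Fin d → ℂ) S Q p :=
  (hS.chart (ga p hp).G (ga p hp).sl hp (ga p hp).hc).1

/-- The complex structure given by a choice of gauges. -/
@[reducible] def TorusQuot.chartedSpace (hS : TorusQuot k β A S Q) (ga : ∀ p ∈ S, GaugeAt k β A d p) :
    ChartedSpace (Fin d → ℂ) M :=
  chartedSpaceOf (hS.localChart ga) hS.surj

theorem TorusQuot.isHolQuot (hS : TorusQuot k β A S Q) (ga : ∀ p ∈ S, GaugeAt k β A d p) :
    let := hS.chartedSpace ga
    IsHolQuot d S Q :=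
  isHolQuot_chartedSpaceOf _ _ hS.continuousOn

/-- A quotient with a form that is compatible with `∑ dzᵢ ∧ dwᵢ`. -/
structure IsSymplQuot (k : Submodule ℝ (Fin N → ℝ)) (β : k →L[ℝ] ℂ) (d : ℕ) (S : Set (HN N)) (Q : HN N → M)
    [ChartedSpace (Fin d → ℂ) M]
    (Ω : (x : M) → TangentSpace 𝓘(ℂ, Fin d → ℂ) x [⋀^Fin 2]→L[ℂ] ℂ) : Prop extends IsHolQuot d S Q where
  sub : ∀ q ∈ S, muC k q = β
  inv_form : ∀ p ∈ S, ∃ F : HN N → (Fin d → ℂ), ContDiffAt ℂ ω F p ∧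
    (∀ᶠ q in 𝓝[S] p, F q = chartAt (Fin d → ℂ) (Q p) (Q q)) ∧
    ∀ v v', TanK k p v → TanK k p v' → Ω (Q p) ![fderiv ℂ F p v, fderiv ℂ F p v'] = complexForm v v'

/-- Tangent spaces of M are model spaces of preferred charts, so a derivative is computed by reading
f in the preferred chart at the image point. -/
theorem mfderiv_eq_mfderiv_chartAt {E' H' N' : Type*} [NormedAddCommGroup E'] [NormedSpace ℂ E']
    [TopologicalSpace H'] {I : ModelWithCorners ℂ E' H'} [TopologicalSpace N'] [ChartedSpace H' N']
    [ChartedSpace (Fin d → ℂ) M] {f : N' → M} {x : N'} (hf : MDifferentiableAt I 𝓘(ℂ, Fin d → ℂ) f x)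
    {h : N' → (Fin d → ℂ)} (hh : MDifferentiableAt I 𝓘(ℂ, Fin d → ℂ) h x)
    (he : h =ᶠ[𝓝 x] fun y => chartAt (Fin d → ℂ) (f x) (f y)) (u : TangentSpace I x) :
    mfderiv I 𝓘(ℂ, Fin d → ℂ) f x u = mfderiv I 𝓘(ℂ, Fin d → ℂ) h x u := by
  have hh' : MDifferentiableAt I 𝓘(ℂ, Fin d → ℂ) (fun y => chartAt (Fin d → ℂ) (f x) (f y)) x :=
    hh.congr_of_eventuallyEq he.symm
  have h1 : mfderiv I 𝓘(ℂ, Fin d → ℂ) f x =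
      mfderiv I 𝓘(ℂ, Fin d → ℂ) (fun y => chartAt (Fin d → ℂ) (f x) (f y)) x := by
    simp only [mfderiv, hf, hh']
    rfl
  rw [h1]
  exact congrArg (fun T : E' →L[ℂ] (Fin d → ℂ) => T u) he.symm.mfderiv_eq

theorem IsSymplQuot.pull [ChartedSpace (Fin d → ℂ) M]
    {Ω : (x : M) → TangentSpace 𝓘(ℂ, Fin d → ℂ) x [⋀^Fin 2]→L[ℂ] ℂ} (h : IsSymplQuot k β d S Q Ω)
    {E' H' N' : Type*} [NormedAddCommGroup E'] [NormedSpace ℂ E']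
    [TopologicalSpace H'] {I : ModelWithCorners ℂ E' H'} [TopologicalSpace N'] [ChartedSpace H' N']
    {f : N' → HN N} {x : N'} (hf : ContMDiffAt I 𝓘(ℂ, HN N) ω f x) (hfS : ∀ᶠ y in 𝓝 x, f y ∈ S)
    (u v : TangentSpace I x) :
    Ω (Q (f x)) ![mfderiv I 𝓘(ℂ, Fin d → ℂ) (fun y => Q (f y)) x u,
      mfderiv I 𝓘(ℂ, Fin d → ℂ) (fun y => Q (f y)) x v] =
      complexForm (mfderiv I 𝓘(ℂ, HN N) f x u) (mfderiv I 𝓘(ℂ, HN N) f x v) := by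
  obtain ⟨F, hF, hFe, hΩ⟩ := h.inv_form (f x) hfS.self_of_nhds
  have hfd := hf.mdifferentiableAt (by simp : (ω : WithTop ℕ∞) ≠ 0)
  have hten : Filter.Tendsto f (𝓝 x) (𝓝[S] (f x)) :=
    tendsto_nhdsWithin_iff.2 ⟨hf.continuousAt, hfS⟩
  have hQf := (h.contMDiffAt_comp hf hfS).mdifferentiableAt (by simp : (ω : WithTop ℕ∞) ≠ 0)
  have hFf : HasMFDerivAt I 𝓘(ℂ, Fin d → ℂ) (F ∘ f) x _ :=
    (hF.differentiableAt (by simp)).hasFDerivAt.hasMFDerivAt.comp x hfd.hasMFDerivAt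
  have key : ∀ u, mfderiv I 𝓘(ℂ, Fin d → ℂ) (fun y => Q (f y)) x u =
      fderiv ℂ F (f x) (mfderiv I 𝓘(ℂ, HN N) f x u) := by
    intro u
    rw [mfderiv_eq_mfderiv_chartAt hQf hFf.mdifferentiableAt (hten.eventually hFe) u, hFf.mfderiv]
    rfl
  have hsub : ∀ᶠ y in 𝓝 x, muC k (f y) = β := hfS.mono fun y hy => h.sub _ hy
  have := hΩ _ _ (tanK_mfderiv hfd hsub u) (tanK_mfderiv hfd hsub v)
  rw [← this]
  congr 2
  · exact key u
  · rw [key v]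

section

variable (hS : TorusQuot k β Set.univ S Q) (ga : ∀ p ∈ S, GaugeAt k β Set.univ d p)

/-- The symplectic form given by a choice of gauges. -/
def TorusQuot.form : let := hS.chartedSpace ga
    (x : M) → TangentSpace 𝓘(ℂ, Fin d → ℂ) x [⋀^Fin 2]→L[ℂ] ℂ :=
  let := hS.chartedSpace ga
  fun x => (cform N).compContinuousLinearMap (ga (hS.surj x).choose (hS.surj x).choose_spec.1).sl.ρ

theorem TorusQuot.isSymplQuot : let := hS.chartedSpace ga
    IsSymplQuot k β d S Q (hS.form ga) := by
  let := hS.chartedSpace ga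
  refine ⟨hS.isHolQuot ga, fun q hq => (hS.sub hq).1, fun p hp => ?_⟩
  set p' := (hS.surj (Q p)).choose with hp'def
  have hp' : p' ∈ S := (hS.surj (Q p)).choose_spec.1
  have hQ : Q p' = Q p := (hS.surj (Q p)).choose_spec.2
  set g := ga p' hp' with hg
  obtain ⟨-, -, hc⟩ := (hS.chart g.G g.sl hp' g.hc).2
  have hpd : p ∈ g.G.dom := by
    refine ((hc p hp).1).1 ?_
    exact mem_chart_source (Fin d → ℂ) (Q p)
  refine ⟨fun q => g.sl.κ (g.G.nrm q), g.sl.κ.contDiff.contDiffAt.comp p (Gauge.contDiffAt_nrm hpd), ?_,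
    fun v v' hv hv' => complexForm_chart g.sl hpd hv hv'⟩
  filter_upwards [self_mem_nhdsWithin, mem_nhdsWithin_of_mem_nhds (Gauge.isOpen_dom.mem_nhds hpd)] with q hq hqd
  exact ((hc q hq).2 hqd).symm

/-- The charts are Darboux charts: the coefficients are constant. Pulled back by the slice section
the form is `complexForm`, and the chart composed with the section is the identity. -/
theorem TorusQuot.formInChart_form (x₀ : M) : let := hS.chartedSpace ga
    ∀ y ∈ (chartAt (Fin d → ℂ) x₀).target, ComplexGeometry.formInChart (hS.form ga) x₀ y =
      (cform N).compContinuousLinearMap (ga (hS.surj x₀).choose (hS.surj x₀).choose_spec.1).sl.ρ := by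
  intro _ y hy
  set p' := (hS.surj x₀).choose with hp'def
  have hp' : p' ∈ S := (hS.surj x₀).choose_spec.1
  set g := ga p' hp' with hg
  obtain ⟨hs, -, hc⟩ := (hS.chart g.G g.sl hp' g.hc).2
  set c := (hS.chart g.G g.sl hp' g.hc).1 with hcdef
  have hce : chartAt (Fin d → ℂ) x₀ = c.e := rfl
  have hyt : y ∈ c.e.target := hy
  have hte : c.e.target ∈ 𝓝 y := c.e.open_target.mem_nhds hyt
  set s : (Fin d → ℂ) → HN N := fun a => g.G.slc (g.sl.ρ a) with hsdef
  have hscd : ContDiff ℂ ω s := Gauge.contDiff_slc.comp g.sl.ρ.contDiff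
  have hsS : ∀ᶠ a in 𝓝 y, s a ∈ S := by
    filter_upwards [hte] with a ha
    have := c.s_mem a ha
    rwa [hs] at this
  have hQs : ∀ a ∈ c.e.target, Q (s a) = c.e.symm a := fun a ha => by
    have := c.Q_s a ha
    rwa [hs] at this
  have hpull := fun u v : Fin d → ℂ => (hS.isSymplQuot ga).pull (I := 𝓘(ℂ, Fin d → ℂ)) (f := s) (x := y)
    hscd.contDiffAt.contMDiffAt hsS u v
  have hmf : mfderiv 𝓘(ℂ, Fin d → ℂ) 𝓘(ℂ, Fin d → ℂ) (fun y => Q (s y)) y =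
      mfderiv 𝓘(ℂ, Fin d → ℂ) 𝓘(ℂ, Fin d → ℂ) c.e.symm y := by
    refine Filter.EventuallyEq.mfderiv_eq ?_
    filter_upwards [hte] with a ha using hQs a ha
  have hform : ∀ u v : Fin d → ℂ, complexForm (fderiv ℂ s y u) (fderiv ℂ s y v) =
      complexForm (g.sl.ρ u) (g.sl.ρ v) := by
    intro u v
    have hd : s y ∈ g.G.dom := Gauge.slc_mem_dom _
    have htan : ∀ u, TanK k (s y) (fderiv ℂ s y u) := by
      intro u
      have := tanK_mfderiv (k := k) (β := β) (I := 𝓘(ℂ, Fin d → ℂ)) (f := s) (x := y)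
        (hscd.contDiffAt.contMDiffAt.mdifferentiableAt (by simp : (ω : WithTop ℕ∞) ≠ 0))
        (hsS.mono fun a ha => (hS.sub ha).1) u
      rw [mfderiv_eq_fderiv] at this
      exact this
    rw [← complexForm_chart g.sl hd (htan u) (htan v)]
    have hid : HasFDerivAt (fun a => g.sl.κ (g.G.nrm (s a))) (ContinuousLinearMap.id ℂ (Fin d → ℂ)) y := by
      refine (hasFDerivAt_id y).congr_of_eventuallyEq (Filter.Eventually.of_forall fun a => ?_)
      simp only [hsdef, Gauge.nrm_slc, Gauge.κ_slc, id]
    have hF : DifferentiableAt ℂ (fun q => g.sl.κ (g.G.nrm q)) (s y) :=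
      (g.sl.κ.contDiff.contDiffAt.comp _ (Gauge.contDiffAt_nrm hd)).differentiableAt (by simp)
    have hcomp := hF.hasFDerivAt.comp y (hscd.contDiffAt.differentiableAt (by simp)).hasFDerivAt
    have := hcomp.unique hid
    have h2 : ∀ u, fderiv ℂ (fun q => g.sl.κ (g.G.nrm q)) (s y) (fderiv ℂ s y u) = u := fun u =>
      congrArg (fun T : (Fin d → ℂ) →L[ℂ] (Fin d → ℂ) => T u) this
    rw [h2, h2]
  ext m
  have hm : m = ![m 0, m 1] := by ext i; fin_cases i <;> rfl
  have h1 := hpull (m 0) (m 1)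
  rw [hmf, mfderiv_eq_fderiv] at h1
  have h2 := h1.trans (hform (m 0) (m 1))
  have hq : Q (s y) = c.e.symm y := hQs y hyt
  have h3 : hS.form ga (c.e.symm y) ![mfderiv 𝓘(ℂ, Fin d → ℂ) 𝓘(ℂ, Fin d → ℂ) c.e.symm y (m 0),
      mfderiv 𝓘(ℂ, Fin d → ℂ) 𝓘(ℂ, Fin d → ℂ) c.e.symm y (m 1)] =
      complexForm (g.sl.ρ (m 0)) (g.sl.ρ (m 1)) := by
    rw [← h2, ← hq]
  refine Eq.trans ?_ h3
  change hS.form ga (c.e.symm y) (_ ∘ m) = _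
  congr 1
  ext i; fin_cases i <;> rfl

/-- The quaternionic structure `(z, w) ↦ (-w̄, z̄)`. -/
def quatJ (v : HN N) : HN N := (fun i => -starRingEnd ℂ (v.2 i), fun i => starRingEnd ℂ (v.1 i))

/-- The value is |v|². -/
theorem complexForm_quatJ_ne {v : HN N} (hv : v ≠ 0) : complexForm v (quatJ v) ≠ 0 := by
  have h : complexForm v (quatJ v) = ((∑ i, (‖v.1 i‖ ^ 2 + ‖v.2 i‖ ^ 2) : ℝ) : ℂ) := by
    simp only [complexForm, quatJ]
    push_cast
    refine Finset.sum_congr rfl fun i _ => ?_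
    rw [← Complex.mul_conj', ← Complex.mul_conj']; ring
  rw [h]
  intro h0
  have h1 : ∑ i, (‖v.1 i‖ ^ 2 + ‖v.2 i‖ ^ 2) = 0 := by exact_mod_cast h0
  rw [Finset.sum_eq_zero_iff_of_nonneg (fun i _ => by positivity)] at h1
  apply hv
  ext i
  · have := h1 i (Finset.mem_univ i)
    have h2 : ‖v.1 i‖ ^ 2 = 0 := by nlinarith [sq_nonneg ‖v.1 i‖, sq_nonneg ‖v.2 i‖]
    simpa using h2
  · have := h1 i (Finset.mem_univ i)
    have h2 : ‖v.2 i‖ ^ 2 = 0 := by nlinarith [sq_nonneg ‖v.1 i‖, sq_nonneg ‖v.2 i‖]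
    simpa using h2

theorem TorusQuot.isHolomorphicSymplectic : let := hS.chartedSpace ga
    ComplexGeometry.IsHolomorphicSymplectic (hS.form ga) := by
  let := hS.chartedSpace ga
  refine ⟨fun x₀ => ?_, fun x₀ y hy => ?_, fun x u hu => ?_⟩
  · exact contDiffOn_const.congr (hS.formInChart_form ga x₀)
  · have : ComplexGeometry.formInChart (hS.form ga) x₀ =ᶠ[𝓝 y] fun _ =>
        (cform N).compContinuousLinearMap (ga (hS.surj x₀).choose (hS.surj x₀).choose_spec.1).sl.ρ := by
      filter_upwards [(chartAt (Fin d → ℂ) x₀).open_target.mem_nhds hy] with a ha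
      exact hS.formInChart_form ga x₀ a ha
    rw [this.extDeriv_eq]
    ext v
    rw [extDeriv_apply (differentiableAt_const _)]
    simp
  · set g := ga (hS.surj x).choose (hS.surj x).choose_spec.1
    have hne : g.sl.ρ u ≠ 0 := fun h => hu (by rw [← g.sl.κ_ρ u, h, map_zero]; rfl)
    -- The free coordinates come in pairs z, w, so their span is stable under the quaternionic
    -- structure and the form is non-degenerate on it.
    have hJ : g.sl.ρ (g.sl.κ (quatJ (g.sl.ρ u))) = quatJ (g.sl.ρ u) := by
      ext l
      · by_cases hl : l ∈ g.G.B
        · rw [(g.sl.ρ_zero _ l (Or.inr hl)).1]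
          simp [quatJ, (g.sl.ρ_zero u l (Or.inr hl)).2]
        · rw [(g.sl.ρ_κ _ l trivial hl).1]
      · by_cases hl : l ∈ g.G.B
        · rw [(g.sl.ρ_zero _ l (Or.inr hl)).2]
          simp [quatJ, (g.sl.ρ_zero u l (Or.inr hl)).1]
        · rw [(g.sl.ρ_κ _ l trivial hl).2]
    refine ⟨g.sl.κ (quatJ (g.sl.ρ u)), ?_⟩
    change complexForm (g.sl.ρ u) (g.sl.ρ (g.sl.κ (quatJ (g.sl.ρ u)))) ≠ 0
    rw [hJ]
    exact complexForm_quatJ_ne hne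

end

end ToricHK

namespace ToricHK

variable {N : ℕ} {k : Submodule ℝ (Fin N → ℝ)} {α : StrongDual ℝ k} {β : k →L[ℝ] ℂ}

/-! ## The hyperkähler quotient structure -/

theorem hasFDerivAt_smul_sum {𝕂 V : Type*} [RCLike 𝕂] [NormedAddCommGroup V] [NormedSpace ℝ V]
    [NormedSpace 𝕂 V] [IsScalarTower ℝ 𝕂 V] {p : HN N} {g : Fin N → HN N → 𝕂} {g' : Fin N → HN N →L[ℝ] 𝕂}
    (c : 𝕂) (L : Fin N → V) (hg : ∀ i, HasFDerivAt (g i) (g' i) p) :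
    HasFDerivAt (fun p => c • ∑ i, g i p • L i) (c • ∑ i, (g' i).smulRight (L i)) p :=
  HasFDerivAt.const_smul (HasFDerivAt.fun_sum fun i _ => (hg i).smul_const (L i)) c

theorem fderiv_muC_apply (p v : HN N) (x : k) : fderiv ℝ (muC k) p v x =
    (-2 * Real.pi * Complex.I : ℂ) * ∑ l, (v.1 l * p.2 l + p.1 l * v.2 l) * ((x : Fin N → ℝ) l : ℂ) := by
  have h := hasFDerivAt_smul_sum (V := k →L[ℝ] ℂ) (p := p) (g := fun i q => q.1 i * q.2 i)
    (-2 * Real.pi * Complex.I : ℂ) (fun i => Complex.ofRealCLM.comp (iotaU k i))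
    (fun l => ((coordL (l, true)).restrictScalars ℝ).hasFDerivAt.mul
      ((coordL (l, false)).restrictScalars ℝ).hasFDerivAt)
  have h2 : fderiv ℝ (muC k) p = _ := h.fderiv
  rw [h2]
  simp only [smul_apply, sum_apply, ContinuousLinearMap.smulRight_apply, add_apply,
    ContinuousLinearMap.coe_restrictScalars', coordL_true, coordL_false, smul_eq_mul,
    ContinuousLinearMap.comp_apply, iotaU_apply, Complex.ofRealCLM_apply]
  congr 1
  exact Finset.sum_congr rfl fun l _ => by ring

theorem fderiv_mu1_apply (p v : HN N) (x : k) : fderiv ℝ (mu1 k) p v x =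
    2 * Real.pi * ∑ l, ((starRingEnd ℂ (p.1 l) * v.1 l).re - (starRingEnd ℂ (p.2 l) * v.2 l).re) *
      (x : Fin N → ℝ) l := by
  have h := hasFDerivAt_smul_sum (V := k →L[ℝ] ℝ) (p := p) (g := fun i q => ‖q.1 i‖ ^ 2 - ‖q.2 i‖ ^ 2)
    Real.pi (fun i => iotaU k i)
    (fun l => (((coordL (l, true)).restrictScalars ℝ).hasFDerivAt (x := p)).norm_sq.sub
        (((coordL (l, false)).restrictScalars ℝ).hasFDerivAt (x := p)).norm_sq)
  have h2 : fderiv ℝ (mu1 k) p = _ := h.fderiv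
  rw [h2]
  simp only [smul_apply, sum_apply, ContinuousLinearMap.smulRight_apply, sub_apply,
    ContinuousLinearMap.coe_restrictScalars', coordL_true, coordL_false, smul_eq_mul,
    ContinuousLinearMap.comp_apply, iotaU_apply, innerSL_apply_apply, Complex.inner]
  simp only [Finset.mul_sum]
  refine Finset.sum_congr rfl fun l _ => ?_
  simp only [nsmul_eq_mul]
  push_cast
  rw [mul_comm (v.1 l), mul_comm (v.2 l)]
  ring

theorem tanK_of_horizontal {p v : HN N} (hv : v ∈ horizontal k p) : TanK k p v := by
  intro x hx
  have h := congrArg (fun T : k →L[ℝ] ℂ => T ⟨x, hx⟩) hv.2.1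
  simp only [fderiv_muC_apply] at h
  exact (mul_eq_zero.1 h).resolve_left two_pi_I_ne_zero

/-- The quaternionic structure rotates the equations: the differential of μ₁ and orthogonality to
the orbit become the real and imaginary parts of the complex equation for Jv. -/
theorem tanK_quatJ {p v : HN N} (hv : v ∈ horizontal k p) : TanK k p (quatJ v) := by
  intro x hx
  have h1 := congrArg (fun T : StrongDual ℝ k => T ⟨x, hx⟩) hv.1
  simp only [fderiv_mu1_apply] at h1
  have h1' := (mul_eq_zero.1 h1).resolve_left (by positivity)
  have h2 := hv.2.2 x hx
  simp only [metric, infAct] at h2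
  have h2' : (-2 * Real.pi) * ∑ l, ((starRingEnd ℂ (v.1 l) * p.1 l).im -
      (starRingEnd ℂ (v.2 l) * p.2 l).im) * x l = 0 := by
    rw [← h2, Finset.mul_sum]
    refine Finset.sum_congr rfl fun l _ => ?_
    simp
    ring
  have h2'' := (mul_eq_zero.1 h2').resolve_left (by have := Real.pi_pos; linarith)
  apply Complex.ext
  · rw [Complex.re_sum, Complex.zero_re, ← h1']
    refine Finset.sum_congr rfl fun l _ => ?_
    simp [quatJ, -mul_eq_mul_right_iff]
    ring
  · rw [Complex.im_sum, Complex.zero_im, ← h2'']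
    refine Finset.sum_congr rfl fun l _ => ?_
    simp [quatJ, -mul_eq_mul_right_iff]
    ring

/-- The linear equations defining the horizontal space. -/
def horizontalEq (k : Submodule ℝ (Fin N → ℝ)) (p : HN N) :
    HN N →ₗ[ℝ] ((k →ₗ[ℝ] ℝ) × (k →ₗ[ℝ] ℂ) × (k →ₗ[ℝ] ℝ)) :=
  ((ContinuousLinearMap.coeLM ℝ).comp (fderiv ℝ (mu1 k) p).toLinearMap).prod
    (((ContinuousLinearMap.coeLM ℝ).comp (fderiv ℝ (muC k) p).toLinearMap).prod
      { toFun := fun v =>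
          { toFun := fun x => metric v (infAct x p)
            map_add' := fun x y => by
              simp only [metric, infAct, ← Finset.sum_add_distrib]
              refine Finset.sum_congr rfl fun i _ => ?_
              simp; ring
            map_smul' := fun c x => by
              simp only [metric, infAct, Finset.smul_sum]
              refine Finset.sum_congr rfl fun i _ => ?_
              simp; ring }
        map_add' := fun v w => by
          ext x
          simp only [metric, infAct, LinearMap.coe_mk, AddHom.coe_mk, LinearMap.add_apply,
            ← Finset.sum_add_distrib]
          refine Finset.sum_congr rfl fun i _ => ?_
          simp; ring
        map_smul' := fun c v => by
          ext x
          simp only [metric, infAct, LinearMap.coe_mk, AddHom.coe_mk, LinearMap.smul_apply,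
            Finset.smul_sum]
          refine Finset.sum_congr rfl fun i _ => ?_
          simp; ring })

theorem mem_ker_horizontalEq {p v : HN N} : v ∈ LinearMap.ker (horizontalEq k p) ↔ v ∈ horizontal k p := by
  rw [LinearMap.mem_ker]
  constructor
  · intro h
    have h1 := congrArg Prod.fst h
    have h2 := congrArg (fun y => y.2.1) h
    have h3 := congrArg (fun y => y.2.2) h
    refine ⟨ContinuousLinearMap.coe_injective h1, ContinuousLinearMap.coe_injective h2, fun x hx => ?_⟩
    exact congrArg (fun T : k →ₗ[ℝ] ℝ => T ⟨x, hx⟩) h3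
  · rintro ⟨h1, h2, h3⟩
    refine Prod.ext ?_ (Prod.ext ?_ ?_)
    · exact congrArg (fun T : StrongDual ℝ k => (T : k →ₗ[ℝ] ℝ)) h1
    · exact congrArg (fun T : k →L[ℝ] ℂ => (T : k →ₗ[ℝ] ℂ)) h2
    · ext x; exact h3 x x.2

/-- There are 4 dim k real equations in dimension 4N. The lower bound suffices, because injectivity
into ℂ²ⁿ supplies the upper one. -/
theorem le_finrank_horizontal {n : ℕ} (hn : Module.finrank ℝ k + n = N) (p : HN N) :
    4 * n ≤ Module.finrank ℝ (LinearMap.ker (horizontalEq k p)) := by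
  have h1 := LinearMap.finrank_range_add_finrank_ker (horizontalEq k p)
  have h2 := Submodule.finrank_le (LinearMap.range (horizontalEq k p))
  have h3 : Module.finrank ℝ ((k →ₗ[ℝ] ℝ) × (k →ₗ[ℝ] ℂ) × (k →ₗ[ℝ] ℝ)) = 4 * Module.finrank ℝ k := by
    rw [Module.finrank_prod, Module.finrank_prod, Module.finrank_linearMap, Module.finrank_linearMap,
      Complex.finrank_real_complex, Module.finrank_self]
    ring
  have h4 : Module.finrank ℝ (HN N) = 4 * N := by
    rw [Module.finrank_prod, Module.finrank_pi_fintype]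
    simp [Complex.finrank_real_complex]; ring
  omega

/-- If the differential kills a horizontal v, pairing the images of v and Jv under Ω gives |v|² = 0.
So it is injective on the horizontal space, and bijective by dimension. -/
theorem IsSymplQuot.isHyperkahlerQuotient {n : ℕ} (hn : Module.finrank ℝ k + n = N) (hK : IsUnimodular k)
    [Nonempty (X k α β)] [ChartedSpace (Fin (2 * n) → ℂ) (X k α β)]
    {Ω : (x : X k α β) → TangentSpace 𝓘(ℂ, Fin (2 * n) → ℂ) x [⋀^Fin 2]→L[ℂ] ℂ}
    (h : IsSymplQuot k β (2 * n) (stab k α β) (Qm k α β) Ω) : IsHyperkahlerQuotient k α β Ω := by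
  refine ⟨h.isManifold, fun p => ?_⟩
  obtain ⟨F, hF, hFe, hΩ⟩ := h.inv_form p (level_subset_stab p.2)
  have hF' : ContDiffAt ℝ ω F p := hF.restrict_scalars ℝ
  have hfd : ∀ v, fderiv ℝ F p v = fderiv ℂ F p v := fun v => by
    rw [((hF.differentiableAt (by simp)).hasFDerivAt.restrictScalars ℝ).fderiv]; rfl
  have hmk : ∀ q : level k α β, Qm k α β q = X.mk q := fun q => Qm_of_mem_level hK q.2
  have hform : ∀ v ∈ horizontal k (p : HN N), ∀ v' : HN N, TanK k p v' →
      Ω (X.mk p) ![fderiv ℝ F p v, fderiv ℝ F p v'] = complexForm v v' := by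
    intro v hv v' hv'
    rw [← hΩ v v' (tanK_of_horizontal hv) hv', hfd, hfd, ← hmk p]
  have hinj : ∀ v ∈ horizontal k (p : HN N), fderiv ℝ F p v = 0 → v = 0 := by
    intro v hv h0
    by_contra hne
    have h1 := hform v hv (quatJ v) (tanK_quatJ hv)
    rw [h0] at h1
    refine complexForm_quatJ_ne hne ?_
    rw [← h1]
    exact (Ω (X.mk p)).map_coord_zero 0 rfl
  refine ⟨F, hF'.of_le le_top, ?_, ⟨fun _ _ => trivial, ?_, ?_⟩, fun v _ => ?_,
    fun v hv v' hv' => hform v hv v' (tanK_of_horizontal hv')⟩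
  · have : Filter.Tendsto (fun q : level k α β => (q : HN N)) (𝓝 p) (𝓝[stab k α β] (p : HN N)) :=
      tendsto_nhdsWithin_iff.2 ⟨continuous_subtype_val.continuousAt,
        Filter.Eventually.of_forall fun q => level_subset_stab q.2⟩
    filter_upwards [this.eventually hFe] with q hq
    rw [hq, hmk, hmk]
  · intro v hv v' hv' he
    rw [← sub_eq_zero]
    refine hinj _ ?_ (by rw [map_sub]; exact sub_eq_zero.2 he)
    rw [← mem_ker_horizontalEq] at hv hv' ⊢
    exact Submodule.sub_mem _ hv hv'
  · intro y _
    let T : LinearMap.ker (horizontalEq k (p : HN N)) →ₗ[ℝ] (Fin (2 * n) → ℂ) :=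
      (fderiv ℝ F p).toLinearMap.comp (Submodule.subtype _)
    have hT : Function.Injective T := by
      rw [← LinearMap.ker_eq_bot, LinearMap.ker_eq_bot']
      intro v hv
      exact Subtype.ext (hinj v (mem_ker_horizontalEq.1 v.2) hv)
    have h4 : Module.finrank ℝ (Fin (2 * n) → ℂ) = 4 * n := by
      rw [Module.finrank_pi_fintype]; simp [Complex.finrank_real_complex]; ring
    have h5 := LinearMap.finrank_le_finrank_of_injective hT
    have h6 := le_finrank_horizontal hn (p : HN N)
    have hs := (LinearMap.injective_iff_surjective_of_finrank_eq_finrank (f := T) (by omega)).1 hT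
    obtain ⟨v, hv⟩ := hs y
    exact ⟨v, mem_ker_horizontalEq.1 v.2, hv⟩
  · rw [hfd, hfd, map_smul]

end ToricHK

namespace ToricHK

variable {N : ℕ} {k : Submodule ℝ (Fin N → ℝ)} {α αp αm : StrongDual ℝ k} {β : k →L[ℝ] ℂ}
  {Y : Fin N → ℤ}

/-! ## Coordinates adapted to a wall -/

/-- The `Y`-component of the complex moment map. -/
def ysum (Y : Fin N → ℤ) (q : HN N) : ℂ := ∑ i, (Y i : ℂ) * (q.1 i * q.2 i)

/-- The coordinate of positive weight. -/
def xc (Y : Fin N → ℤ) (q : HN N) (i : Fin N) : ℂ := if Y i = 1 then q.1 i else q.2 i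

/-- The coordinate of negative weight. -/
def yc (Y : Fin N → ℤ) (q : HN N) (i : Fin N) : ℂ := if Y i = 1 then q.2 i else q.1 i

theorem xc_mul_yc (q : HN N) (i : Fin N) : xc Y q i * yc Y q i = q.1 i * q.2 i := by
  unfold xc yc; split_ifs <;> ring

section Unit

variable (hu : ∀ i, Y i = 0 ∨ Y i = 1 ∨ Y i = -1)
include hu

theorem hn_ext {q q' : HN N} (h0 : ∀ i, Y i = 0 → q.1 i = q'.1 i ∧ q.2 i = q'.2 i)
    (hx : ∀ i, Y i ≠ 0 → xc Y q i = xc Y q' i) (hy : ∀ i, Y i ≠ 0 → yc Y q i = yc Y q' i) : q = q' := by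
  ext i <;> rcases hu i with h | h | h
  · exact (h0 i h).1
  · have := hx i (by simp [h]); simpa [xc, h] using this
  · have := hy i (by simp [h]); simpa [yc, h] using this
  · exact (h0 i h).2
  · have := hy i (by simp [h]); simpa [yc, h] using this
  · have := hx i (by simp [h]); simpa [xc, h] using this

theorem yVanish_iff {q : HN N} : YVanish Y q ↔ ∀ i, Y i ≠ 0 → yc Y q i = 0 := by
  constructor
  · intro h i hi
    rcases hu i with h' | h' | h'
    · exact absurd h' hi
    · simp [yc, h', (h i).1 h']
    · simp [yc, h', (h i).2 h']
  · intro h i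
    refine ⟨fun h' => ?_, fun h' => ?_⟩
    · have := h i (by simp [h']); simpa [yc, h'] using this
    · have := h i (by simp [h']); simpa [yc, h'] using this

theorem xc_neg {q : HN N} {i : Fin N} (hi : Y i ≠ 0) : xc (-Y) q i = yc Y q i := by
  rcases hu i with h | h | h
  · exact absurd h hi
  · simp [xc, yc, h]
  · simp [xc, yc, h]

theorem yc_neg {q : HN N} {i : Fin N} (hi : Y i ≠ 0) : yc (-Y) q i = xc Y q i := by
  rcases hu i with h | h | h
  · exact absurd h hi
  · simp [xc, yc, h]
  · simp [xc, yc, h]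

theorem xc_blw (t : ℂ) (q : HN N) {i : Fin N} (hi : Y i ≠ 0) : xc Y (blw Y t q) i = xc Y q i := by
  rcases hu i with h | h | h
  · exact absurd h hi
  · simp [xc, blw, h]
  · simp [xc, blw, h]

theorem yc_blw (t : ℂ) (q : HN N) {i : Fin N} (hi : Y i ≠ 0) : yc Y (blw Y t q) i = t * yc Y q i := by
  rcases hu i with h | h | h
  · exact absurd h hi
  · simp [yc, blw, h]
  · simp [yc, blw, h]

theorem blw_mul_blw (t : ℂ) (q : HN N) (i : Fin N) : (blw Y t q).1 i * (blw Y t q).2 i =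
    (if Y i = 0 then 1 else t) * (q.1 i * q.2 i) := by
  rcases hu i with h | h | h <;> simp [blw, h] <;> ring

theorem yVanish_blw {t : ℂ} (ht : t ≠ 0) {q : HN N} : YVanish Y (blw Y t q) ↔ YVanish Y q := by
  rw [yVanish_iff hu, yVanish_iff hu]
  refine forall₂_congr fun i hi => ?_
  rw [yc_blw hu t q hi]; simp [ht]

theorem yVanish_blw_zero (q : HN N) : YVanish Y (blw Y 0 q) := by
  rw [yVanish_iff hu]
  intro i hi
  rw [yc_blw hu 0 q hi, zero_mul]

theorem yVanish_iff_blw_zero {q : HN N} : YVanish Y q ↔ blw Y 0 q = q := by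
  refine ⟨fun h => ?_, fun h => h ▸ yVanish_blw_zero hu q⟩
  rw [yVanish_iff hu] at h
  refine hn_ext hu (fun i hi => by simp [blw, hi]) (fun i hi => xc_blw hu _ _ hi) fun i hi => ?_
  rw [yc_blw hu _ _ hi, h i hi, mul_zero]

theorem ysum_blw (t : ℂ) (q : HN N) : ysum Y (blw Y t q) = t * ysum Y q := by
  unfold ysum
  rw [Finset.mul_sum]
  refine Finset.sum_congr rfl fun i _ => ?_
  rw [blw_mul_blw hu]
  by_cases h : Y i = 0
  · simp [h]
  · simp [h]; ring

theorem muC_blw_neg (t : ℂ) (q : HN N) : muC k (blw (-Y) t q) = muC k (blw Y t q) := by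
  have hu' : ∀ i, (-Y) i = 0 ∨ (-Y) i = 1 ∨ (-Y) i = -1 := fun i => by
    rcases hu i with h | h | h <;> simp [h]
  ext x
  rw [muC_apply, muC_apply]
  congr 1
  refine Finset.sum_congr rfl fun i _ => ?_
  rw [blw_mul_blw hu, blw_mul_blw hu']
  simp

theorem blw_neg_blw {s : ℂˣ} (q : HN N) : blw (-Y) s (blw Y (s⁻¹ : ℂˣ) q) = act (expY Y s) q := by
  ext i <;> rcases hu i with h | h | h <;> simp [blw, act, expY, h, mul_comm]

/-- For s ≠ 0 the points (s x, y) and (x, s y) lie in one K_ℂ-orbit, so the two blow-downs agree off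
the exceptional divisor. -/
theorem blw_neg_eq_act (s : ℂˣ) (q : HN N) : blw (-Y) s q = act (expY Y s) (blw Y s q) := by
  ext i <;> rcases hu i with h | h | h <;> simp [blw, act, expY, h, mul_comm]

end Unit

theorem blw_blw (s t : ℂ) (q : HN N) : blw Y s (blw Y t q) = blw Y (s * t) q := by
  ext i <;> simp only [blw] <;> split_ifs <;> ring

theorem blw_one (q : HN N) : blw Y 1 q = q := by
  ext i <;> simp [blw]

theorem blw_comm_neg (s t : ℂ) (q : HN N) : blw (-Y) s (blw Y t q) = blw Y t (blw (-Y) s q) := by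
  ext i <;> simp only [blw] <;> split_ifs <;> ring

theorem blw_act (t : ℂ) (ζ : Fin N → ℂˣ) (q : HN N) : blw Y t (act ζ q) = act ζ (blw Y t q) := by
  ext i <;> simp only [blw, act] <;> split_ifs <;> ring

theorem proj0_blw (t : ℂ) (q : HN N) : proj0 Y (blw Y t q) = proj0 Y q := by
  ext i <;> by_cases h : Y i = 0 <;> simp [proj0, blw, h]

theorem proj0_neg (q : HN N) : proj0 (-Y) q = proj0 Y q := by
  ext i <;> simp [proj0]

theorem contDiff_blw : ContDiff ℂ ω fun a : HN N × ℂ => blw Y a.2 a.1 := by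
  refine ContDiff.prodMk (contDiff_pi.2 fun l => ?_) (contDiff_pi.2 fun l => ?_) <;>
  · split_ifs <;> fun_prop

theorem ysum_act (ζ : Fin N → ℂˣ) (q : HN N) : ysum Y (act ζ q) = ysum Y q := by
  unfold ysum
  refine Finset.sum_congr rfl fun i _ => ?_
  simp only [act]
  have := (ζ i).ne_zero
  rw [Units.val_inv_eq_inv_val]; field_simp

/-- This is the Y-component of μ_ℂ = β, since β(Y) = 0. -/
theorem WallCrossing.ysum_eq_zero (W : WallCrossing k β α αp αm Y) {q : HN N} (hq : muC k q = β) :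
    ysum Y q = 0 := by
  have h := muC_apply q ⟨_, W.mem⟩
  have h2 : muC k q ⟨_, W.mem⟩ = 0 := by rw [hq]; exact W.beta
  rw [h2] at h
  have := (mul_eq_zero.1 h.symm).resolve_left two_pi_I_ne_zero
  rw [← this]
  refine Finset.sum_congr rfl fun i _ => ?_
  push_cast; ring

/-- The gauge `G` consists of coordinates of weight zero and the coordinate of positive weight with
index `j`. -/
structure IsAdapted (Y : Fin N → ℤ) (j : Fin N) (G : Gauge k β Set.univ) : Prop where
  unit : ∀ i, Y i = 0 ∨ Y i = 1 ∨ Y i = -1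
  mem : j ∈ G.B
  ne : Y j ≠ 0
  zero : ∀ i ∈ G.B, i ≠ j → Y i = 0
  ε_j : G.ε j = true ↔ Y j = 1
  e_j : ∀ l, G.e j l = Y j * Y l
  b_j : G.b j = 0

theorem Frame.linearIndepOn {A : Set (Fin N)} {B : Finset (Fin N)} {e : Fin N → Fin N → ℤ}
    (hB : Frame k A B e) : LinearIndepOn ℝ (iotaU k) (B : Set (Fin N)) := by
  refine (linearIndepOn_finset_iff (R := ℝ) (M := StrongDual ℝ k) (v := iotaU k)).2 ?_
  intro f hf j hj
  have h := congrArg (fun T : StrongDual ℝ k => T ⟨_, hB.mem j hj⟩) hf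
  simp only [sum_apply, smul_apply, iotaU_apply, smul_eq_mul] at h
  rw [Finset.sum_eq_single j] at h
  · simpa [hB.dual j hj j hj] using h
  · intro i hi hij
    simp [hB.dual j hj i hi, hij.symm]
  · intro h'; exact absurd hj h'

/-- One index j of non-zero weight completes a weight-zero frame. The vector dual to j vanishes at
all weight-zero indices, so it is a multiple of Y, and its j-th entry 1 fixes the factor as Yⱼ = ±1.
-/
theorem WallCrossing.exists_adapted_frame (W : WallCrossing k β α αp αm Y) (hK : IsUnimodular k)
    {I : Finset (Fin N)} {e : Fin N → Fin N → ℤ} (hI : Frame k {i | Y i = 0} I e) {j : Fin N} (hj : Y j ≠ 0) :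
    ∃ e', Frame k Set.univ (insert j I) e' ∧ ∀ l, e' j l = Y j * Y l := by
  have hdet : ∀ x ∈ k, (∀ i ∈ insert j (I : Set (Fin N)), x i = 0) → ∀ l ∈ Set.univ, x l = 0 := by
    intro x hx h l _
    obtain ⟨c, hc⟩ := W.line ⟨x, hx⟩ (hI.det x hx fun i hi => h i (Or.inr hi))
    have hc' : ∀ l, x l = c * Y l := fun l => congrFun (congrArg Subtype.val hc) l
    have h1 := h j (Or.inl rfl)
    rw [hc' j, mul_eq_zero] at h1
    rcases h1 with h1 | h1
    · rw [hc', h1, zero_mul]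
    · exact absurd (by exact_mod_cast h1) hj
  obtain ⟨B, e', hB, hIB, hBT⟩ := exists_frame hK (A := Set.univ) (T := insert j (I : Set (Fin N)))
    (B₀ := (I : Set (Fin N))) (Set.subset_univ _) hdet (Set.subset_insert _ _) hI.linearIndepOn
  have hjB : j ∈ B := by
    by_contra hjB
    have := hB.det _ W.mem (fun i hi => ?_) j trivial
    · exact hj (by exact_mod_cast this)
    · rcases hBT hi with rfl | h
      · exact absurd hi hjB
      · have := hI.sub i h
        simp only [Set.mem_ofPred_eq] at this
        simp [this]
  have hBe : B = insert j I := by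
    ext i
    rw [Finset.mem_insert]
    refine ⟨fun h => hBT h, ?_⟩
    rintro (rfl | h)
    · exact hjB
    · exact hIB h
  subst hBe
  refine ⟨e', hB, fun l => ?_⟩
  have hjI : j ∉ I := fun h => hj (hI.sub j h)
  obtain ⟨c, hc⟩ := W.line ⟨_, hB.mem j hjB⟩ (hI.det _ (hB.mem j hjB) fun i hi => by
    have : j ≠ i := by rintro rfl; exact hjI hi
    simp [hB.dual j hjB i (Finset.mem_insert_of_mem hi), this])
  have hc' : ∀ l, (e' j l : ℝ) = c * Y l := fun l => congrFun (congrArg Subtype.val hc) l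
  have h1 := hc' j
  rw [hB.dual j hjB j hjB, if_pos rfl] at h1
  have h2 : c = Y j := by
    rcases W.unit j with h | h | h
    · exact absurd h hj
    · rw [h] at h1 ⊢; push_cast at h1 ⊢; linarith
    · rw [h] at h1 ⊢; push_cast at h1 ⊢; linarith
  have h3 := hc' l
  rw [h2] at h3
  exact_mod_cast h3

/-- The normalized coordinates are those of G₀ and one non-zero xⱼ. The moment equation at j is then
∑ Yₗ xₗ yₗ = 0 up to the sign Yⱼ, hence has right-hand side 0. -/
theorem WallCrossing.exists_adapted (W : WallCrossing k β α αp αm Y) (hK : IsUnimodular k)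
    (G₀ : Gauge k β {i | Y i = 0}) {j : Fin N} (hj : Y j ≠ 0) {p : HN N} (hp : muC k p = β)
    (h0 : ∀ i ∈ G₀.B, raw G₀.ε p i ≠ 0) (hx : xc Y p j ≠ 0) :
    ∃ G : Gauge k β Set.univ, IsAdapted Y j G ∧ G.B = insert j G₀.B ∧ (∀ i ∈ G₀.B, G.ε i = G₀.ε i) ∧
      ∀ i ∈ G.B, raw G.ε p i = G.c i := by
  obtain ⟨e, he, hej⟩ := W.exists_adapted_frame hK G₀.frame hj
  have hjI : j ∉ G₀.B := fun h => hj (G₀.frame.sub j h)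
  have hpf : p ∈ fiberOn k β Set.univ := ⟨hp, fun l hl => absurd trivial hl⟩
  let ε : Fin N → Bool := fun i => if i = j then decide (Y j = 1) else G₀.ε i
  have hε : ∀ i ∈ G₀.B, ε i = G₀.ε i := fun i hi => by
    have : i ≠ j := by rintro rfl; exact hjI hi
    simp [ε, this]
  have hne : ∀ i ∈ insert j G₀.B, raw ε p i ≠ 0 := by
    intro i hi
    rcases Finset.mem_insert.1 hi with rfl | hi
    · unfold raw
      simpa [ε, xc] using hx
    · have := h0 i hi
      unfold raw at this ⊢
      rwa [hε i hi]
  refine ⟨Gauge.ofPoint he ε hpf hne, ⟨W.unit, Finset.mem_insert_self _ _, hj, fun i hi hij => ?_, ?_, hej, ?_⟩,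
    rfl, hε, fun i hi => rfl⟩
  · exact G₀.frame.sub i ((Finset.mem_insert.1 hi).resolve_left hij)
  · simp [Gauge.ofPoint, ε]
  · change ∑ l, p.1 l * p.2 l * (e j l : ℂ) = 0
    have := W.ysum_eq_zero hp
    unfold ysum at this
    calc _ = (Y j : ℂ) * ∑ l, (Y l : ℂ) * (p.1 l * p.2 l) := by
          rw [Finset.mul_sum]
          refine Finset.sum_congr rfl fun l _ => ?_
          rw [hej]; push_cast; ring
      _ = 0 := by rw [this, mul_zero]

/-- The stabilizer of c in K_ℂ is exactly the group generated by Y, not merely up to finite index.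
In an adapted frame η is 1 at every index other than j, so it is a monomial in ηⱼ with exponents Yⱼ
Yₗ. -/
theorem WallCrossing.exists_eq_expY (W : WallCrossing k β α αp αm Y) (hK : IsUnimodular k) {c : HN N}
    (hc : c ∈ stabFix k α β Y) {η : Fin N → ℂˣ} (hη : η ∈ complexSubtorus k) (h : act η c = c) :
    ∃ s : ℂˣ, η = expY Y s := by
  obtain ⟨j, hj⟩ := W.exists_ne
  obtain ⟨I, e, hI, -, hIT⟩ := exists_frame hK (A := {i | Y i = 0}) (T := coordSupp c) (B₀ := ∅)
    (coordSupp_subset_of_mem_fiberOn (stabFix_subset hc)) (W.stabFix_reg hc) (Set.empty_subset _)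
    (linearIndepOn_empty ℝ _)
  obtain ⟨e', he, hej⟩ := W.exists_adapted_frame hK hI hj
  have hjI : j ∉ I := fun h => hj (hI.sub j h)
  have h1 : ∀ i ∈ I, (η i : ℂ) = 1 := by
    intro i hi
    have h2 := congrFun (congrArg Prod.fst h) i
    have h3 := congrFun (congrArg Prod.snd h) i
    simp only [act] at h2 h3
    rcases hIT hi with h4 | h4
    · exact mul_left_cancel₀ h4 (by rw [h2, mul_one])
    · have := mul_left_cancel₀ h4 (h3.trans (mul_one _).symm)
      rw [Units.val_inv_eq_inv_val, inv_eq_one] at this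
      exact this
  refine ⟨η j ^ Y j, funext fun l => Units.ext ?_⟩
  rw [he.torus_expand hη (Set.mem_univ l), Finset.prod_insert hjI,
    Finset.prod_eq_one fun i hi => by rw [h1 i hi, one_zpow], mul_one, hej]
  simp [expY, zpow_mul]

end ToricHK

namespace ToricHK

variable {N : ℕ} {k : Submodule ℝ (Fin N → ℝ)} {α αp αm : StrongDual ℝ k} {β : k →L[ℝ] ℂ}
  {Y : Fin N → ℤ} {G : Gauge k β Set.univ} {j : Fin N}

/-! ## Lifts to the blow-up -/

/-- The point with the free coordinates of `h` such that `blw Y t` maps it to the slice. -/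
def lft (Y : Fin N → ℤ) (G : Gauge k β Set.univ) (j : Fin N) (h : HN N) (t : ℂ) : HN N :=
  (fun l => if Y l = 0 then (G.slc (blw Y t h)).1 l else if l = j then
      if Y j = 1 then G.c j else -(Y j : ℂ) * (∑ i ∈ G.Bᶜ, (Y i : ℂ) * (h.1 i * h.2 i)) / G.c j else h.1 l,
   fun l => if Y l = 0 then (G.slc (blw Y t h)).2 l else if l = j then
      if Y j = 1 then -(Y j : ℂ) * (∑ i ∈ G.Bᶜ, (Y i : ℂ) * (h.1 i * h.2 i)) / G.c j else G.c j else h.2 l)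

namespace IsAdapted

variable (hG : IsAdapted Y j G)
include hG

theorem raw_j (q : HN N) : raw G.ε q j = xc Y q j := by
  unfold raw xc
  by_cases h : Y j = 1
  · rw [if_pos (hG.ε_j.2 h), if_pos h]
  · rw [if_neg (fun h' => h (hG.ε_j.1 h')), if_neg h]

theorem c_ne : G.c j ≠ 0 := G.ne j hG.mem

theorem raw_of_ne {i : Fin N} (hi : i ∈ G.B) (hij : i ≠ j) {q q' : HN N}
    (h : ∀ i, Y i = 0 → q.1 i = q'.1 i ∧ q.2 i = q'.2 i) : raw G.ε q i = raw G.ε q' i := by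
  unfold raw
  rw [(h i (hG.zero i hi hij)).1, (h i (hG.zero i hi hij)).2]

theorem raw_blw (t : ℂ) (q : HN N) {i : Fin N} (hi : i ∈ G.B) : raw G.ε (blw Y t q) i = raw G.ε q i := by
  by_cases hij : i = j
  · subst hij
    rw [hG.raw_j, hG.raw_j, xc_blw hG.unit t q hG.ne]
  · exact hG.raw_of_ne hi hij fun i h => by simp [blw, h]

theorem blw_mem_dom (t : ℂ) (q : HN N) : blw Y t q ∈ G.dom ↔ q ∈ G.dom :=
  forall₂_congr fun i hi => by rw [hG.raw_blw t q hi]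

theorem gam_blw (t : ℂ) (q : HN N) (l : Fin N) : G.gam (blw Y t q) l = G.gam q l := by
  unfold Gauge.gam
  refine Finset.prod_congr rfl fun i hi => ?_
  have := hG.raw_blw t q hi
  unfold raw at this
  unfold Gauge.fac
  split_ifs at this ⊢ <;> rw [this]

theorem nrm_blw (t : ℂ) (q : HN N) : G.nrm (blw Y t q) = blw Y t (G.nrm q) := by
  ext l
  · simp only [Gauge.nrm, hG.gam_blw]
    simp only [blw]; split_ifs <;> ring
  · simp only [Gauge.nrm, hG.gam_blw]
    simp only [blw]; split_ifs <;> ring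

theorem xc_slc (a : HN N) {l : Fin N} (hl : Y l ≠ 0) :
    xc Y (G.slc a) l = if l = j then G.c j else xc Y a l := by
  split_ifs with h
  · subst h; rw [← hG.raw_j, Gauge.raw_slc a hG.mem]
  · have hB : l ∉ G.B := fun hB => hl (hG.zero l hB h)
    unfold xc
    rw [(Gauge.slc_of_notMem a hB).1, (Gauge.slc_of_notMem a hB).2]

theorem yc_slc (a : HN N) {l : Fin N} (hl : Y l ≠ 0) :
    yc Y (G.slc a) l = if l = j then
      -(Y j : ℂ) * (∑ i ∈ G.Bᶜ, (Y i : ℂ) * (a.1 i * a.2 i)) / G.c j else yc Y a l := by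
  split_ifs with h
  · subst h
    rw [eq_div_iff hG.c_ne]
    have h1 := Gauge.slc_mul (G := G) a hG.mem
    rw [← xc_mul_yc (Y := Y), hG.xc_slc a hl, if_pos rfl, hG.b_j] at h1
    rw [mul_comm, h1, zero_sub, Finset.mul_sum, ← Finset.sum_neg_distrib]
    refine Finset.sum_congr rfl fun i _ => ?_
    rw [hG.e_j]; push_cast; ring
  · have hB : l ∉ G.B := fun hB => hl (hG.zero l hB h)
    unfold yc
    rw [(Gauge.slc_of_notMem a hB).1, (Gauge.slc_of_notMem a hB).2]

theorem xc_lft (h : HN N) (t : ℂ) {l : Fin N} (hl : Y l ≠ 0) :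
    xc Y (lft Y G j h t) l = if l = j then G.c j else xc Y h l := by
  simp only [xc, lft, hl, if_false]
  by_cases h1 : l = j
  · subst h1; simp only [if_true]; split_ifs <;> rfl
  · simp only [h1, if_false]

theorem yc_lft (h : HN N) (t : ℂ) {l : Fin N} (hl : Y l ≠ 0) :
    yc Y (lft Y G j h t) l = if l = j then
      -(Y j : ℂ) * (∑ i ∈ G.Bᶜ, (Y i : ℂ) * (h.1 i * h.2 i)) / G.c j else yc Y h l := by
  simp only [yc, lft, hl, if_false]
  by_cases h1 : l = j
  · subst h1; simp only [if_true]; split_ifs <;> rfl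
  · simp only [h1, if_false]

/-- The equation for the j-th negative coordinate is homogeneous of degree one in the negative
coordinates. The lift solves it before multiplication by t, so it makes sense and stays holomorphic
at t = 0. -/
theorem blw_lft (h : HN N) (t : ℂ) : blw Y t (lft Y G j h t) = G.slc (blw Y t h) := by
  refine hn_ext hG.unit (fun i hi => by simp [blw, lft, hi]) (fun i hi => ?_) fun i hi => ?_
  · rw [xc_blw hG.unit _ _ hi, hG.xc_lft h t hi, hG.xc_slc _ hi, xc_blw hG.unit _ _ hi]
  · rw [yc_blw hG.unit _ _ hi, hG.yc_lft h t hi, hG.yc_slc _ hi, yc_blw hG.unit _ _ hi]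
    split_ifs with h1
    · have : ∑ i ∈ G.Bᶜ, (Y i : ℂ) * ((blw Y t h).1 i * (blw Y t h).2 i) =
          t * ∑ i ∈ G.Bᶜ, (Y i : ℂ) * (h.1 i * h.2 i) := by
        rw [Finset.mul_sum]
        refine Finset.sum_congr rfl fun i _ => ?_
        rw [blw_mul_blw hG.unit]
        by_cases h2 : Y i = 0
        · simp [h2]
        · simp only [h2, if_false]; ring
      rw [this]; ring
    · rfl

theorem ysum_split (q : HN N) : ysum Y q = (Y j : ℂ) * (xc Y q j * yc Y q j) +
    ∑ i ∈ G.Bᶜ, (Y i : ℂ) * (q.1 i * q.2 i) := by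
  unfold ysum
  rw [← Finset.sum_add_sum_compl G.B]
  congr 1
  rw [Finset.sum_eq_single j, xc_mul_yc]
  · intro i hi hij; simp [hG.zero i hi hij]
  · intro h; exact absurd hG.mem h

theorem Yj_mul_Yj : (Y j : ℂ) * Y j = 1 := by
  rcases hG.unit j with h | h | h
  · exact absurd h hG.ne
  · simp [h]
  · simp [h]

theorem lft_compl (h : HN N) (t : ℂ) {l : Fin N} (hl : l ∉ G.B) :
    (lft Y G j h t).1 l = h.1 l ∧ (lft Y G j h t).2 l = h.2 l := by
  have hlj : l ≠ j := by rintro rfl; exact hl hG.mem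
  by_cases h0 : Y l = 0
  · simp only [lft, h0, if_true]
    rw [(Gauge.slc_of_notMem _ hl).1, (Gauge.slc_of_notMem _ hl).2]
    simp [blw, h0]
  · simp [lft, h0, hlj]

theorem ysum_lft (h : HN N) (t : ℂ) : ysum Y (lft Y G j h t) = 0 := by
  rw [hG.ysum_split, hG.xc_lft h t hG.ne, hG.yc_lft h t hG.ne, if_pos rfl, if_pos rfl]
  have : ∑ i ∈ G.Bᶜ, (Y i : ℂ) * ((lft Y G j h t).1 i * (lft Y G j h t).2 i) =
      ∑ i ∈ G.Bᶜ, (Y i : ℂ) * (h.1 i * h.2 i) := Finset.sum_congr rfl fun i hi => by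
    rw [Finset.mem_compl] at hi
    rw [(hG.lft_compl h t hi).1, (hG.lft_compl h t hi).2]
  rw [this]
  have h1 := hG.c_ne
  have h2 := hG.Yj_mul_Yj
  generalize ∑ i ∈ G.Bᶜ, (Y i : ℂ) * (h.1 i * h.2 i) = σ
  field_simp
  linear_combination (-σ) * h2

theorem raw_lft (h : HN N) (t : ℂ) {i : Fin N} (hi : i ∈ G.B) : raw G.ε (lft Y G j h t) i = G.c i := by
  rw [← hG.raw_blw t _ hi, hG.blw_lft, Gauge.raw_slc _ hi]

theorem lft_mem_dom (h : HN N) (t : ℂ) : lft Y G j h t ∈ G.dom := fun i hi => by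
  rw [hG.raw_lft h t hi]; exact G.ne i hi

theorem nrm_lft (h : HN N) (t : ℂ) : G.nrm (lft Y G j h t) = lft Y G j h t :=
  Gauge.nrm_eq_self fun _ hi => hG.raw_lft h t hi

theorem lft_eq_self {q a : HN N} {t : ℂ} (hq : muC k (blw Y t q) = β) (hs : ysum Y q = 0)
    (hc : ∀ i ∈ G.B, raw G.ε q i = G.c i) (ha : ∀ l ∉ G.B, a.1 l = q.1 l ∧ a.2 l = q.2 l) :
    lft Y G j a t = q := by
  have h1 : G.slc (blw Y t a) = blw Y t q := by
    refine Gauge.slc_eq_self ⟨hq, fun l hl => absurd trivial hl⟩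
      (fun i hi => by rw [hG.raw_blw t q hi, hc i hi]) fun l hl => ?_
    simp only [blw, (ha l hl).1, (ha l hl).2, and_self]
  have hnB : ∀ i, Y i ≠ 0 → i ≠ j → i ∉ G.B := fun i hi hij hB => hi (hG.zero i hB hij)
  refine hn_ext hG.unit (fun i hi => ?_) (fun i hi => ?_) fun i hi => ?_
  · simp only [lft, hi, if_true, h1]
    simp [blw, hi]
  · rw [hG.xc_lft a t hi]
    split_ifs with hij
    · subst hij; rw [← hG.raw_j, hc i hG.mem]
    · unfold xc; rw [(ha i (hnB i hi hij)).1, (ha i (hnB i hi hij)).2]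
  · rw [hG.yc_lft a t hi]
    split_ifs with hij
    · subst hij
      rw [hG.ysum_split, ← hG.raw_j, hc i hG.mem] at hs
      have : ∑ l ∈ G.Bᶜ, (Y l : ℂ) * (a.1 l * a.2 l) = ∑ l ∈ G.Bᶜ, (Y l : ℂ) * (q.1 l * q.2 l) :=
        Finset.sum_congr rfl fun l hl => by
          rw [Finset.mem_compl] at hl
          rw [(ha l hl).1, (ha l hl).2]
      rw [this, div_eq_iff hG.c_ne]
      have h2 := hG.Yj_mul_Yj
      linear_combination (-(Y i : ℂ)) * hs + (G.c i * yc Y q i) * h2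
    · unfold yc; rw [(ha i (hnB i hi hij)).1, (ha i (hnB i hi hij)).2]

theorem lft_blw (s t : ℂ) (h : HN N) : lft Y G j (blw Y s h) t = blw Y s (lft Y G j h (t * s)) := by
  refine hn_ext hG.unit (fun i hi => ?_) (fun i hi => ?_) fun i hi => ?_
  · simp [lft, hi, blw_blw]; simp [blw, hi]
  · rw [hG.xc_lft _ _ hi, xc_blw hG.unit _ _ hi, xc_blw hG.unit _ _ hi, hG.xc_lft _ _ hi]
  · rw [hG.yc_lft _ _ hi, yc_blw hG.unit _ _ hi, yc_blw hG.unit _ _ hi, hG.yc_lft _ _ hi]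
    split_ifs with h1
    · have : ∑ i ∈ G.Bᶜ, (Y i : ℂ) * ((blw Y s h).1 i * (blw Y s h).2 i) =
          s * ∑ i ∈ G.Bᶜ, (Y i : ℂ) * (h.1 i * h.2 i) := by
        rw [Finset.mul_sum]
        refine Finset.sum_congr rfl fun i _ => ?_
        rw [blw_mul_blw hG.unit]
        by_cases h2 : Y i = 0
        · simp [h2]
        · simp only [h2, if_false]; ring
      rw [this]; ring
    · rfl

end IsAdapted

theorem contDiff_lft : ContDiff ℂ ω fun a : HN N × ℂ => lft Y G j a.1 a.2 := by
  have h1 : ContDiff ℂ ω fun a : HN N × ℂ => G.slc (blw Y a.2 a.1) := Gauge.contDiff_slc.comp contDiff_blw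
  refine ContDiff.prodMk (contDiff_pi.2 fun l => ?_) (contDiff_pi.2 fun l => ?_)
  · by_cases h0 : Y l = 0
    · simp only [h0, if_true]
      exact (coordL (l, true)).contDiff.comp h1
    · simp only [h0, if_false]
      split_ifs <;> fun_prop
  · by_cases h0 : Y l = 0
    · simp only [h0, if_true]
      exact (coordL (l, false)).contDiff.comp h1
    · simp only [h0, if_false]
      split_ifs <;> fun_prop

/-! ## The common blow-up -/

/-- The total space of the principal bundle over the common blow-up. -/
def Zhat (k : Submodule ℝ (Fin N → ℝ)) (β : k →L[ℝ] ℂ) (αp αm : StrongDual ℝ k) (Y : Fin N → ℤ) :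
    Set (HN N × ℂ) :=
  {a | blw Y a.2 a.1 ∈ stab k αp β ∧ blw (-Y) a.2 a.1 ∈ stab k αm β ∧ ysum Y a.1 = 0}

theorem Zhat_swap : Zhat k β αm αp (-Y) = Zhat k β αp αm Y := by
  ext a
  have : ysum (-Y) a.1 = -ysum Y a.1 := by simp [ysum]
  simp only [Zhat, Set.mem_ofPred_eq, neg_neg, this, neg_eq_zero]
  tauto

variable (W : WallCrossing k β α αp αm Y)
include W

/-- A one-sided description: given α₊-stability of (x, t y) and the equation, α₋-stability of (t x,
y) only asks that y ≠ 0. For t ≠ 0 the two points share an orbit off V₊; for t = 0 both are tested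
on the same weight-zero part. -/
theorem WallCrossing.mem_Zhat_iff {p : HN N} {t : ℂ} : (p, t) ∈ Zhat k β αp αm Y ↔
    blw Y t p ∈ stab k αp β ∧ ysum Y p = 0 ∧ ¬ YVanish Y p := by
  have hu := W.unit
  have hu' := W.swap.unit
  constructor
  · rintro ⟨h1, h2, h3⟩
    refine ⟨h1, h3, fun h => W.swap.not_yVanish_neg h2 ?_⟩
    rw [neg_neg, yVanish_iff hu]
    intro i hi
    have hi' : (-Y) i ≠ 0 := by simpa using hi
    have := xc_blw hu' t p hi'
    rw [xc_neg hu hi, xc_neg hu hi] at this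
    rw [this]; exact (yVanish_iff hu).1 h i hi
  · rintro ⟨h1, h2, h3⟩
    refine ⟨h1, ?_, h2⟩
    by_cases ht : t = 0
    · subst ht
      refine W.swap.mem_stab_of_proj0 ?_ (yVanish_blw_zero hu' p) ?_
      · rw [proj0_blw, proj0_neg, ← proj0_blw (Y := Y) 0]
        exact W.proj0_mem_stab h1 (yVanish_blw_zero hu p)
      · rw [neg_neg]
        refine fun h => h3 ((yVanish_iff hu).2 fun i hi => ?_)
        have hi' : (-Y) i ≠ 0 := by simpa using hi
        have h4 := xc_blw hu' 0 p hi'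
        rw [xc_neg hu hi, xc_neg hu hi] at h4
        rw [← h4]; exact (yVanish_iff hu).1 h i hi
    · have := blw_neg_eq_act hu (Units.mk0 t ht) p
      simp only [Units.val_mk0] at this
      simp only [this]
      exact act_mem_stab (expY_mem W.mem _)
        (W.mem_stab_of_not_yVanish h1 fun h => h3 ((yVanish_blw hu ht).1 h)).2

theorem WallCrossing.act_mem_Zhat {ζ : Fin N → ℂˣ} (hζ : ζ ∈ complexSubtorus k) {p : HN N} {t : ℂ}
    (h : (p, t) ∈ Zhat k β αp αm Y) : (act ζ p, t) ∈ Zhat k β αp αm Y := by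
  rw [W.mem_Zhat_iff] at h ⊢
  rw [blw_act, ysum_act, yVanish_act]
  exact ⟨act_mem_stab hζ h.1, h.2⟩

theorem WallCrossing.blw_mem_Zhat {s : ℂ} (hs : s ≠ 0) {p : HN N} {t : ℂ}
    (h : (p, t) ∈ Zhat k β αp αm Y) : (blw Y s⁻¹ p, s * t) ∈ Zhat k β αp αm Y := by
  rw [W.mem_Zhat_iff] at h ⊢
  rw [blw_blw, ysum_blw W.unit, yVanish_blw W.unit (inv_ne_zero hs), h.2.1, mul_zero]
  have : s * t * s⁻¹ = t := by field_simp
  rw [this]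
  exact ⟨h.1, rfl, h.2.2⟩

variable [Nonempty (X k αp β)] [Nonempty (X k αm β)]

/-- The pair of maps to X(α₊, β) and X(α₋, β) has exactly the orbits of K_ℂ × ℂˣ as fibres. -/
theorem WallCrossing.Q_eq_iff (hK : IsUnimodular k) {a b : HN N × ℂ} (ha : a ∈ Zhat k β αp αm Y)
    (hb : b ∈ Zhat k β αp αm Y) :
    (Qm k αp β (blw Y a.2 a.1) = Qm k αp β (blw Y b.2 b.1) ∧
      Qm k αm β (blw (-Y) a.2 a.1) = Qm k αm β (blw (-Y) b.2 b.1)) ↔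
    ∃ ζ ∈ complexSubtorus k, ∃ s : ℂ, s ≠ 0 ∧ b.1 = act ζ (blw Y s⁻¹ a.1) ∧ b.2 = s * a.2 := by
  obtain ⟨p, t⟩ := a
  obtain ⟨p', t'⟩ := b
  have hu := W.unit
  have hu' := W.swap.unit
  simp only
  rw [Qm_eq_iff hK ha.1 hb.1, Qm_eq_iff hK ha.2.1 hb.2.1]
  have hz := (W.mem_Zhat_iff.1 ha)
  have hz' := (W.mem_Zhat_iff.1 hb)
  constructor
  · rintro ⟨⟨ζ, hζ, h⟩, ⟨ζ', hζ', h'⟩⟩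
    have htt : t = 0 ↔ t' = 0 := by
      constructor
      · rintro rfl
        by_contra ht'
        have h1 := (yVanish_act ζ _).2 (yVanish_blw_zero hu p)
        rw [h] at h1
        exact hz'.2.2 ((yVanish_blw hu ht').1 h1)
      · rintro rfl
        by_contra ht
        have h1 := yVanish_blw_zero hu p'
        rw [← h] at h1
        exact hz.2.2 ((yVanish_blw hu ht).1 ((yVanish_act ζ _).1 h1))
    by_cases ht : t = 0
    · have ht' := htt.1 ht
      subst ht ht'
      have hc : proj0 Y p' ∈ stabFix k α β Y := by
        refine ⟨?_, fun i hi => by simp [proj0, hi]⟩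
        rw [← proj0_blw 0]
        exact W.proj0_mem_stab hb.1 (yVanish_blw_zero hu p')
      have e1 : act ζ (proj0 Y p) = proj0 Y p' := by
        rw [← proj0_blw 0 p, ← proj0_act, h, proj0_blw]
      have e2 : act ζ' (proj0 Y p) = proj0 Y p' := by
        rw [← proj0_neg, ← proj0_blw 0 p, ← proj0_act, h', proj0_blw, proj0_neg]
      -- Both group elements agree on the weight-zero part, so they differ by an element of the
      -- group generated by Y. Its parameter is the scaling that was sought.
      obtain ⟨s, hs⟩ := W.exists_eq_expY hK hc (mul_mem hζ' (inv_mem hζ)) (by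
        rw [act_mul, ← e1, act_inv_act, e2, e1])
      have hζs : ζ' = expY Y s * ζ := by rw [← hs]; simp
      refine ⟨ζ, hζ, s, s.ne_zero, ?_, by simp⟩
      refine hn_ext hu (fun i hi => ?_) (fun i hi => ?_) fun i hi => ?_
      · have f1 := congrFun (congrArg Prod.fst e1) i
        have f2 := congrFun (congrArg Prod.snd e1) i
        simp only [act, proj0, hi, if_true] at f1 f2
        simp only [act, blw, hi]
        exact ⟨by simpa using f1.symm, by simpa using f2.symm⟩
      · have f1 := congrArg (fun q => xc Y q i) h
        simp only [xc_blw hu _ _ hi] at f1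
        rw [← f1]
        simp only [xc, act]
        have := xc_blw hu 0 p hi
        have := xc_blw hu (s : ℂ)⁻¹ p hi
        simp only [xc] at *
        split_ifs at * <;> simp_all
      · have hi' : (-Y) i ≠ 0 := by simpa using hi
        have f1 := congrArg (fun q => xc (-Y) q i) h'
        simp only [xc_blw hu' _ _ hi'] at f1
        rw [xc_neg hu hi, xc_neg hu hi] at f1
        rw [← f1, hζs]
        rcases hu i with hY | hY | hY
        · exact absurd hY hi
        · simp [yc, act, hY, blw, expY]; ring
        · simp [yc, act, hY, blw, expY]; ring
    · have ht' : t' ≠ 0 := fun h => ht (htt.2 h)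
      refine ⟨ζ, hζ, t' / t, div_ne_zero ht' ht, ?_, by field_simp⟩
      have := congrArg (blw Y t'⁻¹) h
      rw [blw_blw, inv_mul_cancel₀ ht', blw_one, blw_act, blw_blw] at this
      refine this.symm.trans ?_
      simp only [inv_div]
      congr 2
      field_simp
  · rintro ⟨ζ, hζ, s, hs, rfl, rfl⟩
    refine ⟨⟨ζ, hζ, ?_⟩, ⟨ζ * expY Y (Units.mk0 s hs), mul_mem hζ (expY_mem W.mem _), ?_⟩⟩
    · rw [blw_act, blw_blw]
      congr 2; field_simp
    · rw [blw_act, act_mul]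
      congr 1
      rw [← blw_neg_blw hu, ← blw_comm_neg (Y := Y) t, blw_blw]
      simp

end ToricHK

/-! ### Charts of the common blow-up -/

namespace ToricHK

variable {N : ℕ} {k : Submodule ℝ (Fin N → ℝ)} {α αp αm : StrongDual ℝ k} {β : k →L[ℝ] ℂ}
  {Y : Fin N → ℤ} {d : ℕ}

theorem contDiff_lft_comp {E : Type*} [NormedAddCommGroup E] [NormedSpace ℂ E] {G : Gauge k β Set.univ}
    {j : Fin N} {f : E → HN N} {g : E → ℂ} (hf : ContDiff ℂ ω f) (hg : ContDiff ℂ ω g) :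
    ContDiff ℂ ω fun b => lft Y G j (f b) (g b) :=
  ContDiff.comp (g := fun a : HN N × ℂ => lft Y G j a.1 a.2) (f := fun b => (f b, g b)) contDiff_lft
    (hf.prodMk hg)

/-- Replace the `j`-th coordinate of negative weight by `v`. -/
def ysub (Y : Fin N → ℤ) (j : Fin N) (v : ℂ) (q : HN N) : HN N :=
  (fun l => if l = j ∧ Y j ≠ 1 then v else q.1 l, fun l => if l = j ∧ Y j = 1 then v else q.2 l)

theorem yc_ysub (j : Fin N) (v : ℂ) (q : HN N) (l : Fin N) :
    yc Y (ysub Y j v q) l = if l = j then v else yc Y q l := by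
  unfold yc ysub
  by_cases h : l = j
  · subst h
    by_cases h1 : Y l = 1 <;> simp [h1]
  · simp [h]

theorem ysub_ysub (j : Fin N) (v v' : ℂ) (q : HN N) : ysub Y j v (ysub Y j v' q) = ysub Y j v q := by
  ext l <;> simp only [ysub] <;> split_ifs <;> rfl

theorem ysub_eq_self {j : Fin N} {v : ℂ} {q : HN N} (h : yc Y q j = v) : ysub Y j v q = q := by
  subst h
  ext l
  · by_cases hl : l = j
    · subst hl
      by_cases h1 : Y l = 1 <;> simp [ysub, yc, h1]
    · exact (by simp [ysub, hl])
  · by_cases hl : l = j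
    · subst hl
      by_cases h1 : Y l = 1 <;> simp [ysub, yc, h1]
    · exact (by simp [ysub, hl])

theorem contDiff_yc (j : Fin N) : ContDiff ℂ ω fun q : HN N => yc Y q j := by
  unfold yc; split_ifs <;> fun_prop

theorem contDiff_ysub (j : Fin N) : ContDiff ℂ ω fun a : HN N × ℂ => ysub Y j a.2 a.1 := by
  refine ContDiff.prodMk (contDiff_pi.2 fun l => ?_) (contDiff_pi.2 fun l => ?_) <;>
  · split_ifs <;> fun_prop

theorem yc_nrm_ne {G : Gauge k β Set.univ} {q : HN N} (hq : q ∈ G.dom) (j : Fin N) :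
    yc Y (G.nrm q) j ≠ 0 ↔ yc Y q j ≠ 0 := by
  have := Gauge.gam_ne hq j
  unfold yc Gauge.nrm
  split_ifs <;> simp [this]

/-- The common blow-up of `X(α₊, β)` and `X(α₋, β)`. -/
def ZB (k : Submodule ℝ (Fin N → ℝ)) (β : k →L[ℝ] ℂ) (αp αm : StrongDual ℝ k) (Y : Fin N → ℤ)
    [Nonempty (X k αp β)] [Nonempty (X k αm β)] : Type :=
  Quotient (Setoid.ker fun a : Zhat k β αp αm Y =>
    (Qm k αp β (blw Y a.1.2 a.1.1), Qm k αm β (blw (-Y) a.1.2 a.1.1)))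

section Quot

variable [Nonempty (X k αp β)] [Nonempty (X k αm β)]

instance : TopologicalSpace (ZB k β αp αm Y) :=
  inferInstanceAs (TopologicalSpace (Quotient (Setoid.ker fun a : Zhat k β αp αm Y =>
    (Qm k αp β (blw Y a.1.2 a.1.1), Qm k αm β (blw (-Y) a.1.2 a.1.1)))))

/-- The class of a point in the common blow-up. -/
def ZB.mk (a : Zhat k β αp αm Y) : ZB k β αp αm Y := Quotient.mk _ a

open Classical in
/-- The map to the common blow-up. -/
def QZ (k : Submodule ℝ (Fin N → ℝ)) (β : k →L[ℝ] ℂ) (αp αm : StrongDual ℝ k) (Y : Fin N → ℤ)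
    [Nonempty (X k αp β)] [Nonempty (X k αm β)] [Nonempty (ZB k β αp αm Y)] (a : HN N × ℂ) : ZB k β αp αm Y :=
  if h : a ∈ Zhat k β αp αm Y then ZB.mk ⟨a, h⟩ else Classical.arbitrary _

theorem isQuotientMap_QZ [Nonempty (ZB k β αp αm Y)] :
    Topology.IsQuotientMap ((Zhat k β αp αm Y).domRestrict (QZ k β αp αm Y)) := by
  have h : ((Zhat k β αp αm Y).domRestrict (QZ k β αp αm Y)) = ZB.mk := funext fun a => dif_pos a.2
  rw [h]
  exact isQuotientMap_quotient_mk'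

theorem QZ_eq_iff [Nonempty (ZB k β αp αm Y)] {a b : HN N × ℂ} (ha : a ∈ Zhat k β αp αm Y)
    (hb : b ∈ Zhat k β αp αm Y) : QZ k β αp αm Y a = QZ k β αp αm Y b ↔
      Qm k αp β (blw Y a.2 a.1) = Qm k αp β (blw Y b.2 b.1) ∧
      Qm k αm β (blw (-Y) a.2 a.1) = Qm k αm β (blw (-Y) b.2 b.1) := by
  rw [QZ, QZ, dif_pos ha, dif_pos hb]
  constructor
  · intro h
    have h1 := Quotient.exact h
    exact ⟨congrArg Prod.fst h1, congrArg Prod.snd h1⟩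
  · intro h
    exact Quotient.sound (Prod.ext h.1 h.2)

/-- A complex manifold that is the quotient of `Zhat`. -/
structure ZQuot {M : Type} [TopologicalSpace M] [ChartedSpace (Fin d → ℂ) M]
    (k : Submodule ℝ (Fin N → ℝ)) (β : k →L[ℝ] ℂ) (αp αm : StrongDual ℝ k) (Y : Fin N → ℤ)
    [Nonempty (X k αp β)] [Nonempty (X k αm β)] (Q : HN N × ℂ → M) : Prop where
  hol : IsHolQuot d (Zhat k β αp αm Y) Q
  eq_iff : ∀ a ∈ Zhat k β αp αm Y, ∀ b ∈ Zhat k β αp αm Y, Q a = Q b ↔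
      Qm k αp β (blw Y a.2 a.1) = Qm k αp β (blw Y b.2 b.1) ∧
      Qm k αm β (blw (-Y) a.2 a.1) = Qm k αm β (blw (-Y) b.2 b.1)

theorem ZQuot.swap {M : Type} [TopologicalSpace M] [ChartedSpace (Fin d → ℂ) M] {Q : HN N × ℂ → M}
    (h : ZQuot (d := d) k β αp αm Y Q) : ZQuot (d := d) k β αm αp (-Y) Q := by
  refine ⟨by rw [Zhat_swap]; exact h.hol, fun a ha b hb => ?_⟩
  rw [Zhat_swap] at ha hb
  rw [h.eq_iff a ha b hb, neg_neg, and_comm]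

end Quot

section Charts

variable (W : WallCrossing k β α αp αm Y)
include W

theorem WallCrossing.unblow_mem_Zhat {q : HN N} (hq : q ∈ stab k αp β) (hv : ¬ YVanish Y q) {t : ℂ}
    (ht : t ≠ 0) : (blw Y t⁻¹ q, t) ∈ Zhat k β αp αm Y := by
  rw [W.mem_Zhat_iff, blw_blw, mul_inv_cancel₀ ht, blw_one, ysum_blw W.unit,
    W.ysum_eq_zero (muC_of_mem_stab hq), mul_zero, yVanish_blw W.unit (inv_ne_zero ht)]
  exact ⟨hq, rfl, hv⟩

/-- The exceptional divisor is t = 0: the negative coordinates y themselves are never all zero, so t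
y = 0 only for t = 0. -/
theorem WallCrossing.snd_ne_zero_iff {a : HN N × ℂ} (ha : a ∈ Zhat k β αp αm Y) :
    a.2 ≠ 0 ↔ ¬ YVanish Y (blw Y a.2 a.1) := by
  constructor
  · intro h
    rw [yVanish_blw W.unit h]
    exact (W.mem_Zhat_iff.1 ha).2.2
  · intro h h0
    rw [h0] at h
    exact h (yVanish_blw_zero W.unit _)

variable [Nonempty (X k αp β)] [Nonempty (X k αm β)]

omit [Nonempty (X k αp β)] in
theorem WallCrossing.Q_minus (hK : IsUnimodular k) {p : HN N} {t : ℂ} (ht : t ≠ 0)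
    (h : (p, t) ∈ Zhat k β αp αm Y) :
    blw Y t p ∈ stab k αm β ∧ Qm k αm β (blw (-Y) t p) = Qm k αm β (blw Y t p) := by
  have h1 := (W.mem_stab_of_not_yVanish h.1 ((W.snd_ne_zero_iff h).1 ht)).2
  refine ⟨h1, ?_⟩
  have h2 := blw_neg_eq_act W.unit (Units.mk0 t ht) p
  simp only [Units.val_mk0] at h2
  rw [h2, Qm_act hK (expY_mem W.mem _) h1]

/-- The chart of the blow-up away from the exceptional divisor. -/
def WallCrossing.chartOff (hK : IsUnimodular k) [Nonempty (ZB k β αp αm Y)]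
    (hS : TorusQuot k β Set.univ (stab k αp β) (Qm k αp β)) {p₀ : HN N × ℂ}
    (hp₀ : p₀ ∈ Zhat k β αp αm Y) (ht₀ : p₀.2 ≠ 0) (g : GaugeAt k β Set.univ d (blw Y p₀.2 p₀.1)) :
    LocalChart (Fin d → ℂ) (Zhat k β αp αm Y) (QZ k β αp αm Y) p₀ := by
  have hvac : ∀ q : HN N, ∀ l ∉ (Set.univ : Set (Fin N)), q.1 l = 0 ∧ q.2 l = 0 :=
    fun q l hl => absurd trivial hl
  have hblw : Continuous fun a : HN N × ℂ => blw Y a.2 a.1 := contDiff_blw.continuous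
  -- Off the divisor the α₊-class alone determines the point of the blow-up, and any non-zero t may
  -- represent it; p₀.2 is used so that the section passes through p₀.
  have hzQ : ∀ a ∈ Zhat k β αp αm Y, ∀ q ∈ stab k αp β, a.2 ≠ 0 →
      Qm k αp β q = Qm k αp β (blw Y a.2 a.1) →
      QZ k β αp αm Y (blw Y p₀.2⁻¹ q, p₀.2) = QZ k β αp αm Y a := by
    rintro ⟨p, t⟩ ha q hq ht hQ
    obtain ⟨ζ, hζ, h⟩ := (Qm_eq_iff hK hq ha.1).1 hQ
    have hv : ¬ YVanish Y q := by
      have := (W.snd_ne_zero_iff ha).1 ht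
      rw [← h, yVanish_act] at this
      exact this
    have hz := W.unblow_mem_Zhat hq hv ht₀
    rw [QZ_eq_iff hz ha]
    obtain ⟨m1, e1⟩ := W.Q_minus hK ht₀ hz
    obtain ⟨m2, e2⟩ := W.Q_minus hK ht ha
    simp only at e1 e2 ⊢
    rw [e1, e2]
    rw [blw_blw, mul_inv_cancel₀ ht₀, blw_one] at m1 ⊢
    exact ⟨hQ, (Qm_eq_iff hK m1 m2).2 ⟨ζ, hζ, h⟩⟩
  refine (LocalChart.ofInvariant (F := fun a => g.sl.κ (g.G.nrm (blw Y a.2 a.1)))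
    (s := fun b => (blw Y p₀.2⁻¹ (g.G.slc (g.sl.ρ b)), p₀.2))
    (D := {a | blw Y a.2 a.1 ∈ g.G.dom ∧ a.2 ≠ 0})
    (T := {b | g.G.slc (g.sl.ρ b) ∈ stab k αp β} ∩ {b | ¬ YVanish Y (g.G.slc (g.sl.ρ b))})
    isQuotientMap_QZ ?_ ?_ (fun a ha => ?_) ?_ (fun b hb => ?_) (fun a ha haD => ?_)
    (fun a ha a' ha' h haD => ?_) hp₀ ⟨fun i hi => ?_, ht₀⟩ ?_).1
  · exact (Gauge.isOpen_dom.preimage hblw).inter (isOpen_ne_fun continuous_snd continuous_const)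
  · refine (hS.isOpen_slc g.G g.sl).inter ?_
    exact (isClosed_yVanish (Y := Y)).isOpen_compl.preimage
      (Gauge.contDiff_slc.continuous.comp g.sl.ρ.continuous)
  · exact g.sl.κ.contDiff.contDiffAt.comp a
      (ContDiffAt.comp a (Gauge.contDiffAt_nrm ha.1) contDiff_blw.contDiffAt)
  · refine ContDiff.contDiffOn (ContDiff.prodMk ?_ contDiff_const)
    exact contDiff_blw.comp ((Gauge.contDiff_slc.comp g.sl.ρ.contDiff).prodMk contDiff_const)
  · have hz := W.unblow_mem_Zhat hb.1 hb.2 ht₀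
    have he : blw Y p₀.2 (blw Y p₀.2⁻¹ (g.G.slc (g.sl.ρ b))) = g.G.slc (g.sl.ρ b) := by
      rw [blw_blw, mul_inv_cancel₀ ht₀, blw_one]
    refine ⟨hz, ⟨?_, ht₀⟩, ?_⟩
    · change blw Y p₀.2 (blw Y p₀.2⁻¹ (g.G.slc (g.sl.ρ b))) ∈ g.G.dom
      rw [he]; exact Gauge.slc_mem_dom _
    · change g.sl.κ (g.G.nrm (blw Y p₀.2 (blw Y p₀.2⁻¹ (g.G.slc (g.sl.ρ b))))) = b
      rw [he, Gauge.nrm_slc, Gauge.κ_slc]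
  · have h1 := hS.Q_nrm g.G ha.1 haD.1
    have h2 : g.G.slc (g.sl.ρ (g.sl.κ (g.G.nrm (blw Y a.2 a.1)))) = g.G.nrm (blw Y a.2 a.1) :=
      g.G.slc_nrm g.sl (hS.sub ha.1) haD.1
    simp only [h2]
    refine ⟨⟨by simpa only [Set.mem_ofPred_eq, h2] using h1.1, ?_⟩, hzQ a ha _ h1.1 haD.2 h1.2⟩
    simp only [Set.mem_ofPred_eq, h2]
    obtain ⟨ζ, hζ, -, h3⟩ := Gauge.exists_nrm_eq_act haD.1
    rw [h3, yVanish_act]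
    exact (W.snd_ne_zero_iff ha).1 haD.2
  · have h1 := ((QZ_eq_iff ha ha').1 h).1
    obtain ⟨ζ, hζ, h2⟩ := (Qm_eq_iff hK ha.1 ha'.1).1 h1
    refine ⟨⟨?_, ?_⟩, ?_⟩
    · rw [← h2, Gauge.act_mem_dom]; exact haD.1
    · rw [W.snd_ne_zero_iff ha', ← h2, yVanish_act, ← W.snd_ne_zero_iff ha]; exact haD.2
    · rw [← h2, Gauge.nrm_act hζ (hvac _)]
  · rw [g.hc i hi]; exact g.G.ne i hi
  · have hd : blw Y p₀.2 p₀.1 ∈ g.G.dom := fun i hi => by rw [g.hc i hi]; exact g.G.ne i hi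
    rw [g.G.slc_nrm g.sl (hS.sub hp₀.1) hd, Gauge.nrm_eq_self g.hc, blw_blw, inv_mul_cancel₀ ht₀, blw_one]

theorem WallCrossing.isOpen_preimage_Zhat (hSp : TorusQuot k β Set.univ (stab k αp β) (Qm k αp β))
    (hSm : TorusQuot k β Set.univ (stab k αm β) (Qm k αm β)) {T : Type*} [TopologicalSpace T]
    {f : T → HN N × ℂ} (hf : Continuous f) (h1 : ∀ b, muC k (blw Y (f b).2 (f b).1) = β)
    (h2 : ∀ b, ysum Y (f b).1 = 0) : IsOpen {b | f b ∈ Zhat k β αp αm Y} := by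
  rw [isOpen_iff_mem_nhds]
  intro b hb
  have hc1 : Filter.Tendsto (fun b => blw Y (f b).2 (f b).1) (𝓝 b)
      (𝓝[fiberOn k β Set.univ] (blw Y (f b).2 (f b).1)) :=
    tendsto_nhdsWithin_iff.2 ⟨(contDiff_blw.continuous.comp hf).continuousAt,
      Filter.Eventually.of_forall fun b => ⟨h1 b, fun l hl => absurd trivial hl⟩⟩
  have hc2 : Filter.Tendsto (fun b => blw (-Y) (f b).2 (f b).1) (𝓝 b)
      (𝓝[fiberOn k β Set.univ] (blw (-Y) (f b).2 (f b).1)) :=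
    tendsto_nhdsWithin_iff.2 ⟨(contDiff_blw.continuous.comp hf).continuousAt,
      Filter.Eventually.of_forall fun b => ⟨by rw [muC_blw_neg W.unit]; exact h1 b,
        fun l hl => absurd trivial hl⟩⟩
  filter_upwards [hc1.eventually (hSp.isOpen _ hb.1), hc2.eventually (hSm.isOpen _ hb.2.1)] with b' e1 e2
  exact ⟨e1, e2, h2 b'⟩

/-- The representative of a point of the blow-up that is normalized by `G` and by `yc Y · j₁ = y₁`. -/
def zrep (Y : Fin N → ℤ) (G : Gauge k β Set.univ) (j₁ : Fin N) (y₁ : ℂ) (a : HN N × ℂ) : HN N × ℂ :=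
  (blw Y (yc Y (G.nrm a.1) j₁ / y₁)⁻¹ (G.nrm a.1), yc Y (G.nrm a.1) j₁ / y₁ * a.2)

/-- The section of the blow-up over the chart at a point of the exceptional divisor. -/
def zsec (Y : Fin N → ℤ) (G : Gauge k β Set.univ) (j j₁ : Fin N) (y₁ : ℂ) (h : HN N) : HN N × ℂ :=
  (lft Y G j (ysub Y j₁ y₁ h) (yc Y h j₁), yc Y h j₁)

omit W in
theorem contDiff_zsec {G : Gauge k β Set.univ} {j j₁ : Fin N} {y₁ : ℂ} :
    ContDiff ℂ ω (zsec Y G j j₁ y₁) := by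
  have e1 : ContDiff ℂ ω fun b : HN N => yc Y b j₁ := contDiff_yc j₁
  have e2 : ContDiff ℂ ω fun b : HN N => (b, y₁) := contDiff_id.prodMk contDiff_const
  have e3 : ContDiff ℂ ω fun b : HN N => ysub Y j₁ y₁ b := (contDiff_ysub (Y := Y) j₁).comp e2
  exact (contDiff_lft_comp e3 e1).prodMk e1

omit W in
theorem contDiffAt_zrep {G : Gauge k β Set.univ} {j₁ : Fin N} {y₁ : ℂ} (hy : y₁ ≠ 0)
    {a : HN N × ℂ} (ha : a.1 ∈ G.dom) (hya : yc Y a.1 j₁ ≠ 0) :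
    ContDiffAt ℂ ω (zrep Y G j₁ y₁) a := by
  have hn : ContDiffAt ℂ ω (fun a : HN N × ℂ => G.nrm a.1) a :=
    ContDiffAt.comp a (Gauge.contDiffAt_nrm ha) contDiff_fst.contDiffAt
  have hl : ContDiffAt ℂ ω (fun a : HN N × ℂ => yc Y (G.nrm a.1) j₁ / y₁) a :=
    ContDiffAt.div_const (ContDiffAt.comp a (contDiff_yc j₁).contDiffAt hn) _
  have hb : ContDiffAt ℂ ω (fun a : HN N × ℂ => blw Y (yc Y (G.nrm a.1) j₁ / y₁)⁻¹ (G.nrm a.1)) a :=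
    ContDiffAt.comp (g := fun c : HN N × ℂ => blw Y c.2 c.1) a contDiff_blw.contDiffAt
      (hn.prodMk (hl.inv (div_ne_zero ((yc_nrm_ne ha j₁).2 hya) hy)))
  exact hb.prodMk (hl.mul contDiff_snd.contDiffAt)

/-- The gauge uses up K_ℂ; the remaining scaling group ℂˣ is used up by normalizing one non-zero
negative coordinate. -/
theorem WallCrossing.zrep_spec (hK : IsUnimodular k) {G : Gauge k β Set.univ} {j j₁ : Fin N}
    (hG : IsAdapted Y j G) (hj : Y j₁ ≠ 0) {y₁ : ℂ} (hy : y₁ ≠ 0) {a : HN N × ℂ}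
    (ha : a ∈ Zhat k β αp αm Y) (hd : a.1 ∈ G.dom) (hya : yc Y a.1 j₁ ≠ 0) :
    zrep Y G j₁ y₁ a ∈ Zhat k β αp αm Y ∧ yc Y (zrep Y G j₁ y₁ a).1 j₁ = y₁ ∧
      (∀ i ∈ G.B, raw G.ε (zrep Y G j₁ y₁ a).1 i = G.c i) ∧
      (Qm k αp β (blw Y a.2 a.1) = Qm k αp β (blw Y (zrep Y G j₁ y₁ a).2 (zrep Y G j₁ y₁ a).1) ∧
      Qm k αm β (blw (-Y) a.2 a.1) = Qm k αm β (blw (-Y) (zrep Y G j₁ y₁ a).2 (zrep Y G j₁ y₁ a).1)) := by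
  obtain ⟨p, t⟩ := a
  obtain ⟨ζ, hζ, -, hn⟩ := Gauge.exists_nrm_eq_act hd
  have hyn := (yc_nrm_ne hd j₁).2 hya
  have hl : yc Y (G.nrm p) j₁ / y₁ ≠ 0 := div_ne_zero hyn hy
  have hz : zrep Y G j₁ y₁ (p, t) ∈ Zhat k β αp αm Y :=
    W.blw_mem_Zhat hl (by rw [hn]; exact W.act_mem_Zhat hζ ha)
  refine ⟨hz, ?_, fun i hi => ?_, (W.Q_eq_iff hK ha hz).2 ⟨ζ, hζ, _, hl, ?_, rfl⟩⟩
  · change yc Y (blw Y (yc Y (G.nrm p) j₁ / y₁)⁻¹ (G.nrm p)) j₁ = y₁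
    rw [yc_blw W.unit _ _ hj, inv_div, div_mul_cancel₀ _ hyn]
  · exact (hG.raw_blw _ _ hi).trans (Gauge.raw_nrm hd hi)
  · change blw Y (yc Y (G.nrm p) j₁ / y₁)⁻¹ (G.nrm p) = act ζ (blw Y (yc Y (G.nrm p) j₁ / y₁)⁻¹ p)
    rw [← blw_act, ← hn]

omit W in
-- The negative coordinate at j₁ is normalized to a constant, so its slot among the free coordinates
-- is vacant and records t instead.
theorem zsec_eq {G : Gauge k β Set.univ} {j j₁ : Fin N} (hG : IsAdapted Y j G) (hj₁B : j₁ ∉ G.B)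
    {a : HN N × ℂ} {y₁ : ℂ} (hq : muC k (blw Y a.2 a.1) = β) (hs : ysum Y a.1 = 0)
    (hy : yc Y a.1 j₁ = y₁) (hc : ∀ i ∈ G.B, raw G.ε a.1 i = G.c i) {h : HN N}
    (hh : ∀ l ∉ G.B, h.1 l = (ysub Y j₁ a.2 a.1).1 l ∧ h.2 l = (ysub Y j₁ a.2 a.1).2 l) :
    zsec Y G j j₁ y₁ h = a := by
  have h1 : yc Y h j₁ = a.2 := by
    have : yc Y h j₁ = yc Y (ysub Y j₁ a.2 a.1) j₁ := by
      unfold yc; rw [(hh j₁ hj₁B).1, (hh j₁ hj₁B).2]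
    rw [this, yc_ysub, if_pos rfl]
  unfold zsec
  rw [h1]
  refine Prod.ext (hG.lft_eq_self hq hs hc fun l hl => ?_) rfl
  have h2 : ysub Y j₁ y₁ (ysub Y j₁ a.2 a.1) = a.1 := by rw [ysub_ysub, ysub_eq_self hy]
  have h3 : (ysub Y j₁ y₁ h).1 l = (ysub Y j₁ y₁ (ysub Y j₁ a.2 a.1)).1 l ∧
      (ysub Y j₁ y₁ h).2 l = (ysub Y j₁ y₁ (ysub Y j₁ a.2 a.1)).2 l := by
    constructor
    · change (if _ then _ else h.1 l) = (if _ then _ else (ysub Y j₁ a.2 a.1).1 l)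
      rw [(hh l hl).1]
    · change (if _ then _ else h.2 l) = (if _ then _ else (ysub Y j₁ a.2 a.1).2 l)
      rw [(hh l hl).2]
  rwa [h2] at h3

omit [Nonempty (X k αp β)] [Nonempty (X k αm β)] in
theorem WallCrossing.zrep_congr {G : Gauge k β Set.univ} {j j₁ : Fin N} (hG : IsAdapted Y j G)
    (hj : Y j₁ ≠ 0) {y₁ : ℂ} {ζ : Fin N → ℂˣ} (hζ : ζ ∈ complexSubtorus k) {s : ℂ} (hs : s ≠ 0)
    (a : HN N × ℂ) : zrep Y G j₁ y₁ (act ζ (blw Y s⁻¹ a.1), s * a.2) = zrep Y G j₁ y₁ a := by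
  have hn : G.nrm (act ζ (blw Y s⁻¹ a.1)) = blw Y s⁻¹ (G.nrm a.1) := by
    rw [Gauge.nrm_act (G := G) hζ (fun l hl => absurd trivial hl), hG.nrm_blw]
  have hl : yc Y (blw Y s⁻¹ (G.nrm a.1)) j₁ = s⁻¹ * yc Y (G.nrm a.1) j₁ := yc_blw W.unit _ _ hj
  unfold zrep
  simp only
  rw [hn, hl, blw_blw]
  refine Prod.ext ?_ ?_
  · simp only
    congr 1
    field_simp
  · simp only
    field_simp

/-- The chart of the blow-up at a point of the exceptional divisor. -/
def WallCrossing.chartOn (hK : IsUnimodular k) [Nonempty (ZB k β αp αm Y)]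
    (hSp : TorusQuot k β Set.univ (stab k αp β) (Qm k αp β))
    (hSm : TorusQuot k β Set.univ (stab k αm β) (Qm k αm β)) {p₀ : HN N × ℂ} (hp₀ : p₀ ∈ Zhat k β αp αm Y)
    {j j₁ : Fin N} {G : Gauge k β Set.univ} (hG : IsAdapted Y j G) (hj : Y j₁ ≠ 0) (hjj : j₁ ≠ j)
    (hc : ∀ i ∈ G.B, raw G.ε p₀.1 i = G.c i) (hy : yc Y p₀.1 j₁ ≠ 0) (sl : Slots Set.univ G.B (Fin d → ℂ)) :
    LocalChart (Fin d → ℂ) (Zhat k β αp αm Y) (QZ k β αp αm Y) p₀ := by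
  have hvac : ∀ q : HN N, ∀ l ∉ (Set.univ : Set (Fin N)), q.1 l = 0 ∧ q.2 l = 0 :=
    fun q l hl => absurd trivial hl
  have hj₁B : j₁ ∉ G.B := fun h => hj (hG.zero j₁ h hjj)
  have hd₀ : p₀.1 ∈ G.dom := fun i hi => by rw [hc i hi]; exact G.ne i hi
  have hsec : ∀ a ∈ Zhat k β αp αm Y, yc Y a.1 j₁ = yc Y p₀.1 j₁ → (∀ i ∈ G.B, raw G.ε a.1 i = G.c i) →
      zsec Y G j j₁ (yc Y p₀.1 j₁) (sl.ρ (sl.κ (ysub Y j₁ a.2 a.1))) = a := fun a ha h1 h2 =>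
    zsec_eq hG hj₁B (muC_of_mem_stab ha.1) ha.2.2 h1 h2 fun l hl => sl.ρ_κ _ l trivial hl
  have hs : ContDiff ℂ ω fun b => zsec Y G j j₁ (yc Y p₀.1 j₁) (sl.ρ b) := contDiff_zsec.comp sl.ρ.contDiff
  refine (LocalChart.ofInvariant
    (F := fun a => sl.κ (ysub Y j₁ (zrep Y G j₁ (yc Y p₀.1 j₁) a).2 (zrep Y G j₁ (yc Y p₀.1 j₁) a).1))
    (s := fun b => zsec Y G j j₁ (yc Y p₀.1 j₁) (sl.ρ b)) (D := {a | a.1 ∈ G.dom ∧ yc Y a.1 j₁ ≠ 0})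
    (T := {b | zsec Y G j j₁ (yc Y p₀.1 j₁) (sl.ρ b) ∈ Zhat k β αp αm Y})
    isQuotientMap_QZ ?_ ?_ (fun a ha => ?_) hs.contDiffOn (fun b hb => ?_) (fun a ha haD => ?_)
    (fun a ha a' ha' h haD => ?_) hp₀ ⟨hd₀, hy⟩ ?_).1
  · exact (Gauge.isOpen_dom.preimage continuous_fst).inter
      (isOpen_ne_fun ((contDiff_yc j₁).continuous.comp continuous_fst) continuous_const)
  -- Stability is an open condition inside the fibre of μ_ℂ, and the lift satisfies both equations
  -- identically.
  · refine W.isOpen_preimage_Zhat hSp hSm hs.continuous (fun b => ?_) fun b => hG.ysum_lft _ _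
    exact (congrArg (muC k) (hG.blw_lft _ _)).trans (Gauge.muC_slc (hvac _)).1
  · refine sl.κ.contDiff.contDiffAt.comp a ?_
    exact ContDiffAt.comp (g := fun c : HN N × ℂ => ysub Y j₁ c.2 c.1) a (contDiff_ysub j₁).contDiffAt
      (contDiffAt_zrep hy ha.1 ha.2)
  · have h1 : yc Y (zsec Y G j j₁ (yc Y p₀.1 j₁) (sl.ρ b)).1 j₁ = yc Y p₀.1 j₁ := by
      change yc Y (lft _ _ _ _ _) j₁ = _
      rw [hG.yc_lft _ _ hj, if_neg hjj, yc_ysub, if_pos rfl]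
    refine ⟨hb, ⟨hG.lft_mem_dom _ _, by rw [h1]; exact hy⟩, ?_⟩
    have h2 : G.nrm (zsec Y G j j₁ (yc Y p₀.1 j₁) (sl.ρ b)).1 = (zsec Y G j j₁ (yc Y p₀.1 j₁) (sl.ρ b)).1 :=
      hG.nrm_lft _ _
    have h3 : zrep Y G j₁ (yc Y p₀.1 j₁) (zsec Y G j j₁ (yc Y p₀.1 j₁) (sl.ρ b)) =
        zsec Y G j j₁ (yc Y p₀.1 j₁) (sl.ρ b) := by
      unfold zrep
      rw [h2, h1, div_self hy, inv_one, blw_one, one_mul]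
    simp only [h3]
    refine (sl.κ_congr fun l _ hl => ?_).trans (sl.κ_ρ b)
    have e1 := hG.lft_compl (ysub Y j₁ (yc Y p₀.1 j₁) (sl.ρ b)) (yc Y (sl.ρ b) j₁) hl
    have e2 : ysub Y j₁ (yc Y (sl.ρ b) j₁) (ysub Y j₁ (yc Y p₀.1 j₁) (sl.ρ b)) = sl.ρ b := by
      rw [ysub_ysub, ysub_eq_self rfl]
    constructor
    · refine Eq.trans ?_ (congrFun (congrArg Prod.fst e2) l)
      exact congrArg (fun x => if l = j₁ ∧ Y j₁ ≠ 1 then yc Y (sl.ρ b) j₁ else x) e1.1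
    · refine Eq.trans ?_ (congrFun (congrArg Prod.snd e2) l)
      exact congrArg (fun x => if l = j₁ ∧ Y j₁ = 1 then yc Y (sl.ρ b) j₁ else x) e1.2
  · obtain ⟨e1, e2, e3, e4⟩ := W.zrep_spec hK hG hj hy ha haD.1 haD.2
    have e5 := hsec _ e1 e2 e3
    refine ⟨?_, ?_⟩
    · simp only [Set.mem_ofPred_eq]; rw [e5]; exact e1
    · rw [e5]; exact ((QZ_eq_iff ha e1).2 e4).symm
  · rw [QZ_eq_iff ha ha', W.Q_eq_iff hK ha ha'] at h
    obtain ⟨ζ, hζ, σ, hσ, h1, h2⟩ := h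
    have h3 : a' = (act ζ (blw Y σ⁻¹ a.1), σ * a.2) := Prod.ext h1 h2
    have hd' : a'.1 ∈ G.dom := by rw [h1, Gauge.act_mem_dom, hG.blw_mem_dom]; exact haD.1
    refine ⟨⟨hd', ?_⟩, ?_⟩
    · rw [← yc_nrm_ne hd', h1, Gauge.nrm_act hζ (hvac _), hG.nrm_blw, yc_blw W.unit _ _ hj]
      exact mul_ne_zero (inv_ne_zero hσ) ((yc_nrm_ne haD.1 j₁).2 haD.2)
    · rw [h3, W.zrep_congr hG hj hζ hσ]
  · have h3 : zrep Y G j₁ (yc Y p₀.1 j₁) p₀ = p₀ := by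
      unfold zrep
      rw [Gauge.nrm_eq_self hc, div_self hy, inv_one, blw_one, one_mul]
    simp only [h3]
    exact hsec p₀ hp₀ rfl hc

end Charts

end ToricHK

/-! ### Points with prescribed weighted coordinates, and the manifold structure of the common
blow-up -/

namespace ToricHK

variable {N : ℕ} {k : Submodule ℝ (Fin N → ℝ)} {α αp αm : StrongDual ℝ k} {β : k →L[ℝ] ℂ}
  {Y : Fin N → ℤ}

/-- The point with the coordinates of `c` in weight zero and the given coordinates of positive and
negative weight. -/
def mkXY (Y : Fin N → ℤ) (c : HN N) (x y : Fin N → ℂ) : HN N :=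
  (fun l => if Y l = 0 then c.1 l else if Y l = 1 then x l else y l,
   fun l => if Y l = 0 then c.2 l else if Y l = 1 then y l else x l)

theorem xc_mkXY (c : HN N) (x y : Fin N → ℂ) {l : Fin N} (hl : Y l ≠ 0) : xc Y (mkXY Y c x y) l = x l := by
  unfold xc mkXY; by_cases h : Y l = 1 <;> simp [h, hl]

theorem yc_mkXY (c : HN N) (x y : Fin N → ℂ) {l : Fin N} (hl : Y l ≠ 0) : yc Y (mkXY Y c x y) l = y l := by
  unfold yc mkXY; by_cases h : Y l = 1 <;> simp [h, hl]

theorem mkXY_of_zero (c : HN N) (x y : Fin N → ℂ) {l : Fin N} (hl : Y l = 0) :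
    (mkXY Y c x y).1 l = c.1 l ∧ (mkXY Y c x y).2 l = c.2 l := by simp [mkXY, hl]

theorem proj0_mkXY (c : HN N) (x y : Fin N → ℂ) : proj0 Y (mkXY Y c x y) = proj0 Y c := by
  ext l <;> by_cases h : Y l = 0 <;> simp [proj0, mkXY, h]

theorem ysum_mkXY (c : HN N) (x y : Fin N → ℂ) :
    ysum Y (mkXY Y c x y) = ∑ l, (Y l : ℂ) * (x l * y l) := by
  unfold ysum
  refine Finset.sum_congr rfl fun l _ => ?_
  by_cases h : Y l = 0
  · simp [h]
  · rw [← xc_mul_yc (Y := Y), xc_mkXY c x y h, yc_mkXY c x y h]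

theorem blw_mkXY (hu : ∀ i, Y i = 0 ∨ Y i = 1 ∨ Y i = -1) (t : ℂ) (c : HN N) (x y : Fin N → ℂ) :
    blw Y t (mkXY Y c x y) = mkXY Y c x (t • y) := by
  refine hn_ext hu (fun i hi => ?_) (fun i hi => ?_) fun i hi => ?_
  · simp [blw, mkXY, hi]
  · rw [xc_blw hu _ _ hi, xc_mkXY c _ _ hi, xc_mkXY c _ _ hi]
  · rw [yc_blw hu _ _ hi, yc_mkXY c _ _ hi, yc_mkXY c _ _ hi]; rfl

theorem mkXY_swap (hu : ∀ i, Y i = 0 ∨ Y i = 1 ∨ Y i = -1) (c : HN N) (x y : Fin N → ℂ) :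
    mkXY (-Y) c x y = mkXY Y c y x := by
  ext l <;> rcases hu l with h | h | h <;> simp [mkXY, h]

theorem yVanish_neg_iff (hu : ∀ i, Y i = 0 ∨ Y i = 1 ∨ Y i = -1) {q : HN N} :
    YVanish (-Y) q ↔ ∀ i, Y i ≠ 0 → xc Y q i = 0 := by
  rw [yVanish_iff fun i => by rcases hu i with h | h | h <;> simp [h]]
  refine forall_congr' fun i => ?_
  simp only [Pi.neg_apply, ne_eq, neg_eq_zero]
  exact imp_congr_right fun hi => by rw [yc_neg hu hi]

variable (W : WallCrossing k β α αp αm Y)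
include W

theorem WallCrossing.mkXY_mem_stab {c : HN N} (hc : c ∈ stabFix k α β Y) {x : Fin N → ℂ} {j : Fin N}
    (hj : Y j ≠ 0) (hx : x j ≠ 0) : mkXY Y c x 0 ∈ stab k αp β := by
  refine W.mem_stab_of_proj0 ?_ ((yVanish_iff W.unit).2 fun i hi => yc_mkXY c x 0 hi) fun h => hx ?_
  · rw [proj0_mkXY, proj0_eq_self hc.2]; exact hc.1
  · rw [← xc_mkXY c x 0 hj]; exact (yVanish_neg_iff W.unit).1 h j hj

theorem WallCrossing.mkXY_mem_Zhat {c : HN N} (hc : c ∈ stabFix k α β Y) {x y : Fin N → ℂ}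
    {i j : Fin N} (hi : Y i ≠ 0) (hx : x i ≠ 0) (hj : Y j ≠ 0) (hy : y j ≠ 0)
    (h : ∑ l, (Y l : ℂ) * (x l * y l) = 0) : (mkXY Y c x y, 0) ∈ Zhat k β αp αm Y := by
  rw [W.mem_Zhat_iff]
  refine ⟨?_, by rw [ysum_mkXY, h], fun hv => hy ?_⟩
  · rw [blw_mkXY W.unit, zero_smul]
    exact W.mkXY_mem_stab hc hi hx
  · rw [← yc_mkXY c x y hj]; exact (yVanish_iff W.unit).1 hv j hj

theorem WallCrossing.nonempty_stabFix (hK : IsUnimodular k) : ∃ c ∈ level k α β, c ∈ stabFix k α β Y := by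
  obtain ⟨B, e, hB, -, -⟩ := exists_frame hK (A := {i | Y i = 0}) (T := {i | Y i = 0}) (B₀ := ∅)
    subset_rfl (fun x _ h => h) (Set.empty_subset _) (linearIndepOn_empty ℝ _)
  obtain ⟨c, hc, h⟩ := hB.exists_level α β
    (fun x hx => by obtain ⟨r, rfl⟩ := W.line x hx; rw [map_smul, W.wall, smul_zero])
    (fun x hx => by obtain ⟨r, rfl⟩ := W.line x hx; rw [map_smul, W.beta, smul_zero])
  exact ⟨c, hc, level_subset_stab hc, h⟩

/-- Vectors x and y supported at two different indices of non-zero weight are incident. -/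
theorem WallCrossing.nonempty_Zhat (hK : IsUnimodular k) {i j : Fin N} (hi : Y i ≠ 0) (hj : Y j ≠ 0)
    (hij : i ≠ j) : ∃ a, a ∈ Zhat k β αp αm Y := by
  obtain ⟨c, -, hc⟩ := W.nonempty_stabFix hK
  refine ⟨_, W.mkXY_mem_Zhat hc (x := Pi.single i 1) (y := Pi.single j 1) hi (by simp) hj (by simp) ?_⟩
  refine Finset.sum_eq_zero fun l _ => ?_
  by_cases h : l = i
  · subst h; simp [hij]
  · simp [h]

theorem WallCrossing.proj0_mem_stabFix {p : HN N} (hp : p ∈ stab k αp β) (hv : YVanish Y p) :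
    proj0 Y p ∈ stabFix k α β Y :=
  ⟨W.proj0_mem_stab hp hv, fun i hi => by simp [proj0, hi]⟩

/-- The gauge combines a weight-zero gauge at the projected point with a non-zero coordinate of
positive weight, which exists by stability. -/
theorem WallCrossing.exists_adapted_at (hK : IsUnimodular k) {p : HN N} (hp : p ∈ stab k αp β)
    (hv : YVanish Y p) : ∃ (j : Fin N) (G : Gauge k β Set.univ), IsAdapted Y j G ∧
      ∀ i ∈ G.B, raw G.ε p i = G.c i := by
  have hc := W.proj0_mem_stabFix hp hv
  obtain ⟨G₀, hG₀⟩ := exists_gauge hK (stabFix_subset hc) (W.stabFix_reg hc)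
  have hx := W.not_yVanish_neg hp
  rw [yVanish_neg_iff W.unit] at hx
  push Not at hx
  obtain ⟨j, hj, hxj⟩ := hx
  have h0 : ∀ i ∈ G₀.B, raw G₀.ε p i ≠ 0 := fun i hi => by
    have h0 : Y i = 0 := G₀.frame.sub i hi
    have : raw G₀.ε p i = raw G₀.ε (proj0 Y p) i := by simp [raw, proj0, h0]
    rw [this, hG₀ i hi]
    exact G₀.ne i hi
  obtain ⟨G, h1, -, -, h4⟩ := W.exists_adapted hK G₀ hj (muC_of_mem_stab hp) h0 hxj
  exact ⟨j, G, h1, h4⟩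

omit W in
theorem nonempty_slots {n : ℕ} (hn : Module.finrank ℝ k + n = N) (G : Gauge k β Set.univ) :
    Nonempty (Slots Set.univ G.B (Fin (2 * n) → ℂ)) := by
  classical
  have h1 := card_slots G.frame.sub
  have h2 := G.frame.card_univ
  rw [Set.ncard_univ, Nat.card_fin] at h1
  have h : Nat.card {s : Fin N × Bool // s.1 ∈ Set.univ ∧ s.1 ∉ G.B} = 2 * n := by omega
  rw [Nat.card_eq_fintype_card] at h
  exact ⟨Slots.ofEquiv (Fintype.equivFinOfCardEq h).symm⟩

variable [Nonempty (X k αp β)] [Nonempty (X k αm β)] [Nonempty (ZB k β αp αm Y)]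

theorem WallCrossing.nonempty_localChart_QZ {n : ℕ} (hn : Module.finrank ℝ k + n = N) (hK : IsUnimodular k)
    {p : HN N × ℂ} (hp : p ∈ Zhat k β αp αm Y) :
    Nonempty (LocalChart (Fin (2 * n) → ℂ) (Zhat k β αp αm Y) (QZ k β αp αm Y) p) := by
  have hSp := torusQuot_X hK (α := αp) (β := β) fun q hq => W.free hq
  have hSm := torusQuot_X hK (α := αm) (β := β) fun q hq => W.swap.free hq
  by_cases ht : p.2 = 0
  · have hz := W.mem_Zhat_iff.1 hp
    rw [ht] at hz
    obtain ⟨j, G, hG, hGp⟩ := W.exists_adapted_at hK hz.1 (yVanish_blw_zero W.unit _)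
    have hc : ∀ i ∈ G.B, raw G.ε p.1 i = G.c i := fun i hi => by rw [← hG.raw_blw 0 _ hi, hGp i hi]
    obtain ⟨sl⟩ := nonempty_slots hn G
    -- Some negative coordinate other than the j-th is non-zero: otherwise ∑ Yₗ xₗ yₗ = 0 with xⱼ ≠
    -- 0 forces the j-th to vanish as well, and then y = 0.
    have hex : ∃ j₁, Y j₁ ≠ 0 ∧ j₁ ≠ j ∧ yc Y p.1 j₁ ≠ 0 := by
      by_contra! hcon
      have h1 := hz.2.1
      unfold ysum at h1
      rw [Finset.sum_eq_single j] at h1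
      · rw [← xc_mul_yc (Y := Y), ← hG.raw_j, hc j hG.mem] at h1
        have hyj : yc Y p.1 j = 0 := by
          have hYj : (Y j : ℂ) ≠ 0 := by exact_mod_cast hG.ne
          have := (mul_eq_zero.1 h1).resolve_left hYj
          exact (mul_eq_zero.1 this).resolve_left hG.c_ne
        refine hz.2.2 ((yVanish_iff W.unit).2 fun i hi => ?_)
        by_cases hij : i = j
        · rw [hij, hyj]
        · exact hcon i hi hij
      · intro i _ hij
        by_cases hi : Y i = 0
        · simp [hi]
        · rw [← xc_mul_yc (Y := Y), hcon i hi hij, mul_zero, mul_zero]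
      · intro h; exact absurd (Finset.mem_univ j) h
    obtain ⟨j₁, h1, h2, h3⟩ := hex
    exact ⟨W.chartOn hK hSp hSm hp hG h1 h2 hc h3 sl⟩
  · obtain ⟨g⟩ := nonempty_gaugeAt_X hn hK (fun q hq => W.free hq) hp.1
    exact ⟨W.chartOff hK hSp hp ht g⟩

theorem WallCrossing.exists_zQuot {n : ℕ} (hn : Module.finrank ℝ k + n = N) (hK : IsUnimodular k) :
    ∃ _ : ChartedSpace (Fin (2 * n) → ℂ) (ZB k β αp αm Y),
      ZQuot (d := 2 * n) k β αp αm Y (QZ k β αp αm Y) := by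
  have hs : ∀ x : ZB k β αp αm Y, ∃ p ∈ Zhat k β αp αm Y, QZ k β αp αm Y p = x := fun x => by
    obtain ⟨p, hp⟩ := isQuotientMap_QZ.surjective x
    exact ⟨p, p.2, hp⟩
  refine ⟨chartedSpaceOf (fun p hp => (W.nonempty_localChart_QZ hn hK hp).some) hs, ?_⟩
  let := chartedSpaceOf (fun p hp => (W.nonempty_localChart_QZ hn hK hp).some) hs
  exact ⟨isHolQuot_chartedSpaceOf _ hs
    (continuousOn_iff_continuous_domRestrict.2 isQuotientMap_QZ.continuous), fun a ha b hb => QZ_eq_iff ha hb⟩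

omit [Nonempty (ZB k β αp αm Y)] in
-- By its construction as the quotient by a kernel, the blow-up injects continuously into the
-- product of two Hausdorff quotients.
theorem WallCrossing.t2Space_ZB (hK : IsUnimodular k) : T2Space (ZB k β αp αm Y) := by
  have := t2Space_X (α := αp) (β := β) hK
  have := t2Space_X (α := αm) (β := β) hK
  have hSp := torusQuot_X hK (α := αp) (β := β) fun q hq => W.free hq
  have hSm := torusQuot_X hK (α := αm) (β := β) fun q hq => W.swap.free hq
  have h1 : Continuous fun a : Zhat k β αp αm Y => Qm k αp β (blw Y a.1.2 a.1.1) :=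
    hSp.continuousOn.comp_continuous (contDiff_blw.continuous.comp continuous_subtype_val) fun a => a.2.1
  have h2 : Continuous fun a : Zhat k β αp αm Y => Qm k αm β (blw (-Y) a.1.2 a.1.1) :=
    hSm.continuousOn.comp_continuous (contDiff_blw.continuous.comp continuous_subtype_val) fun a => a.2.2.1
  let f : ZB k β αp αm Y → X k αp β × X k αm β := Quotient.lift
    (fun a : Zhat k β αp αm Y => (Qm k αp β (blw Y a.1.2 a.1.1), Qm k αm β (blw (-Y) a.1.2 a.1.1)))
    fun _ _ h => h
  have hf : Continuous f := (h1.prodMk h2).quotient_lift _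
  refine T2Space.of_injective_continuous (f := f) ?_ hf
  intro a b
  induction a using Quotient.inductionOn with | h a => ?_
  induction b using Quotient.inductionOn with | h b => ?_
  exact fun h => Quotient.sound h

end ToricHK

namespace ToricHK

variable {N : ℕ} {k : Submodule ℝ (Fin N → ℝ)} {α αp αm : StrongDual ℝ k} {β : k →L[ℝ] ℂ}
  {Y : Fin N → ℤ}

/-! ## Coordinates adapted to the blow-up -/

/-- The coordinate functions of negative weight. -/
def IsNegSlot (Y : Fin N → ℤ) (s : Fin N × Bool) : Prop := (Y s.1 = 1 ∧ s.2 = false) ∨ (Y s.1 = -1 ∧ s.2 = true)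

open Classical in
theorem coordL_blw (t : ℂ) (q : HN N) (s : Fin N × Bool) :
    coordL s (blw Y t q) = if IsNegSlot Y s then t * coordL s q else coordL s q := by
  obtain ⟨l, b⟩ := s
  cases b
  · rw [coordL_false, coordL_false]; simp [IsNegSlot, blw]
  · rw [coordL_true, coordL_true]; simp [IsNegSlot, blw]

/-- Each index of non-zero weight other than j contributes one free negative coordinate; the one at
j has been solved for. -/
theorem IsAdapted.card_negSlots {G : Gauge k β Set.univ} {j : Fin N} (hG : IsAdapted Y j G) {r : ℕ}
    (hr : (Finset.univ.filter fun i => Y i ≠ 0).card = r + 1) :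
    Nat.card {s : {s : Fin N × Bool // s.1 ∈ Set.univ ∧ s.1 ∉ G.B} // IsNegSlot Y s} = r := by
  classical
  have h1 : ((Finset.univ.filter fun i => Y i ≠ 0).erase j).card = r := by
    rw [Finset.card_erase_of_mem (by simpa using hG.ne), hr]; rfl
  rw [← h1, ← Nat.card_eq_finsetCard]
  refine Nat.card_congr
    { toFun := fun s => ⟨s.1.1.1, ?_⟩
      invFun := fun i => ⟨⟨(i.1, decide (Y i.1 = -1)), trivial, ?_⟩, ?_⟩
      left_inv := ?_
      right_inv := fun i => rfl }
  · obtain ⟨⟨⟨l, b⟩, -, hl⟩, hs⟩ := s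
    have hlj : l ≠ j := by rintro rfl; exact hl hG.mem
    rcases hs with ⟨h, -⟩ | ⟨h, -⟩ <;> simp at h <;> simp [h, hlj]
  · obtain ⟨i, hi⟩ := i
    simp at hi
    exact fun h => hi.2 (hG.zero i h hi.1)
  · obtain ⟨i, hi⟩ := i
    simp at hi
    rcases hG.unit i with h | h | h
    · exact absurd h hi.2
    · left; simp [h]
    · right; simp [h]
  · rintro ⟨⟨⟨l, b⟩, -, hl⟩, hs⟩
    rcases hs with ⟨h, h'⟩ | ⟨h, h'⟩ <;> simp at h h' <;> simp [h, h']

/-- Listing the negative coordinates last makes `blw` the scaling of the second factor. These are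
the coordinates in which V₊ is the zero set of that factor. -/
theorem IsAdapted.exists_slots {G : Gauge k β Set.univ} {j : Fin N} (hG : IsAdapted Y j G) {n r : ℕ}
    (hn : Module.finrank ℝ k + n = N) (hr : (Finset.univ.filter fun i => Y i ≠ 0).card = r + 1) :
    ∃ e : ℕ, e + r = 2 * n ∧ ∃ sl : Slots Set.univ G.B ((Fin e → ℂ) × (Fin r → ℂ)),
      ∀ t q, sl.κ (blw Y t q) = ((sl.κ q).1, t • (sl.κ q).2) := by
  classical
  have h1 := card_slots G.frame.sub
  have h2 := G.frame.card_univ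
  rw [Set.ncard_univ, Nat.card_fin] at h1
  have h : Nat.card {s : Fin N × Bool // s.1 ∈ Set.univ ∧ s.1 ∉ G.B} = 2 * n := by omega
  have hneg := hG.card_negSlots hr
  let P : {s : Fin N × Bool // s.1 ∈ Set.univ ∧ s.1 ∉ G.B} → Prop := fun s => ¬ IsNegSlot Y s
  have hP : ∀ s, ¬ P s ↔ IsNegSlot Y s := fun s => not_not
  have hneg' : Nat.card {s // ¬ P s} = r := by
    rw [← hneg]; exact Nat.card_congr (Equiv.subtypeEquivRight hP)
  have hsum : Nat.card {s // P s} + Nat.card {s // ¬ P s} = 2 * n := by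
    rw [← h, ← Nat.card_sum]; exact Nat.card_congr (Equiv.sumCompl P)
  let θ₁ : Fin (Nat.card {s // P s}) ≃ {s // P s} := (Finite.equivFin _).symm
  let θ₂ : Fin r ≃ {s // ¬ P s} := (Finite.equivFinOfCardEq hneg').symm
  let θ : Fin (Nat.card {s // P s}) ⊕ Fin r ≃ {s : Fin N × Bool // s.1 ∈ Set.univ ∧ s.1 ∉ G.B} :=
    (Equiv.sumCongr θ₁ θ₂).trans (Equiv.sumCompl P)
  refine ⟨Nat.card {s // P s}, by omega, (Slots.ofEquiv θ).map
    (ContinuousLinearEquiv.sumPiEquivProdPi ℂ _ _ fun _ => ℂ), fun t q => ?_⟩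
  refine Prod.ext (funext fun i => ?_) (funext fun i => ?_)
  · change coordL (θ (Sum.inl i)) (blw Y t q) = coordL (θ (Sum.inl i)) q
    rw [coordL_blw]; exact if_neg (θ₁ i).2
  · change coordL (θ (Sum.inr i)) (blw Y t q) = t * coordL (θ (Sum.inr i)) q
    rw [coordL_blw]; exact if_pos ((hP _).1 (θ₂ i).2)

section Model

variable {G : Gauge k β Set.univ} {j : Fin N} {e r : ℕ}
  {sl : Slots Set.univ G.B ((Fin e → ℂ) × (Fin r → ℂ))}
  (hsl : ∀ t q, sl.κ (blw Y t q) = ((sl.κ q).1, t • (sl.κ q).2))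

include hsl in
theorem ρ_blw (t : ℂ) (a : (Fin e → ℂ) × (Fin r → ℂ)) : sl.ρ (a.1, t • a.2) = blw Y t (sl.ρ a) := by
  have h1 : sl.κ (blw Y t (sl.ρ a)) = (a.1, t • a.2) := by rw [hsl, sl.κ_ρ]
  rw [← h1]
  ext l <;> by_cases hl : l ∈ G.B
  · rw [(sl.ρ_zero _ l (Or.inr hl)).1]; simp [blw, (sl.ρ_zero a l (Or.inr hl)).1]
  · rw [(sl.ρ_κ _ l trivial hl).1]
  · rw [(sl.ρ_zero _ l (Or.inr hl)).2]; simp [blw, (sl.ρ_zero a l (Or.inr hl)).2]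
  · rw [(sl.ρ_κ _ l trivial hl).2]

/-- The lift of homogeneous coordinates of the blow-up. -/
def blowLift (Y : Fin N → ℤ) (G : Gauge k β Set.univ) (j : Fin N)
    (sl : Slots Set.univ G.B ((Fin e → ℂ) × (Fin r → ℂ))) (a : (Fin e → ℂ) × (Fin r → ℂ) × ℂ) : HN N × ℂ :=
  (lft Y G j (sl.ρ (a.1, a.2.1)) a.2.2, a.2.2)

/-- The homogeneous coordinates of a point of the blow-up. -/
def blowCoord (G : Gauge k β Set.univ) (sl : Slots Set.univ G.B ((Fin e → ℂ) × (Fin r → ℂ)))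
    (b : HN N × ℂ) : (Fin e → ℂ) × (Fin r → ℂ) × ℂ :=
  ((sl.κ (G.nrm b.1)).1, (sl.κ (G.nrm b.1)).2, b.2)

theorem contDiff_blowLift : ContDiff ℂ ω (blowLift Y G j sl) := by
  have h1 : ContDiff ℂ ω fun a : (Fin e → ℂ) × (Fin r → ℂ) × ℂ => (a.1, a.2.1) := by fun_prop
  have h2 : ContDiff ℂ ω fun a : (Fin e → ℂ) × (Fin r → ℂ) × ℂ => a.2.2 := by fun_prop
  exact (contDiff_lft_comp (sl.ρ.contDiff.comp h1) h2).prodMk h2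

theorem contDiffAt_blowCoord {b : HN N × ℂ} (hb : b.1 ∈ G.dom) : ContDiffAt ℂ ω (blowCoord G sl) b := by
  have h1 : ContDiffAt ℂ ω (fun b : HN N × ℂ => sl.κ (G.nrm b.1)) b :=
    sl.κ.contDiff.contDiffAt.comp b (ContDiffAt.comp b (Gauge.contDiffAt_nrm hb) contDiff_fst.contDiffAt)
  exact h1.fst.prodMk (h1.snd.prodMk contDiff_snd.contDiffAt)

variable (hG : IsAdapted Y j G)
include hG

theorem κ_lft (a : (Fin e → ℂ) × (Fin r → ℂ)) (t : ℂ) : sl.κ (lft Y G j (sl.ρ a) t) = a := by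
  rw [sl.κ_congr (q' := sl.ρ a) fun l _ hl => hG.lft_compl _ _ hl, sl.κ_ρ]

theorem blowCoord_blowLift (a : (Fin e → ℂ) × (Fin r → ℂ) × ℂ) :
    blowCoord G sl (blowLift Y G j sl a) = a := by
  unfold blowCoord blowLift
  simp only
  rw [hG.nrm_lft, κ_lft hG]

include hsl

theorem blw_blowLift (a : (Fin e → ℂ) × (Fin r → ℂ) × ℂ) :
    blw Y (blowLift Y G j sl a).2 (blowLift Y G j sl a).1 = G.slc (sl.ρ (a.1, a.2.2 • a.2.1)) := by
  rw [ρ_blw hsl a.2.2 (a.1, a.2.1)]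
  exact hG.blw_lft _ _

theorem yVanish_blowLift (a : (Fin e → ℂ) × (Fin r → ℂ) × ℂ) :
    YVanish Y (blowLift Y G j sl a).1 ↔ a.2.1 = 0 := by
  have hκ : sl.κ (blowLift Y G j sl a).1 = (a.1, a.2.1) := κ_lft hG _ _
  constructor
  · intro h
    have h1 := hsl 0 (blowLift Y G j sl a).1
    rw [(yVanish_iff_blw_zero hG.unit).1 h, hκ, zero_smul] at h1
    exact congrArg Prod.snd h1
  · intro h
    have h1 : sl.ρ (a.1, a.2.1) = blw Y 0 (sl.ρ (a.1, a.2.1)) := by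
      rw [← ρ_blw hsl 0 (a.1, a.2.1), zero_smul, h]
    unfold blowLift
    rw [h1, hG.lft_blw]
    exact yVanish_blw_zero hG.unit _

theorem yVanish_slc (a : (Fin e → ℂ) × (Fin r → ℂ)) : YVanish Y (G.slc (sl.ρ a)) ↔ a.2 = 0 := by
  have h1 := blw_blowLift hsl hG (a.1, a.2, 1)
  simp only [one_smul] at h1
  rw [← h1]
  change YVanish Y (blw Y 1 _) ↔ _
  rw [blw_one, yVanish_blowLift hsl hG]

variable (W : WallCrossing k β α αp αm Y)
include W

/-- The lift satisfies ∑ Yₗ xₗ yₗ = 0 by construction, so `WallCrossing.mem_Zhat_iff` leaves only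
these two conditions. -/
theorem blowLift_mem_Zhat_iff (a : (Fin e → ℂ) × (Fin r → ℂ) × ℂ) :
    blowLift Y G j sl a ∈ Zhat k β αp αm Y ↔
      a.2.1 ≠ 0 ∧ G.slc (sl.ρ (a.1, a.2.2 • a.2.1)) ∈ stab k αp β := by
  rw [← blw_blowLift hsl hG a, ne_eq, ← yVanish_blowLift hsl hG]
  refine W.mem_Zhat_iff.trans ?_
  have : ysum Y (blowLift Y G j sl a).1 = 0 := hG.ysum_lft _ _
  tauto

omit hsl in
theorem blowLift_blowCoord {b : HN N × ℂ} (hb : b ∈ Zhat k β αp αm Y) (hd : b.1 ∈ G.dom) :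
    blowLift Y G j sl (blowCoord G sl b) = (G.nrm b.1, b.2) ∧ (G.nrm b.1, b.2) ∈ Zhat k β αp αm Y := by
  obtain ⟨ζ, hζ, -, hn⟩ := Gauge.exists_nrm_eq_act hd
  have hz : (G.nrm b.1, b.2) ∈ Zhat k β αp αm Y := by rw [hn]; exact W.act_mem_Zhat hζ hb
  refine ⟨Prod.ext (hG.lft_eq_self (muC_of_mem_stab hz.1) hz.2.2 (fun i hi => Gauge.raw_nrm hd hi)
    fun l hl => sl.ρ_κ _ l trivial hl) rfl, hz⟩

end Model

end ToricHK

namespace ToricHK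

variable {N : ℕ} {k : Submodule ℝ (Fin N → ℝ)} {α αp αm : StrongDual ℝ k} {β : k →L[ℝ] ℂ}
  {Y : Fin N → ℤ} [Nonempty (X k αp β)] [Nonempty (X k αm β)]

/-! ## The blow-up -/

section

variable {d : ℕ} {M : Type} [TopologicalSpace M] [ChartedSpace (Fin d → ℂ) M] {Q : HN N × ℂ → M}
  {e r : ℕ} {G : Gauge k β Set.univ} {j : Fin N} {sl : Slots Set.univ G.B ((Fin e → ℂ) × (Fin r → ℂ))}
  (hZ : ZQuot (d := d) k β αp αm Y Q) (W : WallCrossing k β α αp αm Y) (hK : IsUnimodular k)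
include W hK hZ

theorem ZQuot.eq_iff_act {a b : HN N × ℂ} (ha : a ∈ Zhat k β αp αm Y) (hb : b ∈ Zhat k β αp αm Y) :
    Q a = Q b ↔ ∃ ζ ∈ complexSubtorus k, ∃ s : ℂ, s ≠ 0 ∧ b.1 = act ζ (blw Y s⁻¹ a.1) ∧ b.2 = s * a.2 := by
  rw [hZ.eq_iff a ha b hb, W.Q_eq_iff hK ha hb]

theorem ZQuot.Q_nrm {b : HN N × ℂ} (hb : b ∈ Zhat k β αp αm Y) (hd : b.1 ∈ G.dom)
    (hz : (G.nrm b.1, b.2) ∈ Zhat k β αp αm Y) : Q (G.nrm b.1, b.2) = Q b := by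
  obtain ⟨ζ, hζ, -, hn⟩ := Gauge.exists_nrm_eq_act hd
  refine ((hZ.eq_iff_act W hK hb hz).2 ⟨ζ, hζ, 1, one_ne_zero, ?_, (one_mul _).symm⟩).symm
  rw [inv_one, blw_one]; exact hn

/-- Both lifts are normalized by one gauge. Applying `nrm` therefore removes the K_ℂ-part of an
identification and leaves the scaling. -/
theorem ZQuot.Q_blowLift_eq_iff (hsl : ∀ t q, sl.κ (blw Y t q) = ((sl.κ q).1, t • (sl.κ q).2))
    (hG : IsAdapted Y j G) {a b : (Fin e → ℂ) × (Fin r → ℂ) × ℂ}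
    (ha : blowLift Y G j sl a ∈ Zhat k β αp αm Y) (hb : blowLift Y G j sl b ∈ Zhat k β αp αm Y) :
    Q (blowLift Y G j sl a) = Q (blowLift Y G j sl b) ↔
      a.1 = b.1 ∧ ∃ s : ℂ, s ≠ 0 ∧ b.2.1 = s • a.2.1 ∧ a.2.2 = s * b.2.2 := by
  rw [hZ.eq_iff_act W hK ha hb]
  constructor
  · rintro ⟨ζ, hζ, s, hs, h1, h2⟩
    have h3 : (blowLift Y G j sl b).1 = blw Y s⁻¹ (blowLift Y G j sl a).1 := by
      have e1 : G.nrm (blowLift Y G j sl b).1 = (blowLift Y G j sl b).1 := hG.nrm_lft _ _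
      have e2 : G.nrm (blowLift Y G j sl a).1 = (blowLift Y G j sl a).1 := hG.nrm_lft _ _
      rw [← e1, h1, Gauge.nrm_act (G := G) hζ (fun l hl => absurd trivial hl), hG.nrm_blw, e2]
    have h4 := congrArg sl.κ h3
    rw [hsl] at h4
    have e1 : sl.κ (blowLift Y G j sl b).1 = (b.1, b.2.1) := κ_lft hG _ _
    have e2 : sl.κ (blowLift Y G j sl a).1 = (a.1, a.2.1) := κ_lft hG _ _
    rw [e1, e2] at h4
    refine ⟨(congrArg Prod.fst h4).symm, s⁻¹, inv_ne_zero hs, congrArg Prod.snd h4, ?_⟩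
    change b.2.2 = s * a.2.2 at h2
    rw [h2]; field_simp
  · rintro ⟨h1, s, hs, h2, h3⟩
    refine ⟨1, one_mem _, s⁻¹, inv_ne_zero hs, ?_, ?_⟩
    · rw [act_one, inv_inv]
      change lft Y G j (sl.ρ (b.1, b.2.1)) b.2.2 = blw Y s (lft Y G j (sl.ρ (a.1, a.2.1)) a.2.2)
      rw [h2, ← h1, ρ_blw hsl s (a.1, a.2.1), hG.lft_blw, h3, mul_comm]
    · change b.2.2 = s⁻¹ * a.2.2
      rw [h3]; field_simp

/-- `blowCoord` after a local section of Q is a holomorphic right inverse near the point. -/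
theorem ZQuot.mfderiv_surjective (hG : IsAdapted Y j G) {a : (Fin e → ℂ) × (Fin r → ℂ) × ℂ}
    (ha : ∀ᶠ b in 𝓝 a, blowLift Y G j sl b ∈ Zhat k β αp αm Y) : Function.Surjective
      (mfderiv 𝓘(ℂ, (Fin e → ℂ) × (Fin r → ℂ) × ℂ) 𝓘(ℂ, Fin d → ℂ) (fun b => Q (blowLift Y G j sl b)) a) := by
  have ha0 := ha.self_of_nhds
  have hS := hZ.hol.contMDiffAt_comp (f := blowLift Y G j sl) (x := a) contDiff_blowLift.contMDiff.contMDiffAt ha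
  obtain ⟨σ, hσ, hσp, hσS⟩ := hZ.hol.sec _ ha0
  have hd : (blowLift Y G j sl a).1 ∈ G.dom := hG.lft_mem_dom _ _
  have hc : ContMDiffAt 𝓘(ℂ, Fin d → ℂ) 𝓘(ℂ, (Fin e → ℂ) × (Fin r → ℂ) × ℂ) ω
      (fun x => blowCoord G sl (σ x)) (Q (blowLift Y G j sl a)) :=
    ContMDiffAt.comp (g := blowCoord G sl) _ (by rw [hσp]; exact (contDiffAt_blowCoord hd).contMDiffAt) hσ
  have hca : blowCoord G sl (σ (Q (blowLift Y G j sl a))) = a := by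
    rw [hσp, blowCoord_blowLift hG]
  have heq : (fun x => Q (blowLift Y G j sl (blowCoord G sl (σ x)))) =ᶠ[𝓝 (Q (blowLift Y G j sl a))] id := by
    have hdom : ∀ᶠ x in 𝓝 (Q (blowLift Y G j sl a)), (σ x).1 ∈ G.dom :=
      hσ.continuousAt.eventually_mem ((Gauge.isOpen_dom.preimage continuous_fst).mem_nhds
        (by rw [hσp]; exact hd))
    filter_upwards [hdom, hσS] with x h1 h2
    obtain ⟨h3, h4⟩ := blowLift_blowCoord (sl := sl) hG W h2.1 h1
    rw [h3, hZ.Q_nrm W hK h2.1 h1 h4, h2.2]; rfl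
  have hd1 := (hS.mdifferentiableAt (by simp)).hasMFDerivAt
  have hd2 := (hc.mdifferentiableAt (by simp)).hasMFDerivAt
  have hd1' : HasMFDerivAt 𝓘(ℂ, (Fin e → ℂ) × (Fin r → ℂ) × ℂ) 𝓘(ℂ, Fin d → ℂ)
      (fun b => Q (blowLift Y G j sl b)) (blowCoord G sl (σ (Q (blowLift Y G j sl a))))
      (mfderiv 𝓘(ℂ, (Fin e → ℂ) × (Fin r → ℂ) × ℂ) 𝓘(ℂ, Fin d → ℂ) (fun b => Q (blowLift Y G j sl b)) a) := by
    rw [hca]; exact hd1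
  have h := HasMFDerivAt.comp (f := fun x => blowCoord G sl (σ x)) (Q (blowLift Y G j sl a)) hd1' hd2
  have hid : HasMFDerivAt 𝓘(ℂ, Fin d → ℂ) 𝓘(ℂ, Fin d → ℂ)
      (fun x => Q (blowLift Y G j sl (blowCoord G sl (σ x)))) (Q (blowLift Y G j sl a))
      (ContinuousLinearMap.id ℂ (Fin d → ℂ)) :=
    (hasMFDerivAt_id (I := 𝓘(ℂ, Fin d → ℂ)) (Q (blowLift Y G j sl a))).congr_of_eventuallyEq heq
  have hu := hasMFDerivAt_unique h hid
  intro w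
  exact ⟨_, DFunLike.congr_fun hu w⟩

end

/-- Off V the inverse takes the class of q to that of (q, 1). At a point of V an adapted gauge gives
coordinates with the negative ones as second factor, and `blowLift` is the standard homogeneous
parametrization of the blow-up. -/
theorem WallCrossing.isBlowUp (W : WallCrossing k β α αp αm Y) (hK : IsUnimodular k) {n r : ℕ}
    (hn : Module.finrank ℝ k + n = N) (hr : (Finset.univ.filter fun i => Y i ≠ 0).card = r + 1)
    {M : Type} [TopologicalSpace M] [ChartedSpace (Fin (2 * n) → ℂ) M] {Q : HN N × ℂ → M}
    (hZ : ZQuot (d := 2 * n) k β αp αm Y Q) [ChartedSpace (Fin (2 * n) → ℂ) (X k αp β)]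
    (hX : IsHolQuot (2 * n) (stab k αp β) (Qm k αp β)) {p : M → X k αp β}
    (hp : ∀ a ∈ Zhat k β αp αm Y, p (Q a) = Qm k αp β (blw Y a.2 a.1)) {V : Set (X k αp β)}
    (hV : ∀ q ∈ stab k αp β, Qm k αp β q ∈ V ↔ YVanish Y q) :
    ComplexGeometry.IsBlowUp (d := 2 * n) p V r := by
  have hS := torusQuot_X hK (α := αp) (β := β) fun q hq => W.free hq
  refine ⟨fun z => ?_, ?_, ?_, fun v hv => ?_⟩
  · obtain ⟨a, ha, rfl⟩ := hZ.hol.surj z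
    refine hZ.hol.contMDiffAt_lift hX (g := fun a : HN N × ℂ => blw Y a.2 a.1) ha contDiff_blw.contDiffAt ?_
    filter_upwards [self_mem_nhdsWithin] with b hb
    exact ⟨hb.1, hp b hb⟩
  · rw [← hS.quot.isClosed_preimage]
    convert (isClosed_yVanish (Y := Y)).preimage (continuous_subtype_val (p := (· ∈ stab k αp β))) using 1
    ext q
    exact hV q q.2
  · have hmem : ∀ q ∈ stab k αp β, ¬ YVanish Y q → (q, (1 : ℂ)) ∈ Zhat k β αp αm Y := fun q hq h => by
      have := W.unblow_mem_Zhat hq h one_ne_zero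
      rwa [inv_one, blw_one] at this
    choose rep hrep hrepx using hX.surj
    -- The class does not depend on the chosen representative, so holomorphy can be checked on q ↦
    -- (q, 1) instead.
    have hg : ∀ q ∈ stab k αp β, ¬ YVanish Y q → Q (rep (Qm k αp β q), 1) = Q (q, 1) := fun q hq h => by
      have h1 : ¬ YVanish Y (rep (Qm k αp β q)) := by rwa [← hV _ (hrep _), hrepx, hV q hq]
      obtain ⟨ζ, hζ, h2⟩ := (Qm_eq_iff hK (hrep _) hq).1 (hrepx (Qm k αp β q))
      refine (hZ.eq_iff_act W hK (hmem _ (hrep _) h1) (hmem _ hq h)).2 ⟨ζ, hζ, 1, one_ne_zero, ?_, by simp⟩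
      rw [inv_one, blw_one]; exact h2.symm
    refine ⟨fun x => Q (rep x, 1), fun x hx => ?_, fun x hx => ?_, fun z hz => ?_⟩
    · obtain ⟨q, hq, rfl⟩ := hX.surj x
      have hq' : ¬ YVanish Y q := fun h => hx ((hV q hq).2 h)
      refine (hX.contMDiffAt_lift hZ.hol (g := fun q => (q, (1 : ℂ))) hq (by fun_prop) ?_).contMDiffWithinAt
      filter_upwards [self_mem_nhdsWithin, mem_nhdsWithin_of_mem_nhds
        ((isClosed_yVanish (Y := Y)).isOpen_compl.mem_nhds hq')] with q' h1 h2
      exact ⟨hmem q' h1 h2, hg q' h1 h2⟩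
    · have h1 : ¬ YVanish Y (rep x) := by rwa [← hV _ (hrep _), hrepx]
      rw [hp _ (hmem _ (hrep x) h1)]
      simp only [blw_one]
      exact hrepx x
    · obtain ⟨a, ha, rfl⟩ := hZ.hol.surj z
      rw [hp a ha, hV _ ha.1] at hz
      have ht := (W.snd_ne_zero_iff ha).2 hz
      rw [hp a ha]
      refine (hg _ ha.1 hz).trans ((hZ.eq_iff_act W hK ha (hmem _ ha.1 hz)).2
        ⟨1, one_mem _, a.2⁻¹, inv_ne_zero ht, ?_, ?_⟩).symm
      · rw [act_one, inv_inv]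
      · rw [inv_mul_cancel₀ ht]
  · obtain ⟨p₀, hp₀, rfl⟩ := hX.surj v
    obtain ⟨j, G, hG, hGp⟩ := W.exists_adapted_at hK hp₀ ((hV _ hp₀).1 hv)
    obtain ⟨e, he, sl, hsl⟩ := hG.exists_slots hn hr
    obtain ⟨c, -, hct, hcs⟩ := hS.chart G sl hp₀ hGp
    have hLc : Continuous fun a : (Fin e → ℂ) × (Fin r → ℂ) × ℂ => (a.1, a.2.2 • a.2.1) := by fun_prop
    have hmem : ∀ a : (Fin e → ℂ) × (Fin r → ℂ) × ℂ, (a.2.1 ≠ 0 ∧ (a.1, a.2.2 • a.2.1) ∈ c.e.target) ↔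
        blowLift Y G j sl a ∈ Zhat k β αp αm Y := fun a => by
      rw [blowLift_mem_Zhat_iff hsl hG W, hct]; rfl
    have hopen : IsOpen {a : (Fin e → ℂ) × (Fin r → ℂ) × ℂ | a.2.1 ≠ 0 ∧ (a.1, a.2.2 • a.2.1) ∈ c.e.target} :=
      (isOpen_ne_fun (by fun_prop) continuous_const).inter (c.e.open_target.preimage hLc)
    have hev : ∀ a : (Fin e → ℂ) × (Fin r → ℂ) × ℂ, (a.2.1 ≠ 0 ∧ (a.1, a.2.2 • a.2.1) ∈ c.e.target) →
        ∀ᶠ b in 𝓝 a, blowLift Y G j sl b ∈ Zhat k β αp αm Y := fun a ha => by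
      filter_upwards [hopen.mem_nhds ha] with b hb
      exact (hmem b).1 hb
    have hpS : ∀ a : (Fin e → ℂ) × (Fin r → ℂ) × ℂ, blowLift Y G j sl a ∈ Zhat k β αp αm Y →
        p (Q (blowLift Y G j sl a)) = Qm k αp β (G.slc (sl.ρ (a.1, a.2.2 • a.2.1))) := fun a ha => by
      rw [hp _ ha, blw_blowLift hsl hG]
    refine ⟨e, he, c.e, c.mem, c.contMDiffOn hX, c.contMDiffOn_symm hX, fun x hx => ?_, _,
      fun a => Q (blowLift Y G j sl a), rfl, fun a ha => ?_, fun a ha => ?_, ?_, fun a ha => ?_,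
      fun a ha b hb => ?_⟩
    · obtain ⟨q, hq, rfl⟩ := hX.surj x
      have hd := (hcs q hq).1.1 hx
      rw [(hcs q hq).2 hd, hV q hq, ← yVanish_slc hsl hG, G.slc_nrm sl (hS.sub hq) hd]
      obtain ⟨ζ, hζ, -, h3⟩ := Gauge.exists_nrm_eq_act hd
      rw [h3, yVanish_act]
    · exact (hZ.hol.contMDiffAt_comp (f := blowLift Y G j sl) contDiff_blowLift.contMDiff.contMDiffAt
        (hev a ha)).contMDiffWithinAt
    · exact hZ.mfderiv_surjective W hK hG (hev a ha)
    · apply Set.Subset.antisymm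
      · rintro _ ⟨a, ha, rfl⟩
        have ha' := (hmem a).1 ha
        have h1 := ((blowLift_mem_Zhat_iff hsl hG W a).1 ha').2
        change p (Q (blowLift Y G j sl a)) ∈ c.e.source
        rw [hpS a ha', (hcs _ h1).1]
        exact Gauge.slc_mem_dom _
      · intro z hz
        obtain ⟨b, hb, rfl⟩ := hZ.hol.surj z
        change p (Q b) ∈ c.e.source at hz
        rw [hp b hb, (hcs _ hb.1).1, hG.blw_mem_dom] at hz
        obtain ⟨h3, h4⟩ := blowLift_blowCoord (sl := sl) hG W hb hz
        refine ⟨blowCoord G sl b, (hmem _).2 (by rw [h3]; exact h4), ?_⟩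
        change Q (blowLift Y G j sl (blowCoord G sl b)) = Q b
        rw [h3, hZ.Q_nrm W hK hb hz h4]
    · have ha' := (hmem a).1 ha
      have h1 := ((blowLift_mem_Zhat_iff hsl hG W a).1 ha').2
      change c.e (p (Q (blowLift Y G j sl a))) = _
      rw [hpS a ha', (hcs _ h1).2 (Gauge.slc_mem_dom _), Gauge.nrm_slc, G.κ_slc]
    · exact hZ.Q_blowLift_eq_iff W hK hsl hG ((hmem a).1 ha) ((hmem b).1 hb)

end ToricHK

namespace ToricHK

variable {N : ℕ} {k : Submodule ℝ (Fin N → ℝ)} {α αp αm : StrongDual ℝ k} {β : k →L[ℝ] ℂ}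
  {Y : Fin N → ℤ}

/-! ## The projective bundles -/

theorem coordL_raw (ε : Fin N → Bool) (q : HN N) (i : Fin N) : coordL (i, ε i) q = raw ε q i := by
  unfold raw
  cases h : ε i
  · simp [coordL_false]
  · simp [coordL_true]

/-- A local section is an immersion, because local coordinate functions composed with it give the
chart. -/
theorem IsHolQuot.eq_zero_of_mfderiv_section {m : ℕ} {E M : Type} [NormedAddCommGroup E] [NormedSpace ℂ E]
    [TopologicalSpace M] [ChartedSpace (Fin m → ℂ) M] {S : Set E} {Q : E → M} (h : IsHolQuot m S Q)
    {σ : M → E} {x : M} (hσ : ContMDiffAt 𝓘(ℂ, Fin m → ℂ) 𝓘(ℂ, E) ω σ x)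
    (hσS : ∀ᶠ y in 𝓝 x, σ y ∈ S ∧ Q (σ y) = y) {u : TangentSpace 𝓘(ℂ, Fin m → ℂ) x}
    (hu : mfderiv 𝓘(ℂ, Fin m → ℂ) 𝓘(ℂ, E) σ x u = 0) : u = 0 := by
  obtain ⟨F, hF, hFe⟩ := h.inv (σ x) hσS.self_of_nhds.1
  rw [hσS.self_of_nhds.2] at hFe
  have hσd := hσ.mdifferentiableAt (by simp : (ω : WithTop ℕ∞) ≠ 0)
  have hten : Filter.Tendsto σ (𝓝 x) (𝓝[S] (σ x)) :=
    tendsto_nhdsWithin_iff.2 ⟨hσ.continuousAt, hσS.mono fun y hy => hy.1⟩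
  have hFσ : HasMFDerivAt 𝓘(ℂ, Fin m → ℂ) 𝓘(ℂ, Fin m → ℂ) (F ∘ σ) x _ :=
    (hF.differentiableAt (by simp)).hasFDerivAt.hasMFDerivAt.comp x hσd.hasMFDerivAt
  have he : F ∘ σ =ᶠ[𝓝 x] fun y => chartAt (Fin m → ℂ) (id x) (id y) := by
    filter_upwards [hten.eventually hFe, hσS] with y h1 h2
    simp only [Function.comp_apply, id]
    rw [h1, h2.2]
  have h1 := mfderiv_eq_mfderiv_chartAt (f := id) mdifferentiableAt_id hFσ.mdifferentiableAt he u
  rw [hFσ.mfderiv, mfderiv_id] at h1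
  have h2 : (ContinuousLinearMap.id ℂ (Fin m → ℂ)) u =
      fderiv ℂ F (σ x) (mfderiv 𝓘(ℂ, Fin m → ℂ) 𝓘(ℂ, E) σ x u) := h1
  exact h2.trans ((congrArg (fderiv ℂ F (σ x)) hu).trans (ContinuousLinearMap.map_zero _))

/-- An enumeration of the indices of non-zero weight. -/
structure JIndex (Y : Fin N → ℤ) {r : ℕ} (θ : Fin (r + 1) → Fin N) (idx : Fin N → Fin (r + 1)) : Prop where
  ne : ∀ i, Y (θ i) ≠ 0
  idx_θ : ∀ i, idx (θ i) = i
  θ_idx : ∀ l, Y l ≠ 0 → θ (idx l) = l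

theorem exists_jIndex {r : ℕ} (hr : (Finset.univ.filter fun i => Y i ≠ 0).card = r + 1) :
    ∃ (θ : Fin (r + 1) → Fin N) (idx : Fin N → Fin (r + 1)), JIndex Y θ idx := by
  classical
  have h : Fintype.card {i // Y i ≠ 0} = r + 1 := by rw [Fintype.card_subtype, hr]
  let t := (Fintype.equivFinOfCardEq h).symm
  refine ⟨fun i => t i, fun l => if hl : Y l ≠ 0 then t.symm ⟨l, hl⟩ else 0, fun i => (t i).2, fun i => ?_,
    fun l hl => ?_⟩
  · rw [dif_pos (t i).2]; simp
  · simp only [dif_pos hl, Equiv.apply_symm_apply]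

theorem JIndex.neg {r : ℕ} {θ : Fin (r + 1) → Fin N} {idx : Fin N → Fin (r + 1)} (h : JIndex Y θ idx) :
    JIndex (-Y) θ idx :=
  ⟨fun i => by simpa using h.ne i, h.idx_θ, fun l hl => h.θ_idx l (by simpa using hl)⟩

theorem JIndex.sum_eq {r : ℕ} {θ : Fin (r + 1) → Fin N} {idx : Fin N → Fin (r + 1)} (h : JIndex Y θ idx)
    {f : Fin N → ℂ} (hf : ∀ l, Y l = 0 → f l = 0) : ∑ l, f l = ∑ i, f (θ i) := by
  classical
  rw [← Finset.sum_filter_of_ne (p := fun l => Y l ≠ 0) fun l _ hl h0 => hl (hf l h0)]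
  exact Finset.sum_nbij' idx θ (by simp) (by simpa using h.ne) (fun l hl => h.θ_idx l (by simpa using hl))
    (by simpa using h.idx_θ) (fun l hl => by rw [h.θ_idx l (by simpa using hl)])

/-- A holomorphic local section `σ` over `O` of the quotient map to the fixed locus, normalized by a
gauge. -/
structure BaseSection {m : ℕ} (k : Submodule ℝ (Fin N → ℝ)) (α : StrongDual ℝ k) (β : k →L[ℝ] ℂ)
    (Y : Fin N → ℤ) (H₀ : Subgroup (Fin N → ℂˣ)) [Nonempty (X k α β)] [Nonempty (fixedLocus k α β H₀)]
    [ChartedSpace (Fin m → ℂ) (fixedLocus k α β H₀)] (O : Set (fixedLocus k α β H₀)) (σ : fixedLocus k α β H₀ → HN N) : Prop where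
  isOpen : IsOpen O
  hol : ContMDiffOn 𝓘(ℂ, Fin m → ℂ) 𝓘(ℂ, HN N) ω σ O
  mem : ∀ c ∈ O, σ c ∈ stabFix k α β Y
  Q_σ : ∀ c ∈ O, Qfix α β H₀ (σ c) = c
  gauge : ∃ G : Gauge k β {i | Y i = 0}, ∀ c ∈ O, ∀ i ∈ G.B, raw G.ε (σ c) i = G.c i

theorem xc_act_expY (hu : ∀ i, Y i = 0 ∨ Y i = 1 ∨ Y i = -1) (s : ℂˣ) (q : HN N) {l : Fin N} (hl : Y l ≠ 0) :
    xc Y (act (expY Y s) q) l = xc Y q l * s := by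
  rcases hu l with h | h | h
  · exact absurd h hl
  · simp [xc, act, expY, h]
  · simp [xc, act, expY, h]

theorem act_expY_of_zero (s : ℂˣ) (q : HN N) {l : Fin N} (hl : Y l = 0) :
    (act (expY Y s) q).1 l = q.1 l ∧ (act (expY Y s) q).2 l = q.2 l := by
  simp [act, expY, hl]

section Triv

variable {r : ℕ} {θ : Fin (r + 1) → Fin N} {idx : Fin N → Fin (r + 1)} {w : Fin N → ℂ}

/-- The point over `c` with homogeneous coordinates `a`. -/
def fibrePt (Y : Fin N → ℤ) (idx : Fin N → Fin (r + 1)) (w : Fin N → ℂ) (c : HN N) (a : Fin (r + 1) → ℂ) : HN N :=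
  mkXY Y c (fun l => w l * a (idx l)) 0

/-- The linear part of `fibrePt` in `c`. -/
def fibreL₁ (Y : Fin N → ℤ) : HN N →L[ℂ] HN N :=
  LinearMap.toContinuousLinearMap
    { toFun := proj0 Y
      map_add' := fun q q' => by ext l <;> by_cases h : Y l = 0 <;> simp [proj0, h]
      map_smul' := fun t q => by ext l <;> by_cases h : Y l = 0 <;> simp [proj0, h] }

/-- The linear part of `fibrePt` in `a`. -/
def fibreL₂ (Y : Fin N → ℤ) (idx : Fin N → Fin (r + 1)) (w : Fin N → ℂ) : (Fin (r + 1) → ℂ) →L[ℂ] HN N :=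
  LinearMap.toContinuousLinearMap
    { toFun := fun a => fibrePt Y idx w 0 a
      map_add' := fun a b => by
        ext l <;> by_cases h : Y l = 0 <;> by_cases h1 : Y l = 1 <;> simp [fibrePt, mkXY, h, h1, mul_add]
      map_smul' := fun t a => by
        ext l <;> by_cases h : Y l = 0 <;> by_cases h1 : Y l = 1 <;>
          simp [fibrePt, mkXY, h, h1, mul_left_comm] }

theorem fibrePt_eq (c : HN N) (a : Fin (r + 1) → ℂ) :
    fibrePt Y idx w c a = fibreL₁ Y c + fibreL₂ Y idx w a := by
  change _ = proj0 Y c + fibrePt Y idx w 0 a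
  ext l <;> by_cases h : Y l = 0 <;> by_cases h1 : Y l = 1 <;> simp [fibrePt, mkXY, proj0, h, h1]

theorem xc_fibrePt (hJ : JIndex Y θ idx) (c : HN N) (a : Fin (r + 1) → ℂ) (i : Fin (r + 1)) :
    xc Y (fibrePt Y idx w c a) (θ i) = w (θ i) * a i := by
  unfold fibrePt
  rw [xc_mkXY _ _ _ (hJ.ne i), hJ.idx_θ]

variable (W : WallCrossing k β α αp αm Y)
include W

theorem WallCrossing.yVanish_fibrePt (c : HN N) (a : Fin (r + 1) → ℂ) : YVanish Y (fibrePt Y idx w c a) :=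
  (yVanish_iff W.unit).2 fun _ hi => yc_mkXY _ _ _ hi

theorem WallCrossing.fibrePt_mem_stab (hJ : JIndex Y θ idx) (hw : ∀ l, Y l ≠ 0 → w l ≠ 0) {c : HN N}
    (hc : c ∈ stabFix k α β Y) {a : Fin (r + 1) → ℂ} (ha : a ≠ 0) :
    fibrePt Y idx w c a ∈ stab k αp β := by
  obtain ⟨i, hi⟩ := Function.ne_iff.1 ha
  refine W.mkXY_mem_stab hc (hJ.ne i) ?_
  rw [hJ.idx_θ]
  exact mul_ne_zero (hw _ (hJ.ne i)) hi

theorem WallCrossing.fibrePt_congr (hJ : JIndex Y θ idx) (hw : ∀ l, Y l ≠ 0 → w l ≠ 0) {c q : HN N}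
    (hq : proj0 Y q = c) (hv : YVanish Y q) :
    fibrePt Y idx w c (fun i => xc Y q (θ i) / w (θ i)) = q := by
  subst hq
  refine hn_ext W.unit (fun l hl => ?_) (fun l hl => ?_) fun l hl => ?_
  · simp [fibrePt, mkXY, proj0, hl]
  · unfold fibrePt
    rw [xc_mkXY _ _ _ hl]
    simp only [hJ.θ_idx l hl]
    rw [mul_div_cancel₀ _ (hw l hl)]
  · rw [(yVanish_iff W.unit).1 hv l hl]; exact yc_mkXY _ _ _ hl

/-- Comparing weight-zero parts forces ζ into the stabilizer of c, the group generated by Y, which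
scales homogeneous coordinates. -/
theorem WallCrossing.act_fibrePt_iff (hK : IsUnimodular k) (hJ : JIndex Y θ idx)
    (hw : ∀ l, Y l ≠ 0 → w l ≠ 0) {c : HN N} (hc : c ∈ stabFix k α β Y) {a a' : Fin (r + 1) → ℂ} :
    (∃ ζ ∈ complexSubtorus k, act ζ (fibrePt Y idx w c a) = fibrePt Y idx w c a') ↔
      ∃ s : ℂ, s ≠ 0 ∧ a' = s • a := by
  constructor
  · rintro ⟨ζ, hζ, h⟩
    have h1 := congrArg (proj0 Y) h
    rw [proj0_act, fibrePt, fibrePt, proj0_mkXY, proj0_mkXY, proj0_eq_self hc.2] at h1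
    obtain ⟨s, rfl⟩ := W.exists_eq_expY hK hc hζ h1
    refine ⟨s, s.ne_zero, funext fun i => ?_⟩
    have h2 := congrArg (fun q => xc Y q (θ i)) h
    simp only [xc_act_expY W.unit s _ (hJ.ne i), xc_fibrePt hJ] at h2
    have := hw _ (hJ.ne i)
    refine mul_left_cancel₀ this ?_
    rw [← h2, Pi.smul_apply, smul_eq_mul]; ring
  · rintro ⟨s, hs, rfl⟩
    refine ⟨expY Y (Units.mk0 s hs), expY_mem W.mem _, hn_ext W.unit (fun l hl => ?_) (fun l hl => ?_)
      fun l hl => ?_⟩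
    · rw [(act_expY_of_zero _ _ hl).1, (act_expY_of_zero _ _ hl).2]; simp [fibrePt, mkXY, hl]
    · rw [xc_act_expY W.unit _ _ hl, fibrePt, fibrePt, xc_mkXY _ _ _ hl, xc_mkXY _ _ _ hl]
      simp only [Units.val_mk0, Pi.smul_apply, smul_eq_mul]; ring
    · rw [(yVanish_iff W.unit).1 ((yVanish_act _ _).2 (W.yVanish_fibrePt c a)) l hl,
        (yVanish_iff W.unit).1 (W.yVanish_fibrePt c _) l hl]

end Triv

end ToricHK

/-! ### Holomorphic trivializations of the projective bundles -/

namespace ToricHK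

variable {N : ℕ} {k : Submodule ℝ (Fin N → ℝ)} {α αp αm : StrongDual ℝ k} {β : k →L[ℝ] ℂ}
  {Y : Fin N → ℤ} {m r : ℕ} {H₀ : Subgroup (Fin N → ℂˣ)} [Nonempty (X k α β)]
  [Nonempty (fixedLocus k α β H₀)] [ChartedSpace (Fin m → ℂ) (fixedLocus k α β H₀)]
  {O : Set (fixedLocus k α β H₀)} {σ : fixedLocus k α β H₀ → HN N} {θ : Fin (r + 1) → Fin N}
  {idx : Fin N → Fin (r + 1)} {w : Fin N → ℂ}

theorem BaseSection.neg (h : BaseSection (m := m) k α β Y H₀ O σ) :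
    BaseSection (m := m) k α β (-Y) H₀ O σ := by
  have hY : {i | (-Y) i = 0} = {i | Y i = 0} := by ext i; simp
  refine ⟨h.isOpen, h.hol, fun c hc => ⟨(h.mem c hc).1, fun i hi => (h.mem c hc).2 i (by simpa using hi)⟩,
    h.Q_σ, ?_⟩
  rw [hY]; exact h.gauge

/-- The derivative of a map to a fibre bundle in homogeneous coordinates. -/
theorem eq_smul_of_fderiv_nrm (hJ : JIndex Y θ idx) (hw : ∀ l, Y l ≠ 0 → w l ≠ 0)
    {j : Fin N} {G : Gauge k β Set.univ} (hG : IsAdapted Y j G) {c : HN N} {a : Fin (r + 1) → ℂ}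
    (hc : ∀ i ∈ G.B, raw G.ε (fibrePt Y idx w c a) i = G.c i) {v : HN N} {u' : Fin (r + 1) → ℂ}
    (hv : ∀ i ∈ G.B, i ≠ j → raw G.ε v i = 0)
    (h : fderiv ℂ G.nrm (fibrePt Y idx w c a) (fibrePt Y idx w v u') = 0) :
    proj0 Y v = 0 ∧ ∃ s : ℂ, u' = s • a := by
  have hd : fibrePt Y idx w c a ∈ G.dom := fun i hi => by rw [hc i hi]; exact G.ne i hi
  obtain ⟨t, ht⟩ := Gauge.fderiv_nrm hd (fibrePt Y idx w v u')
  have h1 : ∀ l, (fibrePt Y idx w v u').1 l + (fibrePt Y idx w c a).1 l * ∑ i ∈ G.B, t i * G.e i l = 0 ∧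
      (fibrePt Y idx w v u').2 l - (fibrePt Y idx w c a).2 l * ∑ i ∈ G.B, t i * G.e i l = 0 := by
    intro l
    have hg := Gauge.gam_ne hd l
    have h2 := ht l
    rw [h] at h2
    exact ⟨(mul_eq_zero.1 h2.1.symm).resolve_left hg, (mul_eq_zero.1 h2.2.symm).resolve_left (inv_ne_zero hg)⟩
  -- At a weight-zero frame index the normalized coordinate is non-zero and v does not move it, so
  -- the infinitesimal motion has no component there.
  have hti : ∀ i ∈ G.B, i ≠ j → t i = 0 := by
    intro i hi hij
    have hs : ∑ l ∈ G.B, t l * (G.e l i : ℂ) = t i := by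
      rw [Finset.sum_eq_single i]
      · simp [G.frame.dual i hi i hi]
      · intro l hl hli; simp [G.frame.dual l hl i hi, hli]
      · intro hn; exact absurd hi hn
    have h2 := h1 i
    rw [hs] at h2
    have h3 := hv i hi hij
    have h4 := hc i hi
    have h5 := G.ne i hi
    rw [← h4] at h5
    have h0 := hG.zero i hi hij
    unfold raw at h3 h5
    unfold fibrePt at h2 h5
    rw [(mkXY_of_zero _ _ _ h0).1, (mkXY_of_zero _ _ _ h0).2, (mkXY_of_zero _ _ _ h0).1,
      (mkXY_of_zero _ _ _ h0).2] at h2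
    rw [(mkXY_of_zero _ _ _ h0).1, (mkXY_of_zero _ _ _ h0).2] at h5
    by_cases hε : G.ε i = true
    · simp only [hε, if_true] at h3 h5
      rw [h3, zero_add] at h2
      exact (mul_eq_zero.1 h2.1).resolve_left h5
    · simp only [hε, if_false, Bool.false_eq_true] at h3 h5
      rw [h3, zero_sub, neg_eq_zero] at h2
      exact (mul_eq_zero.1 h2.2).resolve_left h5
  -- Only the motion along Y survives: it vanishes on weight-zero coordinates and rescales a.
  have hsum : ∀ l, ∑ i ∈ G.B, t i * (G.e i l : ℂ) = t j * (Y j * Y l) := by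
    intro l
    rw [Finset.sum_eq_single j]
    · rw [hG.e_j]; push_cast; ring
    · intro i hi hij; rw [hti i hi hij, zero_mul]
    · intro hn; exact absurd hG.mem hn
  simp only [hsum] at h1
  refine ⟨?_, -(t j * Y j), funext fun i => ?_⟩
  · have h2 : ∀ l, Y l = 0 → v.1 l = 0 ∧ v.2 l = 0 := by
      intro l hl
      have h3 := h1 l
      rw [hl] at h3
      simpa [fibrePt, mkXY, hl] using h3
    ext l <;> by_cases hl : Y l = 0 <;> simp [proj0, hl]
    · exact (h2 l hl).1
    · exact (h2 l hl).2
  · refine mul_left_cancel₀ (hw _ (hJ.ne i)) ?_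
    have h2 := h1 (θ i)
    have e1 := xc_fibrePt (w := w) hJ c a i
    have e2 := xc_fibrePt (w := w) hJ v u' i
    rw [← e2, Pi.smul_apply, smul_eq_mul, mul_left_comm, ← e1]
    unfold xc
    rcases hG.unit (θ i) with h3 | h3 | h3
    · exact absurd h3 (hJ.ne i)
    · rw [h3] at h2
      simp only [h3, if_true]
      push_cast at h2
      linear_combination h2.1
    · rw [h3] at h2
      have : ¬ ((-1 : ℤ) = 1) := by decide
      simp only [h3, if_neg this]
      push_cast at h2
      linear_combination h2.2

variable (W : WallCrossing k β α αp αm Y)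
include W

/-- A point of V₊ is given by a base point, lifted by σ, and its coordinates of positive weight. For
immersivity, `nrm` is invariant under K_ℂ, so a vector collapsed by the quotient map is killed by
its derivative, and `eq_smul_of_fderiv_nrm` applies. -/
theorem WallCrossing.isProjectiveTrivialization (hK : IsUnimodular k) {d : ℕ} [Nonempty (X k αp β)]
    (hF : ∀ p : HN N, (∀ ζ ∈ H₀, act ζ p = p) ↔ ∀ i, Y i ≠ 0 → p.1 i = 0 ∧ p.2 i = 0)
    [ChartedSpace (Fin d → ℂ) (X k αp β)] (hX : IsHolQuot d (stab k αp β) (Qm k αp β))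
    (hB : IsHolQuot m (stabFix k α β Y) (Qfix α β H₀)) (hσ : BaseSection (m := m) k α β Y H₀ O σ)
    (hJ : JIndex Y θ idx) (hw : ∀ l, Y l ≠ 0 → w l ≠ 0) :
    ComplexGeometry.IsProjectiveTrivialization (d := d) (m := m)
      ((fixedLocus k α β H₀).restrictPreimage (natMor Y α αp)) r O
      fun x => Qm k αp β (fibrePt Y idx w (σ x.1) x.2) := by
  have hnat : ∀ c ∈ O, ∀ a : Fin (r + 1) → ℂ, a ≠ 0 →
      natMor Y α αp (Qm k αp β (fibrePt Y idx w (σ c) a)) = c := fun c hc a ha => by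
    have hs := W.fibrePt_mem_stab hJ hw (hσ.mem c hc) ha
    rw [W.natMor_Qm hK hs, toWall, if_pos (W.yVanish_fibrePt _ _), fibrePt, proj0_mkXY,
      proj0_eq_self (hσ.mem c hc).2, ← coe_Qfix hK hF (hσ.mem c hc), hσ.Q_σ c hc]
  have hopen : IsOpen (O ×ˢ {a : Fin (r + 1) → ℂ | a ≠ 0}) :=
    hσ.isOpen.prod (isOpen_ne_fun continuous_id continuous_const)
  have hσat : ∀ c ∈ O, ContMDiffAt 𝓘(ℂ, Fin m → ℂ) 𝓘(ℂ, HN N) ω σ c := fun c hc =>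
    (hσ.hol c hc).contMDiffAt (hσ.isOpen.mem_nhds hc)
  have hf : ∀ x ∈ O ×ˢ {a : Fin (r + 1) → ℂ | a ≠ 0},
      ContMDiffAt (𝓘(ℂ, Fin m → ℂ).prod 𝓘(ℂ, Fin (r + 1) → ℂ)) 𝓘(ℂ, HN N) ω
        (fun x : fixedLocus k α β H₀ × (Fin (r + 1) → ℂ) => fibrePt Y idx w (σ x.1) x.2) x := by
    intro x hx
    have h1 : ContMDiffAt (𝓘(ℂ, Fin m → ℂ).prod 𝓘(ℂ, Fin (r + 1) → ℂ)) 𝓘(ℂ, HN N) ω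
        (fun x : fixedLocus k α β H₀ × (Fin (r + 1) → ℂ) => fibreL₁ Y (σ x.1)) x :=
      ((fibreL₁ Y).contMDiff.contMDiffAt (x := σ x.1)).comp x ((hσat x.1 hx.1).comp x contMDiffAt_fst)
    have h2 : ContMDiffAt (𝓘(ℂ, Fin m → ℂ).prod 𝓘(ℂ, Fin (r + 1) → ℂ)) 𝓘(ℂ, HN N) ω
        (fun x : fixedLocus k α β H₀ × (Fin (r + 1) → ℂ) => fibreL₂ Y idx w x.2) x :=
      ((fibreL₂ Y idx w).contMDiff.contMDiffAt (x := x.2)).comp x contMDiffAt_snd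
    simp only [fibrePt_eq]
    exact h1.add h2
  have hfS : ∀ x ∈ O ×ˢ {a : Fin (r + 1) → ℂ | a ≠ 0},
      ∀ᶠ y : fixedLocus k α β H₀ × (Fin (r + 1) → ℂ) in 𝓝 x,
        fibrePt Y idx w (σ y.1) y.2 ∈ stab k αp β := fun x hx => by
    filter_upwards [hopen.mem_nhds hx] with y hy
    exact W.fibrePt_mem_stab hJ hw (hσ.mem _ hy.1) hy.2
  refine ⟨fun x hx => (hX.contMDiffAt_comp (hf x hx) (hfS x hx)).contMDiffWithinAt,
    fun c hc a ha => ?_, fun v hv => ?_, fun c hc a a' ha ha' => ?_, fun c hc a ha u u' hu => ?_⟩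
  · have h1 := hnat c hc a ha
    exact ⟨by rw [Set.mem_preimage, h1]; exact c.2, Subtype.ext h1⟩
  · obtain ⟨v, hvV⟩ := v
    obtain ⟨q, hq, rfl⟩ := hX.surj v
    have hyv := (W.natMor_mem_fixedLocus_iff hK hF hq).1 hvV
    set c := (fixedLocus k α β H₀).restrictPreimage (natMor Y α αp) ⟨Qm k αp β q, hvV⟩ with hc
    have h1 : Qm k α β (proj0 Y q) = Qm k α β (σ c) := by
      rw [← coe_Qfix hK hF (hσ.mem c hv), hσ.Q_σ c hv, hc]
      change _ = natMor Y α αp (Qm k αp β q)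
      rw [W.natMor_Qm hK hq, toWall, if_pos hyv]
    obtain ⟨ζ, hζ, h2⟩ := (Qm_eq_iff hK (W.proj0_mem_stab hq hyv) (hσ.mem c hv).1).1 h1
    have hq' := act_mem_stab hζ hq
    have h3 := W.fibrePt_congr hJ hw (q := act ζ q) (by rw [proj0_act, h2]) ((yVanish_act ζ q).2 hyv)
    refine ⟨fun i => xc Y (act ζ q) (θ i) / w (θ i), fun h0 => ?_, ?_⟩
    · refine W.not_yVanish_neg hq' ((yVanish_neg_iff W.unit).2 fun l hl => ?_)
      have := congrFun h0 (idx l)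
      simp only [hJ.θ_idx l hl, Pi.zero_apply] at this
      exact (div_eq_zero_iff.1 this).resolve_right (hw l hl)
    · change Qm k αp β (fibrePt Y idx w (σ c) _) = Qm k αp β q
      rw [h3, Qm_act hK hζ hq]
  · rw [← W.act_fibrePt_iff hK hJ hw (hσ.mem c hc)]
    exact Qm_eq_iff hK (W.fibrePt_mem_stab hJ hw (hσ.mem c hc) ha) (W.fibrePt_mem_stab hJ hw (hσ.mem c hc) ha')
  · have hx : (c, a) ∈ O ×ˢ {a : Fin (r + 1) → ℂ | a ≠ 0} := ⟨hc, ha⟩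
    obtain ⟨G₀, hG₀⟩ := hσ.gauge
    obtain ⟨i, hi⟩ := Function.ne_iff.1 ha
    have hz : ∀ i ∈ G₀.B, Y i = 0 := fun i hi => G₀.frame.sub i hi
    have hraw : ∀ i ∈ G₀.B, raw G₀.ε (fibrePt Y idx w (σ c) a) i = raw G₀.ε (σ c) i := fun i hi => by
      unfold raw fibrePt
      rw [(mkXY_of_zero _ _ _ (hz i hi)).1, (mkXY_of_zero _ _ _ (hz i hi)).2]
    obtain ⟨G, hG, hGB, hGε, hGc⟩ := W.exists_adapted hK G₀ (hJ.ne i)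
      (muC_of_mem_stab (W.fibrePt_mem_stab hJ hw (hσ.mem c hc) ha))
      (fun i hi => by rw [hraw i hi, hG₀ c hc i hi]; exact G₀.ne i hi)
      (by rw [xc_fibrePt hJ]; exact mul_ne_zero (hw _ (hJ.ne i)) hi)
    have hd : fibrePt Y idx w (σ c) a ∈ G.dom := fun i hi => by rw [hGc i hi]; exact G.ne i hi
    have h1 := hX.mfderiv_invariant (hf _ hx) (hfS _ hx) (g := G.nrm) Gauge.isOpen_dom hd
      (Gauge.contDiffAt_nrm hd) (fun q hq q' hq' h _ _ => by
        obtain ⟨ζ, hζ, rfl⟩ := (Qm_eq_iff hK hq hq').1 h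
        rw [Gauge.nrm_act (G := G) hζ fun l hl => absurd trivial hl]) hu
    have hσd := ((hσat c hc).mdifferentiableAt (by simp : (ω : WithTop ℕ∞) ≠ 0)).hasMFDerivAt
    have e1 : HasMFDerivAt (𝓘(ℂ, Fin m → ℂ).prod 𝓘(ℂ, Fin (r + 1) → ℂ)) 𝓘(ℂ, HN N)
        (fibreL₁ Y ∘ σ ∘ Prod.fst) (c, a) _ :=
      HasMFDerivAt.comp (c, a) (fibreL₁ Y).hasMFDerivAt (HasMFDerivAt.comp (c, a) hσd (hasMFDerivAt_fst (c, a)))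
    have e2 : HasMFDerivAt (𝓘(ℂ, Fin m → ℂ).prod 𝓘(ℂ, Fin (r + 1) → ℂ)) 𝓘(ℂ, HN N)
        (fibreL₂ Y idx w ∘ Prod.snd) (c, a) _ :=
      HasMFDerivAt.comp (c, a) (fibreL₂ Y idx w).hasMFDerivAt (hasMFDerivAt_snd (c, a))
    have e3 := e1.add e2
    have e4 : (fun x : fixedLocus k α β H₀ × (Fin (r + 1) → ℂ) => fibrePt Y idx w (σ x.1) x.2) =
        fibreL₁ Y ∘ σ ∘ Prod.fst + fibreL₂ Y idx w ∘ Prod.snd := funext fun x => fibrePt_eq _ _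
    rw [← e4] at e3
    have e5 := HasMFDerivAt.comp (c, a)
      ((Gauge.contDiffAt_nrm hd).differentiableAt (by simp)).hasFDerivAt.hasMFDerivAt e3
    obtain ⟨v, hv⟩ : ∃ v : HN N, v = mfderiv 𝓘(ℂ, Fin m → ℂ) 𝓘(ℂ, HN N) σ c u := ⟨_, rfl⟩
    have e6 : fderiv ℂ G.nrm (fibrePt Y idx w (σ c) a) (fibrePt Y idx w v u') = 0 := by
      rw [fibrePt_eq v u', hv]
      exact (congrArg (fun L : ((Fin m → ℂ) × (Fin (r + 1) → ℂ)) →L[ℂ] HN N => L (u, u'))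
        e5.mfderiv).symm.trans h1
    -- σ takes values in the slice of G₀, so the normalized coordinates have zero derivative along
    -- it.
    have hconst : ∀ i ∈ G₀.B, raw G₀.ε v i = 0 := by
      intro i hi
      have f1 : HasMFDerivAt 𝓘(ℂ, Fin m → ℂ) 𝓘(ℂ, ℂ) (coordL (i, G₀.ε i) ∘ σ) c _ :=
        (coordL (i, G₀.ε i)).hasMFDerivAt.comp c hσd
      have f2 : coordL (i, G₀.ε i) ∘ σ =ᶠ[𝓝 c] fun _ => G₀.c i := by
        filter_upwards [hσ.isOpen.mem_nhds hc] with c' hc'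
        exact (coordL_raw _ _ _).trans (hG₀ c' hc' i hi)
      have f3 := hasMFDerivAt_unique f1 ((hasMFDerivAt_const (G₀.c i) c).congr_of_eventuallyEq f2)
      rw [← coordL_raw, hv]
      exact congrArg (fun L : (Fin m → ℂ) →L[ℂ] ℂ => L u) f3
    obtain ⟨h2, h3⟩ := eq_smul_of_fderiv_nrm hJ hw hG hGc (fun i' hi' hij => by
      have hi0 : i' ∈ G₀.B := by rw [hGB] at hi'; exact (Finset.mem_insert.1 hi').resolve_left hij
      have := hconst i' hi0
      unfold raw at this ⊢
      rwa [hGε i' hi0]) e6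
    -- The section has only weight-zero coordinates, so its derivative equals its own projection,
    -- which is zero; sections are immersions.
    refine ⟨hB.eq_zero_of_mfderiv_section (hσat c hc) ?_ ?_, h3⟩
    · filter_upwards [hσ.isOpen.mem_nhds hc] with c' hc'
      exact ⟨hσ.mem c' hc', hσ.Q_σ c' hc'⟩
    · have f1 : HasMFDerivAt 𝓘(ℂ, Fin m → ℂ) 𝓘(ℂ, HN N) (fibreL₁ Y ∘ σ) c _ :=
        (fibreL₁ Y).hasMFDerivAt.comp c hσd
      have f2 : σ =ᶠ[𝓝 c] fibreL₁ Y ∘ σ := by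
        filter_upwards [hσ.isOpen.mem_nhds hc] with c' hc'
        exact (proj0_eq_self (hσ.mem c' hc').2).symm
      have f3 := hasMFDerivAt_unique hσd (f1.congr_of_eventuallyEq f2)
      have f4 : mfderiv 𝓘(ℂ, Fin m → ℂ) 𝓘(ℂ, HN N) σ c u = fibreL₁ Y v := by
        rw [hv]; exact congrArg (fun L : (Fin m → ℂ) →L[ℂ] HN N => L u) f3
      exact f4.trans h2

end ToricHK

namespace ToricHK

variable {N : ℕ} {k : Submodule ℝ (Fin N → ℝ)} {α αp αm : StrongDual ℝ k} {β : k →L[ℝ] ℂ}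
  {Y : Fin N → ℤ}

/-! ## Symplectic forms on the blow-up -/

/-- The part of negative weight. -/
def negL (Y : Fin N → ℤ) : HN N →L[ℂ] HN N :=
  LinearMap.toContinuousLinearMap
    { toFun := fun q => (fun i => if Y i = -1 then q.1 i else 0, fun i => if Y i = 1 then q.2 i else 0)
      map_add' := fun q q' => by
        ext l
        · by_cases h : Y l = -1 <;> simp [h]
        · by_cases h : Y l = 1 <;> simp [h]
      map_smul' := fun t q => by
        ext l
        · by_cases h : Y l = -1 <;> simp [h]
        · by_cases h : Y l = 1 <;> simp [h] }

theorem negL_fst (q : HN N) (i : Fin N) : (negL Y q).1 i = if Y i = -1 then q.1 i else 0 := rfl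

theorem negL_snd (q : HN N) (i : Fin N) : (negL Y q).2 i = if Y i = 1 then q.2 i else 0 := rfl

theorem blw_eq (t : ℂ) (q : HN N) : blw Y t q = q + (t - 1) • negL Y q := by
  ext i
  · change (if Y i = -1 then t * q.1 i else q.1 i) = q.1 i + (t - 1) * (negL Y q).1 i
    rw [negL_fst]; split_ifs <;> ring
  · change (if Y i = 1 then t * q.2 i else q.2 i) = q.2 i + (t - 1) * (negL Y q).2 i
    rw [negL_snd]; split_ifs <;> ring

theorem fderiv_blw (a v : HN N × ℂ) :
    fderiv ℂ (fun a : HN N × ℂ => blw Y a.2 a.1) a v = blw Y a.2 v.1 + v.2 • negL Y a.1 := by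
  have h1 : HasFDerivAt (fun a : HN N × ℂ => a.1) (ContinuousLinearMap.fst ℂ (HN N) ℂ) a := hasFDerivAt_fst
  have h2 : HasFDerivAt (fun a : HN N × ℂ => a.2 - 1) (ContinuousLinearMap.snd ℂ (HN N) ℂ) a :=
    hasFDerivAt_snd.sub_const 1
  have h3 : HasFDerivAt (fun a : HN N × ℂ => negL Y a.1) ((negL Y).comp (ContinuousLinearMap.fst ℂ (HN N) ℂ)) a :=
    (negL Y).hasFDerivAt.comp a h1
  have h4 := h1.add (h2.smul h3)
  have h5 : (fun a : HN N × ℂ => blw Y a.2 a.1) =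
      (fun a : HN N × ℂ => a.1) + (fun a : HN N × ℂ => a.2 - 1) • fun a => negL Y a.1 :=
    funext fun a => blw_eq _ _
  rw [h5, h4.fderiv, blw_eq a.2 v.1, add_assoc]
  rfl

/-- Up to sign, the forms pulled back under (x, t y) and (t x, y) differ by dt ∧ d(∑ Yᵢ xᵢ yᵢ). The
hypotheses say that the second factor vanishes on both vectors. -/
theorem complexForm_blw (hu : ∀ i, Y i = 0 ∨ Y i = 1 ∨ Y i = -1) (p v v' : HN N) (t τ τ' : ℂ)
    (h : ∑ i, (Y i : ℂ) * (v.1 i * p.2 i + p.1 i * v.2 i) = 0)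
    (h' : ∑ i, (Y i : ℂ) * (v'.1 i * p.2 i + p.1 i * v'.2 i) = 0) :
    complexForm (blw Y t v + τ • negL Y p) (blw Y t v' + τ' • negL Y p) =
      complexForm (blw (-Y) t v + τ • negL (-Y) p) (blw (-Y) t v' + τ' • negL (-Y) p) := by
  unfold complexForm
  rw [← sub_eq_zero, ← Finset.sum_sub_distrib]
  calc _ = ∑ i, (τ' * ((Y i : ℂ) * (v.1 i * p.2 i + p.1 i * v.2 i)) -
        τ * ((Y i : ℂ) * (v'.1 i * p.2 i + p.1 i * v'.2 i))) := by
        refine Finset.sum_congr rfl fun i _ => ?_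
        simp only [Prod.fst_add, Prod.snd_add, Prod.smul_fst, Prod.smul_snd, Pi.add_apply, Pi.smul_apply,
          smul_eq_mul, negL_fst, negL_snd, blw, Pi.neg_apply]
        rcases hu i with hi | hi | hi
        · simp [hi]
        · simp [hi]; ring
        · simp [hi]; ring
    _ = 0 := by rw [Finset.sum_sub_distrib, ← Finset.mul_sum, ← Finset.mul_sum, h, h']; simp

theorem ysum_mfderiv {E' H' N' : Type*} [NormedAddCommGroup E'] [NormedSpace ℂ E'] [TopologicalSpace H']
    {I : ModelWithCorners ℂ E' H'} [TopologicalSpace N'] [ChartedSpace H' N'] {f : N' → HN N × ℂ} {x : N'}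
    (hf : MDifferentiableAt I 𝓘(ℂ, HN N × ℂ) f x) (hfS : ∀ᶠ y in 𝓝 x, ysum Y (f y).1 = 0)
    (u : TangentSpace I x) (v : HN N × ℂ) (hv : v = mfderiv I 𝓘(ℂ, HN N × ℂ) f x u) :
    ∑ i, (Y i : ℂ) * (v.1.1 i * (f x).1.2 i + (f x).1.1 i * v.1.2 i) = 0 := by
  let L : HN N × ℂ →L[ℂ] ℂ := ∑ i, (Y i : ℂ) • ((f x).1.1 i • (coordL (i, false)).comp (ContinuousLinearMap.fst ℂ _ _)
    + (f x).1.2 i • (coordL (i, true)).comp (ContinuousLinearMap.fst ℂ _ _))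
  have hg : HasFDerivAt (fun a : HN N × ℂ => ysum Y a.1) L (f x) := by
    refine HasFDerivAt.fun_sum fun i _ => ?_
    refine HasFDerivAt.const_mul ?_ _
    exact (((coordL (i, true)).comp (ContinuousLinearMap.fst ℂ (HN N) ℂ)).hasFDerivAt (x := f x)).mul
      (((coordL (i, false)).comp (ContinuousLinearMap.fst ℂ (HN N) ℂ)).hasFDerivAt (x := f x))
  have h1 := hg.hasMFDerivAt.comp x hf.hasMFDerivAt
  have h2 : (fun a : HN N × ℂ => ysum Y a.1) ∘ f =ᶠ[𝓝 x] fun _ => (0 : ℂ) := hfS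
  have h3 := hasMFDerivAt_unique h1 ((hasMFDerivAt_const (0 : ℂ) x).congr_of_eventuallyEq h2)
  have h4 : L v = 0 := by rw [hv]; exact congrArg (fun T : E' →L[ℂ] ℂ => T u) h3
  rw [← h4]
  simp only [L, sum_apply, smul_apply, add_apply,
    ContinuousLinearMap.comp_apply, ContinuousLinearMap.coe_fst', coordL_true, coordL_false, smul_eq_mul]
  exact Finset.sum_congr rfl fun i _ => by ring

theorem IsSymplQuot.pull_of_eventuallyEq {d : ℕ} {M : Type} [TopologicalSpace M] [ChartedSpace (Fin d → ℂ) M]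
    {S : Set (HN N)} {Q : HN N → M}
    {Ω : (x : M) → TangentSpace 𝓘(ℂ, Fin d → ℂ) x [⋀^Fin 2]→L[ℂ] ℂ} (h : IsSymplQuot k β d S Q Ω)
    {E' H' N' : Type*} [NormedAddCommGroup E'] [NormedSpace ℂ E']
    [TopologicalSpace H'] {I : ModelWithCorners ℂ E' H'} [TopologicalSpace N'] [ChartedSpace H' N']
    {f : N' → HN N} {x : N'} (hf : ContMDiffAt I 𝓘(ℂ, HN N) ω f x) (hfS : ∀ᶠ y in 𝓝 x, f y ∈ S)
    {g : N' → M} (hg : ∀ᶠ y in 𝓝 x, g y = Q (f y)) (u v : TangentSpace I x) :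
    Ω (g x) ![mfderiv I 𝓘(ℂ, Fin d → ℂ) g x u, mfderiv I 𝓘(ℂ, Fin d → ℂ) g x v] =
      complexForm (mfderiv I 𝓘(ℂ, HN N) f x u) (mfderiv I 𝓘(ℂ, HN N) f x v) := by
  rw [← h.pull hf hfS u v]
  have h1 : g x = Q (f x) := hg.self_of_nhds
  have h2 : ∀ w : TangentSpace I x, (mfderiv I 𝓘(ℂ, Fin d → ℂ) g x w : Fin d → ℂ) =
      (mfderiv I 𝓘(ℂ, Fin d → ℂ) (fun y => Q (f y)) x w : Fin d → ℂ) := fun w => by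
    have hQ : MDifferentiableAt I 𝓘(ℂ, Fin d → ℂ) (fun y => Q (f y)) x :=
      (h.contMDiffAt_comp hf hfS).mdifferentiableAt (by simp)
    have := hasMFDerivAt_unique (hQ.congr_of_eventuallyEq hg).hasMFDerivAt
      (hQ.hasMFDerivAt.congr_of_eventuallyEq hg)
    exact congrArg (fun T : E' →L[ℂ] (Fin d → ℂ) => T w) this
  have h3 : ∀ (y : M) (_ : g x = y) (a b : Fin d → ℂ), Ω (g x) ![a, b] = Ω y ![a, b] := by
    rintro _ rfl a b; rfl
  refine (h3 _ h1 _ _).trans ?_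
  congr 2
  · exact h2 u
  · exact congrArg (fun w => ![w]) (h2 v)

end ToricHK

namespace ToricHK

variable {N : ℕ} {k : Submodule ℝ (Fin N → ℝ)} {α αp αm : StrongDual ℝ k} {β : k →L[ℝ] ℂ}
  {Y : Fin N → ℤ} {H₀ : Subgroup (Fin N → ℂˣ)}

/-! ## The flop -/

variable (W : WallCrossing k β α αp αm Y) (hK : IsUnimodular k)
include W hK

theorem WallCrossing.exists_baseSection {n m r : ℕ} (hn : Module.finrank ℝ k + n = N)
    (hr : (Finset.univ.filter fun i => Y i ≠ 0).card = r + 1) (hm : m + 2 * r = 2 * n)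
    [Nonempty (X k α β)] [Nonempty (fixedLocus k α β H₀)]
    (hF : ∀ p : HN N, (∀ ζ ∈ H₀, act ζ p = p) ↔ ∀ i, Y i ≠ 0 → p.1 i = 0 ∧ p.2 i = 0)
    [ChartedSpace (Fin m → ℂ) (fixedLocus k α β H₀)] (hB : IsHolQuot m (stabFix k α β Y) (Qfix α β H₀))
    (b : fixedLocus k α β H₀) : ∃ O σ, b ∈ O ∧ BaseSection (m := m) k α β Y H₀ O σ := by
  have hS := W.torusQuot_fix hK hF
  obtain ⟨p, hp, rfl⟩ := hB.surj b
  obtain ⟨g⟩ := W.nonempty_gaugeAt_fix hn hK hr hm hp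
  obtain ⟨c, hcs, -, -⟩ := hS.chart g.G g.sl hp g.hc
  refine ⟨c.e.source, fun x => c.s (c.e x), c.mem, c.e.open_source, ?_, fun x hx => ?_, fun x hx => ?_,
    g.G, fun x hx i hi => ?_⟩
  · exact c.s_an.contMDiffOn.comp (c.contMDiffOn hB) fun x hx => c.e.map_source hx
  · exact c.s_mem _ (c.e.map_source hx)
  · rw [c.Q_s _ (c.e.map_source hx), c.e.left_inv hx]
  · rw [hcs]; exact Gauge.raw_slc _ hi

section

variable [Nonempty (X k α β)] [Nonempty (X k αp β)] [Nonempty (X k αm β)]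

/-- For t = 0 both sides reduce to the common weight-zero part; for t ≠ 0 the two points lie in one
K_ℂ-orbit and neither is changed by `toWall`. -/
theorem WallCrossing.natMor_eq {a : HN N × ℂ} (ha : a ∈ Zhat k β αp αm Y) :
    natMor Y α αp (Qm k αp β (blw Y a.2 a.1)) = natMor (-Y) α αm (Qm k αm β (blw (-Y) a.2 a.1)) := by
  rw [W.natMor_Qm hK ha.1, W.swap.natMor_Qm hK ha.2.1]
  by_cases ht : a.2 = 0
  · rw [ht, toWall, toWall, if_pos (yVanish_blw_zero W.unit _), if_pos (yVanish_blw_zero W.swap.unit _),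
      proj0_blw, proj0_blw, proj0_neg]
  · have h1 := (W.snd_ne_zero_iff ha).1 ht
    have h2 := (W.swap.snd_ne_zero_iff (a := a) (by rw [Zhat_swap]; exact ha)).1 ht
    rw [toWall, toWall, if_neg h1, if_neg h2]
    have h3 := blw_neg_eq_act W.unit (Units.mk0 a.2 ht) a.1
    simp only [Units.val_mk0] at h3
    rw [h3, Qm_act hK (expY_mem W.mem _) (W.mem_stab_of_not_yVanish ha.1 h1).1]

omit [Nonempty (X k αm β)] in
theorem WallCrossing.restrictPreimage_eq [Nonempty (fixedLocus k α β H₀)]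
    (hF : ∀ p : HN N, (∀ ζ ∈ H₀, act ζ p = p) ↔ ∀ i, Y i ≠ 0 → p.1 i = 0 ∧ p.2 i = 0) {q : HN N}
    (hq : q ∈ stab k αp β) {x : natMor Y α αp ⁻¹' fixedLocus k α β H₀} (hx : x.1 = Qm k αp β q) :
    YVanish Y q ∧ (fixedLocus k α β H₀).restrictPreimage (natMor Y α αp) x = Qfix α β H₀ (proj0 Y q) := by
  have hv : natMor Y α αp (Qm k αp β q) ∈ fixedLocus k α β H₀ := by
    have := x.2
    rw [hx] at this
    exact this
  have hyv := (W.natMor_mem_fixedLocus_iff hK hF hq).1 hv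
  refine ⟨hyv, Subtype.ext ?_⟩
  rw [coe_Qfix hK hF (W.proj0_mem_stabFix hq hyv), Set.restrictPreimage_coe, hx, W.natMor_Qm hK hq, toWall,
    if_pos hyv]

omit [Nonempty (X k αm β)] in
-- Through a local section of the quotient map, the morphism on V₊ is projection to weight zero
-- followed by the quotient map of the fixed locus.
theorem WallCrossing.continuous_restrictPreimage [Nonempty (fixedLocus k α β H₀)]
    (hF : ∀ p : HN N, (∀ ζ ∈ H₀, act ζ p = p) ↔ ∀ i, Y i ≠ 0 → p.1 i = 0 ∧ p.2 i = 0) {d : ℕ}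
    [ChartedSpace (Fin d → ℂ) (X k αp β)] (hX : IsHolQuot d (stab k αp β) (Qm k αp β)) :
    Continuous ((fixedLocus k α β H₀).restrictPreimage (natMor Y α αp : X k αp β → X k α β)) := by
  have hS := W.torusQuot_fix hK hF
  have hco : ContinuousOn (fun q => Qfix α β H₀ (proj0 Y q)) {q | q ∈ stab k αp β ∧ YVanish Y q} :=
    hS.continuousOn.comp continuous_proj0.continuousOn fun q hq => W.proj0_mem_stabFix hq.1 hq.2
  rw [continuous_iff_continuousAt]
  intro x
  obtain ⟨q, hq, hqx⟩ := hX.surj x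
  obtain ⟨σ, hσ, hσq, hσS⟩ := hX.sec q hq
  rw [hqx] at hσ hσq hσS
  have hval : Filter.Tendsto (fun y : natMor Y α αp ⁻¹' fixedLocus k α β H₀ => (y : X k αp β)) (𝓝 x)
      (𝓝 (x : X k αp β)) := continuous_subtype_val.tendsto x
  have hloc : ∀ᶠ y : natMor Y α αp ⁻¹' fixedLocus k α β H₀ in 𝓝 x, σ (y : X k αp β) ∈ {q | q ∈ stab k αp β ∧ YVanish Y q} ∧
      (fixedLocus k α β H₀).restrictPreimage (natMor Y α αp) y = Qfix α β H₀ (proj0 Y (σ (y : X k αp β))) := by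
    filter_upwards [hval.eventually hσS] with y hy
    have h3 := W.restrictPreimage_eq hK hF hy.1 hy.2.symm
    exact ⟨⟨hy.1, h3.1⟩, h3.2⟩
  have hten : Filter.Tendsto (fun y : natMor Y α αp ⁻¹' fixedLocus k α β H₀ => σ (y : X k αp β)) (𝓝 x)
      (𝓝[{q | q ∈ stab k αp β ∧ YVanish Y q}] q) := by
    refine tendsto_nhdsWithin_iff.2 ⟨?_, hloc.mono fun x hx => hx.1⟩
    have h1 : Filter.Tendsto σ (𝓝 (x : X k αp β)) (𝓝 q) := by
      have := hσ.continuousAt.tendsto; rwa [hσq] at this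
    exact h1.comp hval
  have hyv := W.restrictPreimage_eq hK hF hq hqx.symm
  have h1 := (hco q ⟨hq, hyv.1⟩).tendsto.comp hten
  have h2 := h1.congr' (hloc.mono fun y hy => hy.2.symm)
  rw [← hyv.2] at h2
  exact h2

omit [Nonempty (X k α β)] in
-- The factors Yₗ in the homogeneous coordinates on the minus side absorb the signs of ∑ Yₗ xₗ yₗ,
-- so incidence becomes the standard pairing.
theorem WallCrossing.exists_incidence_iff {M : Type} {Q : HN N × ℂ → M} (hsurj : ∀ z, ∃ a ∈ Zhat k β αp αm Y, Q a = z)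
    {pp : M → X k αp β} {pm : M → X k αm β}
    (hpp : ∀ a ∈ Zhat k β αp αm Y, pp (Q a) = Qm k αp β (blw Y a.2 a.1))
    (hpm : ∀ a ∈ Zhat k β αp αm Y, pm (Q a) = Qm k αm β (blw (-Y) a.2 a.1)) {r : ℕ}
    {θ : Fin (r + 1) → Fin N} {idx : Fin N → Fin (r + 1)} (hJ : JIndex Y θ idx) {c : HN N}
    (hc : c ∈ stabFix k α β Y) {a a' : Fin (r + 1) → ℂ} (ha : a ≠ 0) (ha' : a' ≠ 0) :
    (∃ z, pp z = Qm k αp β (fibrePt Y idx (fun _ => 1) c a) ∧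
      pm z = Qm k αm β (fibrePt (-Y) idx (fun l => (Y l : ℂ)) c a')) ↔ ∑ i, a i * a' i = 0 := by
  have hYY : ∀ l, Y l ≠ 0 → (Y l : ℂ) * Y l = 1 := fun l hl => by
    rcases W.unit l with h | h | h
    · exact absurd h hl
    · simp [h]
    · simp [h]
  have hYne : ∀ l, Y l ≠ 0 → (Y l : ℂ) ≠ 0 := fun l hl => by exact_mod_cast hl
  have hc' : c ∈ stabFix k α β (-Y) := ⟨hc.1, fun i hi => hc.2 i (by simpa using hi)⟩
  constructor
  · rintro ⟨z, h1, h2⟩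
    obtain ⟨⟨p, t⟩, hz, rfl⟩ := hsurj z
    rw [hpp _ hz] at h1
    rw [hpm _ hz] at h2
    obtain ⟨ζ, hζ, h1⟩ := (Qm_eq_iff hK hz.1 (W.fibrePt_mem_stab hJ (fun _ _ => one_ne_zero) hc ha)).1 h1
    obtain ⟨ζ', hζ', h2⟩ := (Qm_eq_iff hK hz.2.1 (W.swap.fibrePt_mem_stab hJ.neg
      (fun l hl => hYne l (by simpa using hl)) hc' ha')).1 h2
    -- The image lies in V₊, so z is on the exceptional divisor.
    have ht : t = 0 := by
      by_contra ht
      refine (W.snd_ne_zero_iff hz).1 ht ((yVanish_act ζ _).1 ?_)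
      rw [h1]; exact W.yVanish_fibrePt c a
    subst ht
    simp only at h1 h2
    have e1 := congrArg (proj0 Y) h1
    have e2 := congrArg (proj0 (-Y)) h2
    rw [proj0_act, proj0_blw, fibrePt, proj0_mkXY, proj0_eq_self hc.2] at e1
    rw [proj0_act, proj0_blw, fibrePt, proj0_mkXY, proj0_eq_self hc'.2, proj0_neg] at e2
    obtain ⟨s, hs⟩ := W.exists_eq_expY hK hc (mul_mem hζ' (inv_mem hζ)) (by
      rw [act_mul]
      conv_lhs => rw [← e1, act_inv_act, e2])
    have hζs : ζ' = expY Y s * ζ := by rw [← hs]; simp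
    have hx : ∀ i, xc Y (act ζ p) (θ i) = a i := fun i => by
      have f := congrArg (fun q => xc Y q (θ i)) h1
      rw [← blw_act] at f
      simp only [xc_blw W.unit _ _ (hJ.ne i), xc_fibrePt hJ, one_mul] at f
      exact f
    have hy : ∀ i, yc Y (act ζ p) (θ i) = s * (Y (θ i) * a' i) := fun i => by
      have hn := hJ.neg.ne i
      have f := congrArg (fun q => xc (-Y) q (θ i)) h2
      rw [hζs, act_mul, ← blw_act, ← blw_act] at f
      simp only [xc_blw W.swap.unit _ _ hn, xc_fibrePt hJ.neg] at f
      rw [← f, xc_neg W.unit (hJ.ne i)]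
      rcases W.unit (θ i) with h | h | h
      · exact absurd h (hJ.ne i)
      · simp [yc, act, expY, h]
        field_simp
      · simp [yc, act, expY, h]
        field_simp
    have h0 : ysum Y (act ζ p) = 0 := by rw [ysum_act]; exact hz.2.2
    unfold ysum at h0
    rw [hJ.sum_eq fun l hl => by simp [hl]] at h0
    have h3 : ∀ i, (Y (θ i) : ℂ) * ((act ζ p).1 (θ i) * (act ζ p).2 (θ i)) = s * (a i * a' i) := fun i => by
      rw [← xc_mul_yc (Y := Y), hx, hy]
      linear_combination (s * a i * a' i) * hYY _ (hJ.ne i)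
    simp only [h3] at h0
    rw [← Finset.mul_sum] at h0
    exact (mul_eq_zero.1 h0).resolve_left s.ne_zero
  · intro h
    obtain ⟨i, hi⟩ := Function.ne_iff.1 ha
    obtain ⟨i', hi'⟩ := Function.ne_iff.1 ha'
    have hz : (mkXY Y c (fun l => 1 * a (idx l)) (fun l => (Y l : ℂ) * a' (idx l)), (0 : ℂ)) ∈ Zhat k β αp αm Y := by
      refine W.mkXY_mem_Zhat hc (hJ.ne i) ?_ (hJ.ne i') ?_ ?_
      · rw [hJ.idx_θ, one_mul]; exact hi
      · rw [hJ.idx_θ]; exact mul_ne_zero (hYne _ (hJ.ne i')) hi'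
      · rw [hJ.sum_eq fun l hl => by simp [hl], ← h]
        refine Finset.sum_congr rfl fun i _ => ?_
        rw [hJ.idx_θ]
        linear_combination (a i * a' i) * hYY _ (hJ.ne i)
    refine ⟨Q _, (hpp _ hz).trans ?_, (hpm _ hz).trans ?_⟩
    · rw [blw_mkXY W.unit, zero_smul]; rfl
    · simp only
      rw [← mkXY_swap W.unit, blw_mkXY W.swap.unit, zero_smul]; rfl

end

end ToricHK

/-! ### Assembly of the flop -/

namespace ToricHK

variable {N : ℕ} {k : Submodule ℝ (Fin N → ℝ)} {α αp αm : StrongDual ℝ k} {β : k →L[ℝ] ℂ}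
  {Y : Fin N → ℤ} {H₀ : Subgroup (Fin N → ℂˣ)}

section

variable [Nonempty (X k αp β)] [Nonempty (X k αm β)] {d : ℕ} {M : Type} [TopologicalSpace M]
  [ChartedSpace (Fin d → ℂ) M] {Q : HN N × ℂ → M}

theorem ZQuot.exists_blowDown (hZ : ZQuot (d := d) k β αp αm Y Q) :
    ∃ (pp : M → X k αp β) (pm : M → X k αm β),
      (∀ a ∈ Zhat k β αp αm Y, pp (Q a) = Qm k αp β (blw Y a.2 a.1)) ∧
      ∀ a ∈ Zhat k β αp αm Y, pm (Q a) = Qm k αm β (blw (-Y) a.2 a.1) := by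
  choose s hs hQs using hZ.hol.surj
  exact ⟨fun z => Qm k αp β (blw Y (s z).2 (s z).1), fun z => Qm k αm β (blw (-Y) (s z).2 (s z).1),
    fun a ha => ((hZ.eq_iff _ (hs _) a ha).1 (hQs _)).1, fun a ha => ((hZ.eq_iff _ (hs _) a ha).1 (hQs _)).2⟩

theorem mfderiv_blw_comp {f : M → HN N × ℂ} {z : M}
    (hf : MDifferentiableAt 𝓘(ℂ, Fin d → ℂ) 𝓘(ℂ, HN N × ℂ) f z) (u : TangentSpace 𝓘(ℂ, Fin d → ℂ) z)
    (v : HN N × ℂ) (hv : v = mfderiv 𝓘(ℂ, Fin d → ℂ) 𝓘(ℂ, HN N × ℂ) f z u) (Y : Fin N → ℤ) :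
    mfderiv 𝓘(ℂ, Fin d → ℂ) 𝓘(ℂ, HN N) (fun y => blw Y (f y).2 (f y).1) z u =
      blw Y (f z).2 v.1 + v.2 • negL Y (f z).1 := by
  have h1 : MDifferentiableAt 𝓘(ℂ, HN N × ℂ) 𝓘(ℂ, HN N) (fun a : HN N × ℂ => blw Y a.2 a.1) (f z) :=
    (contDiff_blw.contDiffAt.differentiableAt (by simp)).mdifferentiableAt
  have h2 := mfderiv_comp z h1 hf
  rw [mfderiv_eq_fderiv] at h2
  have h3 : mfderiv 𝓘(ℂ, Fin d → ℂ) 𝓘(ℂ, HN N) (fun y => blw Y (f y).2 (f y).1) z u =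
      fderiv ℂ (fun a : HN N × ℂ => blw Y a.2 a.1) (f z) (mfderiv 𝓘(ℂ, Fin d → ℂ) 𝓘(ℂ, HN N × ℂ) f z u) :=
    congrArg (fun L : (Fin d → ℂ) →L[ℂ] HN N => L u) h2
  rw [h3, ← fderiv_blw, hv]

/-- Both sides are computed upstairs through one local section of the blow-up, where
`complexForm_blw` compares them. -/
theorem ZQuot.pullback_eq (W : WallCrossing k β α αp αm Y) (hZ : ZQuot (d := d) k β αp αm Y Q)
    [ChartedSpace (Fin d → ℂ) (X k αp β)] [ChartedSpace (Fin d → ℂ) (X k αm β)]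
    {Ωp : (x : X k αp β) → TangentSpace 𝓘(ℂ, Fin d → ℂ) x [⋀^Fin 2]→L[ℂ] ℂ}
    {Ωm : (x : X k αm β) → TangentSpace 𝓘(ℂ, Fin d → ℂ) x [⋀^Fin 2]→L[ℂ] ℂ}
    (hXp : IsSymplQuot k β d (stab k αp β) (Qm k αp β) Ωp)
    (hXm : IsSymplQuot k β d (stab k αm β) (Qm k αm β) Ωm)
    {pp : M → X k αp β} {pm : M → X k αm β}
    (hpp : ∀ a ∈ Zhat k β αp αm Y, pp (Q a) = Qm k αp β (blw Y a.2 a.1))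
    (hpm : ∀ a ∈ Zhat k β αp αm Y, pm (Q a) = Qm k αm β (blw (-Y) a.2 a.1))
    (z : M) (u v : TangentSpace 𝓘(ℂ, Fin d → ℂ) z) :
    Ωp (pp z) ![mfderiv 𝓘(ℂ, Fin d → ℂ) 𝓘(ℂ, Fin d → ℂ) pp z u,
        mfderiv 𝓘(ℂ, Fin d → ℂ) 𝓘(ℂ, Fin d → ℂ) pp z v] =
      Ωm (pm z) ![mfderiv 𝓘(ℂ, Fin d → ℂ) 𝓘(ℂ, Fin d → ℂ) pm z u,
        mfderiv 𝓘(ℂ, Fin d → ℂ) 𝓘(ℂ, Fin d → ℂ) pm z v] := by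
  obtain ⟨a, ha, haz⟩ := hZ.hol.surj z
  obtain ⟨σ, hσ, hσa, hσS⟩ := hZ.hol.sec a ha
  rw [haz] at hσ hσa hσS
  have hd := hσ.mdifferentiableAt (by simp)
  obtain ⟨u', hu'⟩ : ∃ v : HN N × ℂ, v = mfderiv 𝓘(ℂ, Fin d → ℂ) 𝓘(ℂ, HN N × ℂ) σ z u := ⟨_, rfl⟩
  obtain ⟨v', hv'⟩ : ∃ w : HN N × ℂ, w = mfderiv 𝓘(ℂ, Fin d → ℂ) 𝓘(ℂ, HN N × ℂ) σ z v := ⟨_, rfl⟩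
  have hY0 : ∀ᶠ y in 𝓝 z, ysum Y (σ y).1 = 0 := hσS.mono fun y hy => hy.1.2.2
  have hc : ∀ Y' : Fin N → ℤ, ContMDiffAt 𝓘(ℂ, Fin d → ℂ) 𝓘(ℂ, HN N) ω (fun y => blw Y' (σ y).2 (σ y).1) z :=
    fun Y' => ContMDiffAt.comp z (g := fun a : HN N × ℂ => blw Y' a.2 a.1) (f := σ)
      contDiff_blw.contDiffAt.contMDiffAt hσ
  rw [hXp.pull_of_eventuallyEq (hc Y) (hσS.mono fun y hy => hy.1.1)
      (hσS.mono fun y hy => by rw [← hpp _ hy.1, hy.2]) u v,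
    hXm.pull_of_eventuallyEq (hc (-Y)) (hσS.mono fun y hy => hy.1.2.1)
      (hσS.mono fun y hy => by rw [← hpm _ hy.1, hy.2]) u v,
    mfderiv_blw_comp hd u u' hu' Y, mfderiv_blw_comp hd v v' hv' Y, mfderiv_blw_comp hd u u' hu' (-Y),
    mfderiv_blw_comp hd v v' hv' (-Y)]
  exact complexForm_blw W.unit _ _ _ _ _ _ (ysum_mfderiv hd hY0 u u' hu') (ysum_mfderiv hd hY0 v v' hv')

theorem ZQuot.mem_iff_mem (W : WallCrossing k β α αp αm Y) (hZ : ZQuot (d := d) k β αp αm Y Q)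
    {pp : M → X k αp β} {pm : M → X k αm β}
    (hpp : ∀ a ∈ Zhat k β αp αm Y, pp (Q a) = Qm k αp β (blw Y a.2 a.1))
    (hpm : ∀ a ∈ Zhat k β αp αm Y, pm (Q a) = Qm k αm β (blw (-Y) a.2 a.1))
    {Vp : Set (X k αp β)} (hVp : ∀ q ∈ stab k αp β, Qm k αp β q ∈ Vp ↔ YVanish Y q)
    {Vm : Set (X k αm β)} (hVm : ∀ q ∈ stab k αm β, Qm k αm β q ∈ Vm ↔ YVanish (-Y) q) (z : M) :
    pp z ∈ Vp ↔ pm z ∈ Vm := by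
  obtain ⟨a, ha, rfl⟩ := hZ.hol.surj z
  rw [hpp a ha, hpm a ha, hVp _ ha.1, hVm _ ha.2.1, ← not_iff_not, ← W.snd_ne_zero_iff ha,
    ← W.swap.snd_ne_zero_iff (a := a) (by rw [Zhat_swap]; exact ha)]

end

theorem card_filter_neg {r : ℕ} (hr : (Finset.univ.filter fun i => Y i ≠ 0).card = r + 1) :
    (Finset.univ.filter fun i => (-Y) i ≠ 0).card = r + 1 := by
  simpa using hr

theorem stabFix_neg : stabFix k α β (-Y) = stabFix k α β Y := by
  ext q; simp [stabFix]

/-- All data on the minus side come from the plus side for −Y; the space `Zhat` and the fixed locus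
are the same for both. -/
theorem WallCrossing.exists_mukaiFlop (W : WallCrossing k β α αp αm Y) (hK : IsUnimodular k)
    [Nonempty (X k α β)] [Nonempty (X k αp β)] [Nonempty (X k αm β)] [Nonempty (fixedLocus k α β H₀)]
    [Nonempty (ZB k β αp αm Y)] {n m r : ℕ} (hn : Module.finrank ℝ k + n = N)
    (hr : (Finset.univ.filter fun i => Y i ≠ 0).card = r + 1) (hm : m + 2 * r = 2 * n)
    (hF : ∀ p : HN N, (∀ ζ ∈ H₀, act ζ p = p) ↔ ∀ i, Y i ≠ 0 → p.1 i = 0 ∧ p.2 i = 0)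
    [ChartedSpace (Fin (2 * n) → ℂ) (X k αp β)] [ChartedSpace (Fin (2 * n) → ℂ) (X k αm β)]
    {Ωp : (x : X k αp β) → TangentSpace 𝓘(ℂ, Fin (2 * n) → ℂ) x [⋀^Fin 2]→L[ℂ] ℂ}
    {Ωm : (x : X k αm β) → TangentSpace 𝓘(ℂ, Fin (2 * n) → ℂ) x [⋀^Fin 2]→L[ℂ] ℂ}
    (hXp : IsSymplQuot k β (2 * n) (stab k αp β) (Qm k αp β) Ωp)
    (hXm : IsSymplQuot k β (2 * n) (stab k αm β) (Qm k αm β) Ωm)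
    (hΩp : ComplexGeometry.IsHolomorphicSymplectic Ωp) (hΩm : ComplexGeometry.IsHolomorphicSymplectic Ωm)
    [ChartedSpace (Fin m → ℂ) (fixedLocus k α β H₀)] (hB : IsHolQuot m (stabFix k α β Y) (Qfix α β H₀)) :
    ∃ F : ComplexGeometry.MukaiFlop (d := 2 * n) (m := m) Ωp Ωm
        ((fixedLocus k α β H₀).restrictPreimage (natMor Y α αp))
        ((fixedLocus k α β H₀).restrictPreimage (natMor (-Y) α αm)) r,
      ∀ z : F.Z, natMor Y α αp (F.pp z) = natMor (-Y) α αm (F.pm z) := by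
  obtain ⟨_, hZ⟩ := W.exists_zQuot hn hK
  obtain ⟨pp, pm, hpp, hpm⟩ := hZ.exists_blowDown
  have hFm : ∀ p : HN N, (∀ ζ ∈ H₀, act ζ p = p) ↔ ∀ i, (-Y) i ≠ 0 → p.1 i = 0 ∧ p.2 i = 0 := fun p => by
    simpa using hF p
  have hVp : ∀ q ∈ stab k αp β, Qm k αp β q ∈ natMor Y α αp ⁻¹' fixedLocus k α β H₀ ↔ YVanish Y q :=
    fun q hq => W.natMor_mem_fixedLocus_iff hK hF hq
  have hVm : ∀ q ∈ stab k αm β, Qm k αm β q ∈ natMor (-Y) α αm ⁻¹' fixedLocus k α β H₀ ↔ YVanish (-Y) q :=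
    fun q hq => W.swap.natMor_mem_fixedLocus_iff hK hFm hq
  have hcomm : ∀ z, natMor Y α αp (pp z) = natMor (-Y) α αm (pm z) := fun z => by
    obtain ⟨a, ha, rfl⟩ := hZ.hol.surj z
    rw [hpp a ha, hpm a ha, W.natMor_eq hK ha]
  have hBm : IsHolQuot m (stabFix k α β (-Y)) (Qfix α β H₀) := by rw [stabFix_neg]; exact hB
  have hpm' : ∀ a ∈ Zhat k β αm αp (-Y), pm (QZ k β αp αm Y a) = Qm k αm β (blw (-Y) a.2 a.1) := by
    rw [Zhat_swap]; exact hpm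
  have := W.t2Space_ZB hK
  have := hZ.hol.isManifold
  refine ⟨{
    isManifold_plus := hXp.isManifold
    isManifold_minus := hXm.isManifold
    isManifold_base := hB.isManifold
    symplectic_plus := hΩp
    symplectic_minus := hΩm
    continuous_plus := W.continuous_restrictPreimage hK hF hXp.toIsHolQuot
    continuous_minus := W.swap.continuous_restrictPreimage hK hFm hXm.toIsHolQuot
    Z := ZB k β αp αm Y
    pp := pp
    pm := pm
    isBlowUp_plus := W.isBlowUp hK hn hr hZ hXp.toIsHolQuot hpp hVp
    isBlowUp_minus := W.swap.isBlowUp hK hn (card_filter_neg hr) hZ.swap hXm.toIsHolQuot hpm' hVm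
    divisor_eq := Set.ext fun z => hZ.mem_iff_mem W hpp hpm hVp hVm z
    pullback_eq := hZ.pullback_eq W hXp hXm hpp hpm
    divisor_fibred := fun z _ _ => Subtype.ext (hcomm z)
    divisor_injective := fun z z' _ h1 h2 => ?_
    dual_bundles := fun b => ?_ }, hcomm⟩
  · obtain ⟨a, ha, rfl⟩ := hZ.hol.surj z
    obtain ⟨a', ha', rfl⟩ := hZ.hol.surj z'
    rw [hpp a ha, hpp a' ha'] at h1
    rw [hpm a ha, hpm a' ha'] at h2
    exact (hZ.eq_iff a ha a' ha').2 ⟨h1, h2⟩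
  · obtain ⟨O, σ, hbO, hσ⟩ := W.exists_baseSection hK hn hr hm hF hB b
    obtain ⟨θ, idx, hJ⟩ := exists_jIndex hr
    refine ⟨O, hσ.isOpen, hbO, fun x => Qm k αp β (fibrePt Y idx (fun _ => 1) (σ x.1) x.2),
      fun x => Qm k αm β (fibrePt (-Y) idx (fun l => (Y l : ℂ)) (σ x.1) x.2),
      W.isProjectiveTrivialization hK hF hXp.toIsHolQuot hB hσ hJ fun _ _ => one_ne_zero,
      W.swap.isProjectiveTrivialization hK hFm hXm.toIsHolQuot hBm hσ.neg hJ.neg fun l hl => ?_,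
      fun c hc a a' ha ha' => W.exists_incidence_iff hK hZ.hol.surj hpp hpm hJ (hσ.mem c hc) ha ha'⟩
    exact_mod_cast (by simpa using hl : Y l ≠ 0)

end ToricHK

/-! ## Blow-ups along divisors -/

namespace ComplexGeometry

variable {d : ℕ} {X Z : Type} [TopologicalSpace X] [ChartedSpace (Fin d → ℂ) X] [TopologicalSpace Z]
  [ChartedSpace (Fin d → ℂ) Z]

/-- The blow-up along a hypersurface is biholomorphic. -/
theorem IsBlowUp.exists_diffeomorph {p : Z → X} {V : Set X} (h : IsBlowUp (d := d) p V 1) :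
    ∃ φ : Z ≃ₘ^ω⟮𝓘(ℂ, Fin d → ℂ), 𝓘(ℂ, Fin d → ℂ)⟯ X, ∀ z, φ z = p z := by
  obtain ⟨g, hg, hpg, hgp⟩ := h.biholomorphic_off
  -- In codimension one l is a non-zero scalar, so t l determines the class of (l, t).
  have hinj : Function.Injective p := by
    intro z z' hz
    by_cases hV : p z ∈ V
    · obtain ⟨e, -, ψ, hv, -, -, -, W, S, hW, -, -, hSW, hψ, hS⟩ := h.local_model _ hV
      obtain ⟨a, ha, rfl⟩ : z ∈ S '' W := by rw [hSW]; exact hv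
      obtain ⟨b, hb, rfl⟩ : z' ∈ S '' W := by rw [hSW, Set.mem_preimage, ← hz]; exact hv
      subst hW
      have e1 := (hψ a ha).symm.trans ((congrArg ψ hz).trans (hψ b hb))
      have e2 := congrArg (fun y => y.2 0) e1
      have h1 : ∀ c : Fin 1 → ℂ, c ≠ 0 → c 0 ≠ 0 := fun c hc h0 => hc (funext fun i => by
        rw [Subsingleton.elim i 0]; exact h0)
      have ha0 := h1 _ ha.1
      have hb0 := h1 _ hb.1
      simp only [Pi.smul_apply, smul_eq_mul] at e2
      refine (hS a ha b hb).2 ⟨(Prod.ext_iff.1 e1).1, b.2.1 0 / a.2.1 0, div_ne_zero hb0 ha0, funext fun i => ?_, ?_⟩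
      · rw [Subsingleton.elim i 0, Pi.smul_apply, smul_eq_mul, div_mul_cancel₀ _ ha0]
      · rw [div_mul_eq_mul_div, eq_div_iff ha0, e2, mul_comm]
    · rw [← hgp z hV, ← hgp z' (hz ▸ hV), hz]
  -- Near V a local inverse is obtained by putting l = 1.
  have hloc : ∀ x, ∃ (q : X → Z) (U : Set X), U ∈ 𝓝 x ∧ ContMDiffOn 𝓘(ℂ, Fin d → ℂ) 𝓘(ℂ, Fin d → ℂ) ω q U ∧
      ∀ y ∈ U, p (q y) = y := by
    intro x
    by_cases hV : x ∈ V
    · obtain ⟨e, -, ψ, hv, hψc, -, -, W, S, hW, hSc, -, hSW, hψ, -⟩ := h.local_model _ hV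
      let f : X → (Fin e → ℂ) × (Fin 1 → ℂ) × ℂ := fun y => ((ψ y).1, fun _ => 1, (ψ y).2 0)
      have hf : ∀ y ∈ ψ.source, f y ∈ W := fun y hy => by
        subst hW
        refine ⟨fun h0 => one_ne_zero (congrFun h0 0), ?_⟩
        have : ((f y).1, (f y).2.2 • (f y).2.1) = ψ y :=
          Prod.ext rfl (funext fun i => by simp [f, Subsingleton.elim i 0])
        rw [this]; exact ψ.map_source hy
      refine ⟨S ∘ f, ψ.source, ψ.open_source.mem_nhds hv, hSc.comp ?_ hf, fun y hy => ?_⟩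
      · have hF : ContDiff ℂ ω fun w : (Fin e → ℂ) × (Fin 1 → ℂ) => (w.1, (fun _ => 1 : Fin 1 → ℂ), w.2 0) := by
          fun_prop
        exact hF.contMDiff.comp_contMDiffOn hψc
      · have h1 : p (S (f y)) ∈ ψ.source := by
          have : S (f y) ∈ S '' W := ⟨_, hf y hy, rfl⟩
          rw [hSW] at this; exact this
        refine ψ.injOn h1 hy ((hψ _ (hf y hy)).trans ?_)
        exact Prod.ext rfl (funext fun i => by simp [f, Subsingleton.elim i 0])
    · exact ⟨g, Vᶜ, h.isClosed.isOpen_compl.mem_nhds hV, hg, hpg⟩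
  have hsurj : Function.Surjective p := fun x => by
    obtain ⟨q, U, hU, -, hq⟩ := hloc x
    exact ⟨q x, hq x (mem_of_mem_nhds hU)⟩
  refine ⟨⟨Equiv.ofBijective p ⟨hinj, hsurj⟩, h.holomorphic, fun x => ?_⟩, fun z => rfl⟩
  obtain ⟨q, U, hU, hqc, hq⟩ := hloc x
  refine (hqc.contMDiffAt hU).congr_of_eventuallyEq ?_
  filter_upwards [hU] with y hy
  exact (Equiv.symm_apply_eq _).2 (hq y hy).symm

end ComplexGeometry

/-! ### The codimension-one case, existence of the structures, and dimensions -/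

namespace ToricHK

variable {N : ℕ} {k : Submodule ℝ (Fin N → ℝ)} {α αp αm : StrongDual ℝ k} {β : k →L[ℝ] ℂ}
  {Y : Fin N → ℤ}

/-- Here r = 1, so both blow-downs are biholomorphic and the composite through the blow-up is the
required map; it respects the natural morphisms because the blow-downs do. -/
theorem WallCrossing.exists_diffeomorph (W : WallCrossing k β α αp αm Y) (hK : IsUnimodular k)
    [Nonempty (X k α β)] [Nonempty (X k αp β)] [Nonempty (X k αm β)]
    [Nonempty (ZB k β αp αm Y)] {n : ℕ} (hn : Module.finrank ℝ k + n = N)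
    (hr : (Finset.univ.filter fun i => Y i ≠ 0).card = 2) {H₀ : Subgroup (Fin N → ℂˣ)}
    (hF : ∀ p : HN N, (∀ ζ ∈ H₀, act ζ p = p) ↔ ∀ i, Y i ≠ 0 → p.1 i = 0 ∧ p.2 i = 0)
    [ChartedSpace (Fin (2 * n) → ℂ) (X k αp β)] [ChartedSpace (Fin (2 * n) → ℂ) (X k αm β)]
    (hXp : IsHolQuot (2 * n) (stab k αp β) (Qm k αp β))
    (hXm : IsHolQuot (2 * n) (stab k αm β) (Qm k αm β)) :
    ∃ φ : X k αp β ≃ₘ^ω⟮𝓘(ℂ, Fin (2 * n) → ℂ), 𝓘(ℂ, Fin (2 * n) → ℂ)⟯ X k αm β,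
      natMor Y α αp = natMor (-Y) α αm ∘ φ := by
  obtain ⟨_, hZ⟩ := W.exists_zQuot hn hK
  obtain ⟨pp, pm, hpp, hpm⟩ := hZ.exists_blowDown
  have hFm : ∀ p : HN N, (∀ ζ ∈ H₀, act ζ p = p) ↔ ∀ i, (-Y) i ≠ 0 → p.1 i = 0 ∧ p.2 i = 0 := fun p => by
    simpa using hF p
  have hpm' : ∀ a ∈ Zhat k β αm αp (-Y), pm (QZ k β αp αm Y a) = Qm k αm β (blw (-Y) a.2 a.1) := by
    rw [Zhat_swap]; exact hpm
  obtain ⟨φp, hφp⟩ := (W.isBlowUp hK hn (r := 1) hr hZ hXp hpp (V := natMor Y α αp ⁻¹' fixedLocus k α β H₀)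
    fun q hq => W.natMor_mem_fixedLocus_iff hK hF hq).exists_diffeomorph
  obtain ⟨φm, hφm⟩ := (W.swap.isBlowUp hK hn (r := 1) (card_filter_neg hr) hZ.swap hXm hpm'
    (V := natMor (-Y) α αm ⁻¹' fixedLocus k α β H₀)
    fun q hq => W.swap.natMor_mem_fixedLocus_iff hK hFm hq).exists_diffeomorph
  refine ⟨φp.symm.trans φm, funext fun x => ?_⟩
  obtain ⟨a, ha, haz⟩ := hZ.hol.surj (φp.symm x)
  change _ = natMor (-Y) α αm (φm (φp.symm x))
  rw [← haz, hφm, hpm a ha, ← W.natMor_eq hK ha, ← hpp a ha, ← hφp, haz, φp.apply_symm_apply]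

/-- `X(α, β)` as a complex symplectic manifold, for `α` such that `K_ℂ` acts freely. -/
theorem exists_isSymplQuot [Nonempty (X k α β)] {n : ℕ} (hn : Module.finrank ℝ k + n = N) (hK : IsUnimodular k)
    (hfree : ∀ q ∈ stab k α β, ∀ x : k, (∀ i ∈ coordSupp q, (x : Fin N → ℝ) i = 0) → x = 0) :
    ∃ (_ : ChartedSpace (Fin (2 * n) → ℂ) (X k α β))
      (Ω : (x : X k α β) → TangentSpace 𝓘(ℂ, Fin (2 * n) → ℂ) x [⋀^Fin 2]→L[ℂ] ℂ),
      IsSymplQuot k β (2 * n) (stab k α β) (Qm k α β) Ω ∧ ComplexGeometry.IsHolomorphicSymplectic Ω := by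
  have hS := torusQuot_X hK hfree
  let ga : ∀ p ∈ stab k α β, GaugeAt k β Set.univ (2 * n) p := fun p hp => (nonempty_gaugeAt_X hn hK hfree hp).some
  exact ⟨hS.chartedSpace ga, hS.form ga, hS.isSymplQuot ga, hS.isHolomorphicSymplectic ga⟩

theorem nonempty_X (hK : IsUnimodular k) (α : StrongDual ℝ k) (β : k →L[ℝ] ℂ) : Nonempty (X k α β) := by
  obtain ⟨B, e, hB⟩ := exists_univ_frame hK
  have h0 : ∀ x : k, (∀ l ∈ (Set.univ : Set (Fin N)), (x : Fin N → ℝ) l = 0) → x = 0 := fun x hx =>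
    Subtype.ext (funext fun l => hx l trivial)
  obtain ⟨p, hp, -⟩ := hB.exists_level α β (fun x hx => by rw [h0 x hx, map_zero])
    fun x hx => by rw [h0 x hx, map_zero]
  exact ⟨X.mk ⟨p, hp⟩⟩

/-- A weight-zero frame has dim k − 1 indices among the N − (r + 1) of weight zero. -/
theorem WallCrossing.le_of_card_eq (W : WallCrossing k β α αp αm Y) (hK : IsUnimodular k) {n r : ℕ}
    (hn : Module.finrank ℝ k + n = N) (hr : (Finset.univ.filter fun i => Y i ≠ 0).card = r + 1) : r ≤ n := by
  obtain ⟨B, e, hB, -, -⟩ := exists_frame hK (A := {i | Y i = 0}) (T := {i | Y i = 0}) (B₀ := ∅)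
    subset_rfl (fun x _ h => h) (Set.empty_subset _) (linearIndepOn_empty ℝ _)
  have h1 := W.card_frame hB
  have h2 := ncard_eq_zero_add_card_ne Y
  have h3 : B.card ≤ Set.ncard {i | Y i = 0} := by
    rw [← Set.ncard_coe_finset]
    exact Set.ncard_le_ncard hB.sub
  omega

end ToricHK

end

/-! ### The theorem -/

open ToricHK

theorem mainTheorem8 {N n : ℕ} (k : Submodule ℝ (Fin N → ℝ)) (hk : ToricHK.IsSubtorusLie k)
    (hn : Module.finrank ℝ k + n = N) (hK : ToricHK.IsUnimodular k) (β : k →L[ℝ] ℂ)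
    (H₀ : Subgroup (Fin N → ℂˣ)) (Cp Cm : Set (StrongDual ℝ k))
    (hC : ToricHK.AreAdjacent k β H₀ Cp Cm)
    (Y : Fin N → ℝ) (hY : Y ∈ ToricHK.lieAlg H₀) (hY0 : Y ≠ 0)
    (J : Finset (Fin N)) (hJ : ∀ i, i ∈ J ↔ Y i ≠ 0)
    (αp αm α : StrongDual ℝ k) (hαp : αp ∈ Cp) (hαm : αm ∈ Cm)
    (hα : α ∈ closure Cp ∩ ToricHK.wall k H₀)
    (hα' : ∀ H ∈ ToricHK.wallIndex k β, H ≠ H₀ → α ∉ ToricHK.wall k H) :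
    ∃ (_ : ChartedSpace (Fin (2 * n) → ℂ) (ToricHK.X k αp β))
      (_ : ChartedSpace (Fin (2 * n) → ℂ) (ToricHK.X k αm β))
      (Ωp : (x : ToricHK.X k αp β) → TangentSpace 𝓘(ℂ, Fin (2 * n) → ℂ) x [⋀^Fin 2]→L[ℂ] ℂ)
      (Ωm : (x : ToricHK.X k αm β) → TangentSpace 𝓘(ℂ, Fin (2 * n) → ℂ) x [⋀^Fin 2]→L[ℂ] ℂ)
      (πp : ToricHK.X k αp β → ToricHK.X k α β) (πm : ToricHK.X k αm β → ToricHK.X k α β),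
      ToricHK.IsHyperkahlerQuotient k αp β Ωp ∧ ToricHK.IsHyperkahlerQuotient k αm β Ωm ∧
      ToricHK.IsNaturalMorphism πp ∧ ToricHK.IsNaturalMorphism πm ∧
      (3 ≤ J.card →
        ∃ r m : ℕ, r + 1 = J.card ∧ m + 2 * r = 2 * n ∧
        ∃ (_ : ChartedSpace (Fin m → ℂ) (ToricHK.fixedLocus k α β H₀))
          (F : ComplexGeometry.MukaiFlop (d := 2 * n) (m := m) Ωp Ωm
            ((ToricHK.fixedLocus k α β H₀).restrictPreimage πp)
            ((ToricHK.fixedLocus k α β H₀).restrictPreimage πm) r),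
          ∀ z : F.Z, πp (F.pp z) = πm (F.pm z)) ∧
      (J.card = 2 →
        ∃ φ : ToricHK.X k αp β ≃ₘ^ω⟮𝓘(ℂ, Fin (2 * n) → ℂ), 𝓘(ℂ, Fin (2 * n) → ℂ)⟯
            ToricHK.X k αm β,
          πp = πm ∘ φ) := by
  obtain ⟨Y', W, hYY⟩ := exists_wallCrossing hK hC hY hY0 hαp hαm hα hα'
  have hF : ∀ p : HN N, (∀ ζ ∈ H₀, act ζ p = p) ↔ ∀ i, Y' i ≠ 0 → p.1 i = 0 ∧ p.2 i = 0 := fun p => by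
    rw [forall_act_eq_iff hK hC.mem.1 hY hY0]
    simp only [hYY]
  have hcard : (Finset.univ.filter fun i => Y' i ≠ 0).card = J.card := by
    congr 1; ext i; simp [hYY, hJ]
  have := nonempty_X hK α β
  have := nonempty_X hK αp β
  have := nonempty_X hK αm β
  have : Nonempty (fixedLocus k α β H₀) := by
    obtain ⟨c, -, hc⟩ := W.nonempty_stabFix hK
    exact ⟨_, (Qm_mem_fixedLocus_iff hK hF hc.1).2 hc.2⟩
  have hZB : 2 ≤ J.card → Nonempty (ZB k β αp αm Y') := fun h => by
    obtain ⟨i, hi, j, hj, hij⟩ := Finset.one_lt_card.1 h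
    obtain ⟨a, ha⟩ := W.nonempty_Zhat hK ((hYY i).2 ((hJ i).1 hi)) ((hYY j).2 ((hJ j).1 hj)) hij
    exact ⟨ZB.mk ⟨a, ha⟩⟩
  obtain ⟨cp, Ωp, hXp, hΩp⟩ := exists_isSymplQuot hn hK fun q hq => W.free hq
  obtain ⟨cm, Ωm, hXm, hΩm⟩ := exists_isSymplQuot hn hK fun q hq => W.swap.free hq
  refine ⟨cp, cm, Ωp, Ωm, natMor Y' α αp, natMor (-Y') α αm, hXp.isHyperkahlerQuotient hn hK,
    hXm.isHyperkahlerQuotient hn hK, W.isNaturalMorphism hK, W.swap.isNaturalMorphism hK, fun h => ?_, fun h => ?_⟩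
  · obtain ⟨r, hr⟩ : ∃ r, r + 1 = J.card := ⟨J.card - 1, by omega⟩
    -- This bound ensures that the subtraction in m = 2n − 2r is not truncated.
    have hle := W.le_of_card_eq hK hn (hcard.trans hr.symm)
    have hm : 2 * n - 2 * r + 2 * r = 2 * n := by omega
    have := hZB (by omega)
    have hS := W.torusQuot_fix hK hF
    let ga : ∀ p ∈ stabFix k α β Y', GaugeAt k β {i | Y' i = 0} (2 * n - 2 * r) p := fun p hp =>
      (W.nonempty_gaugeAt_fix hn hK (hcard.trans hr.symm) hm hp).some
    let := hS.chartedSpace ga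
    exact ⟨r, 2 * n - 2 * r, hr, hm, hS.chartedSpace ga,
      W.exists_mukaiFlop hK hn (hcard.trans hr.symm) hm hF hXp hXm hΩp hΩm (hS.isHolQuot ga)⟩
  · have := hZB h.ge
    exact W.exists_diffeomorph hK hn (hcard.trans h) hF hXp.toIsHolQuot hXm.toIsHolQuot
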